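/- **Data model.** Let $n = rk$ and let $\{A_i\}_{i=1}^r$ and $\{B_j\}_{j=1}^r$ be partitions of $\{1,\dots,n\}$ with $|A_i|=|B_j|=k$ for all $i,j$. The random $n\times n$ matrix $\mathbf X$ (rows are users, columns are items, $1$ means "likes", $0$ means "does not like") is given by $\mathbf X(a,b)=\chi_{ij}$ for $(a,b)\in A_i\times B_j$, where $\{\chi_{ij}\}_{i,j=1}^r$ are i.i.d. Bernoulli$(1/2)$. The observed matrix $\mathbf Y$, with entries in $\{0,1,*\}$, is obtained by passing the entries of $\mathbf X$ independently through a binary symmetric channel with error probability $p$ and then through an erasure channel which replaces each entry by $*$ with probability $\epsilon$. **Algorithm $\mathtt{PAF}(T)$ (recommendation to user $1$).** Given $\mathbf Y$, let $s_{1i}$ be the number of columns $l$ with $\mathbf Y(1,l)\ne *$, $\mathbf Y(i,l)\neq *$ and $\mathbf Y(1,l)=\mathbf Y(i,l)$. Step 1: select the $T$ rows $i\in\{1,\dots,n\}$ (row $1$ included; all the rows if $T>n$) with the highest values of $s_{1i}$. Step 2: amongst the columns $j$ with $\mathbf Y(1,j)=*$, recommend a column $j_{\max}$ having the maximum number of $1$'s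 in the selected rows. In both steps ties are broken uniformly at random. Put $P_e[\mathtt{PAF}(T)]=\Pr[\mathbf X(1,j_{\max})=0]$. (If row $1$ of $\mathbf Y$ contains no $*$, nothing is recommended and no error is counted.) **Theorem.** Let $\alpha>1/2$ and $c>0$ be constants, $p=0$ (erasures only) and $\epsilon=1-c/n^{\alpha}$. Let $n\to\infty$ along a sequence of matrix sizes, and let the cluster size $k=k(n)$, a divisor of $n$, satisfy $k=o(n)$. Then, for every choice of the partitions and for every choice of the neighborhood size $T=T(n)$, $$P_e[\mathtt{PAF}(T)]\longrightarrow \tfrac12 .$$ -/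

import Mathlib

open Filter
open scoped NNReal ENNReal Topology unitInterval

noncomputable section

namespace PAF

/-! ### The data model -/

/-- The Bernoulli probabilities: `true` has probability `q` and `false` has probability `1 - q`. -/
def bernoulliWeight (q : I) (v : Bool) : ℝ≥0∞ :=
  if v then (unitInterval.toNNReal q : ℝ≥0∞) else (unitInterval.toNNReal (σ q) : ℝ≥0∞)

theorem sum_bernoulliWeight (q : I) : ∑ v : Bool, bernoulliWeight q v = 1 := by
  rw [Fintype.sum_bool]
  simp only [bernoulliWeight, if_true, Bool.false_eq_true, if_false]
  exact_mod_cast unitInterval.toNNReal_add_toNNReal_symm q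

theorem sum_prod_bernoulliWeight (a b : ℕ) (q : I) :
    ∑ M : Fin a → Fin b → Bool, ∏ i, ∏ j, bernoulliWeight q (M i j) = 1 := by
  have h : ∑ v : Fin b → Bool, ∏ j, bernoulliWeight q (v j) = 1 := by
    rw [← Fintype.piFinset_univ, ← Finset.prod_univ_sum]
    simp only [sum_bernoulliWeight, Finset.prod_const_one]
  rw [← Fintype.piFinset_univ,
    ← Finset.prod_univ_sum (fun _ => Finset.univ) (fun (_ : Fin a) (v : Fin b → Bool) =>
      ∏ j, bernoulliWeight q (v j))]
  simp only [h, Finset.prod_const_one]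

/-- The law of an `a × b` binary matrix whose entries are independent and equal to `true`
with probability `q`. -/
def iidMatrix (a b : ℕ) (q : I) : PMF (Fin a → Fin b → Bool) :=
  PMF.ofFintype (fun M => ∏ i, ∏ j, bernoulliWeight q (M i j)) (sum_prod_bernoulliWeight a b q)

/-- The block constant matrix with row clusters given by the labels `A`, column clusters given by
the labels `B`, and cluster values `χ`. -/
def blockMatrix {n r : ℕ} (A B : Fin n → Fin r) (χ : Fin r → Fin r → Bool) :
    Fin n → Fin n → Bool :=
  fun i j => χ (A i) (B j)

/-- The observed matrix: the entry of `X` is flipped where `F` is `true` and then erased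
where `E` is `true`. An erased entry `*` is `none`, an observed entry `v` is `some v`. -/
def observe {n : ℕ} (X F E : Fin n → Fin n → Bool) : Fin n → Fin n → Option Bool :=
  fun i j => if E i j then none else some (xor (X i j) (F i j))

/-- The joint law of the rating matrix `X` and of the observed matrix `Y`: the cluster values are
i.i.d. Bernoulli(1/2), the entries of `X` pass independently through a binary symmetric channel
with error probability `p` and then through an erasure channel with erasure probability `ε`. -/
def dataLaw {n r : ℕ} (A B : Fin n → Fin r) (p ε : I) :
    PMF ((Fin n → Fin n → Bool) × (Fin n → Fin n → Option Bool)) :=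
  (iidMatrix r r ⟨1 / 2, by norm_num, by norm_num⟩).bind fun χ =>
    (iidMatrix n n p).bind fun F =>
      (iidMatrix n n ε).map fun E =>
        (blockMatrix A B χ, observe (blockMatrix A B χ) F E)

/-! ### The algorithm -/

/-- The number of columns in which both rows `i` and `j` are observed and agree. -/
def similarity {n : ℕ} (Y : Fin n → Fin n → Option Bool) (i j : Fin n) : ℕ :=
  (Finset.univ.filter fun l => Y i l ≠ none ∧ Y j l ≠ none ∧ Y i l = Y j l).card

/-- All possible outcomes of selecting the `T` rows that are most similar to row `u`
(all the rows, if there are fewer than `T` of them). Row `u` itself takes part. There is more than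
one outcome exactly if ties have to be broken. -/
def topSets {n : ℕ} (Y : Fin n → Fin n → Option Bool) (u : Fin n) (T : ℕ) :
    Finset (Finset (Fin n)) :=
  Finset.univ.filter fun S =>
    S.card = min T n ∧ ∀ i ∈ S, ∀ j ∉ S, similarity Y u j ≤ similarity Y u i

theorem topSets_nonempty {n : ℕ} (Y : Fin n → Fin n → Option Bool) (u : Fin n) (T : ℕ) :
    (topSets Y u T).Nonempty := by
  have hne : (Finset.powersetCard (min T n) (Finset.univ : Finset (Fin n))).Nonempty := by
    rw [Finset.powersetCard_nonempty]
    simp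
  obtain ⟨S, hS, hmax⟩ := Finset.exists_max_image _
    (fun S : Finset (Fin n) => ∑ i ∈ S, similarity Y u i) hne
  rw [Finset.mem_powersetCard] at hS
  refine ⟨S, Finset.mem_filter.2 ⟨Finset.mem_univ _, hS.2, fun i hi j hj => ?_⟩⟩
  have hj' : j ∉ S.erase i := fun h => hj (Finset.mem_of_mem_erase h)
  have hcard : (insert j (S.erase i)).card = min T n := by
    rw [Finset.card_insert_of_notMem hj', Finset.card_erase_add_one hi, hS.2]
  have h := hmax _ (Finset.mem_powersetCard.2 ⟨Finset.subset_univ _, hcard⟩)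
  rw [Finset.sum_insert hj', ← Finset.add_sum_erase S _ hi] at h
  omega

/-- The number of ones in column `j` amongst the rows in `S`. -/
def votes {n : ℕ} (Y : Fin n → Fin n → Option Bool) (S : Finset (Fin n)) (j : Fin n) : ℕ :=
  (S.filter fun i => Y i j = some true).card

/-- The most popular columns: the columns `j` with `Y u j = *` that have the maximum number of ones
amongst the rows in `S`. -/
def mostPopular {n : ℕ} (Y : Fin n → Fin n → Option Bool) (u : Fin n) (S : Finset (Fin n)) :
    Finset (Fin n) :=
  Finset.univ.filter fun j =>
    Y u j = none ∧ ∀ l, Y u l = none → votes Y S l ≤ votes Y S j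

/-- The law of the column recommended to user `u`, given the observed matrix `Y`. Ties are broken
uniformly at random in both steps. The outcome is `none` if user `u` has rated every item, so that
there is nothing to recommend. -/
def recommend {n : ℕ} (Y : Fin n → Fin n → Option Bool) (u : Fin n) (T : ℕ) :
    PMF (Option (Fin n)) :=
  (PMF.uniformOfFinset (topSets Y u T) (topSets_nonempty Y u T)).bind fun S =>
    if h : (mostPopular Y u S).Nonempty then
      (PMF.uniformOfFinset (mostPopular Y u S) h).map some
    else PMF.pure none

/-- The joint law of the rating matrix and of the recommended column. -/
def outcomeLaw {n r : ℕ} (A B : Fin n → Fin r) (p ε : I) (u : Fin n) (T : ℕ) :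
    PMF ((Fin n → Fin n → Bool) × Option (Fin n)) :=
  (dataLaw A B p ε).bind fun XY => (recommend XY.2 u T).map fun J => (XY.1, J)

/-- The probability that user `u` does not like the recommended item. -/
def errorProb {n r : ℕ} (A B : Fin n → Fin r) (p ε : I) (u : Fin n) (T : ℕ) : ℝ :=
  ((outcomeLaw A B p ε u T).toOuterMeasure {ω | ∃ j, ω.2 = some j ∧ ω.1 u j = false}).toReal

end PAF

end

/-!
Without noise, the error probability is the probability `verdictProb` of the verdict `false`
(`errorProb_eq_verdictProb`): random tie breaking amounts to random priorities (`expec_topRows`),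
and, as the columns rated by `u` do not compete, the votes that count are independent of the
selection of the rows (`expec_observe`). The probabilities of the two verdicts add up to at most
one (`verdictProb_add_le`), so it suffices that each of them is at least `1 / 2 - o(1)`
(`exists_le_verdictProb`).

The algorithm learns too little about the taste of `u`. With `q = c / n ^ α` and `α > 1 / 2` the
expected number `n * q ^ 2` of columns rated by two given users tends to zero like a power of `n`,
so that the scores of all other users are bounded by a constant `M`. The selection thus hardly
depends on the values of any one column of cluster values: few of the selected rows have rated an
item of that column cluster which `u` has rated too. Moreover, rows that agree with `u` on
comparable numbers of columns have comparable binomial score distributions (`binom_le`), and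
exchanging such rows shows that they have comparable chances of being selected
(`prob_mem_topRows_le`). As the clusters are small compared with the number of users, the cluster
of `u` provides only few of the selected rows, and the selected rows are spread over many clusters.
The predicate `Diverse` collects these facts; it holds by `diverse_of_many_rated` for `α < 1` and
by `diverse_of_few_rated` for `α ≥ 1`, when `u` has rated a bounded number of columns and almost
all rows have score zero.

Let `b` be the column cluster of the recommended item, and force the cluster value of `u` in `b` to
be `v`. As cluster values are fair coins, this changes probabilities by a factor of at most `2`
(`expec_force_le`), so if `b` still wins, then the verdict `v` has probability at least
`1 / 2 - o(1)` (`le_verdictGiven`). Whether it still wins is a question of how many voters `b` loses: those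
in the cluster of `u` and those replaced in the selection because the scores have changed. There
are three regimes.

* At most `n ^ (9 * ζ)` rows are selected, where `ζ > 0` is a small constant. Then hardly any
  column gets two votes, and the recommended item is that of a uniformly random vote; about half of the
  votes are for columns with the value `v`
  (`le_expec_share_of_few`, `Balanced.votes`, `PAF.le_verdictGiven_of_few_rows`).
* More rows are selected, but few votes are observed. The lost voters are so few that they are
  unlikely to be amongst the observed votes for the winner (`winProb_lower`,
  `le_verdictGiven_of_loss`).
* Many rows are selected, at least as many as there are clusters. Besides forcing the value of `u`,
  switch on each cluster value in column `b` with probability `θ = L ^ 4 / r`, where `r = L ^ 20`.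
  By a Chernoff bound this tilt changes probabilities by a factor close to `1` only, since `θ` is
  far below `r ^ (-1 / 2)`, and the number of voters gained exceeds the number of those lost
  (`le_verdictGiven_of_gain`).
-/

open Filter
open scoped NNReal ENNReal Topology unitInterval

noncomputable section

namespace PAF

/-! ### Expectations over finite probability spaces -/

/-- A probability vector on a finite type. -/
structure IsLaw {Ω : Type*} [Fintype Ω] (w : Ω → ℝ) : Prop where
  nonneg : ∀ x, 0 ≤ w x
  sum_eq : ∑ x, w x = 1

/-- The expectation of `f` under the weights `w`. -/
def expec {Ω : Type*} [Fintype Ω] (w f : Ω → ℝ) : ℝ := ∑ x, w x * f x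

/-- The indicator of a proposition, as a real number. -/
def ind (P : Prop) : ℝ := by classical exact if P then 1 else 0

theorem ind_of {P : Prop} (h : P) : ind P = 1 := by simp [ind, h]

theorem ind_of_not {P : Prop} (h : ¬ P) : ind P = 0 := by simp [ind, h]

theorem ind_eq_ite (P : Prop) [Decidable P] : ind P = if P then 1 else 0 := by
  unfold ind; congr

theorem ind_nonneg (P : Prop) : 0 ≤ ind P := by
  by_cases h : P <;> simp [ind, h]

theorem ind_le_one (P : Prop) : ind P ≤ 1 := by
  by_cases h : P <;> simp [ind, h]

theorem ind_mono {P Q : Prop} (h : P → Q) : ind P ≤ ind Q := by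
  by_cases hP : P
  · rw [ind_of hP, ind_of (h hP)]
  · rw [ind_of_not hP]; exact ind_nonneg _

theorem ind_congr {P Q : Prop} (h : P ↔ Q) : ind P = ind Q := by rw [propext h]

theorem ind_and (P Q : Prop) : ind (P ∧ Q) = ind P * ind Q := by
  by_cases hP : P <;> by_cases hQ : Q <;> simp [ind, hP, hQ]

theorem ind_or_le (P Q : Prop) : ind (P ∨ Q) ≤ ind P + ind Q := by
  by_cases hP : P <;> by_cases hQ : Q <;> simp [ind, hP, hQ]

theorem ind_exists_le {κ : Type*} [Fintype κ] (P : κ → Prop) :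
    ind (∃ x, P x) ≤ ∑ x, ind (P x) := by
  by_cases h : ∃ x, P x
  · obtain ⟨x, hx⟩ := h
    rw [ind_of ⟨x, hx⟩, ← ind_of hx]
    exact Finset.single_le_sum (f := fun x => ind (P x)) (fun i _ => ind_nonneg _)
      (Finset.mem_univ x)
  · rw [ind_of_not h]
    exact Finset.sum_nonneg fun i _ => ind_nonneg _

theorem ind_mul_le {P : Prop} {x y : ℝ} (hy : 0 ≤ y) (h : P → x ≤ y) : ind P * x ≤ y := by
  by_cases hP : P
  · rw [ind_of hP, one_mul]; exact h hP
  · rw [ind_of_not hP, zero_mul]; exact hy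

theorem ind_le_of {P : Prop} {y : ℝ} (hy : 0 ≤ y) (h : P → 1 ≤ y) : ind P ≤ y := by
  simpa using ind_mul_le (P := P) hy h

theorem sum_ind {κ : Type*} (s : Finset κ) (P : κ → Prop) [DecidablePred P] :
    ∑ x ∈ s, ind (P x) = (s.filter P).card := by
  simp only [ind_eq_ite, Finset.sum_boole]

section Expec

variable {Ω : Type*} [Fintype Ω] {Ω' : Type*} [Fintype Ω'] {w f g : Ω → ℝ}

theorem expec_mono (hw : IsLaw w) (h : ∀ x, f x ≤ g x) : expec w f ≤ expec w g :=
  Finset.sum_le_sum fun x _ => mul_le_mul_of_nonneg_left (h x) (hw.nonneg x)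

theorem expec_const (hw : IsLaw w) (c : ℝ) : expec w (fun _ => c) = c := by
  rw [expec, ← Finset.sum_mul, hw.sum_eq, one_mul]

theorem expec_nonneg (hw : IsLaw w) (h : ∀ x, 0 ≤ f x) : 0 ≤ expec w f :=
  Finset.sum_nonneg fun x _ => mul_nonneg (hw.nonneg x) (h x)

theorem expec_le_of_le (hw : IsLaw w) {c : ℝ} (h : ∀ x, f x ≤ c) : expec w f ≤ c :=
  (expec_mono hw h).trans (expec_const hw c).le

theorem expec_add (w f g : Ω → ℝ) : expec w (fun x => f x + g x) = expec w f + expec w g := by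
  simp only [expec, mul_add, Finset.sum_add_distrib]

theorem expec_sub (w f g : Ω → ℝ) : expec w (fun x => f x - g x) = expec w f - expec w g := by
  simp only [expec, mul_sub, Finset.sum_sub_distrib]

theorem expec_mul_left (w f : Ω → ℝ) (c : ℝ) :
    expec w (fun x => c * f x) = c * expec w f := by
  simp only [expec, Finset.mul_sum]
  exact Finset.sum_congr rfl fun x _ => by ring

theorem expec_mul_right (w f : Ω → ℝ) (c : ℝ) :
    expec w (fun x => f x * c) = expec w f * c := by
  simp only [expec, Finset.sum_mul]
  exact Finset.sum_congr rfl fun x _ => by ring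

theorem expec_sum {κ : Type*} (s : Finset κ) (w : Ω → ℝ) (f : κ → Ω → ℝ) :
    expec w (fun x => ∑ k ∈ s, f k x) = ∑ k ∈ s, expec w (f k) := by
  simp only [expec, Finset.mul_sum]
  exact Finset.sum_comm

theorem expec_comm (w : Ω → ℝ) (w' : Ω' → ℝ) (F : Ω → Ω' → ℝ) :
    expec w (fun x => expec w' fun y => F x y) = expec w' (fun y => expec w fun x => F x y) := by
  simp only [expec, Finset.mul_sum]
  rw [Finset.sum_comm]
  exact Finset.sum_congr rfl fun x _ => Finset.sum_congr rfl fun y _ => by ring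

theorem expec_equiv (w f : Ω → ℝ) (e : Ω' ≃ Ω) :
    expec (fun x => w (e x)) (fun x => f (e x)) = expec w f :=
  e.sum_comp (fun x => w x * f x)

theorem expec_perm (e : Ω ≃ Ω) (he : ∀ x, w (e x) = w x) :
    expec w (fun x => f (e x)) = expec w f := by
  rw [← expec_equiv w f e]
  exact Finset.sum_congr rfl fun x _ => by simp only [he]

/-- Markov's inequality. -/
theorem expec_ind_le {P : Ω → Prop} (hw : IsLaw w) {c : ℝ} (hc : 0 < c) (hf : ∀ x, 0 ≤ f x)
    (h : ∀ x, P x → c ≤ f x) : expec w (fun x => ind (P x)) ≤ expec w f / c := by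
  rw [le_div_iff₀ hc, ← expec_mul_right]
  refine expec_mono hw fun x => ?_
  exact ind_mul_le (hf x) (h x)

/-- The product law on pairs. -/
def pairLaw (w : Ω → ℝ) (w' : Ω' → ℝ) : Ω × Ω' → ℝ := fun x => w x.1 * w' x.2

theorem expec_pairLaw (w : Ω → ℝ) (w' : Ω' → ℝ) (F : Ω × Ω' → ℝ) :
    expec (pairLaw w w') F = expec w fun x => expec w' fun y => F (x, y) := by
  simp only [expec, pairLaw, Fintype.sum_prod_type, Finset.mul_sum]
  exact Finset.sum_congr rfl fun x _ => Finset.sum_congr rfl fun y _ => by ring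

theorem IsLaw.pair {w : Ω → ℝ} {w' : Ω' → ℝ} (hw : IsLaw w) (hw' : IsLaw w') :
    IsLaw (pairLaw w w') where
  nonneg x := mul_nonneg (hw.nonneg _) (hw'.nonneg _)
  sum_eq := by
    simp only [pairLaw, Fintype.sum_prod_type, ← Finset.mul_sum, hw'.sum_eq, mul_one, hw.sum_eq]

end Expec

/-! ### Product laws -/

section Product

variable {ι : Type*} [Fintype ι] [DecidableEq ι] {α : Type*} [Fintype α]

/-- The law of a family of independent variables, the `i`-th one with law `w i`. -/
def prodLaw (w : ι → α → ℝ) (f : ι → α) : ℝ := ∏ i, w i (f i)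

theorem expec_prodLaw_prod (w g : ι → α → ℝ) :
    expec (prodLaw w) (fun f => ∏ i, g i (f i)) = ∏ i, expec (w i) (g i) := by
  simp only [expec, prodLaw, ← Finset.prod_mul_distrib]
  rw [← Fintype.piFinset_univ, ← Finset.prod_univ_sum (fun _ => Finset.univ)
    (fun i x => w i x * g i x)]

theorem IsLaw.prodLaw {w : ι → α → ℝ} (hw : ∀ i, IsLaw (w i)) : IsLaw (prodLaw w) where
  nonneg f := Finset.prod_nonneg fun i _ => (hw i).nonneg _
  sum_eq := by
    have h := expec_prodLaw_prod w (fun _ _ => 1)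
    simpa [expec, (hw _).sum_eq] using h

theorem expec_prodLaw_perm (w : α → ℝ) (ρ : Equiv.Perm ι) (F : (ι → α) → ℝ) :
    expec (PAF.prodLaw fun _ => w) (fun f => F (f ∘ ρ)) = expec (PAF.prodLaw fun _ => w) F :=
  expec_perm (w := PAF.prodLaw fun _ => w) (ρ.symm.arrowCongr (Equiv.refl α))
    (fun f => Equiv.prod_comp ρ (fun i => w (f i)))

/-- Resampling one coordinate does not change the law. -/
theorem expec_update (w : ι → α → ℝ) (i : ι) (F : (ι → α) → ℝ)
    (hw : IsLaw (w i)) :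
    expec (prodLaw w) (fun f => expec (w i) fun x => F (Function.update f i x)) =
      expec (prodLaw w) F := by
  have hinv : Function.Involutive
      (fun p : (ι → α) × α => ((Function.update p.1 i p.2, p.1 i) : (ι → α) × α)) := by
    rintro ⟨f, x⟩
    simp
  have h := expec_perm (w := pairLaw (prodLaw w) (w i)) (f := fun p => F p.1) hinv.toPerm (by
    rintro ⟨f, x⟩
    simp only [Function.Involutive.coe_toPerm, pairLaw, prodLaw]
    rw [← Finset.mul_prod_erase _ _ (Finset.mem_univ i),
      ← Finset.mul_prod_erase _ (fun k => w k (f k)) (Finset.mem_univ i)]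
    have : ∏ k ∈ Finset.univ.erase i, w k (Function.update f i x k) =
        ∏ k ∈ Finset.univ.erase i, w k (f k) :=
      Finset.prod_congr rfl fun k hk => by
        rw [Function.update_of_ne (Finset.ne_of_mem_erase hk)]
    rw [this, Function.update_self]
    ring)
  rw [expec_pairLaw, expec_pairLaw] at h
  simpa [expec_const hw] using h

/-- Resampling the coordinates in `P` does not change the law. -/
theorem expec_mix (w : ι → α → ℝ) (P : ι → Prop) [DecidablePred P]
    (F : (ι → α) → ℝ) (hw : ∀ i, IsLaw (w i)) :
    expec (prodLaw w) (fun f => expec (prodLaw w) fun g => F fun i => if P i then g i else f i) =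
      expec (prodLaw w) F := by
  have hinv : Function.Involutive
      (fun p : (ι → α) × (ι → α) =>
        ((fun i => if P i then p.2 i else p.1 i, fun i => if P i then p.1 i else p.2 i) :
          (ι → α) × (ι → α))) := by
    rintro ⟨f, x⟩
    ext i <;> by_cases h : P i <;> simp [h]
  have h := expec_perm (w := pairLaw (prodLaw w) (prodLaw w)) (f := fun p => F p.1) hinv.toPerm (by
    rintro ⟨f, x⟩
    simp only [Function.Involutive.coe_toPerm, pairLaw, prodLaw, ← Finset.prod_mul_distrib]
    refine Finset.prod_congr rfl fun i _ => ?_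
    by_cases h : P i <;> simp [h, mul_comm])
  rw [expec_pairLaw, expec_pairLaw] at h
  simpa [expec_const (IsLaw.prodLaw hw)] using h

/-- Grouping a product over independent variables according to statistics `ρ i` of them. -/
theorem sum_prod_fiber {β : Type*} [Fintype β] [DecidableEq β] (ρ : ι → α → β)
    (F : ι → (ι → β) → α → ℝ) :
    ∑ e : ι → α, ∏ i, F i (fun k => ρ k (e k)) (e i) =
      ∑ s : ι → β, ∏ i, ∑ x, if ρ i x = s i then F i s x else 0 := by
  have h : ∀ s : ι → β, ∏ i, ∑ x, (if ρ i x = s i then F i s x else 0) =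
      ∑ e : ι → α, ∏ i, (if ρ i (e i) = s i then F i s (e i) else 0) := fun s => by
    rw [Finset.prod_univ_sum, Fintype.piFinset_univ]
  simp only [h]
  rw [Finset.sum_comm]
  refine Finset.sum_congr rfl fun e _ => ?_
  rw [Finset.sum_eq_single (fun k => ρ k (e k))]
  · simp
  · intro s _ hs
    obtain ⟨i, hi⟩ := Function.ne_iff.1 hs
    exact Finset.prod_eq_zero (Finset.mem_univ i) (if_neg fun h => hi h.symm)
  · simp

end Product

/-! ### Coin flips -/

/-- The Bernoulli law: `true` has weight `p`. -/
def coin (p : ℝ) (v : Bool) : ℝ := if v then p else 1 - p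

theorem isLaw_coin {p : ℝ} (h0 : 0 ≤ p) (h1 : p ≤ 1) : IsLaw (coin p) where
  nonneg x := by cases x <;> simp [coin, h0, h1]
  sum_eq := by simp [coin]

theorem expec_coin (p : ℝ) (f : Bool → ℝ) :
    expec (coin p) f = p * f true + (1 - p) * f false := by
  simp [expec, coin]

/-- The law of a family of i.i.d. coin flips. -/
abbrev coins (ι : Type*) [Fintype ι] (p : ℝ) : (ι → Bool) → ℝ := prodLaw fun _ => coin p

section Coins

variable {ι : Type*} [Fintype ι] [DecidableEq ι]

theorem isLaw_coins {p : ℝ} (h0 : 0 ≤ p) (h1 : p ≤ 1) : IsLaw (coins ι p) :=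
  IsLaw.prodLaw fun _ => isLaw_coin h0 h1

/-- The generating function of the number of `false` coins in a set `K`. -/
theorem expec_coins_pow (p z : ℝ) (K : Finset ι) :
    expec (coins ι p) (fun e => z ^ (K.filter fun l => e l = false).card) =
      (p + (1 - p) * z) ^ K.card := by
  have h := expec_prodLaw_prod (fun _ : ι => coin p)
    (fun l v => if l ∈ K then (if v = false then z else 1) else 1)
  have h2 : ∀ e : ι → Bool, ∏ l, (if l ∈ K then (if e l = false then z else 1) else 1) =
      z ^ (K.filter fun l => e l = false).card := fun e => by
    rw [Finset.prod_ite_mem, Finset.univ_inter, Finset.prod_ite, Finset.prod_const,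
      Finset.prod_const_one, mul_one]
  simp only [h2] at h
  rw [h]
  have h3 : ∀ l : ι, expec (coin p) (fun v => if l ∈ K then (if v = false then z else 1) else 1) =
      if l ∈ K then p + (1 - p) * z else 1 := fun l => by
    rw [expec_coin]; by_cases hl : l ∈ K <;> simp [hl]
  simp only [h3]
  rw [Finset.prod_ite_mem, Finset.univ_inter, Finset.prod_const]

theorem expec_coins_eval (p : ℝ) (h0 : 0 ≤ p) (h1 : p ≤ 1) (l : ι) (f : Bool → ℝ) :
    expec (coins ι p) (fun e => f (e l)) = p * f true + (1 - p) * f false := by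
  have h := expec_update (fun _ : ι => coin p) l (fun e => f (e l)) (isLaw_coin h0 h1)
  simp only [Function.update_self] at h
  rw [← h, expec_const (isLaw_coins h0 h1), expec_coin]

end Coins

/-! ### Symmetric signs -/

/-- The sign of a bit. -/
def sgn (v : Bool) : ℝ := if v then 1 else -1

/-- The moment generating function of a weighted sum of independent signs is sub-Gaussian. -/
theorem expec_exp_sgn_le {ι : Type*} [Fintype ι] [DecidableEq ι] (c : ι → ℝ) :
    expec (coins ι (1 / 2)) (fun w => Real.exp (∑ i, c i * sgn (w i))) ≤
      Real.exp ((∑ i, c i ^ 2) / 2) := by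
  simp only [Real.exp_sum]
  rw [expec_prodLaw_prod (fun _ : ι => coin (1 / 2)) (fun i v => Real.exp (c i * sgn v)),
    Finset.sum_div, Real.exp_sum]
  refine Finset.prod_le_prod (fun i _ => ?_) fun i _ => ?_
  · exact expec_nonneg (isLaw_coin (by norm_num) (by norm_num)) fun x => (Real.exp_pos _).le
  · rw [expec_coin]
    have h := Real.cosh_le_exp_half_sq (c i)
    rw [Real.cosh_eq] at h
    simp only [sgn, if_true, Bool.false_eq_true, if_false]
    refine le_trans (le_of_eq ?_) h
    rw [mul_one, mul_neg_one]; ring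

/-- Hoeffding's inequality for weighted sums of independent signs. -/
theorem hoeffding {ι : Type*} [Fintype ι] [DecidableEq ι] (c : ι → ℝ) {V t : ℝ} (hV : 0 < V)
    (ht : 0 ≤ t) (hc : ∑ i, c i ^ 2 ≤ V) :
    expec (coins ι (1 / 2)) (fun w => ind (t ≤ ∑ i, c i * sgn (w i))) ≤
      Real.exp (-(t ^ 2 / (2 * V))) := by
  have hlaw : IsLaw (coins ι (1 / 2)) := isLaw_coins (by norm_num) (by norm_num)
  have h1 := expec_ind_le (w := coins ι (1 / 2))
    (f := fun w => Real.exp (∑ i, (t / V * c i) * sgn (w i)))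
    (P := fun w => t ≤ ∑ i, c i * sgn (w i)) hlaw (Real.exp_pos (t / V * t))
    (fun x => (Real.exp_pos _).le) (fun x hx => by
      rw [Real.exp_le_exp]
      simp only [mul_assoc, ← Finset.mul_sum]
      exact mul_le_mul_of_nonneg_left hx (by positivity))
  refine h1.trans ?_
  rw [div_le_iff₀ (Real.exp_pos _), ← Real.exp_add]
  refine (expec_exp_sgn_le _).trans ?_
  rw [Real.exp_le_exp]
  simp only [mul_pow, ← Finset.mul_sum]
  have : (t / V) ^ 2 * ∑ i, c i ^ 2 ≤ (t / V) ^ 2 * V :=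
    mul_le_mul_of_nonneg_left hc (by positivity)
  have h2 : (t / V) ^ 2 * V = t ^ 2 / V := by field_simp
  have h3 : -(t ^ 2 / (2 * V)) + t / V * t = t ^ 2 / V / 2 := by field_simp; ring
  rw [h3]
  linarith

/-- The two-sided version of Hoeffding's inequality. -/
theorem hoeffding_abs {ι : Type*} [Fintype ι] [DecidableEq ι] (c : ι → ℝ) {V t : ℝ} (hV : 0 < V)
    (ht : 0 ≤ t) (hc : ∑ i, c i ^ 2 ≤ V) :
    expec (coins ι (1 / 2)) (fun w => ind (t ≤ |∑ i, c i * sgn (w i)|)) ≤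
      2 * Real.exp (-(t ^ 2 / (2 * V))) := by
  have hlaw : IsLaw (coins ι (1 / 2)) := isLaw_coins (by norm_num) (by norm_num)
  have h1 := hoeffding c hV ht hc
  have h2 := hoeffding (fun i => - c i) hV ht (by simpa using hc)
  have h3 : expec (coins ι (1 / 2)) (fun w => ind (t ≤ |∑ i, c i * sgn (w i)|)) ≤
      expec (coins ι (1 / 2)) (fun w => ind (t ≤ ∑ i, c i * sgn (w i)) +
        ind (t ≤ ∑ i, - c i * sgn (w i))) := expec_mono hlaw fun w => by
    refine le_trans (ind_mono ?_) (ind_or_le _ _)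
    intro h
    simp only [neg_mul, Finset.sum_neg_distrib]
    exact le_abs.1 h
  rw [expec_add] at h3
  linarith

/-! ### Selecting the top rows with random priorities -/

section TopRows

variable {n : ℕ}

/-- The rank key of a row: rows are compared by their score `s i`, and ties are broken by the
priority `π i`. -/
def key (s : Fin n → ℕ) (π : Equiv.Perm (Fin n)) (i : Fin n) : ℕ := s i * n + (π i).val

theorem key_lt_of_lt {s : Fin n → ℕ} {π : Equiv.Perm (Fin n)} {i j : Fin n} (h : s i < s j) :
    key s π i < key s π j := by
  have h1 := (π i).isLt
  have h2 : (s i + 1) * n ≤ s j * n := Nat.mul_le_mul_right n h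
  unfold key
  rw [add_mul] at h2
  omega

theorem key_injective (s : Fin n → ℕ) (π : Equiv.Perm (Fin n)) :
    Function.Injective (key s π) := by
  intro i j h
  rcases lt_trichotomy (s i) (s j) with h1 | h1 | h1
  · exact absurd h (key_lt_of_lt h1).ne
  · unfold key at h
    rw [h1] at h
    exact π.injective (Fin.ext (by omega))
  · exact absurd h (key_lt_of_lt h1).ne'

theorem score_le_of_key_lt {s : Fin n → ℕ} {π : Equiv.Perm (Fin n)} {i j : Fin n}
    (h : key s π i < key s π j) : s i ≤ s j := by
  by_contra hc
  exact absurd (key_lt_of_lt (π := π) (not_le.1 hc)) h.not_gt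

/-- The number of rows ahead of row `i`. -/
def ahead (s : Fin n → ℕ) (π : Equiv.Perm (Fin n)) (i : Fin n) : ℕ :=
  (Finset.univ.filter fun j => key s π i < key s π j).card

theorem ahead_lt_of_key_lt {s : Fin n → ℕ} {π : Equiv.Perm (Fin n)} {i j : Fin n}
    (h : key s π i < key s π j) : ahead s π j < ahead s π i := by
  refine Finset.card_lt_card (Finset.ssubset_iff_subset_ne.2 ⟨fun l hl => ?_, fun he => ?_⟩)
  · simp only [Finset.mem_filter, Finset.mem_univ, true_and] at hl ⊢
    omega
  · have : j ∈ Finset.univ.filter fun l => key s π i < key s π l := by simpa using h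
    rw [← he] at this
    simp at this

theorem ahead_lt (s : Fin n → ℕ) (π : Equiv.Perm (Fin n)) (i : Fin n) : ahead s π i < n := by
  have : (Finset.univ.filter fun j => key s π i < key s π j) ⊂ Finset.univ := by
    refine Finset.ssubset_iff_subset_ne.2 ⟨Finset.subset_univ _, fun he => ?_⟩
    have : i ∈ Finset.univ.filter fun j => key s π i < key s π j := by
      rw [he]; exact Finset.mem_univ i
    simp at this
  simpa [ahead] using Finset.card_lt_card this

theorem ahead_injective (s : Fin n → ℕ) (π : Equiv.Perm (Fin n)) :
    Function.Injective (ahead s π) := by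
  intro i j h
  by_contra hne
  rcases lt_or_gt_of_ne (fun he => hne (key_injective s π he)) with h1 | h1
  · exact absurd h (ahead_lt_of_key_lt h1).ne'
  · exact absurd h (ahead_lt_of_key_lt h1).ne

/-- The `T` rows with the highest scores, ties being broken by the priorities `π`. -/
def topRows (s : Fin n → ℕ) (π : Equiv.Perm (Fin n)) (T : ℕ) : Finset (Fin n) :=
  Finset.univ.filter fun i => ahead s π i < T

variable {s : Fin n → ℕ} {π : Equiv.Perm (Fin n)} {T : ℕ} {i j : Fin n}

theorem mem_topRows : i ∈ topRows s π T ↔ ahead s π i < T := by simp [topRows]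

theorem key_lt_of_mem_of_notMem (hi : i ∈ topRows s π T) (hj : j ∉ topRows s π T) :
    key s π j < key s π i := by
  rw [mem_topRows] at hi hj
  by_contra hc
  rcases (not_lt.1 hc).lt_or_eq with h | h
  · have := ahead_lt_of_key_lt h
    omega
  · rw [key_injective s π h] at hi
    exact hj hi

theorem card_topRows (s : Fin n → ℕ) (π : Equiv.Perm (Fin n)) (T : ℕ) :
    (topRows s π T).card = min T n := by
  have himg : Finset.univ.image (ahead s π) = Finset.range n := by
    refine Finset.eq_of_subset_of_card_le (fun x hx => ?_) ?_
    · obtain ⟨i, -, rfl⟩ := Finset.mem_image.1 hx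
      exact Finset.mem_range.2 (ahead_lt s π i)
    · rw [Finset.card_image_of_injective _ (ahead_injective s π)]
      simp
  have h : (topRows s π T).image (ahead s π) = Finset.range (min T n) := by
    ext x
    simp only [Finset.mem_image, mem_topRows, Finset.mem_range, lt_min_iff]
    constructor
    · rintro ⟨i, hi, rfl⟩
      exact ⟨hi, ahead_lt s π i⟩
    · rintro ⟨h1, h2⟩
      obtain ⟨i, -, rfl⟩ := Finset.mem_image.1 (himg ▸ Finset.mem_range.2 h2)
      exact ⟨i, h1, rfl⟩
  rw [← Finset.card_image_of_injective _ (ahead_injective s π), h, Finset.card_range]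

theorem ahead_comp (s : Fin n → ℕ) (π ρ : Equiv.Perm (Fin n)) (i : Fin n) :
    ahead (s ∘ ρ) (ρ.trans π) i = ahead s π (ρ i) := by
  unfold ahead
  refine Finset.card_bij (fun j _ => ρ j) (fun j hj => ?_) (fun a _ b _ h => ρ.injective h)
    fun j hj => ⟨ρ.symm j, ?_, by simp⟩
  · exact Finset.mem_filter.2 ⟨Finset.mem_univ _, (Finset.mem_filter.1 hj).2⟩
  · refine Finset.mem_filter.2 ⟨Finset.mem_univ _, ?_⟩
    simpa [key] using (Finset.mem_filter.1 hj).2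

/-- Relabelling the rows. -/
theorem mem_topRows_comp (s : Fin n → ℕ) (π ρ : Equiv.Perm (Fin n)) (T : ℕ) (i : Fin n) :
    i ∈ topRows (s ∘ ρ) (ρ.trans π) T ↔ ρ i ∈ topRows s π T := by
  rw [mem_topRows, mem_topRows, ahead_comp]

/-- If two score functions agree off `D`, then the two selections differ by at most as many rows
as one of them has in `D`. -/
theorem card_topRows_sdiff_le {s s' : Fin n → ℕ} (D : Finset (Fin n)) (π : Equiv.Perm (Fin n))
    (T : ℕ) (h : ∀ i ∉ D, s i = s' i) :
    (topRows s' π T \ topRows s π T).card ≤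
      max (D ∩ topRows s π T).card (D ∩ topRows s' π T).card := by
  by_cases h1 : topRows s' π T \ topRows s π T ⊆ D
  · refine le_max_of_le_right (Finset.card_le_card fun i hi => ?_)
    exact Finset.mem_inter.2 ⟨h1 hi, (Finset.mem_sdiff.1 hi).1⟩
  · have h2 : topRows s π T \ topRows s' π T ⊆ D := by
      intro j hj
      by_contra hjD
      obtain ⟨i, hi, hiD⟩ := Finset.not_subset.1 h1
      rw [Finset.mem_sdiff] at hi hj
      have h3 := key_lt_of_mem_of_notMem hj.1 hi.2
      have h4 := key_lt_of_mem_of_notMem hi.1 hj.2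
      unfold key at h3 h4
      rw [h i hiD, h j hjD] at h3
      omega
    have hc : (topRows s' π T \ topRows s π T).card = (topRows s π T \ topRows s' π T).card := by
      have e1 := Finset.card_sdiff_add_card_inter (topRows s' π T) (topRows s π T)
      have e2 := Finset.card_sdiff_add_card_inter (topRows s π T) (topRows s' π T)
      rw [Finset.inter_comm, card_topRows] at e1
      rw [card_topRows] at e2
      omega
    rw [hc]
    refine le_max_of_le_left (Finset.card_le_card fun i hi => ?_)
    exact Finset.mem_inter.2 ⟨h2 hi, (Finset.mem_sdiff.1 hi).1⟩

/-- A selected row of score zero is also selected when only the priorities count. -/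
theorem mem_topRows_zero (hi : i ∈ topRows s π T) (h0 : s i = 0) :
    i ∈ topRows (fun _ => 0) π T := by
  rw [mem_topRows] at hi ⊢
  refine lt_of_le_of_lt (Finset.card_le_card fun j hj => ?_) hi
  simp only [Finset.mem_filter, Finset.mem_univ, true_and, key, h0, zero_mul, zero_add] at hj ⊢
  have : 0 ≤ s j * n := Nat.zero_le _
  omega

/-- The possible selections of `T` rows of highest score. -/
def topChoices (s : Fin n → ℕ) (T : ℕ) : Finset (Finset (Fin n)) :=
  Finset.univ.filter fun S => S.card = min T n ∧ ∀ i ∈ S, ∀ j ∉ S, s j ≤ s i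

theorem topRows_mem_topChoices (s : Fin n → ℕ) (π : Equiv.Perm (Fin n)) (T : ℕ) :
    topRows s π T ∈ topChoices s T :=
  Finset.mem_filter.2 ⟨Finset.mem_univ _, card_topRows s π T, fun _ hi _ hj =>
    score_le_of_key_lt (key_lt_of_mem_of_notMem hi hj)⟩

/-- The uniform law on the priorities. -/
def prioLaw (n : ℕ) (_ : Equiv.Perm (Fin n)) : ℝ := 1 / (Fintype.card (Equiv.Perm (Fin n)) : ℝ)

theorem isLaw_prioLaw (n : ℕ) : IsLaw (prioLaw n) where
  nonneg _ := by unfold prioLaw; positivity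
  sum_eq := by
    simp only [prioLaw, Finset.sum_const, Finset.card_univ, nsmul_eq_mul]
    exact mul_one_div_cancel (by positivity)

theorem expec_prioLaw_trans (ρ : Equiv.Perm (Fin n)) (f : Equiv.Perm (Fin n) → ℝ) :
    expec (prioLaw n) (fun π => f (ρ.trans π)) = expec (prioLaw n) f :=
  expec_perm (w := prioLaw n) (f := f) (Equiv.mulRight ρ) fun _ => rfl

/-- Exchanging a selected row for an unselected row of the same score does not change the
probability of the selection. -/
theorem prob_topRows_eq_of_swap {S : Finset (Fin n)} {i j : Fin n} (hi : i ∈ S) (hj : j ∉ S)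
    (hs : s i = s j) :
    expec (prioLaw n) (fun π => ind (topRows s π T = S)) =
      expec (prioLaw n) (fun π => ind (topRows s π T = insert j (S.erase i))) := by
  rw [← expec_prioLaw_trans (Equiv.swap i j)]
  congr 1
  funext π
  refine ind_congr ?_
  have hss : s ∘ Equiv.swap i j = s := by
    funext l
    simp only [Function.comp]
    rcases eq_or_ne l i with rfl | h1
    · rw [Equiv.swap_apply_left, hs]
    · rcases eq_or_ne l j with rfl | h2
      · rw [Equiv.swap_apply_right, hs]
      · rw [Equiv.swap_apply_of_ne_of_ne h1 h2]
  have hm : ∀ l, l ∈ topRows s ((Equiv.swap i j).trans π) T ↔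
      Equiv.swap i j l ∈ topRows s π T := fun l => by
    have := mem_topRows_comp s π (Equiv.swap i j) T l
    rwa [hss] at this
  have hS : ∀ l, l ∈ insert j (S.erase i) ↔ Equiv.swap i j l ∈ S := fun l => by
    rcases eq_or_ne l i with rfl | h1
    · rw [Equiv.swap_apply_left]
      have : l ≠ j := fun h => hj (h ▸ hi)
      simp [this, hj]
    · rcases eq_or_ne l j with rfl | h2
      · rw [Equiv.swap_apply_right]; simp [hi]
      · rw [Equiv.swap_apply_of_ne_of_ne h1 h2]; simp [h1, h2]
  simp only [Finset.ext_iff, hm, hS]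
  constructor
  · intro h l
    have := h (Equiv.swap i j l)
    rwa [Equiv.swap_apply_self] at this
  · intro h l
    have := h (Equiv.swap i j l)
    rwa [Equiv.swap_apply_self] at this

theorem prob_topRows_eq (d : ℕ) : ∀ S ∈ topChoices s T, ∀ S' ∈ topChoices s T,
    (S \ S').card = d →
    expec (prioLaw n) (fun π => ind (topRows s π T = S)) =
      expec (prioLaw n) (fun π => ind (topRows s π T = S')) := by
  induction d with
  | zero =>
    intro S hS S' hS' h
    have hsub : S ⊆ S' := by rwa [Finset.card_eq_zero, Finset.sdiff_eq_empty_iff_subset] at h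
    simp only [topChoices, Finset.mem_filter] at hS hS'
    rw [Finset.eq_of_subset_of_card_le hsub (by omega)]
  | succ d ih =>
    intro S hS S' hS' h
    have hS0 := hS
    have hS0' := hS'
    simp only [topChoices, Finset.mem_filter, Finset.mem_univ, true_and] at hS hS'
    have hc : (S' \ S).card = d + 1 := by
      have e1 := Finset.card_sdiff_add_card_inter S' S
      have e2 := Finset.card_sdiff_add_card_inter S S'
      rw [Finset.inter_comm] at e1
      omega
    obtain ⟨i, hi⟩ := Finset.card_pos.1 (by omega : 0 < (S \ S').card)
    obtain ⟨j, hj⟩ := Finset.card_pos.1 (by omega : 0 < (S' \ S).card)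
    rw [Finset.mem_sdiff] at hi hj
    have hs : s i = s j := le_antisymm (hS'.2 j hj.1 i hi.2) (hS.2 i hi.1 j hj.2)
    rw [prob_topRows_eq_of_swap hi.1 hj.2 hs]
    refine ih _ (Finset.mem_filter.2 ⟨Finset.mem_univ _, ?_, fun a ha b hb => ?_⟩) S' hS0' ?_
    · rw [Finset.card_insert_of_notMem fun h => hj.2 (Finset.mem_of_mem_erase h),
        Finset.card_erase_add_one hi.1, hS.1]
    · have hb' : b ∉ S ∨ b = i := by
        by_contra hcon
        push Not at hcon
        exact hb (Finset.mem_insert_of_mem (Finset.mem_erase.2 ⟨hcon.2, hcon.1⟩))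
      have hbi : s b ≤ s i := by
        rcases hb' with hb' | rfl
        · exact hS.2 i hi.1 b hb'
        · exact le_rfl
      rcases Finset.mem_insert.1 ha with rfl | ha
      · rw [← hs]; exact hbi
      · rcases hb' with hb' | rfl
        · exact hS.2 a (Finset.mem_of_mem_erase ha) b hb'
        · rw [hs]; exact hS.2 a (Finset.mem_of_mem_erase ha) j hj.2
    · have : insert j (S.erase i) \ S' = (S \ S').erase i := by
        ext l
        simp only [Finset.mem_sdiff, Finset.mem_insert, Finset.mem_erase]
        constructor
        · rintro ⟨rfl | h1, h2⟩
          · exact absurd hj.1 h2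
          · exact ⟨h1.1, h1.2, h2⟩
        · rintro ⟨h1, h2, h3⟩
          exact ⟨Or.inr ⟨h1, h2⟩, h3⟩
      rw [this, Finset.card_erase_of_mem (Finset.mem_sdiff.2 hi), h]
      omega

/-- Random priorities select each of the possible sets with the same probability: breaking ties
uniformly at random amounts to drawing random priorities. -/
theorem expec_topRows (s : Fin n → ℕ) (T : ℕ) (f : Finset (Fin n) → ℝ) :
    expec (prioLaw n) (fun π => f (topRows s π T)) =
      ∑ S ∈ topChoices s T, (1 / ((topChoices s T).card : ℝ)) * f S := by
  obtain ⟨S₀, hS₀⟩ : (topChoices s T).Nonempty := ⟨_, topRows_mem_topChoices s 1 T⟩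
  set p := expec (prioLaw n) (fun π => ind (topRows s π T = S₀)) with hp
  have hall : ∀ S ∈ topChoices s T, expec (prioLaw n) (fun π => ind (topRows s π T = S)) = p :=
    fun S hS => prob_topRows_eq _ S hS S₀ hS₀ rfl
  have hdec : ∀ g : Finset (Fin n) → ℝ, expec (prioLaw n) (fun π => g (topRows s π T)) =
      ∑ S ∈ topChoices s T, p * g S := fun g => by
    have : ∀ π, g (topRows s π T) = ∑ S ∈ topChoices s T, ind (topRows s π T = S) * g S :=
      fun π => by
        rw [Finset.sum_eq_single (topRows s π T)]
        · rw [ind_of rfl, one_mul]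
        · intro S _ hS
          rw [ind_of_not fun h => hS h.symm, zero_mul]
        · intro h
          exact absurd (topRows_mem_topChoices s π T) h
    simp only [this, expec_sum, expec_mul_right]
    exact Finset.sum_congr rfl fun S hS => by rw [hall S hS]
  have h1 := hdec fun _ => 1
  rw [expec_const (isLaw_prioLaw n)] at h1
  simp only [mul_one, Finset.sum_const, nsmul_eq_mul] at h1
  have hp' : p = 1 / ((topChoices s T).card : ℝ) := by
    rw [eq_div_iff (Nat.cast_ne_zero.2 (Finset.card_pos.2 ⟨S₀, hS₀⟩).ne'), mul_comm]
    exact h1.symm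
  rw [hdec, hp']

end TopRows

/-! ### Tails of counts of coin flips -/

section Tails

variable {ι : Type*} [Fintype ι] [DecidableEq ι] {q : ℝ}

theorem tail_count (h0 : 0 ≤ q) (h1 : q ≤ 1) (K : Finset ι) {z : ℝ} (hz : 1 ≤ z) (m : ℕ) :
    expec (coins ι (1 - q)) (fun e => ind (m ≤ (K.filter fun l => e l = false).card)) ≤
      (1 + q * (z - 1)) ^ K.card / z ^ m := by
  have h := expec_ind_le (w := coins ι (1 - q))
    (P := fun e => m ≤ (K.filter fun l => e l = false).card)
    (f := fun e => z ^ (K.filter fun l => e l = false).card) (c := z ^ m)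
    (isLaw_coins (by linarith) (by linarith)) (by positivity) (fun e => by positivity)
    (fun e he => pow_le_pow_right₀ hz he)
  rw [expec_coins_pow] at h
  refine h.trans (le_of_eq ?_)
  congr 2
  ring

theorem one_add_pow_le_exp {x : ℝ} (hx : 0 ≤ 1 + x) (m : ℕ) :
    (1 + x) ^ m ≤ Real.exp (m * x) := by
  rw [Real.exp_nat_mul]
  exact pow_le_pow_left₀ hx (by linarith [Real.add_one_le_exp x]) m

/-- Chernoff's bound with base `2`. -/
theorem tail_count_two (h0 : 0 ≤ q) (h1 : q ≤ 1) (K : Finset ι) (m : ℕ) :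
    expec (coins ι (1 - q)) (fun e => ind (m ≤ (K.filter fun l => e l = false).card)) ≤
      Real.exp (K.card * q) / 2 ^ m := by
  refine (tail_count h0 h1 K (z := 2) (by norm_num) m).trans ?_
  have := one_add_pow_le_exp (x := q) (by linarith) K.card
  rw [show (1 : ℝ) + q * (2 - 1) = 1 + q by ring]
  gcongr

/-- It is unlikely to see `m` successes if the expected number of successes is small. -/
theorem tail_count_small (h0 : 0 ≤ q) (h1 : q ≤ 1) (K : Finset ι) {x : ℝ} (hx0 : 0 < x)
    (hx1 : x ≤ 1) (hK : K.card * q ≤ x) (m : ℕ) :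
    expec (coins ι (1 - q)) (fun e => ind (m ≤ (K.filter fun l => e l = false).card)) ≤
      3 * x ^ m := by
  have hz : 1 ≤ 1 / x := by rw [le_div_iff₀ hx0]; linarith
  refine (tail_count h0 h1 K hz m).trans ?_
  have h2 : (1 + q * (1 / x - 1)) ^ K.card ≤ 3 := by
    refine (one_add_pow_le_exp (by nlinarith) K.card).trans ?_
    have h3 : (K.card : ℝ) * (q * (1 / x - 1)) ≤ 1 := by
      have h4 : (K.card : ℝ) * q * (1 / x - 1) ≤ x * (1 / x - 1) :=
        mul_le_mul_of_nonneg_right hK (by linarith)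
      have h5 : x * (1 / x - 1) = 1 - x := by field_simp
      nlinarith
    exact (Real.exp_le_exp.2 h3).trans (by linarith [Real.exp_one_lt_d9])
  rw [one_div] at h2 ⊢
  rw [inv_pow, div_inv_eq_mul]
  gcongr

end Tails

/-! ### The most popular columns -/

section Share

variable {κ : Type*}

/-- The columns in `R` with the maximal number of votes. -/
def winners (R : Finset κ) (V : κ → ℕ) : Finset κ := R.filter fun j => ∀ l ∈ R, V l ≤ V j

theorem mem_winners {R : Finset κ} {V : κ → ℕ} {j : κ} :
    j ∈ winners R V ↔ j ∈ R ∧ ∀ l ∈ R, V l ≤ V j := Finset.mem_filter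

/-- The probability that column `j` is recommended, if the columns in `R` are available
and `V` counts the votes. -/
def share [DecidableEq κ] (R : Finset κ) (V : κ → ℕ) (j : κ) : ℝ :=
  if j ∈ winners R V then 1 / ((winners R V).card : ℝ) else 0

theorem winners_nonempty {R : Finset κ} (hR : R.Nonempty) (V : κ → ℕ) : (winners R V).Nonempty := by
  obtain ⟨j, hj, h⟩ := Finset.exists_max_image R V hR
  exact ⟨j, Finset.mem_filter.2 ⟨hj, h⟩⟩

variable [DecidableEq κ]

theorem share_nonneg (R : Finset κ) (V : κ → ℕ) (j : κ) : 0 ≤ share R V j := by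
  unfold share; split_ifs <;> positivity

theorem sum_share_filter (R : Finset κ) (V : κ → ℕ) (s : Finset κ) :
    ∑ j ∈ s, share R V j = ((winners R V ∩ s).card : ℝ) / (winners R V).card := by
  unfold share
  rw [← Finset.sum_filter, Finset.sum_const, nsmul_eq_mul, mul_one_div, Finset.filter_mem_eq_inter,
    Finset.inter_comm]

theorem sum_share_le_one (R : Finset κ) (V : κ → ℕ) (s : Finset κ) :
    ∑ j ∈ s, share R V j ≤ 1 := by
  rw [sum_share_filter]
  refine div_le_one_of_le₀ ?_ (by positivity)
  exact_mod_cast Finset.card_le_card Finset.inter_subset_left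

theorem sum_share [Fintype κ] {R : Finset κ} (hR : R.Nonempty) (V : κ → ℕ) :
    ∑ j, share R V j = 1 := by
  rw [sum_share_filter, Finset.inter_univ]
  exact div_self (Nat.cast_ne_zero.2 (Finset.card_pos.2 (winners_nonempty hR V)).ne')

/-- A column is at least as likely to be recommended if other columns lose votes. -/
theorem share_le_share {R : Finset κ} {V V' : κ → ℕ} {j : κ} (hj : V' j = V j)
    (h : ∀ l, V' l ≤ V l) : share R V j ≤ share R V' j := by
  unfold share
  by_cases h1 : j ∈ winners R V
  · have h1' := Finset.mem_filter.1 h1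
    have h2 : j ∈ winners R V' :=
      Finset.mem_filter.2 ⟨h1'.1, fun l hl => by
        rw [hj]; exact (h l).trans (h1'.2 l hl)⟩
    have h3 : winners R V' ⊆ winners R V := fun l hl => by
      have hl' := Finset.mem_filter.1 hl
      refine Finset.mem_filter.2 ⟨hl'.1, fun m hm => ?_⟩
      have e1 := h1'.2 m hm
      have e2 := hl'.2 j h1'.1
      have e3 := h l
      omega
    rw [if_pos h1, if_pos h2]
    refine one_div_le_one_div_of_le ?_ ?_
    · exact_mod_cast Finset.card_pos.2 ⟨j, h2⟩
    · exact_mod_cast Finset.card_le_card h3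
  · rw [if_neg h1]
    split_ifs <;> positivity

/-- A group of columns is at least as likely to contain the recommended one if it gains votes
and the other columns lose votes. -/
theorem sum_share_le_sum_share {R s : Finset κ} {V V' : κ → ℕ} (h1 : ∀ j ∈ s, V j ≤ V' j)
    (h2 : ∀ j ∉ s, V' j ≤ V j) : ∑ j ∈ s, share R V j ≤ ∑ j ∈ s, share R V' j := by
  rw [sum_share_filter, sum_share_filter]
  rcases (winners R V ∩ s).eq_empty_or_nonempty with he | ⟨j, hj⟩
  · rw [he]
    simp only [Finset.card_empty, Nat.cast_zero, zero_div]
    positivity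
  obtain ⟨hjw, hjs⟩ := Finset.mem_inter.1 hj
  obtain ⟨hjR, hjm⟩ := Finset.mem_filter.1 hjw
  have hpos : 0 < (winners R V').card := Finset.card_pos.2 (winners_nonempty ⟨j, hjR⟩ V')
  have hpos' : 0 < (winners R V).card := Finset.card_pos.2 ⟨j, hjw⟩
  rw [div_le_div_iff₀ (by exact_mod_cast hpos') (by exact_mod_cast hpos)]
  by_cases hc : winners R V' ⊆ s
  · rw [Finset.inter_eq_left.2 hc]
    have : (winners R V ∩ s).card ≤ (winners R V).card :=
      Finset.card_le_card Finset.inter_subset_left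
    have h3 : ((winners R V ∩ s).card : ℝ) ≤ (winners R V).card := by exact_mod_cast this
    nlinarith [(Nat.cast_nonneg (winners R V').card : (0 : ℝ) ≤ _)]
  · obtain ⟨i, hi, his⟩ := Finset.not_subset.1 hc
    obtain ⟨hiR, him⟩ := Finset.mem_filter.1 hi
    -- the maximum is still attained outside of `s`, so its value has not changed
    have e1 := him j hjR
    have e2 := h1 j hjs
    have e3 := h2 i his
    have e4 := hjm i hiR
    have hA : winners R V ∩ s ⊆ winners R V' ∩ s := fun l hl => by
      obtain ⟨hlw, hls⟩ := Finset.mem_inter.1 hl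
      obtain ⟨hlR, hlm⟩ := Finset.mem_filter.1 hlw
      refine Finset.mem_inter.2 ⟨Finset.mem_filter.2 ⟨hlR, fun m hm => ?_⟩, hls⟩
      have := him m hm
      have := hlm j hjR
      have := h1 l hls
      omega
    have hB : winners R V' \ s ⊆ winners R V \ s := fun l hl => by
      obtain ⟨hlw, hls⟩ := Finset.mem_sdiff.1 hl
      obtain ⟨hlR, hlm⟩ := Finset.mem_filter.1 hlw
      refine Finset.mem_sdiff.2 ⟨Finset.mem_filter.2 ⟨hlR, fun m hm => ?_⟩, hls⟩
      have := hjm m hm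
      have := hlm j hjR
      have := h2 l hls
      omega
    have cA := Finset.card_le_card hA
    have cB := Finset.card_le_card hB
    have d1 := Finset.card_sdiff_add_card_inter (winners R V) s
    have d2 := Finset.card_sdiff_add_card_inter (winners R V') s
    have : (winners R V ∩ s).card * (winners R V').card ≤
        (winners R V' ∩ s).card * (winners R V).card := by
      rw [← d1, ← d2]
      nlinarith [Nat.mul_le_mul cA cB]
    exact_mod_cast this

end Share

/-! ### The probability that a column cluster wins -/

section Win

variable {n r : ℕ}

/-- The votes for column `j` if `N b` of the voters like the column cluster `b`: as the
observations of the votes are i.i.d., the voters for `j` may be taken to be the first `N (B j)`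
rows. -/
def votesFor (B : Fin n → Fin r) (e : Fin n × Fin n → Bool) (N : Fin r → ℕ) (j : Fin n) : ℕ :=
  ((Finset.univ.filter fun l : Fin n => l.val < N (B j)).filter fun l => e (l, j) = false).card

/-- The probability that the recommended column lies in `s`, if the columns in `R` are available,
each vote is observed with probability `q`, and `N b` voters like the column cluster `b`. -/
def winProb (q : ℝ) (B : Fin n → Fin r) (R : Finset (Fin n)) (N : Fin r → ℕ)
    (s : Finset (Fin n)) : ℝ :=
  expec (coins (Fin n × Fin n) (1 - q)) fun e => ∑ j ∈ s, share R (votesFor B e N) j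

/-- The columns in the cluster `b`. -/
def cluster (B : Fin n → Fin r) (b : Fin r) : Finset (Fin n) := Finset.univ.filter fun j => B j = b

theorem mem_cluster {B : Fin n → Fin r} {b : Fin r} {j : Fin n} : j ∈ cluster B b ↔ B j = b := by
  simp [cluster]

theorem sum_cluster (B : Fin n → Fin r) (f : Fin n → ℝ) :
    ∑ b, ∑ j ∈ cluster B b, f j = ∑ j, f j :=
  Finset.sum_fiberwise Finset.univ B f

variable {q : ℝ} {B : Fin n → Fin r} {R : Finset (Fin n)}

theorem winProb_nonneg (h0 : 0 ≤ q) (h1 : q ≤ 1) (N : Fin r → ℕ) (s : Finset (Fin n)) :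
    0 ≤ winProb q B R N s :=
  expec_nonneg (isLaw_coins (by linarith) (by linarith)) fun _ =>
    Finset.sum_nonneg fun _ _ => share_nonneg _ _ _

theorem winProb_le_one (h0 : 0 ≤ q) (h1 : q ≤ 1) (N : Fin r → ℕ) (s : Finset (Fin n)) :
    winProb q B R N s ≤ 1 :=
  expec_le_of_le (isLaw_coins (by linarith) (by linarith)) fun _ => sum_share_le_one _ _ _

theorem sum_winProb (h0 : 0 ≤ q) (h1 : q ≤ 1) (hR : R.Nonempty) (N : Fin r → ℕ) :
    ∑ b, winProb q B R N (cluster B b) = 1 := by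
  unfold winProb
  rw [← expec_sum]
  simp only [sum_cluster, sum_share hR]
  exact expec_const (isLaw_coins (by linarith) (by linarith)) 1

theorem votesFor_mono {e : Fin n × Fin n → Bool} {N N' : Fin r → ℕ} {j : Fin n}
    (h : N (B j) ≤ N' (B j)) : votesFor B e N j ≤ votesFor B e N' j := by
  refine Finset.card_le_card (Finset.filter_subset_filter _ fun l hl => ?_)
  simp only [Finset.mem_filter, Finset.mem_univ, true_and] at hl ⊢
  omega

theorem winProb_mono (h0 : 0 ≤ q) (h1 : q ≤ 1) {N N' : Fin r → ℕ} {b : Fin r} (hb : N b ≤ N' b)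
    (h : ∀ b' ≠ b, N' b' ≤ N b') :
    winProb q B R N (cluster B b) ≤ winProb q B R N' (cluster B b) := by
  refine expec_mono (isLaw_coins (by linarith) (by linarith)) fun e => ?_
  refine sum_share_le_sum_share (fun j hj => votesFor_mono ?_) fun j hj => votesFor_mono (h _ ?_)
  · rwa [mem_cluster.1 hj]
  · rwa [mem_cluster] at hj

theorem coins_comp_swap {ι : Type*} [Fintype ι] [DecidableEq ι] (p : ℝ) (x y : ι)
    (F : (ι → Bool) → ℝ) :
    expec (coins ι p) (fun e => F (e ∘ Equiv.swap x y)) = expec (coins ι p) F :=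
  expec_prodLaw_perm (coin p) (Equiv.swap x y) F

/-- Exchanging two voters for the same column does not change the votes. -/
theorem votesFor_comp_swap (e : Fin n × Fin n → Bool) (N : Fin r → ℕ) {j x y : Fin n}
    (hx : x.val < N (B j)) (hy : y.val < N (B j)) :
    votesFor B (e ∘ Equiv.swap (x, j) (y, j)) N = votesFor B e N := by
  have hsw : ∀ l i : Fin n, Equiv.swap (x, j) (y, j) (l, i) =
      (if i = j then Equiv.swap x y l else l, i) := by
    intro l i
    split_ifs with hi
    · subst hi
      rcases eq_or_ne l x with rfl | hlx
      · simp
      · rcases eq_or_ne l y with rfl | hly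
        · simp
        · rw [Equiv.swap_apply_of_ne_of_ne hlx hly,
            Equiv.swap_apply_of_ne_of_ne (by simp [hlx]) (by simp [hly])]
    · exact Equiv.swap_apply_of_ne_of_ne (by simp [hi]) (by simp [hi])
  funext i
  unfold votesFor
  rcases eq_or_ne i j with rfl | hij
  · have hlt : ∀ l : Fin n, (Equiv.swap x y l).val < N (B i) ↔ l.val < N (B i) := fun l => by
      rcases eq_or_ne l x with rfl | hlx
      · simp [hx, hy]
      · rcases eq_or_ne l y with rfl | hly
        · simp [hx, hy]
        · rw [Equiv.swap_apply_of_ne_of_ne hlx hly]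
    refine Finset.card_bij (fun l _ => Equiv.swap x y l) (fun l hl => ?_)
      (fun a _ b _ h => (Equiv.swap x y).injective h) fun l hl => ⟨Equiv.swap x y l, ?_, by simp⟩
    · simpa [hsw, hlt] using hl
    · simpa [hsw, hlt] using hl
  · simp [hsw, hij]

/-- Each of the voters for a column is equally likely to have contributed to its success. -/
theorem expec_share_voter (p : ℝ) (N : Fin r → ℕ) {j x : Fin n} (hx : x.val < N (B j)) :
    ((min n (N (B j)) : ℕ) : ℝ) * expec (coins (Fin n × Fin n) p)
      (fun e => share R (votesFor B e N) j * ind (e (x, j) = false)) =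
      expec (coins (Fin n × Fin n) p)
        (fun e => share R (votesFor B e N) j * votesFor B e N j) := by
  have hsame : ∀ y ∈ Finset.univ.filter fun l : Fin n => l.val < N (B j),
      expec (coins (Fin n × Fin n) p)
        (fun e => share R (votesFor B e N) j * ind (e (y, j) = false)) =
      expec (coins (Fin n × Fin n) p)
        (fun e => share R (votesFor B e N) j * ind (e (x, j) = false)) := fun y hy => by
    have hy' : y.val < N (B j) := (Finset.mem_filter.1 hy).2
    rw [← coins_comp_swap p (x, j) (y, j)
      (fun e => share R (votesFor B e N) j * ind (e (y, j) = false))]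
    refine congrArg (expec _) (funext fun e => ?_)
    rw [votesFor_comp_swap e N hx hy', Function.comp_apply, Equiv.swap_apply_right]
  have hcard := Fin.card_filter_val_lt (n := n) (m := N (B j))
  have h2 : ∀ e : Fin n × Fin n → Bool, (votesFor B e N j : ℝ) =
      ∑ y ∈ Finset.univ.filter fun l : Fin n => l.val < N (B j), ind (e (y, j) = false) :=
    fun e => by rw [sum_ind]; rfl
  have h3 : ∀ e : Fin n × Fin n → Bool, share R (votesFor B e N) j * votesFor B e N j =
      ∑ y ∈ Finset.univ.filter fun l : Fin n => l.val < N (B j),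
        share R (votesFor B e N) j * ind (e (y, j) = false) := fun e => by
    rw [h2, Finset.mul_sum]
  simp only [h3]
  rw [expec_sum, Finset.sum_congr rfl hsame, Finset.sum_const, nsmul_eq_mul, hcard]

end Win

section Win

variable {n r : ℕ} {q : ℝ} {B : Fin n → Fin r} {R : Finset (Fin n)}

/-- The cells of the voters for column `j`. -/
def voterCells (B : Fin n → Fin r) (N : Fin r → ℕ) (j : Fin n) : Finset (Fin n × Fin n) :=
  (Finset.univ.filter fun l : Fin n => l.val < N (B j)) ×ˢ {j}

theorem card_voterCells (N : Fin r → ℕ) (j : Fin n) :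
    (voterCells B N j).card = min n (N (B j)) := by
  rw [voterCells, Finset.card_product, Finset.card_singleton, mul_one, Fin.card_filter_val_lt]

theorem votesFor_eq (e : Fin n × Fin n → Bool) (N : Fin r → ℕ) (j : Fin n) :
    votesFor B e N j = ((voterCells B N j).filter fun c => e c = false).card := by
  unfold votesFor voterCells
  refine Finset.card_bij (fun l _ => (l, j)) (fun l hl => ?_)
    (fun a _ b _ h => (Prod.ext_iff.1 h).1)
    fun c hc => ⟨c.1, ?_, ?_⟩
  · simpa using hl
  · simp only [Finset.mem_filter, Finset.mem_product, Finset.mem_univ, true_and,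
      Finset.mem_singleton] at hc ⊢
    obtain ⟨⟨h1, h2⟩, h3⟩ := hc
    subst h2
    exact ⟨h1, h3⟩
  · simp only [Finset.mem_filter, Finset.mem_product, Finset.mem_univ, true_and,
      Finset.mem_singleton] at hc
    exact Prod.ext rfl hc.1.2.symm

theorem votesFor_le (e : Fin n × Fin n → Bool) (N : Fin r → ℕ) (j : Fin n) :
    votesFor B e N j ≤ n := by
  rw [votesFor_eq]
  exact (Finset.card_filter_le _ _).trans ((card_voterCells N j).trans_le (min_le_left _ _))

/-- The cluster `b` is almost as likely to win if it loses `t` of its `M` voters: these are unlikely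
to be among the few voters whose votes for the winning column have been observed. -/
theorem winProb_lower (h0 : 0 ≤ q) (h1 : q ≤ 1) {N N' : Fin r → ℕ} {b : Fin r} {M t v : ℕ}
    (hM : M = min n (N b)) (hM0 : 0 < M) (hb : M ≤ N' b + t)
    (h : ∀ b' ≠ b, N' b' ≤ N b') :
    (1 - t * v / M) * winProb q B R N (cluster B b) -
        t * n ^ 2 * (Real.exp (M * q) / 2 ^ v) ≤
      winProb q B R N' (cluster B b) := by
  set law := coins (Fin n × Fin n) (1 - q) with hlaw_def
  have hlaw : IsLaw law := isLaw_coins (by linarith) (by linarith)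
  set N'' : Fin r → ℕ := Function.update N b (M - t) with hN''
  have hMr : (0 : ℝ) < M := by exact_mod_cast hM0
  -- the voters that are lost
  set W : Finset (Fin n) := Finset.univ.filter fun l : Fin n => M - t ≤ l.val ∧ l.val < M with hW
  have hWcard : (W.card : ℝ) ≤ t := by
    have : W.card ≤ (Finset.Ico (M - t) M).card := by
      refine Finset.card_le_card_of_injOn (fun l => l.val) (fun l hl => ?_)
        fun a _ b _ hab => Fin.ext hab
      simpa [hW] using hl
    rw [Nat.card_Ico] at this
    exact_mod_cast this.trans (by omega)
  have hcol : ∀ j ∈ cluster B b,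
      (1 - t * v / M) * expec law (fun e => share R (votesFor B e N) j) -
        t * n * (Real.exp (M * q) / 2 ^ v) ≤
      expec law (fun e => share R (votesFor B e N'') j) := by
    intro j hj
    have hBj : B j = b := mem_cluster.1 hj
    have hpt : ∀ e, share R (votesFor B e N) j -
        ∑ l ∈ W, share R (votesFor B e N) j * ind (e (l, j) = false) ≤
        share R (votesFor B e N'') j := by
      intro e
      by_cases hex : ∃ l ∈ W, e (l, j) = false
      · obtain ⟨l, hl, hel⟩ := hex
        have : share R (votesFor B e N) j ≤
            ∑ l ∈ W, share R (votesFor B e N) j * ind (e (l, j) = false) := by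
          have h2 := Finset.single_le_sum
            (f := fun l => share R (votesFor B e N) j * ind (e (l, j) = false))
            (fun i _ => mul_nonneg (share_nonneg _ _ _) (ind_nonneg _)) hl
          simpa [ind_of hel] using h2
        linarith [share_nonneg R (votesFor B e N'') j]
      · push Not at hex
        have hsum : 0 ≤ ∑ l ∈ W, share R (votesFor B e N) j * ind (e (l, j) = false) :=
          Finset.sum_nonneg fun i _ => mul_nonneg (share_nonneg _ _ _) (ind_nonneg _)
        have hle : share R (votesFor B e N) j ≤ share R (votesFor B e N'') j := by
          refine share_le_share ?_ fun l => votesFor_mono ?_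
          · unfold votesFor
            congr 1
            ext l
            simp only [hBj, hN'', Function.update_self, Finset.mem_filter, Finset.mem_univ,
              true_and]
            refine and_congr_left fun hl => ⟨fun h => by have := l.isLt; omega, fun h => ?_⟩
            by_contra hcon
            refine hex l (Finset.mem_filter.2 ⟨Finset.mem_univ _, ?_, ?_⟩) hl
            · omega
            · have := l.isLt; omega
          · rw [hN'']
            by_cases hlb : B l = b
            · rw [hlb, Function.update_self]; omega
            · rw [Function.update_of_ne hlb]
        linarith
    have hE := expec_mono hlaw hpt
    rw [expec_sub, expec_sum] at hE
    -- by symmetry the loss is the average number of votes per voter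
    have hvote : ∀ l ∈ W, expec law (fun e => share R (votesFor B e N) j * ind (e (l, j) = false)) ≤
        (v * expec law (fun e => share R (votesFor B e N) j) +
          n * (Real.exp (M * q) / 2 ^ v)) / M := by
      intro l hl
      have hl' : l.val < N (B j) := by
        have := (Finset.mem_filter.1 hl).2.2
        rw [hBj]; omega
      have hs := expec_share_voter (R := R) (1 - q) N hl'
      rw [hBj, ← hM] at hs
      rw [le_div_iff₀ hMr, mul_comm, hs]
      have htail := tail_count_two h0 h1 (voterCells B N j) v
      rw [card_voterCells, hBj, ← hM] at htail
      calc expec law (fun e => share R (votesFor B e N) j * votesFor B e N j)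
          ≤ expec law (fun e => v * share R (votesFor B e N) j +
              n * ind (v ≤ ((voterCells B N j).filter fun c => e c = false).card)) := by
            refine expec_mono hlaw fun e => ?_
            rw [← votesFor_eq]
            have hsh := share_nonneg R (votesFor B e N) j
            have hsh1 : share R (votesFor B e N) j ≤ 1 := by
              simpa using sum_share_le_one R (votesFor B e N) {j}
            by_cases hv : v ≤ votesFor B e N j
            · rw [ind_of hv]
              have : (votesFor B e N j : ℝ) ≤ n := by exact_mod_cast votesFor_le e N j
              have hv0 : (0 : ℝ) ≤ v := by positivity
              nlinarith [mul_nonneg hv0 hsh]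
            · rw [ind_of_not hv]
              have : (votesFor B e N j : ℝ) ≤ v := by exact_mod_cast (not_le.1 hv).le
              nlinarith
        _ = v * expec law (fun e => share R (votesFor B e N) j) + n * expec law (fun e =>
              ind (v ≤ ((voterCells B N j).filter fun c => e c = false).card)) := by
            rw [expec_add, expec_mul_left, expec_mul_left]
        _ ≤ _ := by gcongr
    have hsum := Finset.sum_le_sum hvote
    rw [Finset.sum_const, nsmul_eq_mul] at hsum
    set x := expec law (fun e => share R (votesFor B e N) j) with hx
    have hx0 : 0 ≤ x := expec_nonneg hlaw fun e => share_nonneg _ _ _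
    set y := Real.exp (M * q) / 2 ^ v with hy
    have hy0 : 0 ≤ y := by positivity
    have h5 : (W.card : ℝ) * ((v * x + n * y) / M) ≤ t * ((v * x + n * y) / M) :=
      mul_le_mul_of_nonneg_right hWcard (by positivity)
    have h6 : (t : ℝ) * ((v * x + n * y) / M) = t * v / M * x + t * n * y / M := by
      field_simp
    have h7 : (t : ℝ) * n * y / M ≤ t * n * y :=
      div_le_self (by positivity) (by exact_mod_cast hM0)
    linarith
  have hcc : ((cluster B b).card : ℝ) ≤ n := by
    have := Finset.card_le_univ (cluster B b)
    rw [Fintype.card_fin] at this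
    exact_mod_cast this
  have hsumm := Finset.sum_le_sum hcol
  rw [Finset.sum_sub_distrib, ← Finset.mul_sum, Finset.sum_const, nsmul_eq_mul] at hsumm
  have e1 : ∑ j ∈ cluster B b, expec law (fun e => share R (votesFor B e N) j) =
      winProb q B R N (cluster B b) := (expec_sum _ _ _).symm
  have e2 : ∑ j ∈ cluster B b, expec law (fun e => share R (votesFor B e N'') j) =
      winProb q B R N'' (cluster B b) := (expec_sum _ _ _).symm
  rw [e1, e2] at hsumm
  have h8 : ((cluster B b).card : ℝ) * (t * n * (Real.exp (M * q) / 2 ^ v)) ≤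
      n * (t * n * (Real.exp (M * q) / 2 ^ v)) :=
    mul_le_mul_of_nonneg_right hcc (by positivity)
  have h9 : winProb q B R N'' (cluster B b) ≤ winProb q B R N' (cluster B b) := by
    refine winProb_mono h0 h1 ?_ fun b' hb' => ?_
    · rw [hN'', Function.update_self]; omega
    · rw [hN'', Function.update_of_ne hb']; exact h b' hb'
  have h10 : (n : ℝ) * (t * n * (Real.exp (M * q) / 2 ^ v)) =
      t * n ^ 2 * (Real.exp (M * q) / 2 ^ v) := by ring
  linarith

/-! ### Few votes: at most one per column -/

/-- Each cell of `Z` is equally likely to be picked if one of the observed cells of `Z` is drawn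
uniformly at random. -/
theorem expec_pick {ι : Type*} [Fintype ι] [DecidableEq ι] (p : ℝ) (Z : Finset ι) {z z' : ι}
    (hz : z ∈ Z) (hz' : z' ∈ Z) :
    expec (coins ι p) (fun e => ind (e z = false) / ((Z.filter fun c => e c = false).card : ℝ)) =
      expec (coins ι p)
        (fun e => ind (e z' = false) / ((Z.filter fun c => e c = false).card : ℝ)) := by
  rw [← coins_comp_swap p z z'
    (fun e => ind (e z = false) / ((Z.filter fun c => e c = false).card : ℝ))]
  refine congrArg (expec _) (funext fun e => ?_)
  have hc : (Z.filter fun c => (e ∘ Equiv.swap z z') c = false).card =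
      (Z.filter fun c => e c = false).card := by
    have hZ : ∀ c, Equiv.swap z z' c ∈ Z ↔ c ∈ Z := fun c => by
      rcases eq_or_ne c z with rfl | h1
      · simp [hz, hz']
      · rcases eq_or_ne c z' with rfl | h2
        · simp [hz, hz']
        · rw [Equiv.swap_apply_of_ne_of_ne h1 h2]
    refine Finset.card_bij (fun c _ => Equiv.swap z z' c) (fun c hc => ?_)
      (fun a _ b _ h => (Equiv.swap z z').injective h)
      fun c hc => ⟨Equiv.swap z z' c, ?_, by simp⟩
    · simpa [hZ] using hc
    · simpa [hZ] using hc
  rw [hc, Function.comp_apply, Equiv.swap_apply_left]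

/-- If hardly any column gets two votes, then the recommended column is distributed like that
of a uniformly random positive vote of a selected row, or like a uniformly random column if there
are no votes at all. -/
theorem le_expec_share_of_few (h0 : 0 ≤ q) (h1 : q ≤ 1) (hR : R.Nonempty) {N : Fin r → ℕ} {T : ℕ}
    (hN : ∀ b, N b ≤ T) (hTn : T ≤ n) (hT0 : 0 < T * q) (hTq : T * q ≤ 1) (G : Finset (Fin n))
    {ρ : ℝ}
    (hG1 : ρ * ∑ j ∈ R, (N (B j) : ℝ) ≤ ∑ j ∈ R ∩ G, (N (B j) : ℝ))
    (hG2 : ρ * R.card ≤ (R ∩ G).card) :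
    ρ - 3 * n * (T * q) ^ 2 ≤ winProb q B R N G := by
  set law := coins (Fin n × Fin n) (1 - q) with hlaw_def
  have hlaw : IsLaw law := isLaw_coins (by linarith) (by linarith)
  set Z : Finset (Fin n × Fin n) :=
    Finset.univ.filter fun c => c.2 ∈ R ∧ c.1.val < N (B c.2) with hZ
  set obs : (Fin n × Fin n → Bool) → Finset (Fin n × Fin n) :=
    fun e => Z.filter fun c => e c = false with hobs
  have hmemobs : ∀ e c, c ∈ obs e ↔ (c.2 ∈ R ∧ c.1.val < N (B c.2)) ∧ e c = false := fun e c => by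
    simp [hobs, hZ]
  have hcardZ : ∀ s : Finset (Fin n), ((Z.filter fun c => c.2 ∈ s).card : ℝ) =
      ∑ j ∈ R ∩ s, (N (B j) : ℝ) := by
    intro s
    have : Z.filter (fun c => c.2 ∈ s) = (R ∩ s).biUnion (voterCells B N) := by
      ext c
      simp only [hZ, voterCells, Finset.mem_filter, Finset.mem_univ, true_and, Finset.mem_biUnion,
        Finset.mem_inter, Finset.mem_product, Finset.mem_singleton]
      constructor
      · rintro ⟨⟨h1, h2⟩, h3⟩
        exact ⟨c.2, ⟨h1, h3⟩, h2, rfl⟩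
      · rintro ⟨j, ⟨h1, h2⟩, h3, h4⟩
        rw [h4]; exact ⟨⟨h1, h3⟩, h2⟩
    rw [this, Finset.card_biUnion]
    · push_cast
      refine Finset.sum_congr rfl fun j _ => ?_
      rw [card_voterCells, min_eq_right ((hN _).trans hTn)]
    · intro i _ j _ hij
      refine Finset.disjoint_left.2 fun c hc hc' => hij ?_
      simp only [voterCells, Finset.mem_product, Finset.mem_singleton] at hc hc'
      rw [← hc.2, ← hc'.2]
  have hZR : (Z.card : ℝ) = ∑ j ∈ R, (N (B j) : ℝ) := by
    rw [← Finset.inter_self R, ← hcardZ R]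
    congr 2
    refine (Finset.filter_true_of_mem fun c hc => ?_).symm
    exact (Finset.mem_filter.1 hc).2.1
  have hpt : ∀ e, ρ * ind (obs e = ∅) +
      ∑ z ∈ Z.filter (fun c => c.2 ∈ G), ind (e z = false) / ((obs e).card : ℝ) -
      ∑ j, ind (2 ≤ ((voterCells B N j).filter fun c => e c = false).card) ≤
      ∑ j ∈ G, share R (votesFor B e N) j := by
    intro e
    have hbad0 : 0 ≤ ∑ j, ind (2 ≤ ((voterCells B N j).filter fun c => e c = false).card) :=
      Finset.sum_nonneg fun _ _ => ind_nonneg _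
    have hshare0 : 0 ≤ ∑ j ∈ G, share R (votesFor B e N) j :=
      Finset.sum_nonneg fun _ _ => share_nonneg _ _ _
    have hfil : ∑ z ∈ Z.filter (fun c => c.2 ∈ G), ind (e z = false) / ((obs e).card : ℝ) =
        (((obs e).filter fun c => c.2 ∈ G).card : ℝ) / (obs e).card := by
      rw [← Finset.sum_div, sum_ind, hobs]
      simp only [Finset.filter_filter, and_comm]
    rw [hfil]
    by_cases hbad : ∃ j, 2 ≤ ((voterCells B N j).filter fun c => e c = false).card
    · obtain ⟨j, hj⟩ := hbad
      have hone : 1 ≤ ∑ j, ind (2 ≤ ((voterCells B N j).filter fun c => e c = false).card) := by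
        have := Finset.single_le_sum
          (f := fun j => ind (2 ≤ ((voterCells B N j).filter fun c => e c = false).card))
          (fun i _ => ind_nonneg _) (Finset.mem_univ j)
        simpa [ind_of hj] using this
      have hρ1 : ρ ≤ 1 := by
        have hRpos : (0 : ℝ) < R.card := by exact_mod_cast Finset.card_pos.2 hR
        have : ((R ∩ G).card : ℝ) ≤ R.card := by
          exact_mod_cast Finset.card_le_card Finset.inter_subset_left
        by_contra hcon
        nlinarith
      rcases (obs e).eq_empty_or_nonempty with he | he
      · rw [ind_of he, he]
        simp only [Finset.filter_empty, Finset.card_empty, Nat.cast_zero, zero_div]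
        linarith
      · rw [ind_of_not he.ne_empty]
        have : (((obs e).filter fun c => c.2 ∈ G).card : ℝ) / (obs e).card ≤ 1 :=
          div_le_one_of_le₀ (by exact_mod_cast Finset.card_filter_le _ _) (by positivity)
        linarith
    · push Not at hbad
      have hV : ∀ j, votesFor B e N j ≤ 1 := fun j => by
        rw [votesFor_eq]; have := hbad j; omega
      refine le_trans (sub_le_self _ hbad0) ?_
      rw [sum_share_filter]
      have hVpos : ∀ j ∈ R, 0 < votesFor B e N j ↔ ∃ l, (l, j) ∈ obs e := fun j hj => by
        simp only [votesFor, Finset.card_pos, hmemobs]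
        constructor
        · rintro ⟨l, hl⟩
          simp only [Finset.mem_filter, Finset.mem_univ, true_and] at hl
          exact ⟨l, ⟨hj, hl.1⟩, hl.2⟩
        · rintro ⟨l, hl⟩
          exact ⟨l, by simpa using ⟨hl.1.2, hl.2⟩⟩
      rcases (obs e).eq_empty_or_nonempty with he | he
      · have hV0 : ∀ j ∈ R, votesFor B e N j = 0 := fun j hj => by
          have := hVpos j hj
          simp only [he, Finset.notMem_empty, exists_false, iff_false] at this
          omega
        have hw : winners R (votesFor B e N) = R :=
          Finset.ext fun j => ⟨fun h => (mem_winners.1 h).1, fun hj =>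
            mem_winners.2 ⟨hj, fun l hl => by rw [hV0 j hj, hV0 l hl]⟩⟩
        rw [hw, ind_of he, he]
        simp only [Finset.filter_empty, Finset.card_empty, Nat.cast_zero, zero_div, add_zero,
          mul_one]
        rw [le_div_iff₀ (by exact_mod_cast Finset.card_pos.2 hR)]
        exact hG2
      · rw [ind_of_not he.ne_empty, mul_zero, zero_add]
        obtain ⟨c₀, hc₀⟩ := he
        have hc₀' := (hmemobs e c₀).1 hc₀
        have hw : winners R (votesFor B e N) = R.filter fun j => 0 < votesFor B e N j := by
          ext j
          simp only [winners, Finset.mem_filter]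
          refine and_congr_right fun hj => ⟨fun h => ?_, fun h l hl => (hV l).trans h⟩
          have e1 := h c₀.2 hc₀'.1.1
          have e2 := (hVpos c₀.2 hc₀'.1.1).2 ⟨c₀.1, hc₀⟩
          omega
        -- the observed positive votes correspond to the winning columns
        have himg : ∀ s : Finset (Fin n), (winners R (votesFor B e N) ∩ s).card =
            ((obs e).filter fun c => c.2 ∈ s).card := fun s => by
          symm
          refine Finset.card_bij (fun c _ => c.2) (fun c hc => ?_) (fun c hc c' hc' h => ?_)
            fun j hj => ?_
          · rw [Finset.mem_filter] at hc
            have hcR := ((hmemobs e c).1 hc.1).1.1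
            rw [Finset.mem_inter, hw, Finset.mem_filter]
            exact ⟨⟨hcR, (hVpos _ hcR).2 ⟨c.1, hc.1⟩⟩, hc.2⟩
          · rw [Finset.mem_filter] at hc hc'
            have m1 := (hmemobs e c).1 hc.1
            have m2 := (hmemobs e c').1 hc'.1
            have h2 := hV c.2
            rw [votesFor, Finset.card_le_one] at h2
            refine Prod.ext (h2 c.1 ?_ c'.1 ?_) h
            · simpa using ⟨m1.1.2, m1.2⟩
            · rw [h]; simpa using ⟨m2.1.2, m2.2⟩
          · rw [Finset.mem_inter, hw, Finset.mem_filter] at hj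
            obtain ⟨l, hl⟩ := (hVpos j hj.1.1).1 hj.1.2
            exact ⟨(l, j), Finset.mem_filter.2 ⟨hl, hj.2⟩, rfl⟩
        have hall := himg Finset.univ
        rw [Finset.inter_univ] at hall
        rw [himg G, hall]
        simp
  have hE := expec_mono hlaw hpt
  rw [expec_sub, expec_add, expec_mul_left, expec_sum, expec_sum] at hE
  -- the probability that some column gets two votes
  have hbad : ∑ j : Fin n, expec law
      (fun e => ind (2 ≤ ((voterCells B N j).filter fun c => e c = false).card)) ≤
      3 * n * (T * q) ^ 2 := by
    have : ∀ j ∈ (Finset.univ : Finset (Fin n)), expec law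
        (fun e => ind (2 ≤ ((voterCells B N j).filter fun c => e c = false).card)) ≤
        3 * (T * q) ^ 2 := fun j _ => by
      refine tail_count_small h0 h1 _ hT0 hTq ?_ 2
      rw [card_voterCells]
      have : ((min n (N (B j)) : ℕ) : ℝ) ≤ T := by
        exact_mod_cast (min_le_right _ _).trans (hN _)
      exact mul_le_mul_of_nonneg_right this h0
    refine (Finset.sum_le_sum this).trans (le_of_eq ?_)
    simp; ring
  have hmain : ρ ≤ ρ * expec law (fun e => ind (obs e = ∅)) +
      ∑ z ∈ Z.filter (fun c => c.2 ∈ G), expec law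
        (fun e => ind (e z = false) / ((obs e).card : ℝ)) := by
    have hsumZ : expec law (fun e => ind (obs e = ∅)) +
        ∑ z ∈ Z, expec law (fun e => ind (e z = false) / ((obs e).card : ℝ)) = 1 := by
      rw [← expec_sum, ← expec_add, ← expec_const hlaw 1]
      congr 1
      funext e
      rw [← Finset.sum_div, sum_ind]
      rcases (obs e).eq_empty_or_nonempty with he | he
      · rw [ind_of he, he]; simp
      · rw [ind_of_not he.ne_empty, zero_add]
        exact div_self (Nat.cast_ne_zero.2 (Finset.card_pos.2 he).ne')
    rcases Z.eq_empty_or_nonempty with hZe | ⟨z₀, hz₀⟩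
    · rw [hZe] at hsumZ ⊢
      simp only [Finset.sum_empty, Finset.filter_empty, add_zero] at hsumZ ⊢
      rw [hsumZ, mul_one]
    · set x := expec law (fun e => ind (e z₀ = false) / ((obs e).card : ℝ)) with hx
      have hx0 : 0 ≤ x := expec_nonneg hlaw fun e => div_nonneg (ind_nonneg _) (by positivity)
      have hall : ∀ z ∈ Z, expec law (fun e => ind (e z = false) / ((obs e).card : ℝ)) = x :=
        fun z hz => expec_pick (1 - q) Z hz hz₀
      rw [Finset.sum_congr rfl hall, Finset.sum_const, nsmul_eq_mul, hZR] at hsumZ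
      rw [Finset.sum_congr rfl fun z hz => hall z (Finset.mem_of_mem_filter z hz),
        Finset.sum_const, nsmul_eq_mul, hcardZ G]
      have h3 := mul_le_mul_of_nonneg_right hG1 hx0
      have h4 : ρ * (∑ j ∈ R, (N (B j) : ℝ)) * x =
          ρ * ((∑ j ∈ R, (N (B j) : ℝ)) * x) := by ring
      rw [h4] at h3
      have h5 : (∑ j ∈ R, (N (B j) : ℝ)) * x = 1 - expec law (fun e => ind (obs e = ∅)) := by
        linarith
      rw [h5] at h3
      linarith
  have : winProb q B R N G = expec law fun e => ∑ j ∈ G, share R (votesFor B e N) j := rfl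
  linarith

end Win

/-! ### The error probability as an iterated expectation -/

/-- The law of a matrix with i.i.d. entries. -/
abbrev matLaw (a b : ℕ) (p : ℝ) : (Fin a → Fin b → Bool) → ℝ :=
  prodLaw fun _ : Fin a => coins (Fin b) p

theorem isLaw_matLaw (a b : ℕ) {p : ℝ} (h0 : 0 ≤ p) (h1 : p ≤ 1) : IsLaw (matLaw a b p) :=
  IsLaw.prodLaw fun _ => isLaw_coins h0 h1

theorem expec_matLaw_uncurry (a b : ℕ) (p : ℝ) (F : (Fin a → Fin b → Bool) → ℝ) :
    expec (coins (Fin a × Fin b) p) (fun e => F (Function.curry e)) = expec (matLaw a b p) F := by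
  rw [← expec_equiv (matLaw a b p) F (Equiv.curry (Fin a) (Fin b) Bool)]
  refine Finset.sum_congr rfl fun e _ => ?_
  simp only [coins, matLaw, prodLaw, Fintype.prod_prod_type]
  rfl

theorem bernoulliWeight_toReal (q : unitInterval) (v : Bool) :
    (bernoulliWeight q v).toReal = coin q v := by
  unfold bernoulliWeight coin
  cases v <;> simp

theorem iidMatrix_toReal (a b : ℕ) (q : unitInterval) (M : Fin a → Fin b → Bool) :
    (iidMatrix a b q M).toReal = matLaw a b q M := by
  simp only [iidMatrix, PMF.ofFintype_apply, ENNReal.toReal_prod, bernoulliWeight_toReal]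
  rfl

theorem toReal_bind {Ω Ω' : Type*} [Fintype Ω] (P : PMF Ω) (f : Ω → PMF Ω') (s : Set Ω') :
    ((P.bind f).toOuterMeasure s).toReal =
      expec (fun x => (P x).toReal) fun x => ((f x).toOuterMeasure s).toReal := by
  rw [PMF.toOuterMeasure_bind_apply, tsum_fintype, ENNReal.toReal_sum]
  · simp only [ENNReal.toReal_mul, expec]
  · intro x _
    refine ENNReal.mul_ne_top (PMF.apply_ne_top _ _) (ne_top_of_le_ne_top ENNReal.one_ne_top ?_)
    exact (MeasureTheory.OuterMeasure.mono _ (Set.subset_univ _)).trans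
      (by simp [PMF.toOuterMeasure_apply, PMF.tsum_coe])

section Reduction

variable {n r : ℕ}

theorem winners_eq_mostPopular (Y : Fin n → Fin n → Option Bool) (u : Fin n)
    (S : Finset (Fin n)) :
    winners (Finset.univ.filter fun j => Y u j = none) (votes Y S) = mostPopular Y u S := by
  ext j
  simp [mem_winners, mostPopular]

theorem topChoices_eq_topSets (Y : Fin n → Fin n → Option Bool) (u : Fin n) (T : ℕ) :
    topChoices (similarity Y u) T = topSets Y u T := rfl

theorem recommend_toReal (Y : Fin n → Fin n → Option Bool) (u : Fin n) (T : ℕ)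
    (X : Fin n → Fin n → Bool) (v : Bool) :
    (((recommend Y u T).map fun J => (X, J)).toOuterMeasure
      {ω | ∃ j, ω.2 = some j ∧ ω.1 u j = v}).toReal =
    expec (prioLaw n) fun π => ∑ j ∈ Finset.univ.filter (fun j => X u j = v),
      share (Finset.univ.filter fun j => Y u j = none)
        (votes Y (topRows (similarity Y u) π T)) j := by
  rw [expec_topRows (similarity Y u) T (fun S => ∑ j ∈ Finset.univ.filter (fun j => X u j = v),
      share (Finset.univ.filter fun j => Y u j = none) (votes Y S) j), topChoices_eq_topSets,
    PMF.toOuterMeasure_map_apply, recommend, toReal_bind]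
  have hw : ∀ S, ((PMF.uniformOfFinset (topSets Y u T) (topSets_nonempty Y u T)) S).toReal =
      if S ∈ topSets Y u T then 1 / ((topSets Y u T).card : ℝ) else 0 := fun S => by
    rw [PMF.uniformOfFinset_apply]
    split_ifs <;> simp
  simp only [expec, hw, ite_mul, zero_mul]
  rw [Finset.sum_ite_mem, Finset.univ_inter]
  refine Finset.sum_congr rfl fun S _ => ?_
  congr 1
  rw [sum_share_filter, winners_eq_mostPopular]
  split_ifs with hne
  · rw [PMF.toOuterMeasure_map_apply, PMF.toOuterMeasure_uniformOfFinset_apply,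
      ENNReal.toReal_div, ENNReal.toReal_natCast, ENNReal.toReal_natCast]
    congr 2
    refine congrArg Finset.card (Finset.ext fun j => ?_)
    simp
  · rw [Finset.not_nonempty_iff_eq_empty.1 hne, PMF.toOuterMeasure_pure_apply]
    simp

theorem expec_matLaw_zero (a b : ℕ) (F : (Fin a → Fin b → Bool) → ℝ) :
    expec (matLaw a b 0) F = F fun _ _ => false := by
  rw [expec, Finset.sum_eq_single fun _ _ => false]
  · simp [matLaw, prodLaw, coin]
  · intro M _ hM
    obtain ⟨i, hi⟩ := Function.ne_iff.1 hM
    obtain ⟨j, hj⟩ := Function.ne_iff.1 hi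
    have : M i j = true := by simpa using hj
    rw [matLaw, prodLaw, Finset.prod_eq_zero (Finset.mem_univ i), zero_mul]
    exact Finset.prod_eq_zero (Finset.mem_univ j) (by simp [this, coin])
  · simp

theorem observe_no_flip (X E : Fin n → Fin n → Bool) (i j : Fin n) :
    observe X (fun _ _ => false) E i j = if E i j then none else some (X i j) := by
  simp [observe]

/-- The error probability as an iterated expectation over cluster values, erasures and priorities:
if ties are broken at random, the recommended column is `j` with probability `share _ _ j`. -/
theorem errorProb_eq_expec (A B : Fin n → Fin r) (ε : unitInterval) (u : Fin n) (T : ℕ) :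
    errorProb A B 0 ε u T =
      expec (matLaw r r (1 / 2)) fun χ => expec (matLaw n n ε) fun E => expec (prioLaw n) fun π =>
        ∑ j ∈ Finset.univ.filter (fun j => blockMatrix A B χ u j = false),
          share (Finset.univ.filter fun j =>
              observe (blockMatrix A B χ) (fun _ _ => false) E u j = none)
            (votes (observe (blockMatrix A B χ) (fun _ _ => false) E)
              (topRows (similarity (observe (blockMatrix A B χ) (fun _ _ => false) E) u)
                π T)) j := by
  unfold errorProb outcomeLaw dataLaw
  simp only [PMF.bind_bind, PMF.bind_map, toReal_bind, iidMatrix_toReal, Function.comp_def,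
    recommend_toReal]
  have h0 : ((0 : unitInterval) : ℝ) = 0 := rfl
  simp only [h0, expec_matLaw_zero]

end Reduction

/-! ### Separating the selection of the rows from the votes -/

section Split

variable {n r : ℕ}

/-- The similarity of row `i` to row `u`, if `eu` is the erasure pattern of row `u` and `E` gives
the erasures in the other rows. -/
def score (A B : Fin n → Fin r) (u : Fin n) (eu : Fin n → Bool) (χ : Fin r → Fin r → Bool)
    (E : Fin n → Fin n → Bool) (i : Fin n) : ℕ :=
  if i = u then (Finset.univ.filter fun l => eu l = false).card else
    (Finset.univ.filter fun l => eu l = false ∧ E i l = false ∧ χ (A i) (B l) = χ (A u) (B l)).card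

/-- The selected rows. -/
def selected (A B : Fin n → Fin r) (u : Fin n) (T : ℕ) (eu : Fin n → Bool)
    (χ : Fin r → Fin r → Bool) (x : (Fin n → Fin n → Bool) × Equiv.Perm (Fin n)) :
    Finset (Fin n) :=
  topRows (score A B u eu χ x.1) x.2 T

/-- The number of selected rows other than `u` that like the column cluster `b`. -/
def likes (A B : Fin n → Fin r) (u : Fin n) (T : ℕ) (eu : Fin n → Bool)
    (χ : Fin r → Fin r → Bool) (x : (Fin n → Fin n → Bool) × Equiv.Perm (Fin n)) (b : Fin r) : ℕ :=
  (((selected A B u T eu χ x).erase u).filter fun i => χ (A i) b = true).card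

/-- The law of the erasures that matter for the selection, and of the priorities. -/
def selLaw (n : ℕ) (ε : ℝ) : (Fin n → Fin n → Bool) × Equiv.Perm (Fin n) → ℝ :=
  pairLaw (matLaw n n ε) (prioLaw n)

theorem isLaw_selLaw (n : ℕ) {p : ℝ} (h0 : 0 ≤ p) (h1 : p ≤ 1) : IsLaw (selLaw n p) :=
  (isLaw_matLaw n n h0 h1).pair (isLaw_prioLaw n)

/-- The columns that row `u` has not rated. -/
def unrated (eu : Fin n → Bool) : Finset (Fin n) := Finset.univ.filter fun j => eu j = true

/-- The probability that an item with `χ (A u) (B j) = v` is recommended. -/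
def verdictProb (A B : Fin n → Fin r) (q : ℝ) (u : Fin n) (T : ℕ) (v : Bool) : ℝ :=
  expec (coins (Fin n) (1 - q)) fun eu => expec (matLaw r r (1 / 2)) fun χ =>
    expec (selLaw n (1 - q)) fun x =>
      winProb q B (unrated eu) (likes A B u T eu χ x)
        (Finset.univ.filter fun j => χ (A u) (B j) = v)

theorem share_congr {κ : Type*} [DecidableEq κ] {R : Finset κ} {V V' : κ → ℕ}
    (h : ∀ j ∈ R, V j = V' j) : share R V = share R V' := by
  have : winners R V = winners R V' := by
    ext j
    rw [mem_winners, mem_winners]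
    refine and_congr_right fun hj => forall₂_congr fun l hl => ?_
    rw [h j hj, h l hl]
  funext j
  rw [share, share, this]

/-- Only the numbers of voters for the columns matter, as the observations are i.i.d. -/
theorem expec_share_eq_winProb (B : Fin n → Fin r) (q : ℝ) (R s : Finset (Fin n))
    (C : Fin r → Finset (Fin n)) :
    expec (coins (Fin n × Fin n) (1 - q)) (fun g =>
      ∑ j ∈ s, share R (fun j => ((C (B j)).filter fun i => g (i, j) = false).card) j) =
      winProb q B R (fun b => (C b).card) s := by
  have hex : ∀ b, ∃ ρ : Equiv.Perm (Fin n), ∀ l : Fin n, ρ l ∈ C b ↔ l.val < (C b).card := by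
    intro b
    have hc : Fintype.card {l : Fin n // l.val < (C b).card} =
        Fintype.card {l : Fin n // l ∈ C b} := by
      rw [Fintype.card_coe, Fintype.card_subtype, Fin.card_filter_val_lt]
      refine min_eq_right ?_
      simpa using Finset.card_le_univ (C b)
    refine ⟨(Fintype.equivOfCardEq hc).extendSubtype, fun l => ⟨fun h => ?_, fun h =>
      Equiv.extendSubtype_mem _ _ h⟩⟩
    by_contra hcon
    exact Equiv.extendSubtype_not_mem (Fintype.equivOfCardEq hc) l hcon h
  choose ρ hρ using hex
  unfold winProb
  rw [← expec_prodLaw_perm (coin (1 - q))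
    (Equiv.prodCongrLeft fun j : Fin n => (ρ (B j)).symm : Equiv.Perm (Fin n × Fin n))]
  refine congrArg (expec _) (funext fun e => Finset.sum_congr rfl fun j _ => ?_)
  refine congrFun (share_congr fun j _ => ?_) j
  unfold votesFor
  refine Finset.card_bij (fun i _ => (ρ (B j)).symm i) (fun i hi => ?_)
    (fun a _ b _ h => (ρ (B j)).symm.injective h) fun l hl => ⟨ρ (B j) l, ?_, by simp⟩
  · obtain ⟨h1, h2⟩ := Finset.mem_filter.1 hi
    refine Finset.mem_filter.2 ⟨Finset.mem_filter.2 ⟨Finset.mem_univ _, ?_⟩, ?_⟩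
    · exact (hρ (B j) _).1 (by simpa using h1)
    · simpa using h2
  · obtain ⟨h1, h2⟩ := Finset.mem_filter.1 hl
    refine Finset.mem_filter.2 ⟨(hρ (B j) l).2 (Finset.mem_filter.1 h1).2, ?_⟩
    simpa using h2

variable {A B : Fin n → Fin r} {u : Fin n} {eu : Fin n → Bool} {χ : Fin r → Fin r → Bool}

theorem score_congr {E E' : Fin n → Fin n → Bool}
    (h : ∀ i l, eu l = false → E i l = E' i l) :
    score A B u eu χ E = score A B u eu χ E' := by
  funext i
  unfold score
  congr 2
  ext l
  simp only [Finset.mem_filter, Finset.mem_univ, true_and]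
  exact and_congr_right fun hl => by rw [h i l hl]

theorem similarity_observe (E : Fin n → Fin n → Bool) :
    similarity (observe (blockMatrix A B χ) (fun _ _ => false) (Function.update E u eu)) u =
      score A B u eu χ E := by
  funext i
  unfold similarity score
  rcases eq_or_ne i u with rfl | hi
  · rw [if_pos rfl]
    congr 1
    ext l
    simp [observe]
  · rw [if_neg hi]
    congr 1
    ext l
    simp only [observe_no_flip, Function.update_self, Function.update_of_ne hi, blockMatrix,
      Finset.mem_filter, Finset.mem_univ, true_and]
    cases eu l <;> cases E i l <;> simp [eq_comm]

theorem votes_observe (E : Fin n → Fin n → Bool) (S : Finset (Fin n)) {j : Fin n}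
    (hj : eu j = true) :
    votes (observe (blockMatrix A B χ) (fun _ _ => false) (Function.update E u eu)) S j =
      (((S.erase u).filter fun i => χ (A i) (B j) = true).filter fun i => E i j = false).card := by
  unfold votes
  congr 1
  ext i
  simp only [observe_no_flip, blockMatrix, Finset.mem_filter, Finset.mem_erase]
  rcases eq_or_ne i u with rfl | hi
  · simp [hj]
  · rw [Function.update_of_ne hi]
    cases E i j <;> simp [hi]

/-- The votes for the columns that `u` has not rated are independent of the selection. -/
theorem expec_observe (A B : Fin n → Fin r) (u : Fin n) (T : ℕ) (eu : Fin n → Bool)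
    (χ : Fin r → Fin r → Bool) {p : ℝ} (h0 : 0 ≤ p) (h1 : p ≤ 1) (s : Finset (Fin n)) :
    expec (matLaw n n p) (fun E => expec (prioLaw n) fun π => ∑ j ∈ s,
      share (unrated eu) (votes (observe (blockMatrix A B χ) (fun _ _ => false)
          (Function.update E u eu))
        (topRows (similarity (observe (blockMatrix A B χ) (fun _ _ => false)
          (Function.update E u eu)) u) π T)) j) =
      expec (selLaw n p) fun x =>
        winProb (1 - p) B (unrated eu) (likes A B u T eu χ x) s := by
  -- the observations in the columns rated by `u` matter for the selection, the others for the votes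
  set K : (Fin n → Fin n → Bool) → (Fin n → Fin n → Bool) → ℝ := fun E E' =>
    expec (prioLaw n) fun π => ∑ j ∈ s, share (unrated eu) (fun j =>
      ((((selected A B u T eu χ (E, π)).erase u).filter fun i => χ (A i) (B j) = true).filter
        fun i => E' i j = false).card) j with hK
  have h2 : ∀ E : Fin n → Fin n → Bool, expec (prioLaw n) (fun π => ∑ j ∈ s,
      share (unrated eu) (votes (observe (blockMatrix A B χ) (fun _ _ => false)
          (Function.update E u eu))
        (topRows (similarity (observe (blockMatrix A B χ) (fun _ _ => false)
          (Function.update E u eu)) u) π T)) j) = K E E := fun E => by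
    refine congrArg (expec _) (funext fun π => Finset.sum_congr rfl fun j _ => ?_)
    refine congrFun (share_congr fun j hj => ?_) j
    rw [similarity_observe, votes_observe _ _ (by simpa [unrated] using hj)]
    rfl
  simp only [h2]
  have h3 : expec (matLaw n n p) (fun E => K E E) =
      expec (matLaw n n p) fun E => expec (matLaw n n p) fun E' => K E E' := by
    rw [← expec_matLaw_uncurry n n p (fun E => K E E), ← expec_matLaw_uncurry n n p
      (fun E => expec (matLaw n n p) fun E' => K E E')]
    simp only [← expec_matLaw_uncurry n n p (fun E' => K _ E')]
    rw [← expec_mix _ (fun c : Fin n × Fin n => eu c.2 = true) _ fun _ => isLaw_coin h0 h1]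
    refine congrArg (expec _) (funext fun e => congrArg (expec _) (funext fun g => ?_))
    refine congrArg (expec _) (funext fun π => Finset.sum_congr rfl fun j _ => ?_)
    refine congrFun (share_congr fun j hj => ?_) j
    have hj' : eu j = true := by simpa [unrated] using hj
    have hsel : selected A B u T eu χ (Function.curry
        (fun c : Fin n × Fin n => if eu c.2 = true then g c else e c), π) =
        selected A B u T eu χ (Function.curry e, π) := by
      unfold selected
      dsimp only
      rw [score_congr (E' := Function.curry e)]
      intro i l hl
      simp [Function.curry, hl]
    rw [hsel]
    simp only [Function.curry, hj', if_true]
    congr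
  rw [h3, selLaw, expec_pairLaw]
  refine congrArg (expec _) (funext fun E => ?_)
  rw [hK]
  dsimp only
  rw [expec_comm]
  refine congrArg (expec _) (funext fun π => ?_)
  have h4 := expec_share_eq_winProb B (1 - p) (unrated eu) s fun b =>
    ((selected A B u T eu χ (E, π)).erase u).filter fun i => χ (A i) b = true
  rw [sub_sub_cancel] at h4
  refine Eq.trans ?_ h4
  exact (expec_matLaw_uncurry n n p _).symm

theorem errorProb_eq_verdictProb (A B : Fin n → Fin r) (ε : unitInterval) (u : Fin n) (T : ℕ) :
    errorProb A B 0 ε u T = verdictProb A B (1 - ε) u T false := by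
  rw [errorProb_eq_expec, verdictProb, sub_sub_cancel, expec_comm (coins (Fin n) (ε : ℝ))]
  refine congrArg (expec _) (funext fun χ => ?_)
  rw [← expec_update _ u _ (isLaw_coins ε.2.1 ε.2.2)]
  rw [expec_comm]
  refine congrArg (expec _) (funext fun eu => ?_)
  rw [← expec_observe A B u T eu χ ε.2.1 ε.2.2]
  refine congrArg (expec _) (funext fun E => congrArg (expec _) (funext fun π => ?_))
  have hR : (Finset.univ.filter fun j => observe (blockMatrix A B χ) (fun _ _ => false)
      (Function.update E u eu) u j = none) = unrated eu := by
    ext j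
    simp [unrated, observe]
  rw [hR]
  rfl

/-- The two verdicts exclude each other. -/
theorem verdictProb_add_le (A B : Fin n → Fin r) {q : ℝ} (h0 : 0 ≤ q) (h1 : q ≤ 1) (u : Fin n)
    (T : ℕ) : verdictProb A B q u T true + verdictProb A B q u T false ≤ 1 := by
  unfold verdictProb
  rw [← expec_add]
  refine expec_le_of_le (isLaw_coins (by linarith) (by linarith)) fun eu => ?_
  rw [← expec_add]
  refine expec_le_of_le (isLaw_matLaw _ _ (by norm_num) (by norm_num)) fun χ => ?_
  rw [← expec_add]
  refine expec_le_of_le (isLaw_selLaw _ (by linarith) (by linarith)) fun x => ?_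
  unfold winProb
  rw [← expec_add]
  refine expec_le_of_le (isLaw_coins (by linarith) (by linarith)) fun e => ?_
  rw [← Finset.sum_union]
  · exact sum_share_le_one _ _ _
  · rw [Finset.disjoint_filter]
    intro j _ h
    simp [h]

/-- Resampling a column of the cluster values. -/
theorem expec_update_column (r : ℕ) (b : Fin r) (F : (Fin r → Fin r → Bool) → ℝ) :
    expec (matLaw r r (1 / 2)) (fun χ => expec (coins (Fin r) (1 / 2)) fun w =>
      F fun i => Function.update (χ i) b (w i)) = expec (matLaw r r (1 / 2)) F := by
  have hinv : Function.Involutive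
      (fun p : (Fin r → Fin r → Bool) × (Fin r → Bool) =>
        ((fun i => Function.update (p.1 i) b (p.2 i), fun i => p.1 i b) :
          (Fin r → Fin r → Bool) × (Fin r → Bool))) := by
    rintro ⟨f, x⟩
    simp
  have h := expec_perm (w := pairLaw (matLaw r r (1 / 2)) (coins (Fin r) (1 / 2)))
    (f := fun p => F p.1) hinv.toPerm (by
    rintro ⟨f, x⟩
    simp only [Function.Involutive.coe_toPerm, pairLaw, coins, matLaw, prodLaw,
      ← Finset.prod_mul_distrib]
    refine Finset.prod_congr rfl fun i _ => ?_
    rw [← Finset.mul_prod_erase _ _ (Finset.mem_univ b),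
      ← Finset.mul_prod_erase _ (fun k => coin (1 / 2) (f i k)) (Finset.mem_univ b)]
    have : ∏ k ∈ Finset.univ.erase b, coin (1 / 2) (Function.update (f i) b (x i) k) =
        ∏ k ∈ Finset.univ.erase b, coin (1 / 2) (f i k) :=
      Finset.prod_congr rfl fun k hk => by
        rw [Function.update_of_ne (Finset.ne_of_mem_erase hk)]
    rw [this, Function.update_self]
    ring)
  rw [expec_pairLaw, expec_pairLaw] at h
  refine h.trans (congrArg (expec _) (funext fun χ => ?_))
  exact expec_const (isLaw_coins (ι := Fin r) (p := 1 / 2) (by norm_num) (by norm_num)) (F χ)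

end Split

/-! ### Tilting a column of the cluster values -/

section Tilt

theorem isLaw_bits (ι : Type*) [Fintype ι] [DecidableEq ι] : IsLaw (coins ι (1 / 2)) :=
  isLaw_coins (by norm_num) (by norm_num)

theorem isLaw_bitMatrix (a b : ℕ) : IsLaw (matLaw a b (1 / 2)) :=
  isLaw_matLaw a b (by norm_num) (by norm_num)

variable {ι : Type*} [DecidableEq ι]

/-- The bits `w`, with those in `μ` switched on, and the bit at `a` set to `v`. -/
def force (v : Bool) (a : ι) (w μ : ι → Bool) : ι → Bool :=
  Function.update (fun i => w i || μ i) a v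

theorem force_of_ne (v : Bool) {a i : ι} (w μ : ι → Bool) (h : i ≠ a) :
    force v a w μ i = (w i || μ i) := Function.update_of_ne h _ _

variable [Fintype ι]

/-- Switching on each bit with probability `θ` multiplies the weights by at most
`exp (θ * ∑ i, sgn (z i))`. -/
theorem expec_or_le {θ : ℝ} (h0 : 0 ≤ θ) (h1 : θ ≤ 1) {H : (ι → Bool) → ℝ} (hH : ∀ z, 0 ≤ H z) :
    expec (coins ι (1 / 2)) (fun w => expec (coins ι θ) fun μ => H fun i => w i || μ i) ≤
      expec (coins ι (1 / 2)) fun z => Real.exp (θ * ∑ i, sgn (z i)) * H z := by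
  have hdec : ∀ y : ι → Bool, H y = ∑ z, (∏ i, ind (y i = z i)) * H z := fun y => by
    rw [Finset.sum_eq_single y]
    · simp [ind]
    · intro z _ hz
      obtain ⟨i, hi⟩ := Function.ne_iff.1 hz
      rw [Finset.prod_eq_zero (Finset.mem_univ i) (ind_of_not fun h => hi h.symm), zero_mul]
    · simp
  have hcoin : ∀ z : Bool, expec (coin (1 / 2)) (fun x => expec (coin θ) fun y =>
      ind ((x || y) = z)) ≤ 1 / 2 * Real.exp (θ * sgn z) := fun z => by
    simp only [expec_coin]
    cases z
    · have := Real.add_one_le_exp (-θ)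
      simp [ind, sgn]
      linarith
    · have := Real.add_one_le_exp θ
      simp [ind, sgn]
      linarith
  have hw : ∀ w : ι → Bool, expec (coins ι θ) (fun μ => H fun i => w i || μ i) =
      ∑ z, (∏ i, expec (coin θ) fun y => ind ((w i || y) = z i)) * H z := fun w => by
    simp only [hdec fun i => w i || _]
    rw [expec_sum]
    refine Finset.sum_congr rfl fun z _ => ?_
    rw [expec_mul_right, ← expec_prodLaw_prod (fun _ : ι => coin θ)
      (fun i y => ind ((w i || y) = z i))]
  simp only [hw]
  rw [expec_sum, expec]
  refine Finset.sum_le_sum fun z _ => ?_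
  rw [expec_mul_right, ← mul_assoc]
  refine mul_le_mul_of_nonneg_right ?_ (hH z)
  have hp := expec_prodLaw_prod (fun _ : ι => coin (1 / 2))
    (fun i x => expec (coin θ) fun y => ind ((x || y) = z i))
  refine hp.le.trans ?_
  rw [Finset.mul_sum, Real.exp_sum]
  simp only [coins, prodLaw]
  rw [← Finset.prod_mul_distrib]
  refine Finset.prod_le_prod (fun i _ => ?_) fun i _ => (hcoin (z i)).trans (le_of_eq ?_)
  · exact expec_nonneg (isLaw_coin (by norm_num) (by norm_num)) fun x =>
      expec_nonneg (isLaw_coin h0 h1) fun y => ind_nonneg _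
  · cases z i <;> norm_num [coin]

theorem expec_ind_eq_mul (a : ι) (v : Bool) (F : (ι → Bool) → ℝ) :
    expec (coins ι (1 / 2)) (fun w => ind (w a = v) * F w) =
      1 / 2 * expec (coins ι (1 / 2)) fun w => F (Function.update w a v) := by
  rw [← expec_update _ a _ (isLaw_coin (by norm_num) (by norm_num)), ← expec_mul_left]
  refine congrArg (expec _) (funext fun w => ?_)
  simp only [expec_coin, Function.update_self]
  cases v <;> norm_num [ind]

/-- Switching on a few bits and fixing the bit at `a` is hardly noticeable, except for the
factor `2` for the bit at `a`: by a Chernoff bound, the likelihood ratio is close to `1` with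
high probability. -/
theorem expec_force_le {θ ε : ℝ} (h0 : 0 ≤ θ) (hε : θ ≤ ε / 4) (hε1 : ε ≤ 1) (a : ι) (v : Bool)
    {F : (ι → Bool) → ℝ} (hF0 : ∀ z, 0 ≤ F z) (hF1 : ∀ z, F z ≤ 1) :
    expec (coins ι (1 / 2)) (fun w => expec (coins ι θ) fun μ => F (force v a w μ)) ≤
      2 * Real.exp (θ * ε * Fintype.card ι) *
          expec (coins ι (1 / 2)) (fun w => ind (w a = v) * F w) +
        Real.exp (-(ε ^ 2 * Fintype.card ι / 4)) := by
  refine (expec_or_le h0 (by linarith) (H := fun z => F (Function.update z a v))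
    fun z => hF0 _).trans ?_
  set m : ℝ := ((Fintype.card ι : ℕ) : ℝ) with hm
  have hpt : ∀ z : ι → Bool, Real.exp (θ * ∑ i, sgn (z i)) * F (Function.update z a v) ≤
      Real.exp (θ * ε * m) * F (Function.update z a v) +
        Real.exp (∑ i, (θ + 3 / 4 * ε) * sgn (z i)) * Real.exp (-(3 / 4 * ε ^ 2 * m)) := by
    intro z
    rw [← Finset.mul_sum]
    set X := ∑ i, sgn (z i)
    have e1 := Real.exp_pos (θ * ε * m)
    have e2 := Real.exp_pos (θ * X)
    have e3 : 0 < Real.exp ((θ + 3 / 4 * ε) * X) * Real.exp (-(3 / 4 * ε ^ 2 * m)) := by positivity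
    rcases le_total X (ε * m) with h | h
    · have : Real.exp (θ * X) ≤ Real.exp (θ * ε * m) := Real.exp_le_exp.2 (by nlinarith)
      have := mul_le_mul_of_nonneg_right this (hF0 (Function.update z a v))
      linarith
    · have h2 : Real.exp (θ * X) ≤
          Real.exp ((θ + 3 / 4 * ε) * X) * Real.exp (-(3 / 4 * ε ^ 2 * m)) := by
        rw [← Real.exp_add, Real.exp_le_exp]
        have : 0 ≤ ε * (X - ε * m) := mul_nonneg (by linarith) (by linarith)
        nlinarith
      have h3 := mul_nonneg e1.le (hF0 (Function.update z a v))
      have h4 := mul_le_mul_of_nonneg_left (hF1 (Function.update z a v)) e2.le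
      linarith
  refine (expec_mono (isLaw_bits ι) hpt).trans ?_
  rw [expec_add, expec_mul_left, expec_mul_right, expec_ind_eq_mul]
  have h1 := expec_exp_sgn_le (ι := ι) fun _ => θ + 3 / 4 * ε
  rw [Finset.sum_const, nsmul_eq_mul, Finset.card_univ, ← hm] at h1
  have h2 := mul_le_mul_of_nonneg_right h1 (Real.exp_pos (-(3 / 4 * ε ^ 2 * m))).le
  have h3 : Real.exp (m * (θ + 3 / 4 * ε) ^ 2 / 2) * Real.exp (-(3 / 4 * ε ^ 2 * m)) ≤
      Real.exp (-(ε ^ 2 * m / 4)) := by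
    rw [← Real.exp_add, Real.exp_le_exp]
    have hm0 : 0 ≤ m := by positivity
    have : (θ + 3 / 4 * ε) ^ 2 ≤ ε ^ 2 := pow_le_pow_left₀ (by linarith) (by linarith) 2
    nlinarith
  linarith

end Tilt

section Columns

variable {r : ℕ}

/-- The cluster values with column `b` replaced. -/
def setCol (χ : Fin r → Fin r → Bool) (b : Fin r) (w : Fin r → Bool) : Fin r → Fin r → Bool :=
  fun i => Function.update (χ i) b (w i)

theorem setCol_self (χ : Fin r → Fin r → Bool) (b : Fin r) (w : Fin r → Bool) (i : Fin r) :
    setCol χ b w i b = w i := Function.update_self _ _ _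

theorem setCol_of_ne (χ : Fin r → Fin r → Bool) {b b' : Fin r} (w : Fin r → Bool) (i : Fin r)
    (h : b' ≠ b) : setCol χ b w i b' = χ i b' := Function.update_of_ne h _ _

theorem setCol_setCol (χ : Fin r → Fin r → Bool) (b : Fin r) (w w' : Fin r → Bool) :
    setCol (setCol χ b w) b w' = setCol χ b w' := by
  funext i
  simp [setCol]

theorem setCol_eq (χ : Fin r → Fin r → Bool) (b : Fin r) : setCol χ b (fun i => χ i b) = χ := by
  funext i
  simp [setCol]

theorem expec_setCol (b : Fin r) (F : (Fin r → Fin r → Bool) → ℝ) :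
    expec (matLaw r r (1 / 2)) (fun χ => expec (coins (Fin r) (1 / 2)) fun w => F (setCol χ b w)) =
      expec (matLaw r r (1 / 2)) F := expec_update_column r b F

/-- The cluster values with column `b` forced. -/
def forceCol (v : Bool) (a b : Fin r) (χ : Fin r → Fin r → Bool) (μ : Fin r → Bool) :
    Fin r → Fin r → Bool := setCol χ b (force v a (fun i => χ i b) μ)

theorem expec_forceCol_le {θ ε : ℝ} (h0 : 0 ≤ θ) (hε : θ ≤ ε / 4) (hε1 : ε ≤ 1) (a b : Fin r)
    (v : Bool) {F : (Fin r → Fin r → Bool) → ℝ} (hF0 : ∀ z, 0 ≤ F z) (hF1 : ∀ z, F z ≤ 1) :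
    expec (matLaw r r (1 / 2)) (fun χ => expec (coins (Fin r) θ) fun μ =>
        F (forceCol v a b χ μ)) ≤
      2 * Real.exp (θ * ε * r) * expec (matLaw r r (1 / 2)) (fun χ => ind (χ a b = v) * F χ) +
        Real.exp (-(ε ^ 2 * r / 4)) := by
  rw [← expec_setCol b, ← expec_setCol b fun χ => ind (χ a b = v) * F χ, ← expec_mul_left,
    ← expec_const (isLaw_bitMatrix r r) (Real.exp (-(ε ^ 2 * r / 4))), ← expec_add]
  refine expec_mono (isLaw_bitMatrix r r) fun χ => ?_
  have h := expec_force_le (ι := Fin r) h0 hε hε1 a v (F := fun w => F (setCol χ b w))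
    (fun z => hF0 _) (fun z => hF1 _)
  rw [Fintype.card_fin] at h
  simpa only [forceCol, setCol_self, setCol_setCol] using h

end Columns

/-! ### The effect of a column of the cluster values on the selection -/

section Coupling

variable {n r : ℕ}

/-- The number of rows in `S` that belong to the row cluster `a`. -/
def mult (A : Fin n → Fin r) (S : Finset (Fin n)) (a : Fin r) : ℕ :=
  (S.filter fun i => A i = a).card

/-- The number of rows in `S` that like a column cluster with the values `w`. -/
def likers (A : Fin n → Fin r) (S : Finset (Fin n)) (w : Fin r → Bool) : ℕ :=
  (S.filter fun i => w (A i) = true).card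

/-- The number of rows in `S` outside of the cluster `a` that are made to like a column cluster
with the values `w` by switching on the bits in `μ`. -/
def gain (A : Fin n → Fin r) (S : Finset (Fin n)) (a : Fin r) (w μ : Fin r → Bool) : ℕ :=
  (S.filter fun i => A i ≠ a ∧ w (A i) = false ∧ μ (A i) = true).card

/-- The selected rows other than `u`. -/
def chosen (A B : Fin n → Fin r) (u : Fin n) (T : ℕ) (eu : Fin n → Bool)
    (χ : Fin r → Fin r → Bool) (x : (Fin n → Fin n → Bool) × Equiv.Perm (Fin n)) :
    Finset (Fin n) := (selected A B u T eu χ x).erase u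

/-- The columns of the cluster `b` that row `u` has rated. -/
def ratedIn (B : Fin n → Fin r) (eu : Fin n → Bool) (b : Fin r) : Finset (Fin n) :=
  Finset.univ.filter fun l => eu l = false ∧ B l = b

/-- The rows other than `u` that have rated a column in `K`. -/
def hitters (u : Fin n) (E : Fin n → Fin n → Bool) (K : Finset (Fin n)) : Finset (Fin n) :=
  Finset.univ.filter fun i => i ≠ u ∧ ∃ l ∈ K, E i l = false

theorem mem_hitters {u : Fin n} {E : Fin n → Fin n → Bool} {K : Finset (Fin n)} {i : Fin n} :
    i ∈ hitters u E K ↔ i ≠ u ∧ ∃ l ∈ K, E i l = false := by simp [hitters]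

theorem likes_eq_likers (A B : Fin n → Fin r) (u : Fin n) (T : ℕ) (eu : Fin n → Bool)
    (χ : Fin r → Fin r → Bool) (x : (Fin n → Fin n → Bool) × Equiv.Perm (Fin n)) (b : Fin r) :
    likes A B u T eu χ x b = likers A (chosen A B u T eu χ x) fun i => χ i b := rfl

theorem sum_filter_comp (A : Fin n → Fin r) (S : Finset (Fin n)) (P : Fin r → Prop)
    [DecidablePred P] :
    (S.filter fun i => P (A i)).card = ∑ a, if P a then mult A S a else 0 := by
  rw [Finset.card_eq_sum_card_fiberwise (f := A) (t := Finset.univ) fun _ _ => Finset.mem_univ _]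
  refine Finset.sum_congr rfl fun a _ => ?_
  rw [Finset.filter_filter]
  split_ifs with h
  · refine congrArg Finset.card (Finset.filter_congr fun i _ => ?_)
    exact ⟨fun h => h.2, fun hi => ⟨hi ▸ h, hi⟩⟩
  · refine Finset.card_eq_zero.2 (Finset.filter_eq_empty_iff.2 fun i _ hi => h (hi.2 ▸ hi.1))

theorem sum_mult (A : Fin n → Fin r) (S : Finset (Fin n)) : ∑ a, mult A S a = S.card := by
  have := sum_filter_comp A S fun _ => True
  simpa using this.symm

theorem likers_le_add (A : Fin n → Fin r) (S S' : Finset (Fin n)) (w : Fin r → Bool) :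
    likers A S w ≤ likers A S' w + (S \ S').card := by
  unfold likers
  refine (Finset.card_le_card ?_).trans (Finset.card_union_le _ _)
  intro i hi
  obtain ⟨h1, h2⟩ := Finset.mem_filter.1 hi
  by_cases h : i ∈ S'
  · exact Finset.mem_union_left _ (Finset.mem_filter.2 ⟨h, h2⟩)
  · exact Finset.mem_union_right _ (Finset.mem_sdiff.2 ⟨h1, h⟩)

theorem likers_not (A : Fin n → Fin r) (S : Finset (Fin n)) (w : Fin r → Bool) :
    likers A S w + likers A S (fun i => !w i) = S.card := by
  unfold likers
  rw [← Finset.card_filter_add_card_filter_not (s := S) fun i => w (A i) = true]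
  congr 2
  ext i
  simp

theorem likers_add_gain_le (A : Fin n → Fin r) (S : Finset (Fin n)) (a : Fin r) (v : Bool)
    (w μ : Fin r → Bool) :
    likers A S w + gain A S a w μ ≤ likers A S (force v a w μ) + mult A S a := by
  unfold likers gain mult
  have hd : Disjoint (S.filter fun i => w (A i) = true)
      (S.filter fun i => A i ≠ a ∧ w (A i) = false ∧ μ (A i) = true) := by
    rw [Finset.disjoint_filter]
    intro i _ h1 h2
    simp [h1] at h2
  rw [← Finset.card_union_of_disjoint hd]
  refine (Finset.card_le_card ?_).trans (Finset.card_union_le _ _)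
  intro i hi
  by_cases hia : A i = a
  · refine Finset.mem_union_right _ (Finset.mem_filter.2 ⟨?_, hia⟩)
    rcases Finset.mem_union.1 hi with h | h
    · exact (Finset.mem_filter.1 h).1
    · exact (Finset.mem_filter.1 h).1
  · refine Finset.mem_union_left _ ?_
    rcases Finset.mem_union.1 hi with h | h
    · obtain ⟨h1, h2⟩ := Finset.mem_filter.1 h
      exact Finset.mem_filter.2 ⟨h1, by rw [force_of_ne _ _ _ hia, h2, Bool.true_or]⟩
    · obtain ⟨h1, h2, h3, h4⟩ := Finset.mem_filter.1 h
      exact Finset.mem_filter.2 ⟨h1, by rw [force_of_ne _ _ _ hia, h4, Bool.or_true]⟩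

variable {A B : Fin n → Fin r} {u : Fin n} {T : ℕ} {eu : Fin n → Bool}
  {χ χ' : Fin r → Fin r → Bool} {x : (Fin n → Fin n → Bool) × Equiv.Perm (Fin n)} {b : Fin r}

/-- Only the rows that have rated a column of the cluster `b` also rated by `u` notice a change in
column `b` of the cluster values. -/
theorem score_eq_of_notMem_hitters {E : Fin n → Fin n → Bool} (h : ∀ i, ∀ b' ≠ b, χ i b' = χ' i b')
    {i : Fin n} (hi : i ∉ hitters u E (ratedIn B eu b)) :
    score A B u eu χ E i = score A B u eu χ' E i := by
  unfold score
  split_ifs with hu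
  · rfl
  · refine congrArg Finset.card (Finset.filter_congr fun l _ => ?_)
    refine and_congr_right fun h1 => and_congr_right fun h2 => ?_
    have hb : B l ≠ b := fun hb => hi <| mem_hitters.2
      ⟨hu, l, Finset.mem_filter.2 ⟨Finset.mem_univ _, h1, hb⟩, h2⟩
    rw [h _ _ hb, h _ _ hb]

theorem card_chosen_sdiff_le (h : ∀ i, ∀ b' ≠ b, χ i b' = χ' i b') {τ : ℕ}
    (h1 : (hitters u x.1 (ratedIn B eu b) ∩ selected A B u T eu χ x).card ≤ τ)
    (h2 : (hitters u x.1 (ratedIn B eu b) ∩ selected A B u T eu χ' x).card ≤ τ) :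
    (chosen A B u T eu χ' x \ chosen A B u T eu χ x).card ≤ τ := by
  have h3 := card_topRows_sdiff_le (s := score A B u eu χ x.1) (s' := score A B u eu χ' x.1)
    (hitters u x.1 (ratedIn B eu b)) x.2 T fun i hi => score_eq_of_notMem_hitters h hi
  refine (Finset.card_le_card fun i hi => ?_).trans (h3.trans (max_le h1 h2))
  obtain ⟨hi1, hi2⟩ := Finset.mem_sdiff.1 hi
  obtain ⟨hiu, hi3⟩ := Finset.mem_erase.1 hi1
  exact Finset.mem_sdiff.2 ⟨hi3, fun hc => hi2 (Finset.mem_erase.2 ⟨hiu, hc⟩)⟩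

theorem card_chosen_le : (chosen A B u T eu χ x).card ≤ T := by
  refine (Finset.card_le_card (Finset.erase_subset _ _)).trans ?_
  unfold selected
  rw [card_topRows]
  exact min_le_left _ _

theorem le_card_chosen_add_one (hT : T ≤ n) : T ≤ (chosen A B u T eu χ x).card + 1 := by
  have h := Finset.pred_card_le_card_erase (s := selected A B u T eu χ x) (a := u)
  have h2 : (selected A B u T eu χ x).card = T := by
    unfold selected
    rw [card_topRows, min_eq_left hT]
  unfold chosen
  omega

section Force

variable {v : Bool} {a : Fin r} {μ : Fin r → Bool} {τ : ℕ}

theorem likes_forceCol_of_ne (hχ : (hitters u x.1 (ratedIn B eu b) ∩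
      selected A B u T eu χ x).card ≤ τ)
    (hχ' : (hitters u x.1 (ratedIn B eu b) ∩
      selected A B u T eu (forceCol v a b χ μ) x).card ≤ τ) {b' : Fin r} (hb : b' ≠ b) :
    likes A B u T eu (forceCol v a b χ μ) x b' ≤ likes A B u T eu χ x b' + τ := by
  have h : ∀ i, ∀ b' ≠ b, χ i b' = forceCol v a b χ μ i b' := fun i b' hb' =>
    (setCol_of_ne χ _ i hb').symm
  have h1 := card_chosen_sdiff_le h hχ hχ'
  rw [likes_eq_likers, likes_eq_likers]
  have h2 := likers_le_add A (chosen A B u T eu (forceCol v a b χ μ) x)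
    (chosen A B u T eu χ x) fun i => χ i b'
  simp only [← h _ b' hb]
  omega

theorem likes_add_gain_le (hχ : (hitters u x.1 (ratedIn B eu b) ∩
      selected A B u T eu χ x).card ≤ τ)
    (hχ' : (hitters u x.1 (ratedIn B eu b) ∩
      selected A B u T eu (forceCol v a b χ μ) x).card ≤ τ) :
    likes A B u T eu χ x b + gain A (chosen A B u T eu χ x) a (fun i => χ i b) μ ≤
      likes A B u T eu (forceCol v a b χ μ) x b + mult A (chosen A B u T eu χ x) a + τ := by
  have h : ∀ i, ∀ b' ≠ b, forceCol v a b χ μ i b' = χ i b' := fun i b' hb' =>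
    setCol_of_ne χ _ i hb'
  have h1 := card_chosen_sdiff_le h hχ' hχ
  have h2 := likers_le_add A (chosen A B u T eu χ x)
    (chosen A B u T eu (forceCol v a b χ μ) x) (force v a (fun i => χ i b) μ)
  have h3 := likers_add_gain_le A (chosen A B u T eu χ x) a v (fun i => χ i b) μ
  rw [likes_eq_likers, likes_eq_likers]
  simp only [forceCol, setCol_self] at h1 h2 ⊢
  change _ ≤ likers A _ (force v a (fun i => χ i b) μ) + _ + _
  omega

/-- If the forced bits bring enough additional voters, then the cluster `b` wins more often. -/
theorem winProb_le_of_gain {q : ℝ} (h0 : 0 ≤ q) (h1 : q ≤ 1) {R : Finset (Fin n)}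
    (hχ : (hitters u x.1 (ratedIn B eu b) ∩ selected A B u T eu χ x).card ≤ τ)
    (hχ' : (hitters u x.1 (ratedIn B eu b) ∩
      selected A B u T eu (forceCol v a b χ μ) x).card ≤ τ)
    (hg : mult A (chosen A B u T eu χ x) a + 2 * τ ≤
      gain A (chosen A B u T eu χ x) a (fun i => χ i b) μ) :
    winProb q B R (fun b' => likes A B u T eu χ x b' + τ) (cluster B b) ≤
      winProb q B R (likes A B u T eu (forceCol v a b χ μ) x) (cluster B b) := by
  refine winProb_mono h0 h1 ?_ fun b' hb' => likes_forceCol_of_ne hχ hχ' hb'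
  have := likes_add_gain_le hχ hχ'
  omega

/-- A loss of a few voters does not matter if only few votes are observed. -/
theorem winProb_le_of_loss {q : ℝ} (h0 : 0 ≤ q) (h1 : q ≤ 1) {R : Finset (Fin n)} {τ' m M' : ℕ}
    (hχ : (hitters u x.1 (ratedIn B eu b) ∩ selected A B u T eu χ x).card ≤ τ)
    (hχ' : (hitters u x.1 (ratedIn B eu b) ∩
      selected A B u T eu (forceCol v a b χ μ) x).card ≤ τ)
    (hτ : mult A (chosen A B u T eu χ x) a + τ ≤ τ') (hm0 : 0 < m) (hmn : m ≤ n)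
    (hm : m ≤ likes A B u T eu χ x b) (hM' : likes A B u T eu χ x b + τ' ≤ M') (V : ℕ) :
    (1 - 2 * τ' * V / m) *
          winProb q B R (fun b' => likes A B u T eu χ x b' + τ') (cluster B b) -
        2 * τ' * n ^ 2 * (Real.exp (M' * q) / 2 ^ V) ≤
      winProb q B R (likes A B u T eu (forceCol v a b χ μ) x) (cluster B b) := by
  have hg := likes_add_gain_le hχ hχ'
  set M := min n (likes A B u T eu χ x b + τ') with hM
  have hmM : m ≤ M := le_min hmn (by omega)
  have h := winProb_lower (q := q) (B := B) (R := R) h0 h1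
    (N := fun b' => likes A B u T eu χ x b' + τ')
    (N' := likes A B u T eu (forceCol v a b χ μ) x) (b := b) (M := M) (t := 2 * τ') (v := V)
    hM (by omega) (by
      have : M ≤ likes A B u T eu χ x b + τ' := min_le_right _ _
      omega)
    (fun b' hb' => (likes_forceCol_of_ne hχ hχ' hb').trans (by omega))
  refine le_trans ?_ h
  push_cast
  have hm0' : (0 : ℝ) < m := by exact_mod_cast hm0
  have e1 : (2 * τ' * V / M : ℝ) ≤ 2 * τ' * V / m := by
    have : (m : ℝ) ≤ M := by exact_mod_cast hmM
    gcongr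
  have e2 : (M : ℝ) ≤ M' := by exact_mod_cast (min_le_right _ _).trans hM'
  have e3 := winProb_nonneg h0 h1 (B := B) (R := R) (fun b' => likes A B u T eu χ x b' + τ')
    (cluster B b)
  have e4 : (2 * τ' * n ^ 2 * (Real.exp (M * q) / 2 ^ V) : ℝ) ≤
      2 * τ' * n ^ 2 * (Real.exp (M' * q) / 2 ^ V) := by gcongr
  have e5 := mul_le_mul_of_nonneg_right e1 e3
  linarith

end Force

end Coupling

/-! ### A lower bound for both verdicts -/

section Lower

variable {n r : ℕ} {A B : Fin n → Fin r} {u : Fin n} {T : ℕ} {eu : Fin n → Bool} {q : ℝ}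

/-- The probability that an item with `χ (A u) (B j) = v` is recommended, given the columns that
`u` has rated. -/
def verdictGiven (A B : Fin n → Fin r) (q : ℝ) (u : Fin n) (T : ℕ) (v : Bool)
    (eu : Fin n → Bool) : ℝ :=
  expec (matLaw r r (1 / 2)) fun χ => expec (selLaw n (1 - q)) fun x =>
    winProb q B (unrated eu) (likes A B u T eu χ x)
      (Finset.univ.filter fun j => χ (A u) (B j) = v)

theorem verdictProb_eq (A B : Fin n → Fin r) (q : ℝ) (u : Fin n) (T : ℕ) (v : Bool) :
    verdictProb A B q u T v = expec (coins (Fin n) (1 - q)) (verdictGiven A B q u T v) := rfl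

theorem winProb_verdict (R : Finset (Fin n)) (N : Fin r → ℕ) (f : Fin r → Bool) (v : Bool) :
    winProb q B R N (Finset.univ.filter fun j => f (B j) = v) =
      ∑ b, ind (f b = v) * winProb q B R N (cluster B b) := by
  unfold winProb
  simp only [← expec_mul_left]
  rw [← expec_sum]
  refine congrArg (expec _) (funext fun e => ?_)
  rw [Finset.sum_filter, ← sum_cluster B]
  refine Finset.sum_congr rfl fun b _ => ?_
  rw [Finset.mul_sum]
  refine Finset.sum_congr rfl fun j hj => ?_
  rw [mem_cluster.1 hj, ind_eq_ite, ite_mul, one_mul, zero_mul]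

/-- If forcing a column of the cluster values hardly ever makes it lose, then both verdicts are
about equally likely. -/
theorem le_verdictGiven (hq0 : 0 ≤ q) (hq1 : q ≤ 1) {θ ε : ℝ} (hθ0 : 0 ≤ θ) (hθ : θ ≤ ε / 4)
    (hε : ε ≤ 1) (hR : (unrated eu).Nonempty) {η δ : ℝ} (hη0 : 0 ≤ η) (hδ : 0 ≤ δ)
    (τ : ℕ) (v : Bool)
    (bad : (Fin r → Fin r → Bool) → (Fin n → Fin n → Bool) × Equiv.Perm (Fin n) → Prop)
    (fail : Fin r → (Fin r → Fin r → Bool) → (Fin r → Bool) →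
      (Fin n → Fin n → Bool) × Equiv.Perm (Fin n) → Prop)
    (h : ∀ b χ μ x, ¬ bad χ x → ¬ fail b χ μ x →
      (1 - η) * winProb q B (unrated eu) (fun b' => likes A B u T eu χ x b' + τ) (cluster B b) - δ ≤
        winProb q B (unrated eu) (likes A B u T eu (forceCol v (A u) b χ μ) x) (cluster B b))
    {η₁ δ₁ : ℝ}
    (hbad : expec (matLaw r r (1 / 2)) (fun χ => expec (selLaw n (1 - q)) fun x =>
      ind (bad χ x)) ≤ η₁)
    (hfail : ∀ b, expec (matLaw r r (1 / 2)) (fun χ => expec (coins (Fin r) θ) fun μ =>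
      expec (selLaw n (1 - q)) fun x => ind (¬ bad χ x ∧ fail b χ μ x)) ≤ δ₁) :
    1 - η - η₁ - r * (δ + δ₁ + Real.exp (-(ε ^ 2 * r / 4))) ≤
      2 * Real.exp (θ * ε * r) * verdictGiven A B q u T v eu := by
  have hlaw := isLaw_bitMatrix r r
  have hlawx := isLaw_selLaw n (p := 1 - q) (by linarith) (by linarith)
  have hlawμ : IsLaw (coins (Fin r) θ) := isLaw_coins hθ0 (by linarith)
  set W : Fin r → (Fin r → Fin r → Bool) → (Fin n → Fin n → Bool) × Equiv.Perm (Fin n) → ℝ :=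
    fun b χ x => winProb q B (unrated eu) (likes A B u T eu χ x) (cluster B b) with hW
  set G : Fin r → (Fin r → Fin r → Bool) → (Fin n → Fin n → Bool) × Equiv.Perm (Fin n) → ℝ :=
    fun b χ x => winProb q B (unrated eu) (fun b' => likes A B u T eu χ x b' + τ) (cluster B b)
    with hG
  have hW0 : ∀ b χ x, 0 ≤ W b χ x := fun b χ x => winProb_nonneg hq0 hq1 _ _
  have hW1 : ∀ b χ x, W b χ x ≤ 1 := fun b χ x => winProb_le_one hq0 hq1 _ _
  have hG0 : ∀ b χ x, 0 ≤ G b χ x := fun b χ x => winProb_nonneg hq0 hq1 _ _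
  have hG1 : ∀ b χ x, G b χ x ≤ 1 := fun b χ x => winProb_le_one hq0 hq1 _ _
  have hGs : ∀ χ x, ∑ b, G b χ x = 1 := fun χ x => sum_winProb hq0 hq1 hR _
  have hv : verdictGiven A B q u T v eu = ∑ b, expec (matLaw r r (1 / 2)) fun χ =>
      ind (χ (A u) b = v) * expec (selLaw n (1 - q)) fun x => W b χ x := by
    unfold verdictGiven
    simp only [winProb_verdict]
    rw [← expec_sum]
    refine congrArg (expec _) (funext fun χ => ?_)
    rw [expec_sum]
    exact Finset.sum_congr rfl fun b _ => expec_mul_left _ _ _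
  -- the bound for one column cluster
  have hb : ∀ b, expec (matLaw r r (1 / 2)) (fun χ => expec (selLaw n (1 - q)) fun x =>
        (1 - η) * G b χ x - ind (bad χ x) * G b χ x) - δ - δ₁ ≤
      2 * Real.exp (θ * ε * r) * expec (matLaw r r (1 / 2)) (fun χ =>
        ind (χ (A u) b = v) * expec (selLaw n (1 - q)) fun x => W b χ x) +
      Real.exp (-(ε ^ 2 * r / 4)) := by
    intro b
    have h1 := expec_forceCol_le hθ0 hθ hε (A u) b v
      (F := fun χ => expec (selLaw n (1 - q)) fun x => W b χ x)
      (fun χ => expec_nonneg hlawx fun x => hW0 b χ x)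
      (fun χ => expec_le_of_le hlawx fun x => hW1 b χ x)
    refine le_trans ?_ h1
    have h2 : expec (matLaw r r (1 / 2)) (fun χ => expec (coins (Fin r) θ) fun μ =>
        expec (selLaw n (1 - q)) fun x =>
          ((1 - η) * G b χ x - ind (bad χ x) * G b χ x) - δ - ind (¬ bad χ x ∧ fail b χ μ x)) ≤
        expec (matLaw r r (1 / 2)) (fun χ => expec (coins (Fin r) θ) fun μ =>
        expec (selLaw n (1 - q)) fun x => W b (forceCol v (A u) b χ μ) x) := by
      refine expec_mono hlaw fun χ => expec_mono hlawμ fun μ => expec_mono hlawx fun x => ?_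
      have e0 := hG0 b χ x
      have e1 := hG1 b χ x
      have e2 := hW0 b (forceCol v (A u) b χ μ) x
      by_cases hb1 : bad χ x
      · rw [ind_of hb1, ind_of_not fun h => h.1 hb1]
        nlinarith
      · by_cases hb2 : fail b χ μ x
        · rw [ind_of_not hb1, ind_of (P := ¬ bad χ x ∧ fail b χ μ x) ⟨hb1, hb2⟩]
          nlinarith
        · rw [ind_of_not hb1, ind_of_not fun h => hb2 h.2]
          have := h b χ μ x hb1 hb2
          simp only [hG, hW]
          linarith
    refine le_trans ?_ h2
    simp only [expec_sub, expec_const hlawx, expec_const hlawμ, expec_const hlaw]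
    have := hfail b
    linarith
  have hsum := Finset.sum_le_sum fun b (_ : b ∈ Finset.univ) => hb b
  simp only [Finset.sum_sub_distrib, Finset.sum_add_distrib, Finset.sum_const, Finset.card_univ,
    Fintype.card_fin, nsmul_eq_mul] at hsum
  rw [← Finset.mul_sum, ← hv, ← expec_sum] at hsum
  have h3 : expec (matLaw r r (1 / 2)) (fun χ => ∑ b, expec (selLaw n (1 - q)) fun x =>
      (1 - η) * G b χ x - ind (bad χ x) * G b χ x) =
      (1 - η) - expec (matLaw r r (1 / 2)) (fun χ => expec (selLaw n (1 - q)) fun x =>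
        ind (bad χ x)) := by
    rw [← expec_const hlaw (1 - η), ← expec_sub]
    refine congrArg (expec _) (funext fun χ => ?_)
    rw [expec_const hlaw, ← expec_const hlawx (1 - η), ← expec_sub, ← expec_sum]
    refine congrArg (expec _) (funext fun x => ?_)
    rw [Finset.sum_sub_distrib, ← Finset.mul_sum, ← Finset.mul_sum, hGs, expec_const hlawx]
    ring
  rw [h3] at hsum
  nlinarith

end Lower

/-! ### Concentration of the numbers of voters -/

section Concentration

variable {n r : ℕ} {A : Fin n → Fin r}

theorem likers_eq_sum (A : Fin n → Fin r) (S : Finset (Fin n)) (w : Fin r → Bool) :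
    (likers A S w : ℝ) - S.card / 2 = ∑ a, (mult A S a / 2 : ℝ) * sgn (w a) := by
  have h1 : (likers A S w : ℝ) = ∑ a, if w a = true then (mult A S a : ℝ) else 0 := by
    unfold likers
    rw [sum_filter_comp A S fun a => w a = true]
    push_cast
    rfl
  have h2 : (S.card : ℝ) = ∑ a, (mult A S a : ℝ) := by
    rw [← sum_mult A S]; push_cast; rfl
  rw [h1, h2, Finset.sum_div, ← Finset.sum_sub_distrib]
  refine Finset.sum_congr rfl fun a _ => ?_
  cases w a
  · simp only [sgn, Bool.false_eq_true, if_false]; ring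
  · simp only [sgn, if_true]; ring

theorem hoeffding_likers (A : Fin n → Fin r) (S : Finset (Fin n)) {V t : ℝ} (hV : 0 < V)
    (ht : 0 ≤ t) (hS : ∑ a, (mult A S a : ℝ) ^ 2 ≤ V) :
    expec (coins (Fin r) (1 / 2)) (fun w => ind (t ≤ |(likers A S w : ℝ) - S.card / 2|)) ≤
      2 * Real.exp (-(2 * t ^ 2 / V)) := by
  simp only [likers_eq_sum]
  refine (hoeffding_abs (fun a => (mult A S a / 2 : ℝ)) (V := V / 4) (by positivity) ht ?_).trans
    (le_of_eq ?_)
  · simp only [div_pow, ← Finset.sum_div]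
    linarith
  · congr 3
    field_simp
    norm_num

theorem mult_le_add (A : Fin n → Fin r) (S S' : Finset (Fin n)) (a : Fin r) :
    mult A S a ≤ mult A S' a + mult A (S \ S') a := by
  unfold mult
  refine (Finset.card_le_card ?_).trans (Finset.card_union_le _ _)
  intro i hi
  obtain ⟨h1, h2⟩ := Finset.mem_filter.1 hi
  by_cases h : i ∈ S'
  · exact Finset.mem_union_left _ (Finset.mem_filter.2 ⟨h, h2⟩)
  · exact Finset.mem_union_right _ (Finset.mem_filter.2 ⟨Finset.mem_sdiff.2 ⟨h1, h⟩, h2⟩)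

theorem sum_mult_sq_le_card_sq (A : Fin n → Fin r) (S : Finset (Fin n)) :
    ∑ a, (mult A S a : ℝ) ^ 2 ≤ (S.card : ℝ) ^ 2 := by
  have h : (S.card : ℝ) = ∑ a, (mult A S a : ℝ) := by
    rw [← sum_mult A S]; push_cast; rfl
  rw [h]
  exact Finset.sum_sq_le_sq_sum_of_nonneg fun _ _ => Nat.cast_nonneg _

theorem sum_mult_sq_le (A : Fin n → Fin r) (S S' : Finset (Fin n)) :
    ∑ a, (mult A S a : ℝ) ^ 2 ≤
      2 * ∑ a, (mult A S' a : ℝ) ^ 2 + 2 * ((S \ S').card : ℝ) ^ 2 := by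
  have h1 : ∀ a, (mult A S a : ℝ) ^ 2 ≤
      2 * (mult A S' a : ℝ) ^ 2 + 2 * (mult A (S \ S') a : ℝ) ^ 2 := fun a => by
    have h2 : (mult A S a : ℝ) ≤ mult A S' a + mult A (S \ S') a := by
      exact_mod_cast mult_le_add A S S' a
    have h3 : (0 : ℝ) ≤ mult A S a := Nat.cast_nonneg _
    nlinarith [sq_nonneg ((mult A S' a : ℝ) - mult A (S \ S') a)]
  refine (Finset.sum_le_sum fun a _ => h1 a).trans ?_
  rw [Finset.sum_add_distrib, ← Finset.mul_sum, ← Finset.mul_sum]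
  have := sum_mult_sq_le_card_sq A (S \ S')
  linarith

theorem exp_neg_le_quadratic {x : ℝ} (hx : 0 ≤ x) : Real.exp (-x) ≤ 1 - x + x ^ 2 / 2 := by
  have h1 := Real.quadratic_le_exp_of_nonneg hx
  have h2 : Real.exp (-x) * Real.exp x = 1 := by rw [← Real.exp_add]; simp
  have h3 : (1 - x + x ^ 2 / 2) * (1 + x + x ^ 2 / 2) = 1 + x ^ 4 / 4 := by ring
  have h4 : 0 < 1 - x + x ^ 2 / 2 := by nlinarith [sq_nonneg (x - 1)]
  have h5 := mul_le_mul_of_nonneg_left h1 h4.le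
  have h6 : 0 ≤ x ^ 4 / 4 := by positivity
  by_contra hc
  have h7 := mul_lt_mul_of_pos_right (not_le.1 hc) (Real.exp_pos x)
  linarith

/-- Switching on bits typically yields the expected gain, up to a constant factor. -/
theorem prob_gain_lt (A : Fin n → Fin r) (S : Finset (Fin n)) (a : Fin r) (w : Fin r → Bool)
    {θ Z Q : ℝ} (h0 : 0 ≤ θ) (h1 : θ ≤ 1) (hZ0 : 0 ≤ Z) (hQ0 : 0 < Q)
    (hQ : ∑ a, (mult A S a : ℝ) ^ 2 ≤ Q)
    (hZ : Z ≤ ∑ a', if a' ≠ a ∧ w a' = false then (mult A S a' : ℝ) else 0) :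
    expec (coins (Fin r) θ) (fun μ => ind ((gain A S a w μ : ℝ) < θ * Z / 4)) ≤
      Real.exp (-(θ * Z ^ 2 / (4 * Q))) := by
  set l := Z / Q with hl
  have hl0 : 0 ≤ l := by positivity
  have hlaw : IsLaw (coins (Fin r) θ) := isLaw_coins h0 h1
  set g : Fin r → Bool → ℝ := fun a' y =>
    Real.exp (if a' ≠ a ∧ w a' = false ∧ y = true then -(l * mult A S a') else 0) with hg
  have hgain : ∀ μ, Real.exp (-(l * gain A S a w μ)) = ∏ a', g a' (μ a') := fun μ => by
    rw [hg, ← Real.exp_sum]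
    congr 1
    unfold gain
    rw [sum_filter_comp A S fun a' => a' ≠ a ∧ w a' = false ∧ μ a' = true]
    push_cast
    rw [Finset.mul_sum, ← Finset.sum_neg_distrib]
    refine Finset.sum_congr rfl fun a' _ => ?_
    split_ifs <;> simp
  have hM := expec_ind_le (w := coins (Fin r) θ)
    (P := fun μ => (gain A S a w μ : ℝ) < θ * Z / 4)
    (f := fun μ => Real.exp (-(l * gain A S a w μ))) (c := Real.exp (-(l * (θ * Z / 4)))) hlaw
    (Real.exp_pos _) (fun μ => (Real.exp_pos _).le) (fun μ hμ => by
      rw [Real.exp_le_exp]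
      have := mul_le_mul_of_nonneg_left hμ.le hl0
      linarith)
  refine hM.trans ?_
  simp only [hgain]
  rw [expec_prodLaw_prod (fun _ : Fin r => coin θ) g, div_le_iff₀ (Real.exp_pos _), ← Real.exp_add]
  have hfac : ∀ a', expec (coin θ) (g a') ≤ Real.exp (-(θ * (l * (if a' ≠ a ∧ w a' = false then
      (mult A S a' : ℝ) else 0) - l ^ 2 / 2 * (mult A S a' : ℝ) ^ 2))) := by
    intro a'
    rw [expec_coin, hg]
    have hm0 : (0 : ℝ) ≤ mult A S a' := Nat.cast_nonneg _
    by_cases hc : a' ≠ a ∧ w a' = false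
    · simp only [hc.1, hc.2, ne_eq, not_false_eq_true, and_self, true_and, if_true,
        Bool.false_eq_true, if_false, Real.exp_zero, mul_one]
      have e1 := exp_neg_le_quadratic (x := l * mult A S a') (by positivity)
      have e2 := Real.add_one_le_exp (-(θ * (l * (mult A S a' : ℝ) -
        l ^ 2 / 2 * (mult A S a' : ℝ) ^ 2)))
      have e3 := mul_le_mul_of_nonneg_left e1 h0
      linarith
    · have hc2 : ∀ y, ¬ (a' ≠ a ∧ w a' = false ∧ y = true) := fun y h => hc ⟨h.1, h.2.1⟩
      beta_reduce
      rw [if_neg hc, if_neg (hc2 true), if_neg (hc2 false), Real.exp_zero]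
      have : 0 ≤ θ * (l ^ 2 / 2 * (mult A S a' : ℝ) ^ 2) := by positivity
      rw [show θ * 1 + (1 - θ) * 1 = 1 by ring]
      exact Real.one_le_exp (by linarith)
  refine (Finset.prod_le_prod (fun a' _ => ?_) fun a' _ => hfac a').trans ?_
  · exact expec_nonneg (isLaw_coin h0 h1) fun y => (Real.exp_pos _).le
  rw [← Real.exp_sum, Real.exp_le_exp, Finset.sum_neg_distrib, ← Finset.mul_sum,
    Finset.sum_sub_distrib, ← Finset.mul_sum, ← Finset.mul_sum]
  have e1 := mul_le_mul_of_nonneg_left hZ hl0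
  have e2 := mul_le_mul_of_nonneg_left hQ (by positivity : (0 : ℝ) ≤ l ^ 2 / 2)
  have e3 : l ^ 2 / 2 * Q = Z ^ 2 / Q / 2 := by rw [hl]; field_simp
  have e4 : l * Z = Z ^ 2 / Q := by rw [hl]; field_simp
  have e5 : θ * Z ^ 2 / (4 * Q) = θ * (Z ^ 2 / Q) / 4 := by field_simp
  have e6 : l * (θ * Z / 4) = θ * (l * Z) / 4 := by ring
  rw [e5, e6, e4]
  have e7 : Z ^ 2 / Q / 2 ≤ l * (∑ a', if a' ≠ a ∧ w a' = false then (mult A S a' : ℝ) else 0) -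
      l ^ 2 / 2 * ∑ a', (mult A S a' : ℝ) ^ 2 := by linarith
  have := mul_le_mul_of_nonneg_left e7 h0
  linarith

end Concentration

/-! ### The two ways of compensating for the influence of a column -/

section Transfer

variable {n r : ℕ} {A B : Fin n → Fin r} {u : Fin n} {T : ℕ} {eu : Fin n → Bool} {q : ℝ}

/-- The number of selected rows that notice a change in column `b` of the cluster values. -/
def noticing (A B : Fin n → Fin r) (u : Fin n) (T : ℕ) (eu : Fin n → Bool) (b : Fin r)
    (χ : Fin r → Fin r → Bool) (x : (Fin n → Fin n → Bool) × Equiv.Perm (Fin n)) : ℕ :=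
  (hitters u x.1 (ratedIn B eu b) ∩ selected A B u T eu χ x).card

/-- The selection is untypical: this collects the exceptional events for the cluster values and
for the observations, a selection with many rows of the cluster of `u`, and a selection that is
concentrated on few clusters. -/
def Untypical (A B : Fin n → Fin r) (u : Fin n) (T : ℕ) (eu : Fin n → Bool)
    (X : (Fin r → Fin r → Bool) → Prop) (Y : (Fin n → Fin n → Bool) × Equiv.Perm (Fin n) → Prop)
    (τ₁ : ℕ) (Q : ℝ) (χ : Fin r → Fin r → Bool)
    (x : (Fin n → Fin n → Bool) × Equiv.Perm (Fin n)) : Prop :=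
  ¬ X χ ∨ ¬ Y x ∨ τ₁ < mult A (chosen A B u T eu χ x) (A u) ∨
    Q < ∑ a, (mult A (chosen A B u T eu χ x) a : ℝ) ^ 2

variable {X : (Fin r → Fin r → Bool) → Prop}
  {Y : (Fin n → Fin n → Bool) × Equiv.Perm (Fin n) → Prop} {τ₀ τ₁ : ℕ} {Q : ℝ} {δ : ℝ}

/-- The voters for a column cluster are about half of the selected rows: without the few rows that
notice the column, the selection is independent of the column. -/
theorem prob_unbalanced (hq0 : 0 ≤ q) (hq1 : q ≤ 1) (hT : T ≤ n) (hτ : 8 * τ₀ + 4 ≤ T)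
    (hτQ : (τ₀ : ℝ) ^ 2 ≤ Q) (hQ : 0 < Q)
    (hloc : ∀ χ b y, X χ → expec (selLaw n (1 - q)) (fun x =>
      ind (Y x ∧ τ₀ < noticing A B u T eu b (setCol χ b y) x)) ≤ δ) (hδ : 0 ≤ δ) (b : Fin r) :
    expec (matLaw r r (1 / 2)) (fun χ => expec (selLaw n (1 - q)) fun x =>
      ind (¬ Untypical A B u T eu X Y τ₁ Q χ x ∧ (τ₀ < noticing A B u T eu b χ x ∨
        4 * likes A B u T eu χ x b < T ∨ 3 * T < 4 * likes A B u T eu χ x b))) ≤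
      2 * δ + 2 * Real.exp (-(T ^ 2 / (128 * Q))) := by
  have hlaw := isLaw_bitMatrix r r
  have hlawx := isLaw_selLaw n (p := 1 - q) (by linarith) (by linarith)
  set χ0 : (Fin r → Fin r → Bool) → Fin r → Fin r → Bool := fun χ => setCol χ b fun _ => false
    with hχ0
  set H : (Fin r → Fin r → Bool) → (Fin n → Fin n → Bool) × Equiv.Perm (Fin n) → Prop :=
    fun χ x => ∑ a, (mult A (chosen A B u T eu (χ0 χ) x) a : ℝ) ^ 2 ≤ 4 * Q ∧
      (T / 8 : ℝ) ≤ |(likers A (chosen A B u T eu (χ0 χ) x) fun i => χ i b : ℝ) -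
        (chosen A B u T eu (χ0 χ) x).card / 2| with hH
  have hpt : ∀ χ x, ind (¬ Untypical A B u T eu X Y τ₁ Q χ x ∧
      (τ₀ < noticing A B u T eu b χ x ∨
        4 * likes A B u T eu χ x b < T ∨ 3 * T < 4 * likes A B u T eu χ x b)) ≤
      ind (X χ) * ind (Y x ∧ τ₀ < noticing A B u T eu b χ x) +
      ind (X χ) * ind (Y x ∧ τ₀ < noticing A B u T eu b (χ0 χ) x) + ind (H χ x) := by
    intro χ x
    have e1 := ind_nonneg (X χ)
    have e2 := ind_nonneg (Y x ∧ τ₀ < noticing A B u T eu b χ x)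
    have e3 := ind_nonneg (Y x ∧ τ₀ < noticing A B u T eu b (χ0 χ) x)
    have e4 := ind_nonneg (H χ x)
    refine ind_le_of (by positivity) fun h => ?_
    obtain ⟨hb, hf⟩ := h
    unfold Untypical at hb
    push Not at hb
    obtain ⟨hX, hY, -, hQ'⟩ := hb
    by_cases h1 : τ₀ < noticing A B u T eu b χ x
    · rw [ind_of hX, ind_of (P := Y x ∧ _) ⟨hY, h1⟩, one_mul]
      linarith
    by_cases h2 : τ₀ < noticing A B u T eu b (χ0 χ) x
    · rw [ind_of hX, ind_of (P := Y x ∧ τ₀ < noticing A B u T eu b (χ0 χ) x) ⟨hY, h2⟩]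
      linarith
    have h12 : ∀ i, ∀ b' ≠ b, χ i b' = χ0 χ i b' := fun i b' hb' => (setCol_of_ne χ _ i hb').symm
    have h21 : ∀ i, ∀ b' ≠ b, χ0 χ i b' = χ i b' := fun i b' hb' => setCol_of_ne χ _ i hb'
    have d1 := card_chosen_sdiff_le (T := T) h12 (not_lt.1 h1) (not_lt.1 h2)
    have d2 := card_chosen_sdiff_le (T := T) h21 (not_lt.1 h2) (not_lt.1 h1)
    set S := chosen A B u T eu χ x with hS
    set S0 := chosen A B u T eu (χ0 χ) x with hS0
    have hHχ : H χ x := by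
      refine ⟨?_, ?_⟩
      · have := sum_mult_sq_le A S0 S
        have d3 : ((S0 \ S).card : ℝ) ≤ τ₀ := by exact_mod_cast d1
        have d4 : ((S0 \ S).card : ℝ) ^ 2 ≤ (τ₀ : ℝ) ^ 2 := pow_le_pow_left₀ (by positivity) d3 2
        linarith
      · have l1 := likers_le_add A S0 S fun i => χ i b
        have l2 := likers_le_add A S S0 fun i => χ i b
        have c1 : S0.card ≤ T := card_chosen_le
        have c2 : T ≤ S0.card + 1 := le_card_chosen_add_one hT
        rw [likes_eq_likers] at hf
        have hf' := hf.resolve_left h1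
        have l1' : (likers A S0 (fun i => χ i b) : ℝ) ≤ likers A S (fun i => χ i b) + τ₀ := by
          exact_mod_cast l1.trans (by omega)
        have l2' : (likers A S (fun i => χ i b) : ℝ) ≤ likers A S0 (fun i => χ i b) + τ₀ := by
          exact_mod_cast l2.trans (by omega)
        have c1' : (S0.card : ℝ) ≤ T := by exact_mod_cast c1
        have c2' : (T : ℝ) ≤ S0.card + 1 := by exact_mod_cast c2
        have hτ' : (8 * τ₀ + 4 : ℝ) ≤ T := by exact_mod_cast hτ
        rw [le_abs]
        rcases hf' with hf' | hf'
        · right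
          have : (4 * likers A S (fun i => χ i b) : ℝ) < T := by exact_mod_cast hf'
          linarith
        · left
          have : (3 * T : ℝ) < 4 * likers A S (fun i => χ i b) := by exact_mod_cast hf'
          linarith
    rw [ind_of hHχ]
    have := mul_nonneg e1 e2
    have := mul_nonneg e1 e3
    linarith
  refine (expec_mono hlaw fun χ => expec_mono hlawx fun x => hpt χ x).trans ?_
  simp only [expec_add, expec_mul_left]
  have k1 : ∀ y : (Fin r → Fin r → Bool) → Fin r → Bool, expec (matLaw r r (1 / 2)) (fun χ =>
      ind (X χ) * expec (selLaw n (1 - q)) fun x =>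
        ind (Y x ∧ τ₀ < noticing A B u T eu b (setCol χ b (y χ)) x)) ≤ δ := fun y =>
    expec_le_of_le hlaw fun χ => ind_mul_le hδ fun hX => hloc χ b (y χ) hX
  have k2 := k1 fun χ i => χ i b
  simp only [setCol_eq] at k2
  have k3 := k1 fun _ _ => false
  have k4 : expec (matLaw r r (1 / 2)) (fun χ => expec (selLaw n (1 - q)) fun x => ind (H χ x)) ≤
      2 * Real.exp (-(T ^ 2 / (128 * Q))) := by
    rw [← expec_setCol b]
    refine expec_le_of_le hlaw fun χ => ?_
    rw [expec_comm]
    refine expec_le_of_le hlawx fun x => ?_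
    simp only [hH, hχ0, setCol_setCol, setCol_self]
    set S0 := chosen A B u T eu (setCol χ b fun _ => false) x
    by_cases hs : ∑ a, (mult A S0 a : ℝ) ^ 2 ≤ 4 * Q
    · simp only [hs, true_and]
      refine (hoeffding_likers A S0 (V := 4 * Q) (by linarith) (by positivity) hs).trans
        (le_of_eq ?_)
      congr 3
      field_simp
      ring
    · simp only [hs, false_and, ind_of_not not_false]
      rw [expec_const (isLaw_bits _)]
      positivity
  linarith

/-- The bound on the number of rows that notice a change holds for any new column, hence also for
the tilted one. -/
theorem prob_noticing_forceCol (hq0 : 0 ≤ q) (hq1 : q ≤ 1) {θ : ℝ} (hθ0 : 0 ≤ θ) (hθ1 : θ ≤ 1)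
    (hloc : ∀ χ b y, X χ → expec (selLaw n (1 - q)) (fun x =>
      ind (Y x ∧ τ₀ < noticing A B u T eu b (setCol χ b y) x)) ≤ δ) (hδ : 0 ≤ δ) (b : Fin r)
    (v : Bool) :
    expec (matLaw r r (1 / 2)) (fun χ => expec (coins (Fin r) θ) fun μ =>
      expec (selLaw n (1 - q)) fun x => ind (¬ Untypical A B u T eu X Y τ₁ Q χ x ∧
        τ₀ < noticing A B u T eu b (forceCol v (A u) b χ μ) x)) ≤ δ := by
  refine expec_le_of_le (isLaw_bitMatrix r r) fun χ => expec_le_of_le (isLaw_coins hθ0 hθ1)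
    fun μ => ?_
  by_cases hX : X χ
  · refine le_trans (expec_mono (isLaw_selLaw n (by linarith) (by linarith)) fun x => ?_)
      (hloc χ b (force v (A u) (fun i => χ i b) μ) hX)
    refine ind_mono fun h => ⟨?_, h.2⟩
    by_contra hY
    exact h.1 (Or.inr (Or.inl hY))
  · refine expec_le_of_le (isLaw_selLaw n (by linarith) (by linarith)) fun x => ?_
    rw [ind_of_not fun h => h.1 (Or.inl hX)]
    exact hδ

/-- Both verdicts are about equally likely, if the influence of a column is small compared with
the number of voters per observed vote. -/
theorem le_verdictGiven_of_loss (hq0 : 0 ≤ q) (hq1 : q ≤ 1) (hR : (unrated eu).Nonempty)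
    (hT : T ≤ n) (hτ : 8 * τ₀ + 4 ≤ T) (hτ₁ : τ₀ + τ₁ ≤ T) (hτQ : (τ₀ : ℝ) ^ 2 ≤ Q) (hQ : 0 < Q)
    (hloc : ∀ χ b y, X χ → expec (selLaw n (1 - q)) (fun x =>
      ind (Y x ∧ τ₀ < noticing A B u T eu b (setCol χ b y) x)) ≤ δ) (hδ : 0 ≤ δ) {η₁ : ℝ}
    (hbad : expec (matLaw r r (1 / 2)) (fun χ => expec (selLaw n (1 - q)) fun x =>
      ind (Untypical A B u T eu X Y τ₁ Q χ x)) ≤ η₁) (V : ℕ) (v : Bool) :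
    1 - 16 * (τ₀ + τ₁) * V / T - η₁ - r * (2 * T * n ^ 2 * (Real.exp (2 * T * q) / 2 ^ V) +
        (3 * δ + 2 * Real.exp (-(T ^ 2 / (128 * Q)))) + Real.exp (-(r / 16))) ≤
      2 * verdictGiven A B q u T v eu := by
  have hlaw := isLaw_bitMatrix r r
  have hlawx := isLaw_selLaw n (p := 1 - q) (by linarith) (by linarith)
  have hlawμ : IsLaw (coins (Fin r) 0) := isLaw_coins le_rfl zero_le_one
  have hT0 : (0 : ℝ) < T := by
    have : 0 < T := by omega
    exact_mod_cast this
  have h := le_verdictGiven (A := A) (B := B) (u := u) (T := T) hq0 hq1 (θ := 0) (ε := 1 / 2)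
    le_rfl (by norm_num) (by norm_num) hR
    (η := 16 * (τ₀ + τ₁) * V / T) (δ := 2 * T * n ^ 2 * (Real.exp (2 * T * q) / 2 ^ V))
    (by positivity) (by positivity) (τ₀ + τ₁) v (Untypical A B u T eu X Y τ₁ Q)
    (fun b χ μ x => (τ₀ < noticing A B u T eu b χ x ∨
        4 * likes A B u T eu χ x b < T ∨ 3 * T < 4 * likes A B u T eu χ x b) ∨
      τ₀ < noticing A B u T eu b (forceCol v (A u) b χ μ) x) ?_ hbad
    (δ₁ := 3 * δ + 2 * Real.exp (-(T ^ 2 / (128 * Q)))) ?_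
  · rw [show (0 : ℝ) * (1 / 2) * r = 0 by ring, Real.exp_zero, mul_one] at h
    refine le_trans (le_of_eq ?_) h
    rw [show (1 / 2 : ℝ) ^ 2 * r / 4 = r / 16 by ring]
  · intro b χ μ x hb hf
    unfold Untypical at hb
    push Not at hb hf
    obtain ⟨-, -, hm1, -⟩ := hb
    obtain ⟨⟨hn1, hl1, hl2⟩, hn2⟩ := hf
    have hmT : (T : ℝ) / 8 ≤ ((T / 4 : ℕ) : ℝ) := by
      have : T ≤ 8 * (T / 4) := by omega
      have : (T : ℝ) ≤ 8 * ((T / 4 : ℕ) : ℝ) := by exact_mod_cast this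
      linarith
    have h2 := winProb_le_of_loss (q := q) (R := unrated eu) (v := v) (a := A u) (τ' := τ₀ + τ₁)
      (m := T / 4) (M' := 2 * T) hq0 hq1 hn1 hn2 (by omega) (by omega) (by omega) (by omega)
      (by omega) V
    refine le_trans ?_ h2
    have hW := winProb_nonneg hq0 hq1 (B := B) (R := unrated eu)
      (fun b' => likes A B u T eu χ x b' + (τ₀ + τ₁)) (cluster B b)
    have e1 : (2 * (τ₀ + τ₁ : ℕ) * V / ((T / 4 : ℕ) : ℝ) : ℝ) ≤ 16 * (τ₀ + τ₁) * V / T := by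
      rw [show (16 * (τ₀ + τ₁) * V / T : ℝ) = 2 * (τ₀ + τ₁ : ℕ) * V / (T / 8) by
        push_cast; field_simp; ring]
      gcongr
    have e2 : (2 * (τ₀ + τ₁ : ℕ) * n ^ 2 * (Real.exp ((2 * T : ℕ) * q) / 2 ^ V) : ℝ) ≤
        2 * T * n ^ 2 * (Real.exp (2 * T * q) / 2 ^ V) := by
      have : ((τ₀ + τ₁ : ℕ) : ℝ) ≤ T := by exact_mod_cast hτ₁
      push_cast at this ⊢
      gcongr
    have := mul_le_mul_of_nonneg_right e1 hW
    linarith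
  · intro b
    have k1 := prob_unbalanced (τ₁ := τ₁) hq0 hq1 hT hτ hτQ hQ hloc hδ b
    have k2 := prob_noticing_forceCol (τ₁ := τ₁) (Q := Q) hq0 hq1 le_rfl zero_le_one hloc hδ b v
    refine le_trans (b := expec (matLaw r r (1 / 2)) fun χ => expec (coins (Fin r) 0) fun μ =>
      expec (selLaw n (1 - q)) fun x =>
        (ind (¬ Untypical A B u T eu X Y τ₁ Q χ x ∧ (τ₀ < noticing A B u T eu b χ x ∨
          4 * likes A B u T eu χ x b < T ∨ 3 * T < 4 * likes A B u T eu χ x b)) +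
        ind (¬ Untypical A B u T eu X Y τ₁ Q χ x ∧
          τ₀ < noticing A B u T eu b (forceCol v (A u) b χ μ) x))) ?_ ?_
    · refine expec_mono hlaw fun χ => expec_mono hlawμ fun μ => expec_mono hlawx fun x => ?_
      exact le_trans (ind_mono fun h => h.2.imp (fun h' => ⟨h.1, h'⟩) fun h' => ⟨h.1, h'⟩)
        (ind_or_le _ _)
    · simp only [expec_add, expec_const hlawμ]
      linarith

/-- Both verdicts are about equally likely, if the influence of a column is small compared with
the fluctuations of the number of voters. -/
theorem le_verdictGiven_of_gain (hq0 : 0 ≤ q) (hq1 : q ≤ 1) (hR : (unrated eu).Nonempty)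
    (hT : T ≤ n) (hτ : 8 * τ₀ + 4 ≤ T) (hτ₁ : 8 * τ₁ + 8 ≤ T) (hτQ : (τ₀ : ℝ) ^ 2 ≤ Q)
    (hQ : 0 < Q) {θ ε : ℝ} (hθ0 : 0 ≤ θ) (hθ : θ ≤ ε / 4) (hε : ε ≤ 1)
    (hg : 2 * τ₀ + τ₁ ≤ θ * T / 32)
    (hloc : ∀ χ b y, X χ → expec (selLaw n (1 - q)) (fun x =>
      ind (Y x ∧ τ₀ < noticing A B u T eu b (setCol χ b y) x)) ≤ δ) (hδ : 0 ≤ δ) {η₁ : ℝ}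
    (hbad : expec (matLaw r r (1 / 2)) (fun χ => expec (selLaw n (1 - q)) fun x =>
      ind (Untypical A B u T eu X Y τ₁ Q χ x)) ≤ η₁) (v : Bool) :
    1 - η₁ - r * (3 * δ + 2 * Real.exp (-(T ^ 2 / (128 * Q))) +
        Real.exp (-(θ * T ^ 2 / (256 * Q))) + Real.exp (-(ε ^ 2 * r / 4))) ≤
      2 * Real.exp (θ * ε * r) * verdictGiven A B q u T v eu := by
  have hlaw := isLaw_bitMatrix r r
  have hlawx := isLaw_selLaw n (p := 1 - q) (by linarith) (by linarith)
  have hlawμ : IsLaw (coins (Fin r) θ) := isLaw_coins hθ0 (by linarith)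
  set J : Fin r → (Fin r → Fin r → Bool) → (Fin r → Bool) →
      (Fin n → Fin n → Bool) × Equiv.Perm (Fin n) → Prop := fun b χ μ x =>
    (T / 8 : ℝ) ≤ (∑ a', if a' ≠ A u ∧ χ a' b = false then
      (mult A (chosen A B u T eu χ x) a' : ℝ) else 0) ∧
    ∑ a', (mult A (chosen A B u T eu χ x) a' : ℝ) ^ 2 ≤ Q ∧
    (gain A (chosen A B u T eu χ x) (A u) (fun i => χ i b) μ : ℝ) < θ * (T / 8) / 4 with hJ
  have h := le_verdictGiven (A := A) (B := B) (u := u) (T := T) hq0 hq1 hθ0 hθ hε hR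
    (η := 0) (δ := 0) le_rfl le_rfl τ₀ v (Untypical A B u T eu X Y τ₁ Q)
    (fun b χ μ x => ((τ₀ < noticing A B u T eu b χ x ∨
        4 * likes A B u T eu χ x b < T ∨ 3 * T < 4 * likes A B u T eu χ x b) ∨
      τ₀ < noticing A B u T eu b (forceCol v (A u) b χ μ) x) ∨ J b χ μ x) ?_ hbad
    (δ₁ := 3 * δ + 2 * Real.exp (-(T ^ 2 / (128 * Q))) + Real.exp (-(θ * T ^ 2 / (256 * Q)))) ?_
  · refine le_trans (le_of_eq ?_) h
    ring
  · intro b χ μ x hb hf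
    unfold Untypical at hb
    push Not at hb hf
    obtain ⟨-, -, hm1, hm2⟩ := hb
    obtain ⟨⟨⟨hn1, hl1, hl2⟩, hn2⟩, hj⟩ := hf
    set S := chosen A B u T eu χ x with hS
    have hz : (T / 8 : ℝ) ≤ ∑ a', if a' ≠ A u ∧ χ a' b = false then (mult A S a' : ℝ) else 0 := by
      have z1 := sum_filter_comp A S fun a' => χ a' b = false
      have z2 := likers_not A S fun i => χ i b
      have z3 : (S.filter fun i => χ (A i) b = false).card = likers A S fun i => !χ i b := by
        unfold likers
        refine congrArg Finset.card (Finset.filter_congr fun i _ => ?_)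
        simp
      have z4 : T ≤ S.card + 1 := le_card_chosen_add_one hT
      have z5 : ∑ a', (if χ a' b = false then mult A S a' else 0) ≤
          (∑ a', if a' ≠ A u ∧ χ a' b = false then mult A S a' else 0) + mult A S (A u) := by
        rw [← Finset.sum_erase_add _ _ (Finset.mem_univ (A u))]
        refine add_le_add ?_ (by split_ifs <;> simp)
        refine (Finset.sum_le_sum fun a' ha' => ?_).trans
          (Finset.sum_le_sum_of_subset (Finset.erase_subset (A u) _))
        rw [if_congr (and_iff_right (Finset.ne_of_mem_erase ha')) rfl rfl]
      change 4 * likers A S (fun i => χ i b) ≤ 3 * T at hl2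
      have z6 : T ≤ 8 * ∑ a', if a' ≠ A u ∧ χ a' b = false then mult A S a' else 0 := by omega
      have z7 : (T : ℝ) ≤ 8 * ∑ a', if a' ≠ A u ∧ χ a' b = false then (mult A S a' : ℝ) else 0 := by
        exact_mod_cast z6
      linarith
    have hgain := not_lt.1 fun hlt => hj ⟨hz, hm2, hlt⟩
    have h2 := winProb_le_of_gain (q := q) (R := unrated eu) (v := v) (a := A u) (τ := τ₀)
      hq0 hq1 hn1 hn2 (by
        have : (mult A S (A u) : ℝ) ≤ τ₁ := by exact_mod_cast hm1
        have h3 : (mult A S (A u) + 2 * τ₀ : ℝ) ≤ gain A S (A u) (fun i => χ i b) μ := by linarith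
        exact_mod_cast h3)
    linarith
  · intro b
    have k1 := prob_unbalanced (τ₁ := τ₁) hq0 hq1 hT hτ hτQ hQ hloc hδ b
    have k2 := prob_noticing_forceCol (τ₁ := τ₁) (Q := Q) hq0 hq1 hθ0 (by linarith) hloc hδ b v
    have k3 : expec (matLaw r r (1 / 2)) (fun χ => expec (coins (Fin r) θ) fun μ =>
        expec (selLaw n (1 - q)) fun x => ind (J b χ μ x)) ≤
        Real.exp (-(θ * T ^ 2 / (256 * Q))) := by
      refine expec_le_of_le hlaw fun χ => ?_
      rw [expec_comm]
      refine expec_le_of_le hlawx fun x => ?_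
      by_cases h1 : (T / 8 : ℝ) ≤ (∑ a', if a' ≠ A u ∧ χ a' b = false then
          (mult A (chosen A B u T eu χ x) a' : ℝ) else 0) ∧
        ∑ a', (mult A (chosen A B u T eu χ x) a' : ℝ) ^ 2 ≤ Q
      · refine le_trans (expec_mono hlawμ fun μ => ind_mono fun h => h.2.2)
          ((prob_gain_lt A (chosen A B u T eu χ x) (A u) (fun i => χ i b) hθ0 (by linarith)
            (by positivity) hQ h1.2 h1.1).trans (le_of_eq ?_))
        congr 2
        field_simp
        ring
      · refine expec_le_of_le hlawμ fun μ => ?_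
        rw [ind_of_not fun h => h1 ⟨h.1, h.2.1⟩]
        positivity
    refine le_trans (b := expec (matLaw r r (1 / 2)) fun χ => expec (coins (Fin r) θ) fun μ =>
      expec (selLaw n (1 - q)) fun x =>
        (ind (¬ Untypical A B u T eu X Y τ₁ Q χ x ∧ (τ₀ < noticing A B u T eu b χ x ∨
          4 * likes A B u T eu χ x b < T ∨ 3 * T < 4 * likes A B u T eu χ x b)) +
        ind (¬ Untypical A B u T eu X Y τ₁ Q χ x ∧
          τ₀ < noticing A B u T eu b (forceCol v (A u) b χ μ) x) + ind (J b χ μ x))) ?_ ?_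
    · refine expec_mono hlaw fun χ => expec_mono hlawμ fun μ => expec_mono hlawx fun x => ?_
      refine le_trans ?_ ((ind_or_le _ _).trans (add_le_add (ind_or_le _ _) le_rfl))
      refine ind_mono fun h => ?_
      rcases h with ⟨hb, (h' | h') | h'⟩
      · exact Or.inl (Or.inl ⟨hb, h'⟩)
      · exact Or.inl (Or.inr ⟨hb, h'⟩)
      · exact Or.inr h'
    · simp only [expec_add, expec_const hlawμ]
      linarith

end Transfer

/-! ### The number of observed entries in a set of columns -/

section Binomial

theorem filter_update_of_notMem {ι : Type*} [DecidableEq ι] {K : Finset ι} {l : ι} (hl : l ∉ K)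
    (e : ι → Bool) (x : Bool) :
    (K.filter fun j => Function.update e l x j = false) = K.filter fun j => e j = false := by
  refine Finset.filter_congr fun j hj => ?_
  have : j ≠ l := fun h => hl (h ▸ hj)
  rw [Function.update_of_ne this]

variable {ι : Type*} [Fintype ι] [DecidableEq ι] {q : ℝ}

theorem expec_coins_split {p : ℝ} (h0 : 0 ≤ p) (h1 : p ≤ 1) (l : ι) (F : (ι → Bool) → ℝ) :
    expec (coins ι p) F = p * expec (coins ι p) (fun e => F (Function.update e l true)) +
      (1 - p) * expec (coins ι p) (fun e => F (Function.update e l false)) := by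
  rw [← expec_update _ l F (isLaw_coin h0 h1), ← expec_mul_left, ← expec_mul_left, ← expec_add]
  exact congrArg (expec _) (funext fun e => expec_coin _ _)

/-- The binomial weights. -/
def binom (q : ℝ) (m s : ℕ) : ℝ := m.choose s * q ^ s * (1 - q) ^ (m - s)

theorem binom_nonneg (h0 : 0 ≤ q) (h1 : q ≤ 1) (m s : ℕ) : 0 ≤ binom q m s := by
  have : 0 ≤ 1 - q := by linarith
  unfold binom; positivity

theorem prob_count_eq (h0 : 0 ≤ q) (h1 : q ≤ 1) (K : Finset ι) : ∀ s : ℕ,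
    expec (coins ι (1 - q)) (fun e => ind ((K.filter fun j => e j = false).card = s)) =
      binom q K.card s := by
  have hlaw : IsLaw (coins ι (1 - q)) := isLaw_coins (by linarith) (by linarith)
  induction K using Finset.induction_on with
  | empty =>
    intro s
    rcases Nat.eq_zero_or_pos s with rfl | hs
    · simp only [Finset.filter_empty, Finset.card_empty, ind_of trivial]
      rw [expec_const hlaw]
      simp [binom]
    · have : ¬ (0 = s) := by omega
      simp only [Finset.filter_empty, Finset.card_empty, ind_of_not this]
      rw [expec_const hlaw]
      simp [binom, Nat.choose_eq_zero_of_lt hs]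
  | insert l K hl ih =>
    intro s
    rw [expec_coins_split (by linarith) (by linarith) l]
    have e1 : ∀ e : ι → Bool, ((insert l K).filter fun j =>
        Function.update e l true j = false).card = (K.filter fun j => e j = false).card := by
      intro e
      rw [Finset.filter_insert, if_neg (by simp), filter_update_of_notMem hl]
    have e2 : ∀ e : ι → Bool, ((insert l K).filter fun j =>
        Function.update e l false j = false).card = (K.filter fun j => e j = false).card + 1 := by
      intro e
      rw [Finset.filter_insert, if_pos (by simp), filter_update_of_notMem hl,
        Finset.card_insert_of_notMem (by simp [hl])]
    simp only [e1, e2]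
    rw [ih, Finset.card_insert_of_notMem hl, sub_sub_cancel]
    rcases s with _ | s
    · simp only [Nat.succ_ne_zero, ind_of_not not_false]
      rw [expec_const hlaw]
      simp only [binom, Nat.choose_zero_right, Nat.sub_zero, pow_succ]
      ring
    · simp only [Nat.add_right_cancel_iff]
      rw [ih]
      unfold binom
      rw [Nat.choose_succ_succ, Nat.add_sub_add_right]
      push_cast
      rcases Nat.lt_or_ge K.card (s + 1) with h | h
      · rw [Nat.choose_eq_zero_of_lt h]
        push_cast
        ring
      · obtain ⟨m, hm⟩ := Nat.exists_eq_add_of_le h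
        rw [hm, show s + 1 + m - s = m + 1 by omega, show s + 1 + m - (s + 1) = m by omega]
        ring

theorem prob_count_eq_and_notMem (h0 : 0 ≤ q) (h1 : q ≤ 1) {K : Finset ι} {l : ι} (hl : l ∉ K)
    (s : ℕ) :
    expec (coins ι (1 - q)) (fun e =>
      ind ((K.filter fun j => e j = false).card = s) * ind (e l = false)) =
      q * binom q K.card s := by
  rw [expec_coins_split (by linarith) (by linarith) l]
  simp only [filter_update_of_notMem hl, Function.update_self, ind_of trivial, mul_one,
    Bool.true_eq_false, ind_of_not not_false, mul_zero]
  rw [prob_count_eq h0 h1, expec_const (isLaw_coins (by linarith) (by linarith))]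
  ring

theorem prob_count_eq_and_mem (h0 : 0 ≤ q) (h1 : q ≤ 1) {K : Finset ι} {l : ι} (hl : l ∈ K)
    (s : ℕ) :
    K.card * expec (coins ι (1 - q)) (fun e =>
      ind ((K.filter fun j => e j = false).card = s) * ind (e l = false)) =
      s * binom q K.card s := by
  have hlaw : IsLaw (coins ι (1 - q)) := isLaw_coins (by linarith) (by linarith)
  obtain ⟨K, hlK, rfl⟩ : ∃ K', l ∉ K' ∧ K = insert l K' :=
    ⟨K.erase l, Finset.notMem_erase l K, (Finset.insert_erase hl).symm⟩
  rw [expec_coins_split (by linarith) (by linarith) l]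
  have e2 : ∀ e : ι → Bool, ((insert l K).filter fun j =>
      Function.update e l false j = false).card = (K.filter fun j => e j = false).card + 1 := by
    intro e
    rw [Finset.filter_insert, if_pos (by simp), filter_update_of_notMem hlK,
      Finset.card_insert_of_notMem (by simp [hlK])]
  simp only [e2, Function.update_self, ind_of trivial, mul_one,
    Bool.true_eq_false, ind_of_not not_false, mul_zero]
  rw [expec_const hlaw, Finset.card_insert_of_notMem hlK, sub_sub_cancel]
  rcases s with _ | s
  · simp only [Nat.succ_ne_zero, ind_of_not not_false]
    rw [expec_const hlaw]
    simp
  · simp only [Nat.add_right_cancel_iff]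
    rw [prob_count_eq h0 h1]
    unfold binom
    have h2 : ((K.card + 1 : ℕ) : ℝ) * (K.card.choose s : ℕ) =
        ((K.card + 1).choose (s + 1) : ℕ) * (s + 1 : ℕ) := by
      exact_mod_cast Nat.add_one_mul_choose_eq K.card s
    rw [Nat.add_sub_add_right, pow_succ]
    push_cast at h2 ⊢
    linear_combination (q ^ s * q * (1 - q) ^ (K.card - s)) * h2

/-- Given the number of observations in `K`, it is unlikely that one of them is in the small
set `J`, as each of the entries in `K` is equally likely to have been observed. -/
theorem prob_count_eq_and_hit (h0 : 0 ≤ q) (h1 : q ≤ 1) (K J : Finset ι) {s M : ℕ} (hs : s ≤ M)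
    {o : ℝ} (ho : 0 < o) (hK : o ≤ K.card) :
    expec (coins ι (1 - q)) (fun e =>
      ind ((K.filter fun j => e j = false).card = s) * ind (∃ l ∈ J, e l = false)) ≤
      J.card * (q + M / o) * binom q K.card s := by
  have hlaw : IsLaw (coins ι (1 - q)) := isLaw_coins (by linarith) (by linarith)
  have hb := binom_nonneg h0 h1 K.card s
  have hpt : ∀ e : ι → Bool, ind ((K.filter fun j => e j = false).card = s) *
      ind (∃ l ∈ J, e l = false) ≤
      ∑ l ∈ J, ind ((K.filter fun j => e j = false).card = s) * ind (e l = false) := by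
    intro e
    rw [← Finset.mul_sum]
    refine mul_le_mul_of_nonneg_left ?_ (ind_nonneg _)
    refine ind_le_of (Finset.sum_nonneg fun _ _ => ind_nonneg _) fun ⟨l, hl, hel⟩ => ?_
    rw [← ind_of hel]
    exact Finset.single_le_sum (f := fun l => ind (e l = false)) (fun _ _ => ind_nonneg _) hl
  refine (expec_mono hlaw hpt).trans ?_
  rw [expec_sum]
  have hl : ∀ l ∈ J, expec (coins ι (1 - q)) (fun e =>
      ind ((K.filter fun j => e j = false).card = s) * ind (e l = false)) ≤
      (q + M / o) * binom q K.card s := by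
    intro l _
    have hMo : (0 : ℝ) ≤ M / o := by positivity
    by_cases hlK : l ∈ K
    · have h2 := prob_count_eq_and_mem h0 h1 hlK s
      have hK0 : (0 : ℝ) < K.card := lt_of_lt_of_le ho hK
      have h3 : expec (coins ι (1 - q)) (fun e =>
          ind ((K.filter fun j => e j = false).card = s) * ind (e l = false)) =
          s / K.card * binom q K.card s := by
        field_simp
        linarith
      rw [h3]
      refine mul_le_mul_of_nonneg_right ?_ hb
      have : (s : ℝ) / K.card ≤ M / o := by
        have : (s : ℝ) ≤ M := by exact_mod_cast hs
        gcongr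
      linarith
    · rw [prob_count_eq_and_notMem h0 h1 hlK]
      exact mul_le_mul_of_nonneg_right (by linarith) hb
  refine (Finset.sum_le_sum hl).trans (le_of_eq ?_)
  rw [Finset.sum_const, nsmul_eq_mul]
  ring

/-- Binomial weights for similar numbers of trials are comparable. -/
theorem binom_le (h0 : 0 ≤ q) {m m' s M : ℕ} (hs : s ≤ M) (hm' : 2 * M ≤ m')
    (hm : m ≤ 8 * m') (hq : m' * q ≤ 1 / 2) (hq1 : q ≤ 1) :
    binom q m s ≤ 2 * 16 ^ M * binom q m' s := by
  have hq' : 0 ≤ 1 - q := by linarith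
  have e1 : (m.choose s : ℝ) ≤ 16 ^ M * m'.choose s := by
    have c1 : (m.choose s : ℝ) ≤ (m : ℝ) ^ s / (s.factorial : ℝ) := Nat.choose_le_pow_div s m
    have c2 : ((m' + 1 - s : ℕ) : ℝ) ^ s / (s.factorial : ℝ) ≤ m'.choose s :=
      Nat.pow_le_choose s m'
    have c3 : (m : ℝ) ≤ 16 * ((m' + 1 - s : ℕ) : ℝ) := by
      have : m ≤ 16 * (m' + 1 - s) := by omega
      exact_mod_cast this
    have hf : (0 : ℝ) < (s.factorial : ℝ) := by positivity
    calc (m.choose s : ℝ) ≤ (m : ℝ) ^ s / (s.factorial : ℝ) := c1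
      _ ≤ (16 * ((m' + 1 - s : ℕ) : ℝ)) ^ s / (s.factorial : ℝ) := by gcongr
      _ = 16 ^ s * (((m' + 1 - s : ℕ) : ℝ) ^ s / (s.factorial : ℝ)) := by
          rw [mul_pow, mul_div_assoc]
      _ ≤ 16 ^ M * m'.choose s := by
          gcongr
          norm_num
  have e2 : (1 - q) ^ (m - s) ≤ 2 * (1 - q) ^ (m' - s) := by
    have d1 : (1 - q) ^ (m - s) ≤ 1 := pow_le_one₀ hq' (by linarith)
    have d2 : 1 + m' * (-q) ≤ (1 + (-q)) ^ m' := one_add_mul_le_pow (by linarith) m'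
    have d3 : (1 - q) ^ m' ≤ (1 - q) ^ (m' - s) :=
      pow_le_pow_of_le_one hq' (by linarith) (Nat.sub_le _ _)
    have d4 : (1 + (-q)) ^ m' = (1 - q) ^ m' := by rw [← sub_eq_add_neg]
    linarith
  unfold binom
  calc (m.choose s : ℝ) * q ^ s * (1 - q) ^ (m - s)
      ≤ (16 ^ M * m'.choose s) * q ^ s * (2 * (1 - q) ^ (m' - s)) := by gcongr
    _ = _ := by ring

end Binomial

/-! ### Exchanging rows with comparable scores -/

section Exchange

/-- Functions `ρ i (e i)` of independent variables are independent, with the push-forward laws. -/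
theorem expec_prodLaw_map {ι α β : Type*} [Fintype ι] [DecidableEq ι] [Fintype α] [Fintype β]
    [DecidableEq β] (w : ι → α → ℝ) (ρ : ι → α → β) (f : (ι → β) → ℝ) :
    expec (prodLaw w) (fun e => f fun i => ρ i (e i)) =
      expec (prodLaw fun i s => expec (w i) fun x => ind (ρ i x = s)) f := by
  have hdec : ∀ y : ι → β, f y = ∑ z, (∏ i, ind (y i = z i)) * f z := fun y => by
    rw [Finset.sum_eq_single y]
    · simp [ind]
    · intro z _ hz
      obtain ⟨i, hi⟩ := Function.ne_iff.1 hz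
      rw [Finset.prod_eq_zero (Finset.mem_univ i) (ind_of_not fun h => hi h.symm), zero_mul]
    · simp
  have h1 : ∀ e : ι → α, f (fun i => ρ i (e i)) = ∑ z, (∏ i, ind (ρ i (e i) = z i)) * f z :=
    fun e => hdec _
  simp only [h1]
  rw [expec_sum]
  refine Finset.sum_congr rfl fun z _ => ?_
  rw [expec_mul_right, expec_prodLaw_prod w fun i x => ind (ρ i x = z i)]
  rfl

variable {n : ℕ}

theorem sum_ind_mem_topRows_le (s : Fin n → ℕ) (π : Equiv.Perm (Fin n)) (T : ℕ)
    (K : Finset (Fin n)) : ∑ l ∈ K, ind (l ∈ topRows s π T) ≤ T := by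
  rw [sum_ind]
  have : (K.filter fun l => l ∈ topRows s π T).card ≤ T := by
    refine (Finset.card_le_card fun l hl => (Finset.mem_filter.1 hl).2).trans ?_
    rw [card_topRows]
    exact min_le_left _ _
  exact_mod_cast this

/-- If the scores are independent and the score of row `i` is distributed similarly as
that of each of the rows in `K`, then row `i` is not much more likely to be selected than these. -/
theorem prob_mem_topRows_le {N : ℕ} (w : Fin n → Fin N → ℝ) (hw : ∀ i, IsLaw (w i)) (T M : ℕ)
    {C : ℝ} (hC : 0 ≤ C) {i : Fin n} {K Z : Finset (Fin n)} (hi : i ∉ K) (hiZ : i ∉ Z)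
    (hKZ : Disjoint K Z)
    (h : ∀ l ∈ K, ∀ x y, x.val ≤ M → y.val ≤ M → w i x * w l y ≤ C * (w i y * w l x)) :
    K.card * expec (prodLaw w) (fun s => expec (prioLaw n) fun π =>
        ind ((∀ l, l = i ∨ l ∈ K → (s l).val ≤ M) ∧ i ∈ topRows (fun l => (s l).val) π T ∧
          Z ⊆ topRows (fun l => (s l).val) π T)) ≤
      C * T * expec (prodLaw w) (fun s => expec (prioLaw n) fun π =>
        ind (Z ⊆ topRows (fun l => (s l).val) π T)) := by
  have hlaw : IsLaw (prodLaw w) := IsLaw.prodLaw hw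
  have hπ := isLaw_prioLaw n
  set f : Fin n → (Fin n → Fin N) → ℝ := fun j s => expec (prioLaw n) fun π =>
    ind (j ∈ topRows (fun l => (s l).val) π T ∧ Z ⊆ topRows (fun l => (s l).val) π T) with hf
  have hf0 : ∀ j s, 0 ≤ f j s := fun j s => expec_nonneg hπ fun _ => ind_nonneg _
  have hl : ∀ l ∈ K, expec (prodLaw w) (fun s => expec (prioLaw n) fun π =>
        ind ((∀ l, l = i ∨ l ∈ K → (s l).val ≤ M) ∧ i ∈ topRows (fun l => (s l).val) π T ∧
          Z ⊆ topRows (fun l => (s l).val) π T)) ≤ C * expec (prodLaw w) (f l) := by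
    intro l hl
    have hli : l ≠ i := fun h => hi (h ▸ hl)
    set ρ := Equiv.swap i l with hρ
    -- exchanging the rows `i` and `l`
    have hswap : ∀ s : Fin n → Fin N, f i (s ∘ ρ) = f l s := by
      intro s
      rw [hf]
      dsimp only
      rw [← expec_prioLaw_trans ρ]
      refine congrArg (expec _) (funext fun π => ind_congr ?_)
      have hmem : ∀ j, j ∈ topRows (fun l => ((s ∘ ρ) l).val) (ρ.trans π) T ↔
          ρ j ∈ topRows (fun l => (s l).val) π T :=
        fun j => mem_topRows_comp (fun l => (s l).val) π ρ T j
      have hfix : ∀ j ∈ Z, ρ j = j := fun j hj => Equiv.swap_apply_of_ne_of_ne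
        (fun h => hiZ (h ▸ hj)) fun h => Finset.disjoint_left.1 hKZ hl (h ▸ hj)
      rw [hmem, hρ, Equiv.swap_apply_left, ← hρ]
      refine and_congr_right fun _ => ⟨fun h j hj => ?_, fun h j hj => ?_⟩
      · have := (hmem j).1 (h hj)
        rwa [hfix j hj] at this
      · refine (hmem j).2 ?_
        rw [hfix j hj]
        exact h hj
    have hpt : ∀ s : Fin n → Fin N, prodLaw w s * expec (prioLaw n) (fun π =>
        ind ((∀ l, l = i ∨ l ∈ K → (s l).val ≤ M) ∧ i ∈ topRows (fun l => (s l).val) π T ∧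
          Z ⊆ topRows (fun l => (s l).val) π T)) ≤ C * (prodLaw w (s ∘ ρ) * f i s) := by
      intro s
      by_cases hs : ∀ l, l = i ∨ l ∈ K → (s l).val ≤ M
      · simp only [eq_true hs, true_and]
        rw [← mul_assoc]
        refine mul_le_mul_of_nonneg_right ?_ (hf0 i s)
        have hsplit : ∀ s : Fin n → Fin N, prodLaw w s =
            w i (s i) * w l (s l) * ∏ j ∈ (Finset.univ.erase i).erase l, w j (s j) := fun s => by
          rw [prodLaw, ← Finset.mul_prod_erase _ _ (Finset.mem_univ i),
            ← Finset.mul_prod_erase _ _ (Finset.mem_erase.2 ⟨hli, Finset.mem_univ l⟩), mul_assoc]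
        have hrest : ∏ j ∈ (Finset.univ.erase i).erase l, w j ((s ∘ ρ) j) =
            ∏ j ∈ (Finset.univ.erase i).erase l, w j (s j) := by
          refine Finset.prod_congr rfl fun j hj => ?_
          have h1 := Finset.ne_of_mem_erase hj
          have h2 := Finset.ne_of_mem_erase (Finset.mem_of_mem_erase hj)
          rw [Function.comp_apply, hρ, Equiv.swap_apply_of_ne_of_ne h2 h1]
        rw [hsplit s, hsplit (s ∘ ρ), hrest, ← mul_assoc]
        refine mul_le_mul_of_nonneg_right ?_ (Finset.prod_nonneg fun j _ => (hw j).nonneg _)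
        have := h l hl (s i) (s l) (hs i (Or.inl rfl)) (hs l (Or.inr hl))
        simpa [hρ] using this
      · have : expec (prioLaw n) (fun π =>
            ind ((∀ l, l = i ∨ l ∈ K → (s l).val ≤ M) ∧ i ∈ topRows (fun l => (s l).val) π T ∧
              Z ⊆ topRows (fun l => (s l).val) π T)) = 0 := by
          simp only [eq_false hs, false_and, ind_of_not not_false]
          exact expec_const hπ 0
        rw [this, mul_zero]
        exact mul_nonneg hC (mul_nonneg (hlaw.nonneg _) (hf0 i s))
    refine (Finset.sum_le_sum fun s _ => hpt s).trans (le_of_eq ?_)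
    rw [← Finset.mul_sum]
    congr 1
    rw [expec, ← (ρ.arrowCongr (Equiv.refl (Fin N))).sum_comp]
    refine Finset.sum_congr rfl fun s _ => ?_
    have h1 : (ρ.arrowCongr (Equiv.refl (Fin N))) s = s ∘ ρ := by
      funext j
      simp [hρ]
    have h2 : (s ∘ ρ) ∘ ρ = s := by
      funext j
      simp [hρ]
    rw [h1, h2, hswap]
  have hsum := Finset.sum_le_sum hl
  rw [Finset.sum_const, nsmul_eq_mul] at hsum
  refine hsum.trans ?_
  rw [← Finset.mul_sum, mul_assoc]
  refine mul_le_mul_of_nonneg_left ?_ hC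
  rw [← expec_sum, ← expec_mul_left]
  refine expec_mono hlaw fun s => ?_
  rw [hf]
  dsimp only
  rw [← expec_sum, ← expec_mul_left]
  refine expec_mono hπ fun π => ?_
  simp only [ind_and]
  rw [← Finset.sum_mul]
  exact mul_le_mul_of_nonneg_right (sum_ind_mem_topRows_le _ _ _ _) (ind_nonneg _)

end Exchange

/-! ### The composition of a random set of rows -/

section Composition

variable {Ω : Type*} [Fintype Ω] {w : Ω → ℝ} {n r : ℕ} {A : Fin n → Fin r} {u : Fin n}
  {S : Ω → Finset (Fin n)} {G : Ω → Prop} {k : ℕ} {p : ℝ}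

theorem mult_erase_eq (A : Fin n → Fin r) (u : Fin n) (S : Finset (Fin n)) (a : Fin r) :
    (mult A (S.erase u) a : ℝ) =
      ∑ i ∈ Finset.univ.filter (fun i => A i = a), ind (i ∈ S.erase u) := by
  rw [sum_ind]
  unfold mult
  congr 2
  ext i
  simp only [Finset.mem_filter, Finset.mem_univ, true_and]
  exact and_comm

/-- If no row of the cluster `a` is selected with probability more than `p`, then the cluster has at
most `k * p` selected rows on average. -/
theorem expec_mult_le (hw : IsLaw w)
    (hA : ∀ a, (Finset.univ.filter fun i => A i = a).card = k) (hp : 0 ≤ p) (a : Fin r)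
    (h : ∀ i, i ≠ u → A i = a → expec w (fun x => ind (G x ∧ i ∈ S x)) ≤ p) :
    expec w (fun x => ind (G x) * mult A ((S x).erase u) a) ≤ k * p := by
  simp only [mult_erase_eq, Finset.mul_sum]
  rw [expec_sum, ← hA a, ← nsmul_eq_mul]
  refine Finset.sum_le_card_nsmul _ _ _ fun i hi => ?_
  rcases eq_or_ne i u with rfl | hiu
  · refine expec_le_of_le hw fun x => ?_
    rw [ind_of_not (Finset.notMem_erase i _), mul_zero]
    exact hp
  · refine le_trans (expec_mono hw fun x => ?_) (h i hiu (Finset.mem_filter.1 hi).2)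
    rw [← ind_and]
    exact ind_mono fun h => ⟨h.1, Finset.mem_of_mem_erase h.2⟩

theorem sum_mult_sq_eq (A : Fin n → Fin r) (S : Finset (Fin n)) :
    ∑ a, (mult A S a : ℝ) ^ 2 = ∑ i, ind (i ∈ S) * mult A S (A i) := by
  rw [← Finset.sum_fiberwise Finset.univ A]
  refine Finset.sum_congr rfl fun a _ => ?_
  have h1 : ∀ i ∈ Finset.univ.filter (fun i => A i = a),
      ind (i ∈ S) * (mult A S (A i) : ℝ) = ind (i ∈ S) * mult A S a := fun i hi => by
    rw [(Finset.mem_filter.1 hi).2]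
  rw [Finset.sum_congr rfl h1, ← Finset.sum_mul, sum_ind, sq]
  congr 2
  unfold mult
  congr 1
  ext i
  simp only [Finset.mem_filter, Finset.mem_univ, true_and]
  exact and_comm

/-- The second moment of the cluster sizes in the selection: it counts the pairs of selected rows in
the same cluster. The hypothesis says that a row `i` is selected with probability at most `p`, even
given the selection of another row `i'`. -/
theorem expec_sum_mult_sq_le (hw : IsLaw w)
    (hA : ∀ a, (Finset.univ.filter fun i => A i = a).card = k) (hp : 0 ≤ p) {T : ℕ}
    (hT : ∀ x, (S x).card ≤ T)
    (h : ∀ i i', i ≠ i' → i ≠ u → i' ≠ u → expec w (fun x => ind (G x ∧ i ∈ S x ∧ i' ∈ S x)) ≤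
      p * expec w (fun x => ind (i' ∈ S x))) :
    expec w (fun x => ind (G x) * ∑ a, (mult A ((S x).erase u) a : ℝ) ^ 2) ≤
      (1 + k * p) * T := by
  have hrow : ∀ i', expec w (fun x => ind (G x) *
      (ind (i' ∈ (S x).erase u) * (mult A ((S x).erase u) (A i') : ℝ))) ≤
      (1 + k * p) * expec w (fun x => ind (i' ∈ S x)) := by
    intro i'
    rcases eq_or_ne i' u with rfl | hiu
    · refine le_trans (expec_le_of_le hw (c := 0) fun x => ?_)
        (mul_nonneg (by positivity) (expec_nonneg hw fun x => ind_nonneg _))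
      rw [ind_of_not (Finset.notMem_erase i' _)]
      simp
    · have hpt : ∀ x, ind (G x) *
          (ind (i' ∈ (S x).erase u) * (mult A ((S x).erase u) (A i') : ℝ)) ≤
          ind (i' ∈ S x) + ∑ i ∈ Finset.univ.filter (fun i => A i = A i'),
            ind ((i ≠ i' ∧ i ≠ u) ∧ (G x ∧ i ∈ S x ∧ i' ∈ S x)) := by
        intro x
        have e0 : 0 ≤ ∑ i ∈ Finset.univ.filter (fun i => A i = A i'),
            ind ((i ≠ i' ∧ i ≠ u) ∧ (G x ∧ i ∈ S x ∧ i' ∈ S x)) :=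
          Finset.sum_nonneg fun _ _ => ind_nonneg _
        have e1 := ind_nonneg (i' ∈ S x)
        by_cases hG : G x ∧ i' ∈ S x
        · have hmem : i' ∈ Finset.univ.filter (fun i => A i = A i') :=
            Finset.mem_filter.2 ⟨Finset.mem_univ _, rfl⟩
          have e2 : (mult A ((S x).erase u) (A i') : ℝ) ≤ 1 +
              ∑ i ∈ Finset.univ.filter (fun i => A i = A i'),
                ind ((i ≠ i' ∧ i ≠ u) ∧ (G x ∧ i ∈ S x ∧ i' ∈ S x)) := by
            rw [mult_erase_eq, ← Finset.add_sum_erase _ _ hmem]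
            refine add_le_add (ind_le_one _) ?_
            refine (Finset.sum_le_sum fun i hi => ?_).trans
              (Finset.sum_le_sum_of_subset_of_nonneg (Finset.erase_subset i' _)
                fun _ _ _ => ind_nonneg _)
            refine ind_mono fun hS => ?_
            obtain ⟨h1, h2⟩ := Finset.mem_erase.1 hS
            exact ⟨⟨Finset.ne_of_mem_erase hi, h1⟩, hG.1, h2, hG.2⟩
          rw [ind_of hG.1, ind_of hG.2, ind_of (Finset.mem_erase.2 ⟨hiu, hG.2⟩)]
          linarith
        · have : ind (G x) *
              (ind (i' ∈ (S x).erase u) * (mult A ((S x).erase u) (A i') : ℝ)) = 0 := by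
            rw [← mul_assoc, ← ind_and, ind_of_not, zero_mul]
            exact fun h => hG ⟨h.1, Finset.mem_of_mem_erase h.2⟩
          linarith
      refine (expec_mono hw hpt).trans ?_
      rw [expec_add, expec_sum, add_mul, one_mul]
      refine add_le_add le_rfl ?_
      rw [← hA (A i'), mul_assoc, ← nsmul_eq_mul]
      refine Finset.sum_le_card_nsmul _ _ _ fun i _ => ?_
      by_cases hi : i ≠ i' ∧ i ≠ u
      · refine le_trans (expec_mono hw fun x => ind_mono fun h => h.2) (h i i' hi.1 hi.2 hiu)
      · refine le_trans (expec_le_of_le hw (c := 0) fun x => ?_)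
          (mul_nonneg hp (expec_nonneg hw fun x => ind_nonneg _))
        rw [ind_of_not fun h => hi h.1]
  simp only [sum_mult_sq_eq, Finset.mul_sum]
  rw [expec_sum]
  refine (Finset.sum_le_sum fun i' _ => hrow i').trans ?_
  rw [← Finset.mul_sum, ← expec_sum]
  refine mul_le_mul_of_nonneg_left (expec_le_of_le hw fun x => ?_) (by positivity)
  rw [sum_ind, Finset.filter_mem_eq_inter, Finset.univ_inter]
  exact_mod_cast hT x

end Composition

/-! ### The law of the scores -/

section ScoreLaw

variable {n r : ℕ} {A B : Fin n → Fin r} {u : Fin n} {T : ℕ} {eu : Fin n → Bool} {q : ℝ}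
  {χ : Fin r → Fin r → Bool}

/-- The columns rated by `u`. -/
def rated (eu : Fin n → Bool) : Finset (Fin n) := Finset.univ.filter fun l => eu l = false

/-- The columns rated by `u` on which the row clusters `a` and `a'` agree. -/
def agree (B : Fin n → Fin r) (eu : Fin n → Bool) (χ : Fin r → Fin r → Bool) (a a' : Fin r) :
    Finset (Fin n) := Finset.univ.filter fun l => eu l = false ∧ χ a' (B l) = χ a (B l)

theorem agree_subset_rated (B : Fin n → Fin r) (eu : Fin n → Bool) (χ : Fin r → Fin r → Bool)
    (a a' : Fin r) : agree B eu χ a a' ⊆ rated eu := fun _ hl =>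
  Finset.mem_filter.2 ⟨Finset.mem_univ _, (Finset.mem_filter.1 hl).2.1⟩

/-- The score of row `i`, if `e` is its erasure pattern. -/
def rowScore (A B : Fin n → Fin r) (u : Fin n) (eu : Fin n → Bool) (χ : Fin r → Fin r → Bool)
    (i : Fin n) (e : Fin n → Bool) : Fin (n + 1) :=
  if i = u then ⟨(rated eu).card, Nat.lt_succ_of_le (by simpa using Finset.card_le_univ (rated eu))⟩
  else ⟨((agree B eu χ (A u) (A i)).filter fun l => e l = false).card, Nat.lt_succ_of_le (by
    simpa using Finset.card_le_univ ((agree B eu χ (A u) (A i)).filter fun l => e l = false))⟩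

theorem rowScore_val (A B : Fin n → Fin r) (u : Fin n) (eu : Fin n → Bool)
    (χ : Fin r → Fin r → Bool) (E : Fin n → Fin n → Bool) (i : Fin n) :
    (rowScore A B u eu χ i (E i)).val = score A B u eu χ E i := by
  unfold rowScore score
  split_ifs
  · rfl
  · dsimp only
    unfold agree
    rw [Finset.filter_filter]
    refine congrArg Finset.card (Finset.filter_congr fun l _ => ?_)
    tauto

theorem score_of_ne (E : Fin n → Fin n → Bool) {i : Fin n} (hi : i ≠ u) :
    score A B u eu χ E i =
      ((agree B eu χ (A u) (A i)).filter fun l => E i l = false).card := by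
  rw [← rowScore_val, rowScore, if_neg hi]

theorem score_le (E : Fin n → Fin n → Bool) {i : Fin n} (hi : i ≠ u) :
    score A B u eu χ E i ≤ ((rated eu).filter fun l => E i l = false).card := by
  rw [score_of_ne E hi]
  exact Finset.card_le_card (Finset.filter_subset_filter _ (agree_subset_rated _ _ _ _ _))

/-- The law of the score of row `i`. -/
def scoreLaw (A B : Fin n → Fin r) (q : ℝ) (u : Fin n) (eu : Fin n → Bool)
    (χ : Fin r → Fin r → Bool) (i : Fin n) (s : Fin (n + 1)) : ℝ :=
  expec (coins (Fin n) (1 - q)) fun e => ind (rowScore A B u eu χ i e = s)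

theorem isLaw_scoreLaw (h0 : 0 ≤ q) (h1 : q ≤ 1) (i : Fin n) :
    IsLaw (scoreLaw A B q u eu χ i) where
  nonneg s := expec_nonneg (isLaw_coins (by linarith) (by linarith)) fun _ => ind_nonneg _
  sum_eq := by
    unfold scoreLaw
    rw [← expec_sum]
    have h : ∀ e : Fin n → Bool, ∑ s, ind (rowScore A B u eu χ i e = s) = 1 := fun e => by
      simp [ind_eq_ite]
    simp only [h]
    exact expec_const (isLaw_coins (by linarith) (by linarith)) 1

theorem scoreLaw_of_ne (h0 : 0 ≤ q) (h1 : q ≤ 1) {i : Fin n} (hi : i ≠ u) (s : Fin (n + 1)) :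
    scoreLaw A B q u eu χ i s = binom q (agree B eu χ (A u) (A i)).card s.val := by
  rw [← prob_count_eq h0 h1]
  unfold scoreLaw
  refine congrArg (expec _) (funext fun e => ind_congr ?_)
  rw [Fin.ext_iff, rowScore, if_neg hi]

theorem expec_score (A B : Fin n → Fin r) (q : ℝ) (u : Fin n) (eu : Fin n → Bool)
    (χ : Fin r → Fin r → Bool) (f : (Fin n → ℕ) → ℝ) :
    expec (matLaw n n (1 - q)) (fun E => f (score A B u eu χ E)) =
      expec (prodLaw (scoreLaw A B q u eu χ)) fun s => f fun i => (s i).val := by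
  have h := expec_prodLaw_map (fun _ : Fin n => coins (Fin n) (1 - q))
    (rowScore A B u eu χ) fun s => f fun i => (s i).val
  refine Eq.trans ?_ h
  refine congrArg (expec _) (funext fun E => ?_)
  congr 1
  funext i
  rw [rowScore_val]

/-- The rows that agree with `u` on comparable numbers of columns have comparable chances of
being selected. -/
theorem prob_mem_selected_le (h0 : 0 ≤ q) (h1 : q ≤ 1) (T M : ℕ) {C : ℝ} (hC : 0 ≤ C) {i : Fin n}
    {K Z : Finset (Fin n)} (hiu : i ≠ u) (huK : u ∉ K) (hi : i ∉ K) (hiZ : i ∉ Z)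
    (hKZ : Disjoint K Z)
    (h : ∀ l ∈ K, ∀ x y, x ≤ M → y ≤ M →
      binom q (agree B eu χ (A u) (A i)).card x * binom q (agree B eu χ (A u) (A l)).card y ≤
        C * (binom q (agree B eu χ (A u) (A i)).card y *
          binom q (agree B eu χ (A u) (A l)).card x)) :
    K.card * expec (selLaw n (1 - q)) (fun x =>
        ind ((∀ l, l ≠ u → score A B u eu χ x.1 l ≤ M) ∧ i ∈ selected A B u T eu χ x ∧
          Z ⊆ selected A B u T eu χ x)) ≤
      C * T * expec (selLaw n (1 - q)) (fun x => ind (Z ⊆ selected A B u T eu χ x)) := by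
  have hk := prob_mem_topRows_le (scoreLaw A B q u eu χ) (isLaw_scoreLaw h0 h1) T M hC hi hiZ hKZ
    fun l hl x y hx hy => by
      have hlu : l ≠ u := fun h => huK (h ▸ hl)
      rw [scoreLaw_of_ne h0 h1 hiu, scoreLaw_of_ne h0 h1 hlu, scoreLaw_of_ne h0 h1 hiu,
        scoreLaw_of_ne h0 h1 hlu]
      exact h l hl _ _ hx hy
  rw [← expec_score A B q u eu χ (fun s => expec (prioLaw n) fun π =>
      ind ((∀ l, l = i ∨ l ∈ K → s l ≤ M) ∧ i ∈ topRows s π T ∧ Z ⊆ topRows s π T)),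
    ← expec_score A B q u eu χ (fun s => expec (prioLaw n) fun π =>
      ind (Z ⊆ topRows s π T)), ← expec_pairLaw (matLaw n n (1 - q)) (prioLaw n)
      (fun x : (Fin n → Fin n → Bool) ×
        Equiv.Perm (Fin n) => ind (Z ⊆ topRows (score A B u eu χ x.1) x.2 T)),
    ← expec_pairLaw (matLaw n n (1 - q)) (prioLaw n) (fun x : (Fin n → Fin n → Bool) ×
        Equiv.Perm (Fin n) => ind ((∀ l, l = i ∨ l ∈ K → score A B u eu χ x.1 l ≤ M) ∧
          i ∈ topRows (score A B u eu χ x.1) x.2 T ∧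
          Z ⊆ topRows (score A B u eu χ x.1) x.2 T))] at hk
  refine le_trans (mul_le_mul_of_nonneg_left ?_ (Nat.cast_nonneg _)) hk
  refine expec_mono (isLaw_selLaw n (by linarith) (by linarith)) fun x => ind_mono fun hx => ?_
  refine ⟨fun l hl => hx.1 l ?_, hx.2⟩
  rcases hl with rfl | hl
  · exact hiu
  · exact fun h => huK (h ▸ hl)

/-- The number of selected rows that have rated a column in a small set `J` has exponential
moments: given the scores, which determine the selection, each row has rated such a column with
a small probability. -/
theorem prob_lt_card_hitters_inter_selected (h0 : 0 ≤ q) (h1 : q ≤ 1) (T M : ℕ)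
    (J : Finset (Fin n)) {o : ℝ} (ho : 0 < o)
    (hag : ∀ i, i ≠ u → o ≤ (agree B eu χ (A u) (A i)).card) (m : ℕ) :
    expec (selLaw n (1 - q)) (fun x =>
        ind ((∀ l, l ≠ u → score A B u eu χ x.1 l ≤ M) ∧
          m ≤ (hitters u x.1 J ∩ selected A B u T eu χ x).card)) ≤
      Real.exp (T * (J.card * (q + M / o))) / 2 ^ m := by
  have hlaw := isLaw_selLaw n (p := 1 - q) (by linarith) (by linarith)
  have hrow : IsLaw (coins (Fin n) (1 - q)) := isLaw_coins (by linarith) (by linarith)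
  set β : ℝ := J.card * (q + M / o) with hβ
  have hβ0 : 0 ≤ β := by positivity
  have hM := expec_ind_le (w := selLaw n (1 - q))
    (P := fun x => (∀ l, l ≠ u → score A B u eu χ x.1 l ≤ M) ∧
          m ≤ (hitters u x.1 J ∩ selected A B u T eu χ x).card)
    (f := fun x => ind (∀ l, l ≠ u → score A B u eu χ x.1 l ≤ M) *
      2 ^ (hitters u x.1 J ∩ selected A B u T eu χ x).card) (c := 2 ^ m) hlaw (by positivity)
    (fun x => mul_nonneg (ind_nonneg _) (by positivity)) (fun x hx => by
      rw [ind_of hx.1, one_mul]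
      exact pow_le_pow_right₀ (by norm_num) hx.2)
  refine hM.trans (div_le_div_of_nonneg_right ?_ (by positivity))
  unfold selLaw
  rw [expec_pairLaw, expec_comm]
  refine expec_le_of_le (isLaw_prioLaw n) fun π => ?_
  -- the contribution of row `i` with erasure pattern `e` if the scores are `s`
  set F : Fin n → (Fin n → Fin (n + 1)) → (Fin n → Bool) → ℝ := fun i s e =>
    coins (Fin n) (1 - q) e * (ind (i ≠ u → (s i).val ≤ M) *
      (1 + ind (i ≠ u ∧ (∃ l ∈ J, e l = false) ∧ i ∈ topRows (fun l => (s l).val) π T))) with hF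
  have hprod : ∀ E : Fin n → Fin n → Bool, matLaw n n (1 - q) E *
      (ind (∀ l, l ≠ u → score A B u eu χ E l ≤ M) *
        2 ^ (hitters u E J ∩ selected A B u T eu χ (E, π)).card) =
      ∏ i, F i (fun k => rowScore A B u eu χ k (E k)) (E i) := by
    intro E
    rw [hF]
    dsimp only
    rw [Finset.prod_mul_distrib, Finset.prod_mul_distrib]
    congr 1
    congr 1
    · by_cases h : ∀ l, l ≠ u → score A B u eu χ E l ≤ M
      · rw [ind_of h, Finset.prod_eq_one]
        intro i _
        rw [ind_of]
        rw [rowScore_val]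
        exact h i
      · rw [ind_of_not h]
        push Not at h
        obtain ⟨i, hi, hlt⟩ := h
        rw [Finset.prod_eq_zero (Finset.mem_univ i)]
        rw [ind_of_not]
        rw [rowScore_val]
        exact fun h => absurd (h hi) (not_le.2 hlt)
    · rw [← Finset.prod_const]
      have hmem : ∀ i, i ∈ hitters u E J ∩ selected A B u T eu χ (E, π) ↔
          i ≠ u ∧ (∃ l ∈ J, E i l = false) ∧
            i ∈ topRows (fun l => (rowScore A B u eu χ l (E l)).val) π T := fun i => by
        rw [Finset.mem_inter, mem_hitters, and_assoc]
        simp only [rowScore_val]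
        rfl
      rw [← Finset.prod_filter_mul_prod_filter_not Finset.univ
        (fun i => i ∈ hitters u E J ∩ selected A B u T eu χ (E, π)),
        Finset.prod_eq_one (s := Finset.univ.filter fun i =>
          i ∉ hitters u E J ∩ selected A B u T eu χ (E, π)), mul_one]
      · rw [Finset.filter_mem_eq_inter, Finset.univ_inter]
        refine Finset.prod_congr rfl fun i hi => ?_
        rw [ind_of ((hmem i).1 hi)]
        norm_num
      · intro i hi
        rw [ind_of_not fun h => (Finset.mem_filter.1 hi).2 ((hmem i).2 h), add_zero]
  unfold expec
  simp only [hprod]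
  rw [sum_prod_fiber (rowScore A B u eu χ) F]
  have hfac : ∀ (s : Fin n → Fin (n + 1)) (i : Fin n),
      (∑ e, if rowScore A B u eu χ i e = s i then F i s e else 0) ≤
        (if i ∈ topRows (fun l => (s l).val) π T then 1 + β else 1) *
          scoreLaw A B q u eu χ i (s i) := by
    intro s i
    have hfac' : (∑ e, if rowScore A B u eu χ i e = s i then F i s e else 0) =
        ind (i ≠ u → (s i).val ≤ M) * (scoreLaw A B q u eu χ i (s i) +
          expec (coins (Fin n) (1 - q)) fun e => ind (rowScore A B u eu χ i e = s i) *
            ind (i ≠ u ∧ (∃ l ∈ J, e l = false) ∧ i ∈ topRows (fun l => (s l).val) π T)) := by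
      unfold scoreLaw
      rw [← expec_add, ← expec_mul_left]
      refine Finset.sum_congr rfl fun e _ => ?_
      rw [hF]
      dsimp only
      by_cases h : rowScore A B u eu χ i e = s i
      · rw [if_pos h, ind_of h]
        ring
      · rw [if_neg h, ind_of_not h]
        ring
    rw [hfac']
    have hs0 := (isLaw_scoreLaw (A := A) (B := B) (u := u) (eu := eu) (χ := χ) h0 h1 i).nonneg (s i)
    by_cases hgood : i ≠ u ∧ i ∈ topRows (fun l => (s l).val) π T
    · rw [if_pos hgood.2]
      refine ind_mul_le (by positivity) fun hsM => ?_
      have hh := prob_count_eq_and_hit h0 h1 (agree B eu χ (A u) (A i)) J (hsM hgood.1) ho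
        (hag i hgood.1)
      rw [← scoreLaw_of_ne h0 h1 hgood.1] at hh
      have hle : expec (coins (Fin n) (1 - q)) (fun e => ind (rowScore A B u eu χ i e = s i) *
            ind (i ≠ u ∧ (∃ l ∈ J, e l = false) ∧ i ∈ topRows (fun l => (s l).val) π T)) ≤
          expec (coins (Fin n) (1 - q)) (fun e =>
            ind (((agree B eu χ (A u) (A i)).filter fun j => e j = false).card = (s i).val) *
              ind (∃ l ∈ J, e l = false)) := by
        refine expec_mono hrow fun e => ?_
        refine mul_le_mul (ind_mono fun h => ?_) (ind_mono fun h => h.2.1) (ind_nonneg _)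
          (ind_nonneg _)
        rw [Fin.ext_iff, rowScore, if_neg hgood.1] at h
        exact h
      linarith
    · have hz : expec (coins (Fin n) (1 - q)) (fun e => ind (rowScore A B u eu χ i e = s i) *
            ind (i ≠ u ∧ (∃ l ∈ J, e l = false) ∧ i ∈ topRows (fun l => (s l).val) π T)) = 0 := by
        rw [← expec_const hrow 0]
        refine congrArg (expec _) (funext fun e => ?_)
        rw [ind_of_not fun h : i ≠ u ∧ (∃ l ∈ J, e l = false) ∧
          i ∈ topRows (fun l => (s l).val) π T => hgood ⟨h.1, h.2.2⟩, mul_zero]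
      rw [hz, add_zero]
      refine mul_le_mul_of_nonneg_right ((ind_le_one _).trans ?_) hs0
      split_ifs <;> linarith
  have hF0 : ∀ i s e, 0 ≤ F i s e := fun i s e => by
    rw [hF]
    have e1 := ind_nonneg (i ≠ u → (s i).val ≤ M)
    have e2 := ind_nonneg (i ≠ u ∧ (∃ l ∈ J, e l = false) ∧ i ∈ topRows (fun l => (s l).val) π T)
    exact mul_nonneg (hrow.nonneg e) (mul_nonneg e1 (by linarith))
  have hsum : ∀ s : Fin n → Fin (n + 1),
      (∏ i, ∑ e, if rowScore A B u eu χ i e = s i then F i s e else 0) ≤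
        (1 + β) ^ T * prodLaw (scoreLaw A B q u eu χ) s := by
    intro s
    refine (Finset.prod_le_prod (fun i _ => Finset.sum_nonneg fun e _ => ?_)
      fun i _ => hfac s i).trans ?_
    · split_ifs
      · exact hF0 _ _ _
      · exact le_rfl
    rw [Finset.prod_mul_distrib]
    refine mul_le_mul_of_nonneg_right ?_
      ((IsLaw.prodLaw (isLaw_scoreLaw h0 h1)).nonneg s)
    rw [Finset.prod_ite, Finset.prod_const, Finset.prod_const_one, mul_one]
    refine pow_le_pow_right₀ (by linarith) ?_
    rw [Finset.filter_mem_eq_inter, Finset.univ_inter, card_topRows]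
    exact min_le_left _ _
  refine (Finset.sum_le_sum fun s _ => hsum s).trans ?_
  rw [← Finset.mul_sum, (IsLaw.prodLaw (isLaw_scoreLaw h0 h1)).sum_eq, mul_one]
  exact one_add_pow_le_exp (by linarith) T

/-- The number of rows that have rated a column in `K` has exponential moments. -/
theorem prob_le_card_hitters (h0 : 0 ≤ q) (h1 : q ≤ 1) (u : Fin n) (K : Finset (Fin n)) (m : ℕ) :
    expec (selLaw n (1 - q)) (fun x => ind (m ≤ (hitters u x.1 K).card)) ≤
      Real.exp (n * (K.card * q)) / 2 ^ m := by
  have hlaw := isLaw_selLaw n (p := 1 - q) (by linarith) (by linarith)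
  have hrow : IsLaw (coins (Fin n) (1 - q)) := isLaw_coins (by linarith) (by linarith)
  have hM := expec_ind_le (w := selLaw n (1 - q))
    (P := fun x => m ≤ (hitters u x.1 K).card)
    (f := fun x => ∏ i, (1 + ind (∃ l ∈ K, x.1 i l = false))) (c := 2 ^ m) hlaw (by positivity)
    (fun x => Finset.prod_nonneg fun i _ => by
      linarith [ind_nonneg (∃ l ∈ K, x.1 i l = false)]) (fun x hx => by
      refine (pow_le_pow_right₀ (by norm_num : (1 : ℝ) ≤ 2) hx).trans ?_
      rw [← Finset.prod_const]
      calc ∏ _i ∈ hitters u x.1 K, (2 : ℝ)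
          = ∏ i ∈ hitters u x.1 K, (1 + ind (∃ l ∈ K, x.1 i l = false)) :=
            Finset.prod_congr rfl fun i hi => by
              rw [ind_of (mem_hitters.1 hi).2]; norm_num
        _ ≤ _ := Finset.prod_le_prod_of_subset_of_one_le (Finset.subset_univ _)
            (fun i _ => by linarith [ind_nonneg (∃ l ∈ K, x.1 i l = false)])
            fun i _ _ => by linarith [ind_nonneg (∃ l ∈ K, x.1 i l = false)])
  refine hM.trans (div_le_div_of_nonneg_right ?_ (by positivity))
  unfold selLaw
  rw [expec_pairLaw]
  simp only [expec_const (isLaw_prioLaw n)]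
  rw [expec_prodLaw_prod (fun _ : Fin n => coins (Fin n) (1 - q))
    (fun _ e => 1 + ind (∃ l ∈ K, e l = false)), Finset.prod_const, Finset.card_univ,
    Fintype.card_fin]
  refine le_trans (pow_le_pow_left₀ ?_ ?_ n)
    (one_add_pow_le_exp (x := K.card * q) (by positivity) n)
  · exact expec_nonneg hrow fun e => by linarith [ind_nonneg (∃ l ∈ K, e l = false)]
  · rw [expec_add, expec_const hrow]
    refine add_le_add le_rfl ?_
    refine (expec_mono hrow (g := fun e => ∑ l ∈ K, ind (e l = false)) fun e => ?_).trans ?_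
    · refine ind_le_of (Finset.sum_nonneg fun _ _ => ind_nonneg _) fun ⟨l, hl, hel⟩ => ?_
      rw [← ind_of hel]
      exact Finset.single_le_sum (f := fun l => ind (e l = false)) (fun _ _ => ind_nonneg _) hl
    · rw [expec_sum]
      refine (Finset.sum_le_sum (g := fun _ => q) fun l _ => le_of_eq ?_).trans
        (le_of_eq ?_)
      · rw [expec_coins_eval (1 - q) (by linarith) (by linarith) l fun v => ind (v = false)]
        simp [ind]
      · rw [Finset.sum_const, nsmul_eq_mul]

end ScoreLaw

/-! ### Agreement of the row clusters -/

section Agreement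

variable {n r : ℕ} {A B : Fin n → Fin r} {u : Fin n} {T : ℕ} {eu : Fin n → Bool} {q : ℝ}
  {χ : Fin r → Fin r → Bool}

theorem agree_self (B : Fin n → Fin r) (eu : Fin n → Bool) (χ : Fin r → Fin r → Bool)
    (a : Fin r) : agree B eu χ a a = rated eu := by
  unfold agree rated
  exact Finset.filter_congr fun l _ => by simp

theorem card_rated_eq (B : Fin n → Fin r) (eu : Fin n → Bool) :
    ((rated eu).card : ℝ) = ∑ b, ((ratedIn B eu b).card : ℝ) := by
  rw [Finset.card_eq_sum_card_fiberwise (f := B) (t := Finset.univ) fun _ _ => Finset.mem_univ _]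
  push_cast
  refine Finset.sum_congr rfl fun b _ => ?_
  unfold rated ratedIn
  rw [Finset.filter_filter]

theorem card_agree_eq (B : Fin n → Fin r) (eu : Fin n → Bool) (χ : Fin r → Fin r → Bool)
    (a a' : Fin r) : ((agree B eu χ a a').card : ℝ) - (rated eu).card / 2 =
      ∑ b, ((ratedIn B eu b).card / 2 * sgn (χ a b)) * sgn (χ a' b) := by
  rw [card_rated_eq B eu, Finset.card_eq_sum_card_fiberwise (f := B) (t := Finset.univ)
    fun _ _ => Finset.mem_univ _, Finset.sum_div]
  push_cast
  rw [← Finset.sum_sub_distrib]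
  refine Finset.sum_congr rfl fun b _ => ?_
  have h : (agree B eu χ a a').filter (fun l => B l = b) =
      if χ a' b = χ a b then ratedIn B eu b else ∅ := by
    ext l
    unfold agree ratedIn
    split_ifs with hc
    · simp only [Finset.mem_filter, Finset.mem_univ, true_and]
      exact ⟨fun h => ⟨h.1.1, h.2⟩, fun h => ⟨⟨h.1, by rw [h.2, hc]⟩, h.2⟩⟩
    · simp only [Finset.mem_filter, Finset.mem_univ, true_and, Finset.notMem_empty, iff_false]
      rintro ⟨⟨-, h1⟩, h2⟩
      rw [h2] at h1
      exact hc h1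
  rw [h]
  cases χ a' b <;> cases χ a b <;> simp [sgn] <;> ring

/-- By Hoeffding's inequality, `u` agrees with each of the row clusters on a positive fraction of
the rated columns, if no column cluster contains too many of these. -/
theorem prob_card_agree_lt (a : Fin r) {R ob : ℝ} (hR : R = (rated eu).card) (hR0 : 0 < R)
    (hob0 : 0 < ob) (hob : ∀ b, ((ratedIn B eu b).card : ℝ) ≤ ob) :
    expec (matLaw r r (1 / 2)) (fun χ => ind (¬ ∀ a', R / 4 ≤ (agree B eu χ a a').card)) ≤
      r * (2 * Real.exp (-(R / (8 * ob)))) := by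
  have hlaw := isLaw_bitMatrix r r
  have hpt : ∀ χ, ind (¬ ∀ a', R / 4 ≤ (agree B eu χ a a').card) ≤
      ∑ a', ind (((agree B eu χ a a').card : ℝ) < R / 4) := fun χ => by
    refine le_trans (ind_mono fun h => ?_) (ind_exists_le _)
    push Not at h
    exact h
  refine (expec_mono hlaw hpt).trans ?_
  rw [expec_sum]
  have hrow : ∀ a' ∈ (Finset.univ : Finset (Fin r)), expec (matLaw r r (1 / 2)) (fun χ =>
      ind (((agree B eu χ a a').card : ℝ) < R / 4)) ≤ 2 * Real.exp (-(R / (8 * ob))) := by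
    intro a' _
    rcases eq_or_ne a' a with rfl | ha
    · refine expec_le_of_le hlaw fun χ => ?_
      rw [agree_self, ind_of_not]
      · positivity
      · rw [← hR]
        linarith
    · rw [← expec_update _ a' _ (isLaw_bits _)]
      refine expec_le_of_le hlaw fun χ => ?_
      refine le_trans (expec_mono (isLaw_bits _) fun w => ind_mono fun h => ?_)
        ((hoeffding_abs (fun b => ((ratedIn B eu b).card / 2 * sgn (χ a b) : ℝ))
          (V := ob * R / 4) (t := R / 4) (by positivity) (by positivity) ?_).trans (le_of_eq ?_))
      · have h2 := card_agree_eq B eu (Function.update χ a' w) a a'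
        simp only [Function.update_self, Function.update_of_ne ha.symm] at h2
        rw [← h2, ← hR, le_abs]
        right
        linarith
      · rw [hR, card_rated_eq B eu, Finset.mul_sum, Finset.sum_div]
        refine Finset.sum_le_sum fun b _ => ?_
        have h1 : sgn (χ a b) ^ 2 = 1 := by cases χ a b <;> simp [sgn]
        rw [mul_pow, h1]
        have h2 := mul_le_mul_of_nonneg_right (hob b) (Nat.cast_nonneg (ratedIn B eu b).card)
        nlinarith
      · congr 3
        field_simp
        norm_num
  refine (Finset.sum_le_sum hrow).trans (le_of_eq ?_)
  simp

theorem le_card_agree_setCol {o : ℝ} {a a' b : Fin r} (w : Fin r → Bool)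
    (h : o ≤ (agree B eu χ a a').card) :
    o - (ratedIn B eu b).card ≤ (agree B eu (setCol χ b w) a a').card := by
  have h1 : (agree B eu χ a a').card ≤
      (agree B eu (setCol χ b w) a a').card + (ratedIn B eu b).card := by
    refine (Finset.card_le_card fun l hl => ?_).trans (Finset.card_union_le _ _)
    obtain ⟨-, h1, h2⟩ := Finset.mem_filter.1 hl
    by_cases hb : B l = b
    · exact Finset.mem_union_right _ (Finset.mem_filter.2 ⟨Finset.mem_univ _, h1, hb⟩)
    · refine Finset.mem_union_left _ (Finset.mem_filter.2 ⟨Finset.mem_univ _, h1, ?_⟩)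
      rw [setCol_of_ne _ _ _ hb, setCol_of_ne _ _ _ hb, h2]
  have h2 : ((agree B eu χ a a').card : ℝ) ≤
      (agree B eu (setCol χ b w) a a').card + (ratedIn B eu b).card := by exact_mod_cast h1
  linarith

/-- It is unlikely that a row has rated many of the columns rated by `u`. -/
theorem prob_many_hits (h0 : 0 ≤ q) (h1 : q ≤ 1) (u : Fin n) (K : Finset (Fin n)) {x : ℝ}
    (hx0 : 0 < x) (hx1 : x ≤ 1) (hx : K.card * q ≤ x) (M : ℕ) :
    expec (selLaw n (1 - q)) (fun y =>
        ind (¬ ∀ l, l ≠ u → (K.filter fun j => y.1 l j = false).card ≤ M)) ≤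
      n * (3 * x ^ (M + 1)) := by
  have hlaw := isLaw_selLaw n (p := 1 - q) (by linarith) (by linarith)
  have hrow : IsLaw (coins (Fin n) (1 - q)) := isLaw_coins (by linarith) (by linarith)
  have hpt : ∀ y : (Fin n → Fin n → Bool) × Equiv.Perm (Fin n),
      ind (¬ ∀ l, l ≠ u → (K.filter fun j => y.1 l j = false).card ≤ M) ≤
      ∑ l, ind (M + 1 ≤ (K.filter fun j => y.1 l j = false).card) := fun y => by
    refine le_trans (ind_mono fun h => ?_) (ind_exists_le _)
    push Not at h
    obtain ⟨l, -, h⟩ := h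
    exact ⟨l, h⟩
  refine (expec_mono hlaw hpt).trans ?_
  rw [expec_sum]
  have hl : ∀ l ∈ (Finset.univ : Finset (Fin n)), expec (selLaw n (1 - q)) (fun y =>
      ind (M + 1 ≤ (K.filter fun j => y.1 l j = false).card)) ≤ 3 * x ^ (M + 1) := by
    intro l _
    unfold selLaw
    rw [expec_pairLaw]
    simp only [expec_const (isLaw_prioLaw n)]
    rw [← expec_update _ l _ hrow]
    simp only [Function.update_self]
    rw [expec_const (isLaw_matLaw n n (by linarith) (by linarith))]
    exact tail_count_small h0 h1 K hx0 hx1 hx (M + 1)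
  refine (Finset.sum_le_sum hl).trans (le_of_eq ?_)
  simp

end Agreement

/-! ### The composition of the selection -/

section Stage

variable {n r : ℕ} {A B : Fin n → Fin r} {u : Fin n} {T : ℕ} {eu : Fin n → Bool} {q : ℝ}
  {χ : Fin r → Fin r → Bool} {k : ℕ}

theorem le_card_compl {n : ℕ} (hn : 6 ≤ n) (Z : Finset (Fin n)) (hZ : Z.card ≤ 3) :
    (n : ℝ) / 2 ≤ (Finset.univ \ Z).card := by
  have h := Finset.card_sdiff_add_card_inter (Finset.univ : Finset (Fin n)) Z
  rw [Finset.univ_inter, Finset.card_univ, Fintype.card_fin] at h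
  have h2 : n ≤ 2 * (Finset.univ \ Z).card := by omega
  have h3 : (n : ℝ) ≤ 2 * (Finset.univ \ Z).card := by exact_mod_cast h2
  linarith

/-- All rows have about the same chance of being selected if all of them agree with `u` on a
positive fraction of the rated columns and no row has more than `M` hits. -/
theorem prob_mem_selected_le_of_agree (h0 : 0 ≤ q) (h1 : q ≤ 1) (hn : 6 ≤ n) (M : ℕ)
    (hag : ∀ a', ((rated eu).card : ℝ) / 4 ≤ (agree B eu χ (A u) a').card)
    (hM : 16 * M ≤ (rated eu).card) (hRq : (rated eu).card * q ≤ 1 / 2) {i : Fin n} (hi : i ≠ u)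
    {Z : Finset (Fin n)} (hiZ : i ∉ Z) (hZ : Z.card ≤ 1) :
    expec (selLaw n (1 - q)) (fun x =>
        ind ((∀ l, l ≠ u → score A B u eu χ x.1 l ≤ M) ∧ i ∈ selected A B u T eu χ x ∧
          Z ⊆ selected A B u T eu χ x)) ≤
      2 * (2 * 16 ^ M) ^ 2 * T / n *
        expec (selLaw n (1 - q)) (fun x => ind (Z ⊆ selected A B u T eu χ x)) := by
  have hlaw := isLaw_selLaw n (p := 1 - q) (by linarith) (by linarith)
  set K : Finset (Fin n) := Finset.univ \ (insert i (insert u Z)) with hK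
  have hKc : (n : ℝ) / 2 ≤ K.card := by
    refine le_card_compl hn _ ?_
    have e1 := Finset.card_insert_le i (insert u Z)
    have e2 := Finset.card_insert_le u Z
    omega
  have hag2 : ∀ a', (rated eu).card ≤ 4 * (agree B eu χ (A u) a').card := fun a' => by
    have := hag a'
    have h3 : ((rated eu).card : ℝ) ≤ 4 * (agree B eu χ (A u) a').card := by linarith
    exact_mod_cast h3
  have hle : ∀ a', (agree B eu χ (A u) a').card ≤ (rated eu).card := fun a' =>
    Finset.card_le_card (agree_subset_rated _ _ _ _ _)
  have hbin : ∀ a' a'' s, s ≤ M → binom q (agree B eu χ (A u) a').card s ≤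
      2 * 16 ^ M * binom q (agree B eu χ (A u) a'').card s := by
    intro a' a'' s hs
    refine binom_le h0 hs ?_ ?_ ?_ h1
    · have := hag2 a''; omega
    · have := hag2 a''; have := hle a'; omega
    · refine le_trans (mul_le_mul_of_nonneg_right ?_ h0) hRq
      exact_mod_cast hle a''
  have h := prob_mem_selected_le (A := A) (B := B) (u := u) (eu := eu) (χ := χ) h0 h1 T M
    (C := (2 * 16 ^ M) ^ 2) (by positivity) (i := i) (K := K) (Z := Z) hi (by simp [hK])
    (by simp [hK]) hiZ (by
      rw [hK, Finset.disjoint_left]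
      intro l hl hlZ
      exact (Finset.mem_sdiff.1 hl).2 (Finset.mem_insert_of_mem (Finset.mem_insert_of_mem hlZ)))
    fun l _ x y hx hy => by
      have b1 := hbin (A i) (A l) x hx
      have b2 := hbin (A l) (A i) y hy
      have b3 := mul_le_mul b1 b2 (binom_nonneg h0 h1 _ _)
        (mul_nonneg (by positivity) (binom_nonneg h0 h1 _ _))
      linarith
  set P := expec (selLaw n (1 - q)) (fun x =>
        ind ((∀ l, l ≠ u → score A B u eu χ x.1 l ≤ M) ∧ i ∈ selected A B u T eu χ x ∧
          Z ⊆ selected A B u T eu χ x)) with hP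
  have hP0 : 0 ≤ P := expec_nonneg hlaw fun _ => ind_nonneg _
  have h2 := (mul_le_mul_of_nonneg_right hKc hP0).trans h
  have hn0 : (0 : ℝ) < n := by
    have : 0 < n := by omega
    exact_mod_cast this
  rw [div_mul_eq_mul_div, le_div_iff₀ hn0]
  linarith

theorem card_selected_le (x : (Fin n → Fin n → Bool) × Equiv.Perm (Fin n)) :
    (selected A B u T eu χ x).card ≤ T := by
  unfold selected
  rw [card_topRows]
  exact min_le_left _ _

/-- The cluster of `u` does not stand out in the selection: up to a factor depending on `M`, its
share of the selected rows is that of a uniformly random selection. -/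
theorem expec_mult_chosen_le (h0 : 0 ≤ q) (h1 : q ≤ 1) (hn : 6 ≤ n) (hnk : n = r * k)
    (hA : ∀ a, (Finset.univ.filter fun i => A i = a).card = k) (M : ℕ)
    (hag : ∀ a', ((rated eu).card : ℝ) / 4 ≤ (agree B eu χ (A u) a').card)
    (hM : 16 * M ≤ (rated eu).card) (hRq : (rated eu).card * q ≤ 1 / 2) :
    expec (selLaw n (1 - q)) (fun x => ind (∀ l, l ≠ u → score A B u eu χ x.1 l ≤ M) *
        mult A (chosen A B u T eu χ x) (A u)) ≤
      2 * (2 * 16 ^ M) ^ 2 * (T / r) := by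
  have hlaw := isLaw_selLaw n (p := 1 - q) (by linarith) (by linarith)
  have hk0 : 0 < k := Nat.pos_of_ne_zero fun h => by rw [h] at hnk; omega
  have hr0 : 0 < r := Nat.pos_of_ne_zero fun h => by rw [h] at hnk; omega
  have hk0' : (0 : ℝ) < k := by exact_mod_cast hk0
  have hr0' : (0 : ℝ) < r := by exact_mod_cast hr0
  have h := expec_mult_le (u := u) (S := fun x => selected A B u T eu χ x)
    (G := fun x => ∀ l, l ≠ u → score A B u eu χ x.1 l ≤ M) hlaw hA
    (p := 2 * (2 * 16 ^ M) ^ 2 * T / n) (by positivity) (A u) fun i hi _ => by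
      have h2 := prob_mem_selected_le_of_agree (T := T) h0 h1 hn M hag hM hRq hi
        (Z := ∅) (Finset.notMem_empty i) (by simp)
      simpa [expec_const hlaw, ind_of trivial] using h2
  refine h.trans (le_of_eq ?_)
  rw [hnk]
  push_cast
  field_simp

theorem expec_sum_mult_chosen_sq_le (h0 : 0 ≤ q) (h1 : q ≤ 1) (hn : 6 ≤ n) (hnk : n = r * k)
    (hA : ∀ a, (Finset.univ.filter fun i => A i = a).card = k) (M : ℕ)
    (hag : ∀ a', ((rated eu).card : ℝ) / 4 ≤ (agree B eu χ (A u) a').card)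
    (hM : 16 * M ≤ (rated eu).card) (hRq : (rated eu).card * q ≤ 1 / 2) :
    expec (selLaw n (1 - q)) (fun x => ind (∀ l, l ≠ u → score A B u eu χ x.1 l ≤ M) *
        ∑ a, (mult A (chosen A B u T eu χ x) a : ℝ) ^ 2) ≤
      2 * (2 * 16 ^ M) ^ 2 * (T + T ^ 2 / r) := by
  have hlaw := isLaw_selLaw n (p := 1 - q) (by linarith) (by linarith)
  have hk0 : 0 < k := Nat.pos_of_ne_zero fun h => by rw [h] at hnk; omega
  have hr0 : 0 < r := Nat.pos_of_ne_zero fun h => by rw [h] at hnk; omega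
  have hk0' : (0 : ℝ) < k := by exact_mod_cast hk0
  have hr0' : (0 : ℝ) < r := by exact_mod_cast hr0
  have h := expec_sum_mult_sq_le (u := u) (S := fun x => selected A B u T eu χ x)
    (G := fun x => ∀ l, l ≠ u → score A B u eu χ x.1 l ≤ M) hlaw hA
    (p := 2 * (2 * 16 ^ M) ^ 2 * T / n) (by positivity) (T := T) (fun x => card_selected_le x)
    fun i i' hii hi hi' => by
      have h2 := prob_mem_selected_le_of_agree (T := T) h0 h1 hn M hag hM hRq hi
        (Z := {i'}) (by simpa using hii) (by simp)
      simpa only [Finset.singleton_subset_iff] using h2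
  refine h.trans ?_
  rw [hnk]
  push_cast
  have e1 : (1 + k * (2 * (2 * 16 ^ M) ^ 2 * T / (r * k)) : ℝ) * T =
      T + 2 * (2 * 16 ^ M) ^ 2 * (T ^ 2 / r) := by
    field_simp
  rw [e1]
  have e2 : (1 : ℝ) ≤ 16 ^ M := one_le_pow₀ (by norm_num)
  have e3 : (0 : ℝ) ≤ T := Nat.cast_nonneg T
  have e4 : (1 : ℝ) ≤ 2 * (2 * 16 ^ M) ^ 2 := by nlinarith
  nlinarith

/-- The properties of the selection of the rows that enter the analysis of the votes: outside of
an exceptional event of probability `e`, at most `τ₀` of the selected rows notice a change in a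
given column, whatever its new values are, and the selection contains neither many rows of the
cluster of `u` nor many rows of few clusters. -/
def Diverse (A B : Fin n → Fin r) (q : ℝ) (u : Fin n) (T : ℕ) (eu : Fin n → Bool) (τ₀ : ℕ)
    (δ e C : ℝ) : Prop :=
  ∃ (X : (Fin r → Fin r → Bool) → Prop)
    (Y : (Fin n → Fin n → Bool) × Equiv.Perm (Fin n) → Prop),
    (∀ χ b y, X χ → expec (selLaw n (1 - q)) (fun x =>
      ind (Y x ∧ τ₀ < noticing A B u T eu b (setCol χ b y) x)) ≤ δ) ∧
    expec (matLaw r r (1 / 2)) (fun χ => expec (selLaw n (1 - q)) fun x =>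
      ind (¬ X χ ∨ ¬ Y x)) ≤ e ∧
    (∀ χ, X χ → ∀ W : ℝ, 0 < W → expec (selLaw n (1 - q)) (fun x =>
      ind (Y x ∧ τ₀ + W * (T / r) < mult A (chosen A B u T eu χ x) (A u))) ≤ C / W) ∧
    (∀ χ, X χ → ∀ W : ℝ, 0 < W → expec (selLaw n (1 - q)) (fun x =>
      ind (Y x ∧ 2 * (τ₀ : ℝ) ^ 2 + W * (T + T ^ 2 / r) <
        ∑ a, (mult A (chosen A B u T eu χ x) a : ℝ) ^ 2)) ≤ C / W)

/-- Diversity of the selection if `u` has rated many columns. Here `M` bounds the scores of the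
other rows, `R` is the number of columns rated by `u`, and `ob` is the most that `u` has rated of a
single column cluster. For the number of rows that notice a change in a column there are two bounds:
a selected row has at most `M` of its ratings, in random places, amongst the columns on which it
agrees with `u`, and few rows altogether have rated one of `ob` columns. -/
theorem diverse_of_many_rated (h0 : 0 ≤ q) (h1 : q ≤ 1) (hn : 6 ≤ n) (hnk : n = r * k)
    (hA : ∀ a, (Finset.univ.filter fun i => A i = a).card = k) (hT : 0 < T) (M : ℕ) {R ob x : ℝ}
    (hR : R = (rated eu).card) (hR0 : 0 < R) (hob0 : 0 < ob)
    (hob : ∀ b, ((ratedIn B eu b).card : ℝ) ≤ ob) (hob8 : 8 * ob ≤ R)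
    (hM : 16 * M ≤ R) (hx0 : 0 < x) (hx1 : x ≤ 1 / 2) (hRq : R * q ≤ x) {τ₀ : ℕ} {δ : ℝ}
    (hδ : Real.exp (T * (ob * (q + M / (R / 8)))) / 2 ^ τ₀ ≤ δ ∨
      Real.exp (n * (ob * q)) / 2 ^ τ₀ ≤ δ) :
    Diverse A B q u T eu τ₀ δ (r * (2 * Real.exp (-(R / (8 * ob)))) + n * (3 * x ^ (M + 1)))
      (2 * (2 * 16 ^ M) ^ 2) := by
  have hlaw := isLaw_bitMatrix r r
  have hlawx := isLaw_selLaw n (p := 1 - q) (by linarith) (by linarith)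
  have hr0 : 0 < r := Nat.pos_of_ne_zero fun h => by rw [h] at hnk; omega
  have hr0' : (0 : ℝ) < r := by exact_mod_cast hr0
  have hT' : (0 : ℝ) < T := by exact_mod_cast hT
  have hM' : 16 * M ≤ (rated eu).card := by
    rw [hR] at hM
    exact_mod_cast hM
  have hRq' : (rated eu).card * q ≤ 1 / 2 := by rw [← hR]; linarith
  have hgood : ∀ (χ : Fin r → Fin r → Bool) (x : (Fin n → Fin n → Bool) × Equiv.Perm (Fin n)),
      (∀ l, l ≠ u → ((rated eu).filter fun j => x.1 l j = false).card ≤ M) →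
      ∀ l, l ≠ u → score A B u eu χ x.1 l ≤ M := fun χ x h l hl =>
    (score_le x.1 hl).trans (h l hl)
  refine ⟨fun χ => ∀ a', R / 4 ≤ (agree B eu χ (A u) a').card,
    fun x => ∀ l, l ≠ u → ((rated eu).filter fun j => x.1 l j = false).card ≤ M,
    fun χ b y hχ => ?_, ?_, fun χ hχ W hW => ?_, fun χ hχ W hW => ?_⟩
  · rcases hδ with hδ | hδ
    · refine le_trans ?_ hδ
      have h := prob_lt_card_hitters_inter_selected (A := A) (B := B) (u := u) (eu := eu)
        (χ := setCol χ b y) h0 h1 T M (ratedIn B eu b) (o := R / 8) (by linarith)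
        (fun i _ => by
          have := le_card_agree_setCol (b := b) y (hχ (A i))
          have := hob b
          linarith) τ₀
      refine le_trans (expec_mono hlawx fun x => ind_mono fun hx => ?_) (h.trans ?_)
      · exact ⟨hgood _ x hx.1, hx.2.le⟩
      · have := hob b
        gcongr
    · refine le_trans ?_ hδ
      have h := prob_le_card_hitters h0 h1 u (ratedIn B eu b) τ₀
      refine le_trans (expec_mono hlawx fun x => ind_mono fun hx => ?_) (h.trans ?_)
      · exact hx.2.le.trans (Finset.card_le_card Finset.inter_subset_left)
      · have := hob b
        gcongr
  · have k1 := prob_card_agree_lt (B := B) (A u) hR hR0 hob0 hob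
    have k2 := prob_many_hits h0 h1 u (rated eu) hx0 (by linarith) (by rwa [hR] at hRq) M
    refine le_trans (expec_mono hlaw fun χ => expec_mono hlawx fun x => ind_or_le _ _) ?_
    simp only [expec_add, expec_const hlawx, expec_const hlaw]
    linarith
  · have h := expec_mult_chosen_le (T := T) h0 h1 hn hnk hA M (χ := χ) (B := B)
      (by rw [← hR]; exact hχ) hM' hRq'
    have hM2 := expec_ind_le (w := selLaw n (1 - q))
      (P := fun x => (∀ l, l ≠ u → ((rated eu).filter fun j => x.1 l j = false).card ≤ M) ∧
        τ₀ + W * (T / r) < mult A (chosen A B u T eu χ x) (A u))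
      (f := fun x => ind (∀ l, l ≠ u → score A B u eu χ x.1 l ≤ M) *
        mult A (chosen A B u T eu χ x) (A u)) (c := W * (T / r)) hlawx (by positivity)
      (fun x => mul_nonneg (ind_nonneg _) (Nat.cast_nonneg _)) (fun x hx => by
        rw [ind_of (hgood χ x hx.1), one_mul]
        have : (0 : ℝ) ≤ τ₀ := Nat.cast_nonneg _
        linarith [hx.2])
    refine hM2.trans ((div_le_div_of_nonneg_right h (by positivity)).trans (le_of_eq ?_))
    field_simp
  · have h := expec_sum_mult_chosen_sq_le (T := T) h0 h1 hn hnk hA M (χ := χ) (B := B)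
      (by rw [← hR]; exact hχ) hM' hRq'
    have hM2 := expec_ind_le (w := selLaw n (1 - q))
      (P := fun x => (∀ l, l ≠ u → ((rated eu).filter fun j => x.1 l j = false).card ≤ M) ∧
        2 * (τ₀ : ℝ) ^ 2 + W * (T + T ^ 2 / r) <
          ∑ a, (mult A (chosen A B u T eu χ x) a : ℝ) ^ 2)
      (f := fun x => ind (∀ l, l ≠ u → score A B u eu χ x.1 l ≤ M) *
        ∑ a, (mult A (chosen A B u T eu χ x) a : ℝ) ^ 2) (c := W * (T + T ^ 2 / r)) hlawx
      (by positivity)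
      (fun x => mul_nonneg (ind_nonneg _) (Finset.sum_nonneg fun _ _ => by positivity))
      (fun x hx => by
        rw [ind_of (hgood χ x hx.1), one_mul]
        have : (0 : ℝ) ≤ (τ₀ : ℝ) ^ 2 := by positivity
        linarith [hx.2])
    refine hM2.trans ((div_le_div_of_nonneg_right h (by positivity)).trans (le_of_eq ?_))
    field_simp

/-- The rows of the uniformly random selection that ignores the scores. -/
theorem prob_mem_topRows_zero_le (hn : 6 ≤ n) (T : ℕ) (u : Fin n) {i : Fin n}
    {Z : Finset (Fin n)} (hiZ : i ∉ Z) (hZ : Z.card ≤ 1) :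
    expec (prioLaw n) (fun π =>
        ind (i ∈ topRows (fun _ => 0) π T ∧ Z ⊆ topRows (fun _ => 0) π T)) ≤
      2 * T / n * expec (prioLaw n) (fun π => ind (Z ⊆ topRows (fun _ => 0) π T)) := by
  set K : Finset (Fin n) := Finset.univ \ (insert i (insert u Z)) with hK
  have hKc : (n : ℝ) / 2 ≤ K.card := by
    refine le_card_compl hn _ ?_
    have e1 := Finset.card_insert_le i (insert u Z)
    have e2 := Finset.card_insert_le u Z
    omega
  have hw : ∀ i : Fin n, IsLaw fun _ : Fin 1 => (1 : ℝ) := fun _ => ⟨fun _ => zero_le_one, by simp⟩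
  have h := prob_mem_topRows_le (N := 1) (fun _ _ => 1) hw T 0 (C := 1) zero_le_one (i := i)
    (K := K) (Z := Z) (by simp [hK]) hiZ (by
      rw [hK, Finset.disjoint_left]
      intro l hl hlZ
      exact (Finset.mem_sdiff.1 hl).2 (Finset.mem_insert_of_mem (Finset.mem_insert_of_mem hlZ)))
    fun l _ x y _ _ => by norm_num
  have hs : ∀ s : Fin n → Fin 1, (fun l => (s l).val) = fun _ => 0 := fun s => by
    funext l; omega
  have hs0 : ∀ s : Fin n → Fin 1, ∀ l, l = i ∨ l ∈ K → (s l).val ≤ 0 := fun s l _ => by omega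
  have hs1 : ∀ s : Fin n → Fin 1, (∀ l, l = i ∨ l ∈ K → (s l).val ≤ 0) ↔ True := fun s =>
    iff_true_intro (hs0 s)
  simp only [hs1, hs, true_and] at h
  rw [expec_const (IsLaw.prodLaw hw), expec_const (IsLaw.prodLaw hw), one_mul] at h
  have hP0 : 0 ≤ expec (prioLaw n) (fun π =>
        ind (i ∈ topRows (fun _ => 0) π T ∧ Z ⊆ topRows (fun _ => 0) π T)) :=
    expec_nonneg (isLaw_prioLaw n) fun _ => ind_nonneg _
  have h2 := (mul_le_mul_of_nonneg_right hKc hP0).trans h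
  have hn0 : (0 : ℝ) < n := by
    have : 0 < n := by omega
    exact_mod_cast this
  rw [div_mul_eq_mul_div, le_div_iff₀ hn0]
  linarith

/-- Diversity of the selection if only few rows have rated one of the columns rated by `u`: up to
these rows, it is contained in a uniformly random selection. -/
theorem diverse_of_few_rated (h0 : 0 ≤ q) (h1 : q ≤ 1) (hn : 6 ≤ n) (hnk : n = r * k)
    (hA : ∀ a, (Finset.univ.filter fun i => A i = a).card = k) (hT : 0 < T) (τ₀ : ℕ) :
    Diverse A B q u T eu τ₀ 0 (Real.exp (n * ((rated eu).card * q)) / 2 ^ τ₀) 4 := by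
  have hlaw := isLaw_bitMatrix r r
  have hlawx := isLaw_selLaw n (p := 1 - q) (by linarith) (by linarith)
  have hlawE : IsLaw (matLaw n n (1 - q)) := isLaw_matLaw n n (by linarith) (by linarith)
  have hπ := isLaw_prioLaw n
  have hk0 : 0 < k := Nat.pos_of_ne_zero fun h => by rw [h] at hnk; omega
  have hr0 : 0 < r := Nat.pos_of_ne_zero fun h => by rw [h] at hnk; omega
  have hk0' : (0 : ℝ) < k := by exact_mod_cast hk0
  have hr0' : (0 : ℝ) < r := by exact_mod_cast hr0
  have hT' : (0 : ℝ) < T := by exact_mod_cast hT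
  set S : Equiv.Perm (Fin n) → Finset (Fin n) := fun π => topRows (fun _ => 0) π T with hS
  have hST : ∀ π, (S π).card ≤ T := fun π => by
    rw [hS]
    dsimp only
    rw [card_topRows]
    exact min_le_left _ _
  have m1 := expec_mult_le (u := u) (S := S) (G := fun _ => True) hπ hA
    (p := 2 * T / n) (by positivity) (A u) fun i _ _ => by
      have h2 := prob_mem_topRows_zero_le hn T u (Z := ∅) (Finset.notMem_empty i) (by simp)
      simpa [expec_const hπ, ind_of trivial] using h2
  have m2 := expec_sum_mult_sq_le (u := u) (S := S) (G := fun _ => True) hπ hA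
    (p := 2 * T / n) (by positivity) hST fun i i' hii _ _ => by
      have h2 := prob_mem_topRows_zero_le hn T u (i := i) (Z := {i'}) (by simpa using hii) (by simp)
      simpa only [Finset.singleton_subset_iff, true_and] using h2
  simp only [ind_of trivial, one_mul] at m1 m2
  have c1 : (k * (2 * T / n) : ℝ) = 2 * (T / r) := by
    rw [hnk]; push_cast; field_simp
  rw [c1] at m1 m2
  have hsub : ∀ χ x, chosen A B u T eu χ x \ (S x.2).erase u ⊆ hitters u x.1 (rated eu) := by
    intro χ x i hi
    obtain ⟨h1, h2⟩ := Finset.mem_sdiff.1 hi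
    obtain ⟨hiu, h3⟩ := Finset.mem_erase.1 h1
    by_contra hD
    refine h2 (Finset.mem_erase.2 ⟨hiu, mem_topRows_zero h3 ?_⟩)
    rw [score_of_ne _ hiu, Finset.card_eq_zero, Finset.filter_eq_empty_iff]
    intro l hl hE
    exact hD (mem_hitters.2 ⟨hiu, l, agree_subset_rated _ _ _ _ _ hl, hE⟩)
  refine ⟨fun _ => True, fun x => (hitters u x.1 (rated eu)).card ≤ τ₀, fun χ b y _ => ?_, ?_,
    fun χ _ W hW => ?_, fun χ _ W hW => ?_⟩
  · refine expec_le_of_le hlawx fun x => ?_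
    rw [ind_of_not]
    rintro ⟨hx1, hx2⟩
    refine absurd hx2 (not_lt.2 (le_trans (Finset.card_le_card fun i hi => ?_) hx1))
    obtain ⟨hiu, l, hl, hE⟩ := mem_hitters.1 (Finset.mem_inter.1 hi).1
    refine mem_hitters.2 ⟨hiu, l, Finset.mem_filter.2 ⟨Finset.mem_univ _, ?_⟩, hE⟩
    exact (Finset.mem_filter.1 hl).2.1
  · refine expec_le_of_le hlaw fun χ => ?_
    refine le_trans (expec_mono hlawx fun x => ind_mono fun h => ?_)
      (prob_le_card_hitters h0 h1 u (rated eu) τ₀)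
    rcases h with h | h
    · exact absurd trivial h
    · exact (not_le.1 h).le
  · have hM2 := expec_ind_le (w := prioLaw n)
      (P := fun π => W * (T / r) < mult A ((S π).erase u) (A u))
      (f := fun π => (mult A ((S π).erase u) (A u) : ℝ)) (c := W * (T / r)) hπ (by positivity)
      (fun x => Nat.cast_nonneg _) (fun x hx => hx.le)
    refine le_trans ?_ (hM2.trans ((div_le_div_of_nonneg_right m1 (by positivity)).trans ?_))
    · unfold selLaw
      rw [expec_pairLaw]
      refine expec_le_of_le hlawE fun E => expec_mono hπ fun π => ind_mono fun h => ?_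
      have h2 := mult_le_add A (chosen A B u T eu χ (E, π)) ((S π).erase u) (A u)
      have h3 : mult A (chosen A B u T eu χ (E, π) \ (S π).erase u) (A u) ≤ τ₀ :=
        (Finset.card_filter_le _ _).trans ((Finset.card_le_card (hsub χ (E, π))).trans h.1)
      have h4 : (mult A (chosen A B u T eu χ (E, π)) (A u) : ℝ) ≤
          mult A ((S π).erase u) (A u) + τ₀ := by exact_mod_cast h2.trans (by omega)
      linarith [h.2]
    · rw [div_le_div_iff₀ (by positivity) hW]
      have : 0 ≤ W * (T / r : ℝ) := by positivity
      linarith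
  · have hM2 := expec_ind_le (w := prioLaw n)
      (P := fun π => W * (T + T ^ 2 / r) / 2 < ∑ a, (mult A ((S π).erase u) a : ℝ) ^ 2)
      (f := fun π => ∑ a, (mult A ((S π).erase u) a : ℝ) ^ 2) (c := W * (T + T ^ 2 / r) / 2) hπ
      (by positivity) (fun x => Finset.sum_nonneg fun _ _ => by positivity) (fun x hx => hx.le)
    refine le_trans ?_ (hM2.trans ((div_le_div_of_nonneg_right m2 (by positivity)).trans ?_))
    · unfold selLaw
      rw [expec_pairLaw]
      refine expec_le_of_le hlawE fun E => expec_mono hπ fun π => ind_mono fun h => ?_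
      have h2 := sum_mult_sq_le A (chosen A B u T eu χ (E, π)) ((S π).erase u)
      have h3 : (chosen A B u T eu χ (E, π) \ (S π).erase u).card ≤ τ₀ :=
        (Finset.card_le_card (hsub χ (E, π))).trans h.1
      have h4 : ((chosen A B u T eu χ (E, π) \ (S π).erase u).card : ℝ) ≤ τ₀ := by
        exact_mod_cast h3
      have h5 : ((chosen A B u T eu χ (E, π) \ (S π).erase u).card : ℝ) ^ 2 ≤ (τ₀ : ℝ) ^ 2 :=
        pow_le_pow_left₀ (by positivity) h4 2
      linarith [h.2]
    · rw [div_le_div_iff₀ (by positivity) hW]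
      have e1 : (1 + 2 * (T / r) : ℝ) * T = T + 2 * (T ^ 2 / r) := by ring
      rw [e1]
      have : 0 ≤ W * (T : ℝ) := by positivity
      nlinarith

end Stage

/-! ### Verdicts from diverse selections -/

section Verdict

variable {n r : ℕ} {A B : Fin n → Fin r} {u : Fin n} {T : ℕ} {eu : Fin n → Bool} {q : ℝ}
  {τ₀ : ℕ} {δ e C : ℝ}

/-- Untypical selections are unlikely by Markov's inequality, with a factor `W` to spare. -/
theorem prob_untypical_le (h0 : 0 ≤ q) (h1 : q ≤ 1) (hC : 0 ≤ C) {W : ℝ} (hW : 0 < W)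
    {X : (Fin r → Fin r → Bool) → Prop} {Y : (Fin n → Fin n → Bool) × Equiv.Perm (Fin n) → Prop}
    (he : expec (matLaw r r (1 / 2)) (fun χ => expec (selLaw n (1 - q)) fun x =>
      ind (¬ X χ ∨ ¬ Y x)) ≤ e)
    (ha : ∀ χ, X χ → ∀ W : ℝ, 0 < W → expec (selLaw n (1 - q)) (fun x =>
      ind (Y x ∧ τ₀ + W * (T / r) < mult A (chosen A B u T eu χ x) (A u))) ≤ C / W)
    (hs : ∀ χ, X χ → ∀ W : ℝ, 0 < W → expec (selLaw n (1 - q)) (fun x =>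
      ind (Y x ∧ 2 * (τ₀ : ℝ) ^ 2 + W * (T + T ^ 2 / r) <
        ∑ a, (mult A (chosen A B u T eu χ x) a : ℝ) ^ 2)) ≤ C / W) :
    expec (matLaw r r (1 / 2)) (fun χ => expec (selLaw n (1 - q)) fun x =>
      ind (Untypical A B u T eu X Y (τ₀ + ⌊W * (T / r : ℝ)⌋₊)
        (2 * (τ₀ : ℝ) ^ 2 + W * (T + T ^ 2 / r)) χ x)) ≤ e + 2 * (C / W) := by
  have hlaw := isLaw_bitMatrix r r
  have hlawx := isLaw_selLaw n (p := 1 - q) (by linarith) (by linarith)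
  have hpt : ∀ χ x, ind (Untypical A B u T eu X Y (τ₀ + ⌊W * (T / r : ℝ)⌋₊)
      (2 * (τ₀ : ℝ) ^ 2 + W * (T + T ^ 2 / r)) χ x) ≤ ind (¬ X χ ∨ ¬ Y x) +
      (ind (X χ) * ind (Y x ∧ τ₀ + W * (T / r) < mult A (chosen A B u T eu χ x) (A u)) +
        ind (X χ) * ind (Y x ∧ 2 * (τ₀ : ℝ) ^ 2 + W * (T + T ^ 2 / r) <
          ∑ a, (mult A (chosen A B u T eu χ x) a : ℝ) ^ 2)) := by
    intro χ x
    rw [← ind_and, ← ind_and]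
    refine le_trans (ind_mono fun h => ?_)
      ((ind_or_le _ _).trans (add_le_add le_rfl (ind_or_le _ _)))
    by_cases hX : X χ
    · by_cases hY : Y x
      · rcases h with h | h | h | h
        · exact absurd hX h
        · exact absurd hY h
        · refine Or.inr (Or.inl ⟨hX, hY, ?_⟩)
          have h2 := Nat.lt_floor_add_one (W * (T / r : ℝ))
          have h3 : ((τ₀ + ⌊W * (T / r : ℝ)⌋₊ : ℕ) : ℝ) + 1 ≤
              mult A (chosen A B u T eu χ x) (A u) := by exact_mod_cast h
          push_cast at h3
          linarith
        · exact Or.inr (Or.inr ⟨hX, hY, h⟩)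
      · exact Or.inl (Or.inr hY)
    · exact Or.inl (Or.inl hX)
  refine (expec_mono hlaw fun χ => expec_mono hlawx fun x => hpt χ x).trans ?_
  simp only [expec_add, expec_mul_left]
  have e1 : expec (matLaw r r (1 / 2)) (fun χ => ind (X χ) * expec (selLaw n (1 - q)) fun x =>
      ind (Y x ∧ τ₀ + W * (T / r) < mult A (chosen A B u T eu χ x) (A u))) ≤ C / W :=
    expec_le_of_le hlaw fun χ => ind_mul_le (by positivity) fun hX => ha χ hX W hW
  have e2 : expec (matLaw r r (1 / 2)) (fun χ => ind (X χ) * expec (selLaw n (1 - q)) fun x =>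
      ind (Y x ∧ 2 * (τ₀ : ℝ) ^ 2 + W * (T + T ^ 2 / r) <
          ∑ a, (mult A (chosen A B u T eu χ x) a : ℝ) ^ 2)) ≤ C / W :=
    expec_le_of_le hlaw fun χ => ind_mul_le (by positivity) fun hX => hs χ hX W hW
  linarith

theorem exp_half_le_two_pow (V : ℕ) : Real.exp (V / 2) ≤ 2 ^ V := by
  have h : Real.exp (1 / 2) ≤ 2 := by
    have h1 : Real.exp (1 / 2) * Real.exp (1 / 2) = Real.exp 1 := by
      rw [← Real.exp_add]; norm_num
    have h2 := Real.exp_one_lt_d9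
    by_contra hc
    nlinarith [not_le.1 hc]
  rw [show (V / 2 : ℝ) = V * (1 / 2) by ring, Real.exp_nat_mul]
  exact pow_le_pow_left₀ (Real.exp_pos _).le h V

theorem few_votes_loss_le {t T q z r C' V s : ℝ} (ht : 0 ≤ t) (hT : 0 < T) (hq : 0 ≤ q) (hr : 0 < r)
    (hC' : 1 ≤ C') (hz : 1 ≤ z) (hTq : T * q * z ^ 4 ≤ C' * r) (hzr : z ^ 4 ≤ r)
    (hτ : t * (T * q + z) * z ≤ C' * T) (hV0 : 0 ≤ V) (hV : V ≤ 8 * (T * q) + 2 * z)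
    (hs : s ≤ 2 * t + z * (T / r)) : 16 * s * V / T ≤ 416 * C' / z := by
  have hz0 : 0 < z := by linarith
  have hTq0 : 0 ≤ T * q := by positivity
  rw [div_le_div_iff₀ hT hz0]
  have s2 : s * V ≤ (2 * t + z * (T / r)) * (8 * (T * q) + 2 * z) :=
    mul_le_mul hs hV hV0 (by positivity)
  have a1 : 2 * t * (8 * (T * q) + 2 * z) * z ≤ 16 * (C' * T) := by
    have e1 : 0 ≤ t * z * z := by positivity
    have e2 : 2 * t * (8 * (T * q) + 2 * z) * z =
        16 * (t * (T * q + z) * z) - 12 * (t * z * z) := by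
      ring
    linarith
  have hz34 : z ^ 3 ≤ z ^ 4 := pow_le_pow_right₀ hz (by norm_num)
  have hz24 : z ^ 2 ≤ z ^ 4 := pow_le_pow_right₀ hz (by norm_num)
  have a2 : z * (T / r) * (2 * z) * z ≤ 2 * (C' * T) := by
    have e1 : z * (T / r) * (2 * z) * z = 2 * (z ^ 3 * T) / r := by ring
    rw [e1, div_le_iff₀ hr]
    have e2 : z ^ 3 * T ≤ r * T := mul_le_mul_of_nonneg_right (hz34.trans hzr) hT.le
    have e3 : 1 * (r * T) ≤ C' * (r * T) := mul_le_mul_of_nonneg_right hC' (by positivity)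
    have e4 : 2 * (C' * T) * r = 2 * (C' * (r * T)) := by ring
    linarith
  have a3 : z * (T / r) * (8 * (T * q)) * z ≤ 8 * (C' * T) := by
    have e1 : z * (T / r) * (8 * (T * q)) * z = 8 * (T * (T * q * z ^ 2)) / r := by ring
    rw [e1, div_le_iff₀ hr]
    have b1 : T * q * z ^ 2 ≤ T * q * z ^ 4 := mul_le_mul_of_nonneg_left hz24 hTq0
    have b2 := mul_le_mul_of_nonneg_left (b1.trans hTq) hT.le
    have e4 : 8 * (C' * T) * r = 8 * (T * (C' * r)) := by ring
    linarith
  have s3 : (2 * t + z * (T / r)) * (8 * (T * q) + 2 * z) * z =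
      2 * t * (8 * (T * q) + 2 * z) * z + z * (T / r) * (2 * z) * z +
        z * (T / r) * (8 * (T * q)) * z := by ring
  have s4 := mul_le_mul_of_nonneg_right s2 hz0.le
  have e5 : 16 * s * V * z = 16 * (s * V * z) := by ring
  have e6 : 416 * C' * T = 16 * (26 * (C' * T)) := by ring
  rw [e5, e6]
  linarith

theorem few_votes_square_le {t T z r C' : ℝ} (ht : 0 ≤ t) (hT : 0 < T) (hr : 0 < r)
    (hz : 1 ≤ z) (hzr : z ^ 4 ≤ r) (hzT : z ^ 4 ≤ T)
    (hτ : t * z ^ 2 ≤ C' * T) :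
    z * (128 * (2 * t ^ 2 + z * (T + T ^ 2 / r))) ≤ T ^ 2 * (256 * (C' ^ 2 + 1)) := by
  have hz0 : 0 < z := by linarith
  have hz24 : z ^ 2 ≤ z ^ 4 := pow_le_pow_right₀ hz (by norm_num)
  have s1 : z * t ^ 2 ≤ C' ^ 2 * T ^ 2 := by
    have b1 : t * z ≤ C' * T := by
      refine le_trans (mul_le_mul_of_nonneg_left ?_ ht) hτ
      exact le_self_pow₀ hz (by norm_num)
    have b2 : (t * z) ^ 2 ≤ (C' * T) ^ 2 := pow_le_pow_left₀ (by positivity) b1 2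
    have b3 : z * t ^ 2 ≤ z ^ 2 * t ^ 2 :=
      mul_le_mul_of_nonneg_right (le_self_pow₀ hz (by norm_num)) (by positivity)
    have b4 : (t * z) ^ 2 = z ^ 2 * t ^ 2 := by ring
    have b5 : (C' * T) ^ 2 = C' ^ 2 * T ^ 2 := by ring
    linarith
  have b2 : z ^ 2 * T ≤ T ^ 2 := by
    rw [sq T]
    exact mul_le_mul_of_nonneg_right (hz24.trans hzT) hT.le
  have b3 : z ^ 2 * (T ^ 2 / r) ≤ T ^ 2 := by
    rw [← mul_div_assoc, div_le_iff₀ hr, mul_comm]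
    exact mul_le_mul_of_nonneg_left (hz24.trans hzr) (by positivity)
  have e1 : z * (128 * (2 * t ^ 2 + z * (T + T ^ 2 / r))) =
      256 * (z * t ^ 2) + 128 * (z ^ 2 * T) + 128 * (z ^ 2 * (T ^ 2 / r)) := by ring
  have e2 : T ^ 2 * (256 * (C' ^ 2 + 1)) = 256 * (C' ^ 2 * T ^ 2) + 256 * T ^ 2 := by ring
  rw [e1, e2]
  linarith

theorem exp_div_two_pow_le {x z : ℝ} {V : ℕ} (hV : 2 * x + z ≤ V) :
    Real.exp x / 2 ^ V ≤ Real.exp (-(z / 2)) := by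
  rw [div_le_iff₀ (by positivity)]
  have s3 : Real.exp x ≤ Real.exp (-(z / 2)) * Real.exp (V / 2) := by
    rw [← Real.exp_add, Real.exp_le_exp]
    linarith
  exact s3.trans (mul_le_mul_of_nonneg_left (exp_half_le_two_pow V) (Real.exp_pos _).le)

theorem many_rows_square_le {t T L r C' : ℝ} (ht : 0 ≤ t) (hr : 0 < r) (hL : 0 < L)
    (hLr : L ≤ r) (hrT : r ≤ T) (hτ : t ≤ C' * L * (T / r)) :
    2 * t ^ 2 + L * (T + T ^ 2 / r) ≤ 2 * (C' ^ 2 + 1) * (L * (T ^ 2 / r)) := by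
  have hT : 0 < T := by linarith
  have e1 : t ^ 2 ≤ (C' * L * (T / r)) ^ 2 := pow_le_pow_left₀ ht hτ 2
  have e2 : (C' * L * (T / r)) ^ 2 ≤ C' ^ 2 * (L * (T ^ 2 / r)) := by
    have : (C' * L * (T / r)) ^ 2 = C' ^ 2 * (L * (T ^ 2 / r)) * (L / r) := by field_simp
    rw [this]
    refine mul_le_of_le_one_right (by positivity) ?_
    rw [div_le_one hr]
    exact hLr
  have e3 : T ≤ T ^ 2 / r := by
    rw [le_div_iff₀ hr, sq]
    exact mul_le_mul_of_nonneg_left hrT hT.le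
  have e4 := mul_le_mul_of_nonneg_left e3 hL.le
  have e5 : 2 * t ^ 2 + L * (T + T ^ 2 / r) = 2 * t ^ 2 + L * T + L * (T ^ 2 / r) := by ring
  have e6 : 2 * (C' ^ 2 + 1) * (L * (T ^ 2 / r)) =
      2 * (C' ^ 2 * (L * (T ^ 2 / r))) + 2 * (L * (T ^ 2 / r)) := by ring
  rw [e5, e6]
  linarith

theorem many_rows_large {T L t : ℝ} (hL : 128 ≤ L) (ht : 1 ≤ t) (hT : T = t * L ^ 20) :
    L ^ 2 * t * 1000 + 1000 ≤ T := by
  have h18 : (2000 : ℝ) ≤ L ^ 18 := by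
    refine le_trans ?_ (pow_le_pow_left₀ (by norm_num) hL 18)
    norm_num
  have e2 : 1 ≤ L ^ 2 * t := by
    have := one_le_pow₀ (n := 2) (by linarith : (1 : ℝ) ≤ L)
    exact one_le_mul_of_one_le_of_one_le this ht
  have e3 : T = L ^ 2 * t * L ^ 18 := by rw [hT]; ring
  have e4 := mul_le_mul_of_nonneg_left h18 (by linarith : 0 ≤ L ^ 2 * t)
  rw [e3]
  linarith

theorem many_rows_exponents {T L r C' Q : ℝ} (hL : 1 ≤ L) (hr : r = L ^ 20) (hrT : r ≤ T)
    (hQ0 : 0 < Q) (hQ : Q ≤ 2 * (C' ^ 2 + 1) * (L * (T ^ 2 / r))) :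
    L ^ 3 / (512 * (C' ^ 2 + 1)) ≤ L ^ 4 / r * T ^ 2 / (256 * Q) ∧
      L ^ 3 / (512 * (C' ^ 2 + 1)) ≤ T ^ 2 / (128 * Q) ∧
      L ^ 3 / (512 * (C' ^ 2 + 1)) ≤ (1 / L ^ 6) ^ 2 * r / 4 := by
  have hL0 : 0 < L := by linarith
  have hr0 : 0 < r := by rw [hr]; positivity
  have hT0 : 0 < T := by linarith
  have hCC : 0 < C' ^ 2 + 1 := by positivity
  have t1 : L ^ 3 / (512 * (C' ^ 2 + 1)) ≤ L ^ 4 / r * T ^ 2 / (256 * Q) := by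
    rw [div_le_div_iff₀ (by positivity) (by positivity)]
    have : L ^ 4 / r * T ^ 2 * (512 * (C' ^ 2 + 1)) =
        L ^ 3 * (256 * (2 * (C' ^ 2 + 1) * (L * (T ^ 2 / r)))) := by ring
    rw [this]
    exact mul_le_mul_of_nonneg_left (mul_le_mul_of_nonneg_left hQ (by norm_num)) (by positivity)
  refine ⟨t1, t1.trans ?_, ?_⟩
  · have h1 : L ^ 4 / r ≤ 1 := by
      rw [div_le_one hr0, hr]
      exact pow_le_pow_right₀ hL (by norm_num)
    have h2 : L ^ 4 / r * T ^ 2 ≤ T ^ 2 := mul_le_of_le_one_left (by positivity) h1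
    exact div_le_div₀ (by positivity) h2 (by positivity) (by linarith)
  · have e1 : (1 / L ^ 6) ^ 2 * r / 4 = L ^ 8 / 4 := by rw [hr]; field_simp
    rw [e1, div_le_div_iff₀ (by positivity) (by norm_num)]
    have e2 : L ^ 3 ≤ L ^ 8 := pow_le_pow_right₀ hL (by norm_num)
    have e3 : (4 : ℝ) ≤ 512 * (C' ^ 2 + 1) := by
      have := sq_nonneg C'
      linarith
    exact mul_le_mul e2 e3 (by norm_num) (by positivity)

/-- Diverse selections with few observed votes: the winner has at most of the order of `T * q + z`
observed votes, and by `hτ` it is unlikely that one of them is amongst those of `τ₀` lost voters. -/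
theorem le_verdictGiven_of_diverse_of_few_votes (h0 : 0 ≤ q) (h1 : q ≤ 1)
    (hR : (unrated eu).Nonempty) (hT : T ≤ n) (hr0 : 0 < r) (hr : r ≤ n)
    (hdiv : Diverse A B q u T eu τ₀ δ e C) (hC : 0 ≤ C) (hδ : 0 ≤ δ) {z C' : ℝ} (hC' : 1 ≤ C')
    (hz : 32 * C' ≤ z) (hTq : T * q * z ^ 4 ≤ C' * r) (hzr : z ^ 4 ≤ r) (hzT : z ^ 4 ≤ T)
    (hτ : τ₀ * (T * q + z) * z ≤ C' * T) (v : Bool) :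
    1 - (416 * C' + 2 * C) / z - e - n * (2 * n ^ 3 * Real.exp (-(z / 2)) + (3 * δ +
        2 * Real.exp (-(z / (256 * (C' ^ 2 + 1))))) + Real.exp (-(z / 16))) ≤
      2 * verdictGiven A B q u T v eu := by
  obtain ⟨X, Y, hloc, hexc, ha, hs⟩ := hdiv
  have hz0 : 0 < z := by linarith
  have hz32 : 32 ≤ z := by linarith
  have hr0' : (0 : ℝ) < r := by exact_mod_cast hr0
  have hz4 : z ≤ z ^ 4 := by
    exact le_self_pow₀ (by linarith) (by norm_num)
  have hT0 : (0 : ℝ) < T := lt_of_lt_of_le (by positivity) hzT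
  have hTq0 : 0 ≤ T * q := by positivity
  have hτ0 : (0 : ℝ) ≤ τ₀ := Nat.cast_nonneg _
  have hτ2 : τ₀ * z ^ 2 ≤ C' * T := by
    have := mul_nonneg (mul_nonneg hτ0 hTq0) hz0.le
    have e1 : τ₀ * (T * q + z) * z = τ₀ * (T * q) * z + τ₀ * z ^ 2 := by ring
    linarith
  -- the Markov factor is `z`
  have hbad := prob_untypical_le (T := T) (A := A) (B := B) (u := u) (eu := eu) h0 h1 hC hz0
    hexc ha hs
  set τ₁ := τ₀ + ⌊z * (T / r : ℝ)⌋₊ with hτ₁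
  set Q := 2 * (τ₀ : ℝ) ^ 2 + z * (T + T ^ 2 / r) with hQ
  have hfl : (⌊z * (T / r : ℝ)⌋₊ : ℝ) ≤ z * (T / r) := Nat.floor_le (by positivity)
  have hTr : z * (T / r : ℝ) * z ^ 3 ≤ T := by
    rw [show z * (T / r : ℝ) * z ^ 3 = z ^ 4 * T / r by ring, div_le_iff₀ hr0', mul_comm]
    exact mul_le_mul_of_nonneg_left hzr hT0.le
  have hz3 : 16 ≤ z ^ 3 := by
    have := pow_le_pow_left₀ (by norm_num) hz32 3
    norm_num at this
    linarith
  have hzTr0 : 0 ≤ z * (T / r : ℝ) := by positivity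
  have hτ8 : 32 * (τ₀ : ℝ) ≤ T := by
    have : 32 * C' * (τ₀ : ℝ) ≤ C' * T := by
      have : 32 * C' * (τ₀ : ℝ) ≤ z ^ 2 * τ₀ := by
        refine mul_le_mul_of_nonneg_right (hz.trans ?_) hτ0
        exact le_self_pow₀ (by linarith) (by norm_num)
      linarith
    have : C' * (32 * (τ₀ : ℝ)) ≤ C' * T := by linarith
    exact le_of_mul_le_mul_left this (by linarith)
  have hT16 : (16 : ℝ) ≤ T := by linarith
  have hflT : (⌊z * (T / r : ℝ)⌋₊ : ℝ) * 16 ≤ T := by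
    have := mul_le_mul_of_nonneg_left hz3 hzTr0
    linarith
  have hQpos : 0 < Q := by
    have : 0 < z * (T + T ^ 2 / r) := by positivity
    have : 0 ≤ 2 * (τ₀ : ℝ) ^ 2 := by positivity
    linarith
  set V := ⌈8 * (T * q) + z⌉₊ with hV
  have hV1 : 8 * (T * q) + z ≤ V := Nat.le_ceil _
  have hV2 : (V : ℝ) ≤ 8 * (T * q) + 2 * z := by
    have := Nat.ceil_lt_add_one (show 0 ≤ 8 * (T * q) + z by positivity)
    linarith
  have key := le_verdictGiven_of_loss (A := A) (B := B) (u := u) (τ₁ := τ₁) (X := X) (Y := Y) h0 h1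
    hR hT (τ₀ := τ₀) (by
      have : 8 * (τ₀ : ℝ) + 4 ≤ T := by linarith
      exact_mod_cast this) (by
      have : (τ₀ : ℝ) + τ₁ ≤ T := by
        rw [hτ₁]; push_cast; linarith
      exact_mod_cast this) (Q := Q) (by
      have : 0 ≤ z * (T + T ^ 2 / r : ℝ) := by positivity
      have : 0 ≤ (τ₀ : ℝ) ^ 2 := by positivity
      linarith) hQpos (fun χ b y hχ => hloc χ b y hχ) hδ hbad V v
  refine le_trans ?_ key
  have hrn : (r : ℝ) ≤ n := by exact_mod_cast hr
  have hTn : (T : ℝ) ≤ n := by exact_mod_cast hT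
  have hz1 : 1 ≤ z := by linarith
  have t1 : 16 * (τ₀ + τ₁) * V / T ≤ 416 * C' / z := by
    refine few_votes_loss_le hτ0 hT0 h0 hr0' hC' hz1 hTq hzr hτ (Nat.cast_nonneg _) hV2 ?_
    rw [hτ₁]; push_cast; linarith
  have t2 : 2 * T * n ^ 2 * (Real.exp (2 * T * q) / 2 ^ V) ≤ 2 * n ^ 3 * Real.exp (-(z / 2)) := by
    have s1 : Real.exp (2 * T * q) / 2 ^ V ≤ Real.exp (-(z / 2)) :=
      exp_div_two_pow_le (by linarith)
    have s4 : 2 * T * n ^ 2 ≤ 2 * (n : ℝ) ^ 3 := by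
      have : (T : ℝ) * n ^ 2 ≤ n * n ^ 2 := mul_le_mul_of_nonneg_right hTn (by positivity)
      have e1 : 2 * T * n ^ 2 = 2 * ((T : ℝ) * (n : ℝ) ^ 2) := by ring
      have e2 : 2 * (n : ℝ) ^ 3 = 2 * ((n : ℝ) * (n : ℝ) ^ 2) := by ring
      rw [e1, e2]
      linarith
    exact mul_le_mul s4 s1 (by positivity) (by positivity)
  have t3 : Real.exp (-(T ^ 2 / (128 * Q))) ≤ Real.exp (-(z / (256 * (C' ^ 2 + 1)))) := by
    rw [Real.exp_le_exp, neg_le_neg_iff, div_le_div_iff₀ (by positivity) (by positivity)]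
    exact few_votes_square_le hτ0 hT0 hr0' hz1 hzr hzT hτ2
  have t4 : Real.exp (-(r / 16 : ℝ)) ≤ Real.exp (-(z / 16)) := by
    rw [Real.exp_le_exp]
    linarith
  have t5 : 0 ≤ 2 * T * n ^ 2 * (Real.exp (2 * T * q) / 2 ^ V) +
      (3 * δ + 2 * Real.exp (-(T ^ 2 / (128 * Q)))) + Real.exp (-(r / 16 : ℝ)) := by positivity
  have t6 := mul_le_mul_of_nonneg_right hrn t5
  have t7 := mul_le_mul_of_nonneg_left (add_le_add (add_le_add t2 (add_le_add
    (le_refl (3 * δ)) (mul_le_mul_of_nonneg_left t3 (by norm_num : (0 : ℝ) ≤ 2)))) t4)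
    (Nat.cast_nonneg n : (0 : ℝ) ≤ n)
  rw [add_div]
  have : 2 * C / z = 2 * (C / z) := by ring
  linarith

/-- Diverse selections of many rows: `τ₀` is small compared with `T / √r`, which is the order of the
fluctuations of the numbers of voters. A tilt by `θ = L ^ 4 / r` creates a gain of the order
`L ^ 4 * T / r`, which exceeds `τ₀`. -/
theorem le_verdictGiven_of_diverse_of_many_rows (h0 : 0 ≤ q) (h1 : q ≤ 1)
    (hR : (unrated eu).Nonempty) (hT : T ≤ n)
    (hdiv : Diverse A B q u T eu τ₀ δ e C) (hC : 0 ≤ C) (hδ : 0 ≤ δ) {L C' : ℝ} (hC' : 1 ≤ C')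
    (hL : 128 * C' ≤ L) (hr : (r : ℝ) = L ^ 20) (hrT : r ≤ T)
    (hτ : (τ₀ : ℝ) ≤ C' * L * (T / r)) (v : Bool) :
    1 - 2 * C / L - e - r * (3 * δ + 4 * Real.exp (-(L ^ 3 / (512 * (C' ^ 2 + 1))))) ≤
      2 * Real.exp (1 / L ^ 2) * verdictGiven A B q u T v eu := by
  obtain ⟨X, Y, hloc, hexc, ha, hs⟩ := hdiv
  have hL128 : 128 ≤ L := by linarith
  have hL0 : 0 < L := by linarith
  have hr0 : (0 : ℝ) < r := by rw [hr]; positivity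
  have hrT' : (r : ℝ) ≤ T := by exact_mod_cast hrT
  have hT0 : (0 : ℝ) < T := by linarith
  have hLr : L ≤ r := by rw [hr]; exact le_self_pow₀ (by linarith) (by norm_num)
  have hbad := prob_untypical_le (T := T) (A := A) (B := B) (u := u) (eu := eu) h0 h1 hC hL0
    hexc ha hs
  set τ₁ := τ₀ + ⌊L * (T / r : ℝ)⌋₊ with hτ₁
  set Q := 2 * (τ₀ : ℝ) ^ 2 + L * (T + T ^ 2 / r) with hQ
  have hfl : (⌊L * (T / r : ℝ)⌋₊ : ℝ) ≤ L * (T / r) := Nat.floor_le (by positivity)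
  set t : ℝ := T / r with ht
  have htT : T = t * L ^ 20 := by rw [ht, ← hr]; field_simp
  have ht1 : 1 ≤ t := by rw [ht, le_div_iff₀ hr0]; linarith
  have hτ0 : (0 : ℝ) ≤ τ₀ := Nat.cast_nonneg _
  have hC'L : C' * L * t ≤ L ^ 2 * t := by
    have : C' * L ≤ L ^ 2 := by
      rw [sq]
      exact mul_le_mul_of_nonneg_right (by linarith) hL0.le
    exact mul_le_mul_of_nonneg_right this (by linarith)
  have hLt : L * t ≤ L ^ 2 * t := by
    have : L ≤ L ^ 2 := le_self_pow₀ (by linarith) (by norm_num)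
    exact mul_le_mul_of_nonneg_right this (by linarith)
  have hbig : L ^ 2 * t * 1000 + 1000 ≤ T := many_rows_large hL128 ht1 htT
  have hQpos : 0 < Q := by
    have : 0 < L * (T + T ^ 2 / r) := by positivity
    have : 0 ≤ 2 * (τ₀ : ℝ) ^ 2 := by positivity
    linarith
  have hτ₁' : (τ₁ : ℝ) ≤ C' * L * t + L * t := by
    rw [hτ₁]; push_cast; linarith
  -- Tilting with `θ = L ^ 4 / r` costs the factor `exp (θ * ε * r) = exp (1 / L ^ 2)`, which is
  -- close to `1` for `ε = 1 / L ^ 6`. This `ε` is above the relative fluctuations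
  -- `r ^ (-1 / 2) = L ^ (-10)`.
  have hθ : L ^ 4 / r = 1 / L ^ 16 := by rw [hr]; field_simp
  have hL6 : (1 : ℝ) ≤ L ^ 6 := one_le_pow₀ (by linarith)
  have key := le_verdictGiven_of_gain (A := A) (B := B) (u := u) (τ₁ := τ₁) (X := X) (Y := Y) h0 h1
    hR hT (τ₀ := τ₀) (by
      have : 8 * (τ₀ : ℝ) + 4 ≤ T := by linarith
      exact_mod_cast this) (by
      have : 8 * (τ₁ : ℝ) + 8 ≤ T := by linarith
      exact_mod_cast this) (Q := Q) (by
      have : 0 ≤ L * (T + T ^ 2 / r : ℝ) := by positivity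
      have : 0 ≤ (τ₀ : ℝ) ^ 2 := by positivity
      linarith) hQpos (θ := L ^ 4 / r) (ε := 1 / L ^ 6) (by positivity) (by
      rw [hθ, div_div, div_le_div_iff₀ (by positivity) (by positivity)]
      have : (4 : ℝ) ≤ L ^ 10 := by
        have : (128 : ℝ) ^ 10 ≤ L ^ 10 := pow_le_pow_left₀ (by norm_num) hL128 10
        norm_num at this
        linarith
      have h3 : L ^ 16 = L ^ 6 * L ^ 10 := by ring
      rw [h3, one_mul, one_mul]
      gcongr) (by
      rw [div_le_one (by positivity)]; exact hL6) (by
      have e1 : L ^ 4 / r * T / 32 = L ^ 4 * t / 32 := by rw [ht]; ring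
      rw [e1]
      have e2 : 32 * (3 * C' + 1) ≤ L ^ 3 :=
        le_trans (by linarith) (le_self_pow₀ (by linarith : 1 ≤ L) (by norm_num))
      have e3 : 32 * (3 * C' + 1) * (L * t) ≤ L ^ 3 * (L * t) :=
        mul_le_mul_of_nonneg_right e2 (by positivity)
      have e4 : L ^ 3 * (L * t) = L ^ 4 * t := by ring
      have e5 : 32 * (3 * C' + 1) * (L * t) = 96 * (C' * L * t) + 32 * (L * t) := by ring
      have e6 : 0 ≤ L * t := by positivity
      linarith) (fun χ b y hχ => hloc χ b y hχ) hδ hbad v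
  have hexp : L ^ 4 / r * (1 / L ^ 6) * r = 1 / L ^ 2 := by rw [hr]; field_simp
  rw [hexp] at key
  refine le_trans ?_ key
  have hQle : Q ≤ 2 * (C' ^ 2 + 1) * (L * (T ^ 2 / r)) :=
    many_rows_square_le hτ0 hr0 hL0 hLr hrT' hτ
  obtain ⟨t1, t2, t3⟩ := many_rows_exponents (by linarith) hr hrT' hQpos hQle
  have x1 := Real.exp_le_exp.2 (neg_le_neg t1)
  have x2 := Real.exp_le_exp.2 (neg_le_neg t2)
  have x3 := Real.exp_le_exp.2 (neg_le_neg t3)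
  have x4 : 3 * δ + 2 * Real.exp (-(T ^ 2 / (128 * Q))) +
      Real.exp (-(L ^ 4 / r * T ^ 2 / (256 * Q))) + Real.exp (-((1 / L ^ 6) ^ 2 * r / 4)) ≤
      3 * δ + 4 * Real.exp (-(L ^ 3 / (512 * (C' ^ 2 + 1)))) := by linarith
  have x5 := mul_le_mul_of_nonneg_left x4 hr0.le
  have : 2 * C / L = 2 * (C / L) := by ring
  linarith

/-- Averaging over the columns that `u` has rated. -/
theorem le_verdictProb (h0 : 0 ≤ q) (h1 : q ≤ 1) {G : (Fin n → Bool) → Prop} {lo g : ℝ} {v : Bool}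
    (hlo : lo ≤ 1) (hG : expec (coins (Fin n) (1 - q)) (fun eu => ind (¬ G eu)) ≤ g)
    (h : ∀ eu, G eu → lo ≤ verdictGiven A B q u T v eu) :
    lo - g ≤ verdictProb A B q u T v := by
  have hlaw : IsLaw (coins (Fin n) (1 - q)) := isLaw_coins (by linarith) (by linarith)
  have hpt : ∀ eu, lo - ind (¬ G eu) ≤ verdictGiven A B q u T v eu := fun eu => by
    by_cases hg : G eu
    · rw [ind_of_not fun hn => hn hg]
      linarith [h eu hg]
    · rw [ind_of hg]
      have : 0 ≤ verdictGiven A B q u T v eu := expec_nonneg (isLaw_bitMatrix r r) fun χ =>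
        expec_nonneg (isLaw_selLaw n (by linarith) (by linarith)) fun x => winProb_nonneg h0 h1 _ _
      linarith
  have := expec_mono hlaw hpt
  rw [expec_sub, expec_const hlaw] at this
  rw [verdictProb_eq]
  linarith

end Verdict

/-! ### Selections of few rows -/

section Few

variable {n r k : ℕ} {A B : Fin n → Fin r} {u : Fin n} {T : ℕ} {eu : Fin n → Bool} {q : ℝ}
  {χ : Fin r → Fin r → Bool} {a : Fin r} {δ : ℝ}

/-- Every row of cluster values is balanced, and it is nearly orthogonal to the row `a`. -/
def Balanced (χ : Fin r → Fin r → Bool) (a : Fin r) (δ : ℝ) : Prop :=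
  ∀ a', |∑ b, sgn (χ a' b)| ≤ δ * r ∧ (a' ≠ a → |∑ b, sgn (χ a b) * sgn (χ a' b)| ≤ δ * r)

theorem sgn_sq (v : Bool) : sgn v ^ 2 = 1 := by cases v <;> simp [sgn]

theorem prob_not_balanced (hr : 0 < r) (a : Fin r) (hδ : 0 ≤ δ) :
    expec (matLaw r r (1 / 2)) (fun χ => ind (¬ Balanced χ a δ)) ≤
      r * (4 * Real.exp (-(δ ^ 2 * r / 2))) := by
  have hlaw := isLaw_bitMatrix r r
  have hr' : (0 : ℝ) < r := by exact_mod_cast hr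
  have he : (δ * r) ^ 2 / (2 * r) = δ ^ 2 * r / 2 := by field_simp
  have hpt : ∀ χ : Fin r → Fin r → Bool, ind (¬ Balanced χ a δ) ≤
      ∑ a', (ind (δ * r ≤ |∑ b, 1 * sgn (χ a' b)|) +
        ind (a' ≠ a ∧ δ * r ≤ |∑ b, sgn (χ a b) * sgn (χ a' b)|)) := fun χ => by
    refine le_trans (ind_mono fun h => ?_) ((ind_exists_le fun a' =>
      (δ * r ≤ |∑ b, 1 * sgn (χ a' b)|) ∨
        (a' ≠ a ∧ δ * r ≤ |∑ b, sgn (χ a b) * sgn (χ a' b)|)).trans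
      (Finset.sum_le_sum fun a' _ => ind_or_le _ _))
    by_contra hc
    push Not at hc
    refine h fun a' => ⟨?_, fun ha => ((hc a').2 ha).le⟩
    have := (hc a').1.le
    simpa only [one_mul] using this
  refine (expec_mono hlaw hpt).trans ?_
  rw [expec_sum]
  have hrow : ∀ a' ∈ (Finset.univ : Finset (Fin r)), expec (matLaw r r (1 / 2)) (fun χ =>
      ind (δ * r ≤ |∑ b, 1 * sgn (χ a' b)|) +
        ind (a' ≠ a ∧ δ * r ≤ |∑ b, sgn (χ a b) * sgn (χ a' b)|)) ≤
      4 * Real.exp (-(δ ^ 2 * r / 2)) := by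
    intro a' _
    rw [expec_add]
    have e1 : expec (matLaw r r (1 / 2)) (fun χ => ind (δ * r ≤ |∑ b, 1 * sgn (χ a' b)|)) ≤
        2 * Real.exp (-(δ ^ 2 * r / 2)) := by
      rw [← expec_update _ a' _ (isLaw_bits _)]
      refine expec_le_of_le hlaw fun χ => ?_
      simp only [Function.update_self]
      refine (hoeffding_abs (fun _ => (1 : ℝ)) (V := r) hr' (by positivity) (by simp)).trans ?_
      rw [he]
    have e2 : expec (matLaw r r (1 / 2)) (fun χ =>
        ind (a' ≠ a ∧ δ * r ≤ |∑ b, sgn (χ a b) * sgn (χ a' b)|)) ≤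
        2 * Real.exp (-(δ ^ 2 * r / 2)) := by
      rcases eq_or_ne a' a with rfl | ha
      · refine expec_le_of_le hlaw fun χ => ?_
        rw [ind_of_not fun h => h.1 rfl]
        positivity
      · rw [← expec_update _ a' _ (isLaw_bits _)]
        refine expec_le_of_le hlaw fun χ => ?_
        simp only [Function.update_self, Function.update_of_ne ha.symm]
        refine le_trans (expec_mono (isLaw_bits _) fun w => ind_mono fun h => h.2)
          ((hoeffding_abs (fun b => sgn (χ a b)) (V := r) hr' (by positivity) ?_).trans ?_)
        · simp [sgn_sq]
        · rw [he]
    linarith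
  refine (Finset.sum_le_sum hrow).trans (le_of_eq ?_)
  simp

theorem sum_comp_of_card (hB : ∀ b, (Finset.univ.filter fun j => B j = b).card = k)
    (f : Fin r → ℝ) : ∑ j, f (B j) = k * ∑ b, f b := by
  rw [← Finset.sum_fiberwise Finset.univ B, Finset.mul_sum]
  refine Finset.sum_congr rfl fun b _ => ?_
  rw [Finset.sum_congr rfl fun j hj => by rw [(Finset.mem_filter.1 hj).2], Finset.sum_const, hB,
    nsmul_eq_mul]

theorem sum_le_sum_unrated_inter (G : Finset (Fin n)) {f : Fin n → ℝ} {m : ℝ}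
    (hf : ∀ j, 0 ≤ f j) (hm : ∀ j, f j ≤ m) :
    ∑ j ∈ G, f j ≤ ∑ j ∈ unrated eu ∩ G, f j + (rated eu).card * m := by
  have h1 : G ⊆ (unrated eu ∩ G) ∪ rated eu := fun j hj => by
    cases h : eu j
    · exact Finset.mem_union_right _ (Finset.mem_filter.2 ⟨Finset.mem_univ _, h⟩)
    · exact Finset.mem_union_left _ (Finset.mem_inter.2
        ⟨Finset.mem_filter.2 ⟨Finset.mem_univ _, h⟩, hj⟩)
  have h2 := Finset.sum_le_sum_of_subset_of_nonneg h1 fun j _ _ => hf j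
  have h3 := Finset.sum_union_inter (s₁ := unrated eu ∩ G) (s₂ := rated eu) (f := f)
  have h4 : 0 ≤ ∑ j ∈ (unrated eu ∩ G) ∩ rated eu, f j := Finset.sum_nonneg fun j _ => hf j
  have h5 : ∑ j ∈ rated eu, f j ≤ (rated eu).card * m := by
    rw [← nsmul_eq_mul]
    exact Finset.sum_le_card_nsmul _ _ _ fun j _ => hm j
  linarith

theorem ind_eq_true (v : Bool) : ind (v = true) = (1 + sgn v) / 2 := by
  cases v
  · rw [ind_of_not (by simp)]; norm_num [sgn]
  · rw [ind_of rfl]; norm_num [sgn]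

theorem ind_eq_of (w v : Bool) : ind (w = v) = (1 + sgn v * sgn w) / 2 := by
  cases v <;> cases w <;> norm_num [sgn, ind]

theorem cast_likers (A : Fin n → Fin r) (S : Finset (Fin n)) (w : Fin r → Bool) :
    (likers A S w : ℝ) = ∑ a, (mult A S a : ℝ) * ind (w a = true) := by
  unfold likers
  rw [sum_filter_comp A S fun a => w a = true]
  push_cast
  refine Finset.sum_congr rfl fun a _ => ?_
  rw [ind_eq_ite]
  split_ifs <;> simp

theorem abs_sgn_mul (v : Bool) (x : ℝ) : |sgn v * x| = |x| := by
  cases v <;> simp [sgn]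

/-- About half of the unrated columns get the verdict `v`, and they get about half of the votes. -/
theorem Balanced.votes (hχ : Balanced χ a δ) (hδ0 : 0 ≤ δ) (hδ : δ ≤ 1 / 16) (hnk : n = r * k)
    (hB : ∀ b, (Finset.univ.filter fun j => B j = b).card = k)
    (hO : ((rated eu).card : ℝ) ≤ δ * n) {S : Finset (Fin n)}
    (hS : (mult A S a : ℝ) ≤ 2 * δ * S.card) (v : Bool) :
    (1 / 2 - 8 * δ) * ∑ j ∈ unrated eu, (likers A S (fun i => χ i (B j)) : ℝ) ≤
        ∑ j ∈ unrated eu ∩ Finset.univ.filter (fun j => χ a (B j) = v),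
          (likers A S (fun i => χ i (B j)) : ℝ) ∧
      (1 / 2 - 8 * δ) * (unrated eu).card ≤
        (unrated eu ∩ Finset.univ.filter fun j => χ a (B j) = v).card := by
  set m : ℝ := (S.card : ℝ) with hm
  have hm0 : 0 ≤ m := Nat.cast_nonneg _
  have hk0 : (0 : ℝ) ≤ k := Nat.cast_nonneg _
  have hr0 : (0 : ℝ) ≤ r := Nat.cast_nonneg _
  have hn' : (n : ℝ) = r * k := by rw [hnk]; push_cast; ring
  have hρ : 0 ≤ 1 / 2 - 8 * δ := by linarith
  have hms : m = ∑ a, (mult A S a : ℝ) := by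
    rw [hm, ← sum_mult A S]; push_cast; rfl
  have hlike : ∀ b, (likers A S (fun i => χ i b) : ℝ) ≤ m := fun b => by
    rw [hm]
    exact_mod_cast Finset.card_filter_le _ _
  -- all votes
  have h1 : ∑ b, (likers A S (fun i => χ i b) : ℝ) ≤ m * (r * (1 + δ) / 2) := by
    simp only [cast_likers]
    rw [Finset.sum_comm, hms, Finset.sum_mul]
    refine Finset.sum_le_sum fun a' _ => ?_
    rw [← Finset.mul_sum]
    refine mul_le_mul_of_nonneg_left ?_ (Nat.cast_nonneg _)
    simp only [ind_eq_true]
    rw [← Finset.sum_div, Finset.sum_add_distrib, Finset.sum_const, Finset.card_univ,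
      Fintype.card_fin, nsmul_eq_mul, mul_one]
    have := (abs_le.1 (hχ a').1).2
    linarith
  -- the votes for columns with the verdict `v`
  have h2 : m * (r * (1 / 4 - 5 / 4 * δ)) ≤
      ∑ b, ind (χ a b = v) * (likers A S (fun i => χ i b) : ℝ) := by
    have e1 : ∀ a', (mult A S a' : ℝ) * (r * (1 / 4 - 3 / 4 * δ)) -
        (if a' = a then (mult A S a : ℝ) * r / 4 else 0) ≤
        ∑ b, ind (χ a b = v) * ((mult A S a' : ℝ) * ind (χ a' b = true)) := by
      intro a'
      have hm' : (0 : ℝ) ≤ mult A S a' := Nat.cast_nonneg _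
      by_cases ha : a' = a
      · rw [if_pos ha, ha]
        have p1 : 0 ≤ ∑ b, ind (χ a b = v) * ((mult A S a : ℝ) * ind (χ a b = true)) :=
          Finset.sum_nonneg fun b _ => mul_nonneg (ind_nonneg _)
            (mul_nonneg (Nat.cast_nonneg _) (ind_nonneg _))
        have p2 : 0 ≤ (mult A S a : ℝ) * (r * (3 / 4 * δ)) := by positivity
        linarith
      · rw [if_neg ha, sub_zero]
        have p1 : ∑ b, ind (χ a b = v) * ((mult A S a' : ℝ) * ind (χ a' b = true)) =
            (mult A S a' : ℝ) * ∑ b, (1 + sgn v * sgn (χ a b) + sgn (χ a' b) +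
              sgn v * (sgn (χ a b) * sgn (χ a' b))) / 4 := by
          rw [Finset.mul_sum]
          refine Finset.sum_congr rfl fun b _ => ?_
          rw [ind_eq_true, ind_eq_of]
          ring
        rw [p1]
        refine mul_le_mul_of_nonneg_left ?_ hm'
        rw [← Finset.sum_div, Finset.sum_add_distrib, Finset.sum_add_distrib,
          Finset.sum_add_distrib, Finset.sum_const, Finset.card_univ,
          Fintype.card_fin, nsmul_eq_mul, mul_one, ← Finset.mul_sum, ← Finset.mul_sum]
        have q1 := (abs_le.1 (hχ a').1).1
        have q2 := (abs_le.1 ((abs_sgn_mul v _).trans_le (hχ a).1)).1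
        have q3 := (abs_le.1 ((abs_sgn_mul v _).trans_le ((hχ a').2 ha))).1
        linarith
    have e2 : ∑ b, ind (χ a b = v) * (likers A S (fun i => χ i b) : ℝ) =
        ∑ a', ∑ b, ind (χ a b = v) * ((mult A S a' : ℝ) * ind (χ a' b = true)) := by
      rw [Finset.sum_comm]
      refine Finset.sum_congr rfl fun b _ => ?_
      rw [cast_likers, Finset.mul_sum]
    rw [e2]
    refine le_trans ?_ (Finset.sum_le_sum fun a' _ => e1 a')
    rw [Finset.sum_sub_distrib, ← Finset.sum_mul, ← hms, Finset.sum_ite_eq' Finset.univ a,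
      if_pos (Finset.mem_univ a)]
    have e3 := mul_le_mul_of_nonneg_right hS hr0
    linarith
  have h3 : r / 2 - δ * r / 2 ≤ ∑ b, ind (χ a b = v) := by
    simp only [ind_eq_of]
    rw [← Finset.sum_div, Finset.sum_add_distrib, Finset.sum_const, Finset.card_univ,
      Fintype.card_fin, nsmul_eq_mul, mul_one, ← Finset.mul_sum]
    have q2 := (abs_le.1 ((abs_sgn_mul v _).trans_le (hχ a).1)).1
    linarith
  have hkr : 0 ≤ k * (r * δ : ℝ) := by positivity
  constructor
  · have f1 := sum_le_sum_unrated_inter (eu := eu) (Finset.univ.filter fun j => χ a (B j) = v)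
      (f := fun j => (likers A S (fun i => χ i (B j)) : ℝ)) (m := m) (fun j => Nat.cast_nonneg _)
      (fun j => hlike (B j))
    have f2 : ∑ j ∈ Finset.univ.filter (fun j => χ a (B j) = v),
        (likers A S (fun i => χ i (B j)) : ℝ) =
        k * ∑ b, ind (χ a b = v) * (likers A S (fun i => χ i b) : ℝ) := by
      rw [← sum_comp_of_card hB fun b => ind (χ a b = v) * (likers A S (fun i => χ i b) : ℝ),
        Finset.sum_filter]
      refine Finset.sum_congr rfl fun j _ => ?_
      rw [ind_eq_ite, ite_mul, one_mul, zero_mul]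
    have f3 : ∑ j ∈ unrated eu, (likers A S (fun i => χ i (B j)) : ℝ) ≤
        k * ∑ b, (likers A S (fun i => χ i b) : ℝ) := by
      rw [← sum_comp_of_card hB fun b => (likers A S (fun i => χ i b) : ℝ)]
      exact Finset.sum_le_sum_of_subset_of_nonneg (Finset.subset_univ _)
        fun j _ _ => Nat.cast_nonneg _
    have f4 := mul_le_mul_of_nonneg_left h1 hk0
    have f5 := mul_le_mul_of_nonneg_left h2 hk0
    have f6 := mul_le_mul_of_nonneg_left (f3.trans f4) hρ
    have f7 := mul_le_mul_of_nonneg_right hO hm0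
    rw [hn'] at f7
    have f8 : (1 / 2 - 8 * δ) * (k * (m * (r * (1 + δ) / 2))) + δ * (r * k) * m ≤
        k * (m * (r * (1 / 4 - 5 / 4 * δ))) := by
      have g1 : k * (m * (r * (1 / 4 - 5 / 4 * δ))) -
          ((1 / 2 - 8 * δ) * (k * (m * (r * (1 + δ) / 2))) + δ * (r * k) * m) =
          (k * (r * δ)) * m * (3 / 2 + 4 * δ) := by ring
      have g2 : 0 ≤ (k * (r * δ)) * m * (3 / 2 + 4 * δ) := by positivity
      linarith
    linarith
  · have f1 := sum_le_sum_unrated_inter (eu := eu) (Finset.univ.filter fun j => χ a (B j) = v)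
      (f := fun _ => (1 : ℝ)) (m := 1) (fun j => zero_le_one) (fun j => le_rfl)
    have f2 : ∑ j ∈ Finset.univ.filter (fun j => χ a (B j) = v), (1 : ℝ) =
        k * ∑ b, ind (χ a b = v) := by
      rw [← sum_comp_of_card hB fun b => ind (χ a b = v), Finset.sum_filter]
      refine Finset.sum_congr rfl fun j _ => ?_
      rw [ind_eq_ite]
    have f3 : ((unrated eu).card : ℝ) ≤ n := by
      exact_mod_cast (Finset.card_le_univ _).trans_eq (Fintype.card_fin n)
    have f4 := mul_le_mul_of_nonneg_left h3 hk0
    have f5 := mul_le_mul_of_nonneg_left f3 hρ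
    rw [f2] at f1
    simp only [Finset.sum_const, nsmul_eq_mul, mul_one] at f1
    rw [hn'] at f5 hO
    linarith

theorem unrated_nonempty (hn : 0 < n) (hO : ((rated eu).card : ℝ) ≤ δ * n) (hδ : δ < 1) :
    (unrated eu).Nonempty := by
  by_contra hc
  have hn' : (0 : ℝ) < n := by exact_mod_cast hn
  have h2 : (rated eu).card = n := by
    have : rated eu = Finset.univ := by
      refine Finset.eq_univ_iff_forall.2 fun j => ?_
      refine Finset.mem_filter.2 ⟨Finset.mem_univ _, ?_⟩
      cases h : eu j
      · rfl
      · exact absurd ⟨j, Finset.mem_filter.2 ⟨Finset.mem_univ _, h⟩⟩ hc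
    rw [this, Finset.card_univ, Fintype.card_fin]
  rw [h2] at hO
  have := mul_lt_mul_of_pos_right hδ hn'
  linarith

/-- If hardly any column gets two votes, and hardly any of the selected rows are in the cluster
of `u`, then both verdicts are about equally likely. -/
theorem le_verdictGiven_of_few_rows (h0 : 0 < q) (h1 : q ≤ 1) (hr : 0 < r) (hT : T ≤ n)
    (hnk : n = r * k) (hB : ∀ b, (Finset.univ.filter fun j => B j = b).card = k)
    (hδ0 : 0 ≤ δ) (hδ : δ ≤ 1 / 16) (hO : ((rated eu).card : ℝ) ≤ δ * n) {g x : ℝ}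
    (hTx : (max T 1 : ℕ) ≤ x) (hx : x * q ≤ 1)
    (hg : expec (matLaw r r (1 / 2)) (fun χ => expec (selLaw n (1 - q)) fun y =>
      ind (δ * T < mult A (chosen A B u T eu χ y) (A u))) ≤ g) (v : Bool) :
    1 / 2 - 8 * δ - 3 * n * (x * q) ^ 2 - r * (4 * Real.exp (-(δ ^ 2 * r / 2))) - g ≤
      verdictGiven A B q u T v eu := by
  have hlaw := isLaw_bitMatrix r r
  have hlawx := isLaw_selLaw n (p := 1 - q) (by linarith) (by linarith)
  have hn0 : 0 < n := u.pos
  have hn0' : (0 : ℝ) < n := by exact_mod_cast hn0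
  have hR := unrated_nonempty hn0 hO (by linarith)
  set T' := max T 1 with hT'
  have hT'0 : (0 : ℝ) < (T' : ℝ) := by
    have : 0 < T' := lt_of_lt_of_le one_pos (le_max_right T 1)
    exact_mod_cast this
  have hT'q : T' * q ≤ x * q := mul_le_mul_of_nonneg_right hTx h0.le
  have hpt : ∀ χ y, 1 / 2 - 8 * δ - 3 * n * (x * q) ^ 2 - ind (¬ Balanced χ (A u) δ) -
      ind (δ * T < mult A (chosen A B u T eu χ y) (A u)) ≤
      winProb q B (unrated eu) (likes A B u T eu χ y)
        (Finset.univ.filter fun j => χ (A u) (B j) = v) := by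
    intro χ y
    have hw := winProb_nonneg (R := unrated eu) (B := B) h0.le h1 (likes A B u T eu χ y)
      (Finset.univ.filter fun j => χ (A u) (B j) = v)
    have hx2 : 0 ≤ 3 * n * (x * q) ^ 2 := by positivity
    have i1 := ind_nonneg (¬ Balanced χ (A u) δ)
    have i2 := ind_nonneg (δ * T < mult A (chosen A B u T eu χ y) (A u))
    by_cases hχ : Balanced χ (A u) δ
    · by_cases hm : δ * T < mult A (chosen A B u T eu χ y) (A u)
      · rw [ind_of hm]
        linarith
      · set S := chosen A B u T eu χ y with hS
        have hm' := not_lt.1 hm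
        have hcard : T ≤ S.card + 1 := le_card_chosen_add_one hT
        have hmS : (mult A S (A u) : ℝ) ≤ 2 * δ * S.card := by
          have c1 : (T : ℝ) ≤ S.card + 1 := by exact_mod_cast hcard
          rcases Nat.eq_zero_or_pos S.card with hz | hz
          · rw [hz] at c1 ⊢
            have c2 : (mult A S (A u) : ℝ) < 1 := by
              push_cast at c1
              nlinarith
            have c3 : mult A S (A u) = 0 := by
              have : mult A S (A u) < 1 := by exact_mod_cast c2
              omega
            rw [c3]; simp
          · have c2 : (1 : ℝ) ≤ S.card := by exact_mod_cast hz
            nlinarith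
        obtain ⟨v1, v2⟩ := hχ.votes hδ0 hδ hnk hB hO hmS v
        have key := le_expec_share_of_few h0.le h1 hR (N := likes A B u T eu χ y) (T := T')
          (fun b => by
            rw [likes_eq_likers]
            exact (Finset.card_filter_le _ _).trans (card_chosen_le.trans (le_max_left _ _)))
          (max_le hT hn0) (by positivity) (hT'q.trans hx)
          (Finset.univ.filter fun j => χ (A u) (B j) = v) v1 v2
        have sq1 : (T' * q) ^ 2 ≤ (x * q) ^ 2 := pow_le_pow_left₀ (by positivity) hT'q 2
        have sq2 := mul_le_mul_of_nonneg_left sq1 (by positivity : (0 : ℝ) ≤ 3 * n)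
        linarith
    · rw [ind_of hχ]
      linarith
  have h := expec_mono hlaw fun χ => expec_mono hlawx fun y => hpt χ y
  simp only [expec_sub, expec_const hlaw, expec_const hlawx] at h
  have hb := prob_not_balanced (δ := δ) hr (A u) hδ0
  unfold verdictGiven
  linarith

/-- It is unlikely that a row of the cluster `a` has rated one of few columns. -/
theorem prob_hit_in_cluster (h0 : 0 ≤ q) (h1 : q ≤ 1)
    (hA : ∀ a, (Finset.univ.filter fun i => A i = a).card = k) (a : Fin r) (K : Finset (Fin n)) :
    expec (matLaw n n (1 - q)) (fun E => ind (∃ i, A i = a ∧ ∃ l ∈ K, E i l = false)) ≤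
      k * (K.card * q) := by
  have hlawE : IsLaw (matLaw n n (1 - q)) := isLaw_matLaw n n (by linarith) (by linarith)
  have hrow : IsLaw (coins (Fin n) (1 - q)) := isLaw_coins (by linarith) (by linarith)
  have hpt : ∀ E : Fin n → Fin n → Bool, ind (∃ i, A i = a ∧ ∃ l ∈ K, E i l = false) ≤
      ∑ i ∈ Finset.univ.filter (fun i => A i = a), ∑ l ∈ K, ind (E i l = false) := fun E => by
    refine ind_le_of (Finset.sum_nonneg fun i _ => Finset.sum_nonneg fun l _ => ind_nonneg _) ?_
    rintro ⟨i, hi, l, hl, hE⟩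
    have e1 := Finset.single_le_sum (f := fun l => ind (E i l = false))
      (fun l _ => ind_nonneg _) hl
    have hi' : i ∈ Finset.univ.filter (fun i => A i = a) :=
      Finset.mem_filter.2 ⟨Finset.mem_univ i, hi⟩
    have e2 := Finset.single_le_sum (f := fun i => ∑ l ∈ K, ind (E i l = false))
      (fun i _ => Finset.sum_nonneg fun l _ => ind_nonneg _) hi'
    rw [ind_of hE] at e1
    exact e1.trans e2
  refine (expec_mono hlawE hpt).trans ?_
  rw [expec_sum]
  have hi : ∀ i ∈ Finset.univ.filter (fun i => A i = a), expec (matLaw n n (1 - q)) (fun E =>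
      ∑ l ∈ K, ind (E i l = false)) ≤ K.card * q := by
    intro i _
    rw [expec_sum, ← nsmul_eq_mul]
    refine Finset.sum_le_card_nsmul _ _ _ fun l _ => ?_
    rw [← expec_update _ i _ hrow]
    simp only [Function.update_self]
    rw [expec_const hlawE,
      expec_coins_eval (1 - q) (by linarith) (by linarith) l fun v => ind (v = false)]
    rw [ind_of_not (by simp), ind_of rfl]
    linarith
  refine (Finset.sum_le_card_nsmul _ _ _ hi).trans (le_of_eq ?_)
  rw [hA, nsmul_eq_mul]

/-- If no row in the cluster of `u` has rated one of the columns rated by `u`, then the selected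
rows in the cluster of `u` belong to a uniformly random selection. -/
theorem prob_mult_chosen_of_few_rated (h0 : 0 ≤ q) (h1 : q ≤ 1) (hn : 6 ≤ n) (hnk : n = r * k)
    (hA : ∀ a, (Finset.univ.filter fun i => A i = a).card = k) (hδ : 0 < δ) :
    expec (selLaw n (1 - q)) (fun x => ind (δ * T < mult A (chosen A B u T eu χ x) (A u))) ≤
      k * ((rated eu).card * q) + 2 / (δ * r) := by
  have hlawE : IsLaw (matLaw n n (1 - q)) := isLaw_matLaw n n (by linarith) (by linarith)
  have hπ := isLaw_prioLaw n
  have hk0 : 0 < k := Nat.pos_of_ne_zero fun h => by rw [h] at hnk; omega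
  have hr0 : 0 < r := Nat.pos_of_ne_zero fun h => by rw [h] at hnk; omega
  have hk0' : (0 : ℝ) < k := by exact_mod_cast hk0
  have hr0' : (0 : ℝ) < r := by exact_mod_cast hr0
  set S : Equiv.Perm (Fin n) → Finset (Fin n) := fun π => topRows (fun _ => 0) π T with hS
  have m1 := expec_mult_le (u := u) (S := S) (G := fun _ => True) hπ hA
    (p := 2 * T / n) (by positivity) (A u) fun i _ _ => by
      have h2 := prob_mem_topRows_zero_le hn T u (Z := ∅) (Finset.notMem_empty i) (by simp)
      simpa [expec_const hπ, ind_of trivial] using h2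
  simp only [ind_of trivial, one_mul] at m1
  have c1 : (k * (2 * T / n) : ℝ) = 2 * (T / r) := by
    rw [hnk]; push_cast; field_simp
  rw [c1] at m1
  have hM : expec (prioLaw n) (fun π => ind (δ * T < mult A ((S π).erase u) (A u))) ≤
      2 / (δ * r) := by
    rcases Nat.eq_zero_or_pos T with hT | hT
    · refine expec_le_of_le hπ fun π => ?_
      rw [ind_of_not]
      · positivity
      · rw [not_lt]
        have h2 : (mult A ((S π).erase u) (A u)) ≤ T := by
          refine (Finset.card_filter_le _ _).trans ((Finset.card_erase_le).trans ?_)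
          rw [hS]
          dsimp only
          rw [card_topRows]
          exact min_le_left _ _
        have h3 : mult A ((S π).erase u) (A u) = 0 := by omega
        rw [h3]
        push_cast
        positivity
    · have hT' : (0 : ℝ) < T := by exact_mod_cast hT
      refine (expec_ind_le (f := fun π => (mult A ((S π).erase u) (A u) : ℝ)) (c := δ * T) hπ
        (by positivity) (fun x => Nat.cast_nonneg _) (fun x hx => hx.le)).trans ?_
      refine (div_le_div_of_nonneg_right m1 (by positivity)).trans (le_of_eq ?_)
      field_simp
  have hpt : ∀ E π, ind (δ * T < mult A (chosen A B u T eu χ (E, π)) (A u)) ≤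
      ind (∃ i, A i = A u ∧ ∃ l ∈ rated eu, E i l = false) +
        ind (δ * T < mult A ((S π).erase u) (A u)) := by
    intro E π
    refine le_trans (ind_mono fun h => ?_) (ind_or_le _ _)
    by_contra hc
    push Not at hc
    refine absurd (h.trans_le ?_) (not_lt.2 hc.2)
    have : mult A (chosen A B u T eu χ (E, π)) (A u) ≤ mult A ((S π).erase u) (A u) := by
      refine Finset.card_le_card fun i hi => ?_
      obtain ⟨h1, h2⟩ := Finset.mem_filter.1 hi
      obtain ⟨hiu, h3⟩ := Finset.mem_erase.1 h1
      refine Finset.mem_filter.2 ⟨Finset.mem_erase.2 ⟨hiu, mem_topRows_zero h3 ?_⟩, h2⟩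
      rw [score_of_ne _ hiu, Finset.card_eq_zero, Finset.filter_eq_empty_iff]
      intro l hl hE
      exact hc.1 i h2 l (agree_subset_rated _ _ _ _ _ hl) hE
    exact_mod_cast this
  unfold selLaw
  rw [expec_pairLaw]
  refine (expec_mono hlawE fun E => expec_mono hπ fun π => hpt E π).trans ?_
  simp only [expec_add, expec_const hπ, expec_const hlawE]
  have := prob_hit_in_cluster h0 h1 hA (A u) (rated eu)
  linarith

end Few

/-! ### Large parameters -/

/-- The inequalities between the parameters that hold if `n` and `r` are large. The scale `z` is a
small power of `n`, and `L` is the root of order `20` of `r`; `C` is the constant in `Diverse`. -/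
structure Large (n r : ℕ) (q z L C C' η : ℝ) : Prop where
  η_pos : 0 < η
  η_le : η ≤ 1 / 16
  C_nonneg : 0 ≤ C
  one_le_C' : 1 ≤ C'
  q_pos : 0 < q
  q_le : q ≤ 1
  le_z : 128 * C' ≤ z
  two_votes : 3 * n * (z ^ 9 * q) ^ 2 ≤ η
  markov : (416 * C' + 2 * C) / z ≤ η
  tail : n * (2 * n ^ 3 * Real.exp (-(z / 2)) + (3 * Real.exp (-(z / 2)) +
    2 * Real.exp (-(z / (256 * (C' ^ 2 + 1))))) + Real.exp (-(z / 16))) ≤ η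
  le_n : C' ≤ η * n
  le_L : 128 * C' ≤ L
  r_eq : (r : ℝ) = L ^ 20
  many_rows : 2 * C / L + r * (4 * Real.exp (-(L ^ 3 / (512 * (C' ^ 2 + 1))))) ≤ η
  tilt : Real.exp (1 / L ^ 2) ≤ 1 + η
  balanced : r * (4 * Real.exp (-(η ^ 2 * r / 2))) ≤ η
  cluster : (C + C') / (η * r) ≤ η

/-- Either few votes are observed or many rows are selected, and `τ₀` is small on the respective
scale: in the former case it is unlikely that one of the `T * q + z` votes for a column is lost if
`τ₀` of the `T` voters are, and in the latter case `τ₀` is at most a small power of `r` times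
`T / r`. -/
def Spread (r T : ℕ) (q z L C' : ℝ) (τ₀ : ℕ) : Prop :=
  (T * q * z ^ 4 ≤ C' * r ∧ z ^ 4 ≤ r ∧ τ₀ * (T * q + z) * z ≤ C' * T) ∨
    (r ≤ T ∧ (τ₀ : ℝ) ≤ C' * L * (T / r))

section Large

variable {n r k : ℕ} {A B : Fin n → Fin r} {u : Fin n} {T : ℕ} {eu : Fin n → Bool}
  {q z L C C' η : ℝ}

namespace Large

theorem one_le_z (h : Large n r q z L C C' η) : 1 ≤ z := by
  linarith [h.le_z, h.one_le_C']

theorem n_pos (h : Large n r q z L C C' η) : 0 < n := by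
  refine Nat.pos_of_ne_zero fun hn => ?_
  have h1 := h.le_n
  have h2 := h.one_le_C'
  rw [hn] at h1
  simp only [Nat.cast_zero, mul_zero] at h1
  linarith

theorem r_pos (h : Large n r q z L C C' η) : 0 < r := by
  have h1 : (0 : ℝ) < r := by
    have : 0 < L := by linarith [h.le_L, h.one_le_C']
    rw [h.r_eq]
    positivity
  exact_mod_cast h1

theorem exp_le (h : Large n r q z L C C' η) : n * (3 * Real.exp (-(z / 2))) ≤ η := by
  refine le_trans (mul_le_mul_of_nonneg_left ?_ (Nat.cast_nonneg n)) h.tail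
  have e1 : 0 ≤ 2 * (n : ℝ) ^ 3 * Real.exp (-(z / 2)) := by positivity
  have e2 := Real.exp_pos (-(z / (256 * (C' ^ 2 + 1))))
  have e3 := Real.exp_pos (-(z / 16))
  linarith

theorem pow_mul_q_le (h : Large n r q z L C C' η) : z ^ 9 * q ≤ 1 := by
  have h1 := h.two_votes
  have h2 : (1 : ℝ) ≤ n := by exact_mod_cast h.n_pos
  have h3 := h.η_le
  by_contra hc
  have h4 : 1 < (z ^ 9 * q) ^ 2 := one_lt_pow₀ (not_le.1 hc) (by norm_num)
  have h5 : 1 * 1 ≤ (n : ℝ) * (z ^ 9 * q) ^ 2 :=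
    mul_le_mul h2 h4.le (by norm_num) (by linarith)
  linarith

/-- If more than `z ^ 9` rows are selected, then either few votes are observed and losses are not
noticed, or there are many rows and tilting a column compensates for the losses. -/
theorem le_verdictGiven_of_diverse (h : Large n r q z L C C' η) (hr : r ≤ n) (hT : T ≤ n)
    (hzT : z ^ 9 < T) (hO : ((rated eu).card : ℝ) ≤ η * n) {τ₀ : ℕ} {δ e : ℝ}
    (hdiv : Diverse A B q u T eu τ₀ δ e C) (hδ0 : 0 ≤ δ) (hδ : δ ≤ Real.exp (-(z / 2)))
    (he : e ≤ η) (hs : Spread r T q z L C' τ₀) (v : Bool) :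
    1 / 2 - 3 * η ≤ verdictGiven A B q u T v eu := by
  have hz1 := h.one_le_z
  have hη := h.η_pos
  have hη1 := h.η_le
  have hC'1 := h.one_le_C'
  have hR := unrated_nonempty h.n_pos hO (by linarith)
  have hzT4 : z ^ 4 ≤ T := (pow_le_pow_right₀ hz1 (by norm_num)).trans hzT.le
  rcases hs with ⟨s1, s2, s3⟩ | ⟨s1, s2⟩
  · have key := le_verdictGiven_of_diverse_of_few_votes h.q_pos.le h.q_le hR hT h.r_pos hr hdiv
      h.C_nonneg hδ0 hC'1 (by linarith [h.le_z]) s1 s2 hzT4 s3 v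
    have h1 := h.tail
    have h2 := h.markov
    have h3 := mul_le_mul_of_nonneg_left hδ (Nat.cast_nonneg (α := ℝ) n)
    linarith
  · have key := le_verdictGiven_of_diverse_of_many_rows h.q_pos.le h.q_le hR hT hdiv
      h.C_nonneg hδ0 hC'1 h.le_L h.r_eq s1 s2 v
    have h1 := h.many_rows
    have h2 : r * (3 * δ) ≤ η := by
      refine le_trans ?_ h.exp_le
      have : (r : ℝ) ≤ n := by exact_mod_cast hr
      exact mul_le_mul this (by linarith) (by positivity) (Nat.cast_nonneg _)
    by_contra hc
    have h3 := not_le.1 hc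
    have hexp := Real.exp_pos (1 / L ^ 2)
    have h5 : Real.exp (1 / L ^ 2) * verdictGiven A B q u T v eu ≤
        Real.exp (1 / L ^ 2) * (1 / 2 - 3 * η) := mul_le_mul_of_nonneg_left h3.le hexp.le
    have h6 : Real.exp (1 / L ^ 2) * (1 / 2 - 3 * η) ≤ (1 + η) * (1 / 2 - 3 * η) :=
      mul_le_mul_of_nonneg_right h.tilt (by linarith)
    have h7 : (1 + η) * (1 / 2 - 3 * η) = 1 / 2 - 5 / 2 * η - 3 * η ^ 2 := by ring
    have h8 : 0 < η ^ 2 := by positivity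
    linarith

/-- If at most `z ^ 9` rows are selected, then it is unlikely that some column gets two votes. -/
theorem le_verdictGiven_of_few_rows (h : Large n r q z L C C' η) (hT : T ≤ n) (hzT : T ≤ z ^ 9)
    (hnk : n = r * k) (hB : ∀ b, (Finset.univ.filter fun j => B j = b).card = k)
    (hO : ((rated eu).card : ℝ) ≤ η * n) {g : ℝ}
    (hg : expec (matLaw r r (1 / 2)) (fun χ => expec (selLaw n (1 - q)) fun y =>
      ind (η * T < mult A (chosen A B u T eu χ y) (A u))) ≤ g) (v : Bool) :
    1 / 2 - 10 * η - g ≤ verdictGiven A B q u T v eu := by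
  have key := PAF.le_verdictGiven_of_few_rows h.q_pos h.q_le h.r_pos hT hnk hB h.η_pos.le h.η_le hO
    (x := z ^ 9) (by
      push_cast
      exact max_le hzT (one_le_pow₀ h.one_le_z)) h.pow_mul_q_le hg v
  have h1 := h.two_votes
  have h2 := h.balanced
  linarith

end Large

end Large

/-! ### The number of columns rated by a user -/

section Rated

variable {n r k : ℕ} {A B : Fin n → Fin r} {u : Fin n} {T : ℕ} {q : ℝ}

theorem prob_le_card_rated (h0 : 0 ≤ q) (h1 : q ≤ 1) (K : Finset (Fin n)) {x s : ℝ}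
    (hx : K.card * q ≤ x) :
    expec (coins (Fin n) (1 - q)) (fun eu =>
      ind (2 * x + s < (K.filter fun l => eu l = false).card)) ≤ Real.exp (-(s / 2)) := by
  have hlaw : IsLaw (coins (Fin n) (1 - q)) := isLaw_coins (by linarith) (by linarith)
  refine (expec_mono hlaw fun eu => ind_mono fun h => ?_).trans
    ((tail_count_two h0 h1 K ⌈2 * x + s⌉₊).trans ?_)
  · exact Nat.ceil_le.2 h.le
  · refine exp_div_two_pow_le ?_
    have := Nat.le_ceil (2 * x + s)
    linarith

theorem prob_card_rated_lt (h0 : 0 ≤ q) (h1 : q ≤ 1) (K : Finset (Fin n)) :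
    expec (coins (Fin n) (1 - q)) (fun eu =>
      ind (((K.filter fun l => eu l = false).card : ℝ) < K.card * q / 4)) ≤
      Real.exp (-(K.card * q / 4)) := by
  have hlaw : IsLaw (coins (Fin n) (1 - q)) := isLaw_coins (by linarith) (by linarith)
  have hM := expec_ind_le (w := coins (Fin n) (1 - q))
    (P := fun eu => ((K.filter fun l => eu l = false).card : ℝ) < K.card * q / 4)
    (f := fun eu => (1 / 2 : ℝ) ^ (K.filter fun l => eu l = false).card)
    (c := Real.exp (-(K.card * q / 4))) hlaw (Real.exp_pos _) (fun eu => by positivity)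
    (fun eu h => by
      have e1 : Real.exp (-1) ≤ 1 / 2 := by
        have e2 := Real.add_one_le_exp 1
        rw [Real.exp_neg, ← one_div]
        exact one_div_le_one_div_of_le (by norm_num) (by linarith)
      refine le_trans ?_ (pow_le_pow_left₀ (Real.exp_pos _).le e1 _)
      rw [← Real.exp_nat_mul, Real.exp_le_exp]
      linarith)
  refine hM.trans ?_
  rw [expec_coins_pow, div_le_iff₀ (Real.exp_pos _), ← Real.exp_add]
  have e1 : 1 - q + (1 - (1 - q)) * (1 / 2) ≤ Real.exp (-(q / 2)) := by
    have := Real.add_one_le_exp (-(q / 2))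
    linarith
  refine (pow_le_pow_left₀ (by linarith) e1 _).trans ?_
  rw [← Real.exp_nat_mul, Real.exp_le_exp]
  linarith

end Rated

/-! ### The scales of the selection -/

section Scales

variable {n r T : ℕ} {q z L C₃ C' y : ℝ} {τ₀ : ℕ}

theorem mul_ceil_le {a x y z : ℝ} {τ : ℕ} (hz : 1 ≤ z) (ha : 0 ≤ a) (hy : 0 ≤ y)
    (hτ : τ = ⌈y + z⌉₊) (h : y * a + 2 * z * a ≤ x) : τ * a ≤ x := by
  have h1 := Nat.ceil_lt_add_one (show 0 ≤ y + z by linarith)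
  have h2 : (τ : ℝ) ≤ y + 2 * z := by rw [hτ]; linarith
  have h3 := mul_le_mul_of_nonneg_right h2 ha
  linarith

/-- The scale of the rows that notice a change in a column cluster, if each of the column
clusters has been rated. -/
theorem spread_of_many_ratings (hr : 0 < r) (hq : 0 < q) (hz : 1 ≤ z) (hzT : z ^ 9 < T)
    (hqz : z ^ 9 * q ≤ 1) (hC₃ : 1 ≤ C₃) (hC' : 12 * C₃ + 8 ≤ C') (hL : 1 ≤ L)
    (hy : y = 6 * C₃ * (T / r)) (hτ : τ₀ = ⌈y + z⌉₊) : Spread r T q z L C' τ₀ := by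
  have hr' : (0 : ℝ) < r := by exact_mod_cast hr
  have hT0 : (0 : ℝ) < T := lt_of_le_of_lt (by positivity) hzT
  have hy0 : 0 ≤ y := by rw [hy]; positivity
  have hz0 : 0 < z := by linarith
  have hyr : y * r = 6 * C₃ * T := by rw [hy]; field_simp
  have pz : ∀ i : ℕ, i ≤ 9 → z ^ i ≤ z ^ 9 := fun i hi => pow_le_pow_right₀ hz hi
  have qz : ∀ i : ℕ, i ≤ 9 → z ^ i * q ≤ 1 := fun i hi =>
    (mul_le_mul_of_nonneg_right (pz i hi) hq.le).trans hqz
  have hCT : 12 * C₃ * T + 8 * T ≤ C' * T := by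
    have := mul_le_mul_of_nonneg_right hC' hT0.le
    linarith
  by_cases hA : T * q * z ^ 4 ≤ r ∧ z ^ 4 ≤ r
  · refine Or.inl ⟨?_, hA.2, ?_⟩
    · have : 1 * (r : ℝ) ≤ C' * r := mul_le_mul_of_nonneg_right (by linarith) hr'.le
      linarith [hA.1]
    · rw [mul_assoc]
      refine mul_ceil_le hz (by positivity) hy0 hτ ?_
      have a1 : y * (T * q * z) ≤ y * r := by
        refine mul_le_mul_of_nonneg_left (le_trans ?_ hA.1) hy0
        exact mul_le_mul_of_nonneg_left (le_self_pow₀ hz (by norm_num)) (by positivity)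
      have a2 : y * z ^ 2 ≤ y * r := by
        refine mul_le_mul_of_nonneg_left (le_trans ?_ hA.2) hy0
        exact pow_le_pow_right₀ hz (by norm_num)
      have a3 : T * (z ^ 2 * q) ≤ T * 1 := mul_le_mul_of_nonneg_left (qz 2 (by norm_num)) hT0.le
      have a4 := (pz 3 (by norm_num)).trans hzT.le
      have a5 : y * ((T * q + z) * z) + 2 * z * ((T * q + z) * z) =
          y * (T * q * z) + y * z ^ 2 + 2 * (T * (z ^ 2 * q)) + 2 * z ^ 3 := by ring
      rw [a5]
      linarith
  · set s : ℝ := T / r with hs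
    have hs0 : 0 < s := by positivity
    have hsT : s * r = T := by rw [hs]; field_simp
    have hzs : z ≤ s ∧ (r : ℝ) ≤ T := by
      rcases le_or_gt (z ^ 4) (r : ℝ) with h4 | h4
      · have h5 : (r : ℝ) < T * q * z ^ 4 := not_le.1 fun h => hA ⟨h, h4⟩
        have h6 : 1 ≤ s * (z ^ 4 * q) := by
          have e1 : 1 * (r : ℝ) < s * (z ^ 4 * q) * r := by
            have : s * (z ^ 4 * q) * r = s * r * q * z ^ 4 := by ring
            rw [this, hsT]
            linarith
          exact (lt_of_mul_lt_mul_right e1 hr'.le).le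
        constructor
        · have e1 : z * 1 ≤ z * (s * (z ^ 4 * q)) := mul_le_mul_of_nonneg_left h6 hz0.le
          have e2 : s * (z ^ 5 * q) ≤ s * 1 := mul_le_mul_of_nonneg_left (qz 5 (by norm_num)) hs0.le
          have e3 : z * (s * (z ^ 4 * q)) = s * (z ^ 5 * q) := by ring
          linarith
        · have e1 : T * (z ^ 4 * q) ≤ T * 1 := mul_le_mul_of_nonneg_left (qz 4 (by norm_num)) hT0.le
          have e2 : T * (z ^ 4 * q) = T * q * z ^ 4 := by ring
          linarith
      · have e1 : z * r ≤ z * z ^ 4 := mul_le_mul_of_nonneg_left h4.le hz0.le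
        have e2 : z * z ^ 4 = z ^ 5 := by ring
        have e3 := pz 5 (by norm_num)
        have e4 := pz 4 (by norm_num)
        refine ⟨?_, by linarith⟩
        rw [hs, le_div_iff₀ hr']
        linarith
    refine Or.inr ⟨by exact_mod_cast hzs.2, ?_⟩
    rw [← mul_one (τ₀ : ℝ)]
    refine mul_ceil_le hz (by norm_num) hy0 hτ ?_
    have e1 : C' * 1 ≤ C' * L := mul_le_mul_of_nonneg_left hL (by linarith)
    have e2 := mul_le_mul_of_nonneg_right e1 hs0.le
    have e3 := mul_le_mul_of_nonneg_right hC' hs0.le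
    have e4 : 0 ≤ C₃ * s := by positivity
    rw [hy]
    linarith [hzs.1]

/-- The scale of the rows that notice a change in a column cluster, if most of the column clusters
have not been rated. The two choices are the scale from the scores and the scale of the number of
all rows that have rated one of the relevant columns. -/
theorem spread_of_few_ratings (hr : 0 < r) (hn : 0 < n) (hq : 0 < q) (hz : 1 ≤ z) (hzT : z ^ 9 < T)
    (hqz : z ^ 9 * q ≤ 1) (hnqz : n * (z ^ 9 * q) ^ 2 ≤ 1) (hnq : z ^ 5 ≤ n * q)
    (hnr : n * q ≤ r * z) (hC₃ : 1 ≤ C₃) (hC' : 12 * C₃ + 8 ≤ C') (hL : 1 ≤ L) :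
    Spread r T q z L C' ⌈6 * C₃ * (z * T / (n * q)) + z⌉₊ ∨
      Spread r T q z L C' ⌈6 * z * (n * q) + z⌉₊ := by
  have hr' : (0 : ℝ) < r := by exact_mod_cast hr
  have hn' : (0 : ℝ) < n := by exact_mod_cast hn
  have hT0 : (0 : ℝ) < T := lt_of_le_of_lt (by positivity) hzT
  have hz0 : 0 < z := by linarith
  have pz : ∀ i : ℕ, i ≤ 9 → z ^ i ≤ z ^ 9 := fun i hi => pow_le_pow_right₀ hz hi
  have qz : ∀ i : ℕ, i ≤ 9 → z ^ i * q ≤ 1 := fun i hi =>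
    (mul_le_mul_of_nonneg_right (pz i hi) hq.le).trans hqz
  have nz : ∀ i : ℕ, i ≤ 18 → n * q ^ 2 * z ^ i ≤ 1 := fun i hi => by
    refine le_trans ?_ hnqz
    have e1 : n * (z ^ 9 * q) ^ 2 = n * q ^ 2 * z ^ 18 := by ring
    rw [e1]
    exact mul_le_mul_of_nonneg_left (pow_le_pow_right₀ hz hi) (by positivity)
  have hCT : 12 * C₃ * T + 8 * T ≤ C' * T := by
    have := mul_le_mul_of_nonneg_right hC' hT0.le
    linarith
  have hC₃T : 1 * (T : ℝ) ≤ C₃ * T := mul_le_mul_of_nonneg_right hC₃ hT0.le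
  have hzr : z ^ 4 ≤ r := by
    have e1 : z ^ 4 * z ≤ r * z := by
      have : z ^ 4 * z = z ^ 5 := by ring
      linarith
    exact le_of_mul_le_mul_right e1 hz0
  have a3 : T * (z ^ 2 * q) ≤ T * 1 := mul_le_mul_of_nonneg_left (qz 2 (by norm_num)) hT0.le
  have a4 := (pz 3 (by norm_num)).trans hzT.le
  have a5 : ∀ y : ℝ, y * ((T * q + z) * z) + 2 * z * ((T * q + z) * z) =
      y * (T * q * z) + y * z ^ 2 + 2 * (T * (z ^ 2 * q)) + 2 * z ^ 3 := fun y => by ring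
  by_cases hA : T * q * z ^ 4 ≤ r
  · have hA' : T * q * z ^ 4 ≤ C' * r := by
      have : 1 * (r : ℝ) ≤ C' * r := mul_le_mul_of_nonneg_right (by linarith) hr'.le
      linarith
    rcases le_or_gt (T * z ^ 4 : ℝ) n with hTn | hTn
    · refine Or.inl (Or.inl ⟨hA', hzr, ?_⟩)
      rw [mul_assoc]
      set y := 6 * C₃ * (z * T / (n * q)) with hy
      have hy0 : 0 ≤ y := by positivity
      refine mul_ceil_le hz (by positivity) hy0 rfl ?_
      have hynq : y * (n * q) = 6 * C₃ * T * z := by rw [hy]; field_simp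
      have b1 : y * (T * q * z) ≤ 6 * C₃ * T := by
        have c1 : T * q * z * z ≤ n * q := by
          have c2 : T * z ^ 2 ≤ (n : ℝ) := le_trans
            (mul_le_mul_of_nonneg_left (pow_le_pow_right₀ hz (by norm_num)) hT0.le) hTn
          have c3 := mul_le_mul_of_nonneg_right c2 hq.le
          have c4 : T * q * z * z = T * z ^ 2 * q := by ring
          linarith
        have c5 := mul_le_mul_of_nonneg_left c1 hy0
        have c6 : y * (T * q * z * z) = y * (T * q * z) * z := by ring
        exact le_of_mul_le_mul_right (by linarith) hz0
      have b2 : y * z ^ 2 ≤ 6 * C₃ * T := by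
        have c1 : z ^ 2 * z ≤ n * q := by
          have : z ^ 2 * z = z ^ 3 := by ring
          rw [this]
          exact (pow_le_pow_right₀ hz (by norm_num)).trans hnq
        have c5 := mul_le_mul_of_nonneg_left c1 hy0
        have c6 : y * (z ^ 2 * z) = y * z ^ 2 * z := by ring
        exact le_of_mul_le_mul_right (by linarith) hz0
      rw [a5]
      linarith
    · refine Or.inr (Or.inl ⟨hA', hzr, ?_⟩)
      rw [mul_assoc]
      refine mul_ceil_le hz (by positivity) (by positivity) rfl ?_
      rw [a5]
      have b1 : 6 * z * (n * q) * (T * q * z) ≤ 6 * T := by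
        have c1 := mul_le_mul_of_nonneg_left (nz 2 (by norm_num)) hT0.le
        have c2 : 6 * z * (n * q) * (T * q * z) = 6 * (T * (n * q ^ 2 * z ^ 2)) := by ring
        linarith
      have b2 : 6 * z * (n * q) * z ^ 2 ≤ 6 * T := by
        have c1 := mul_le_mul_of_nonneg_right hTn.le (by positivity : 0 ≤ q * z ^ 3)
        have c2 := mul_le_mul_of_nonneg_left (qz 7 (by norm_num)) hT0.le
        have c3 : 6 * z * (n * q) * z ^ 2 = 6 * (n * (q * z ^ 3)) := by ring
        have c4 : T * z ^ 4 * (q * z ^ 3) = T * (z ^ 7 * q) := by ring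
        linarith
      linarith
  · refine Or.inr (Or.inr ?_)
    have h5 := not_le.1 hA
    set s : ℝ := T / r with hs
    have hs0 : 0 < s := by positivity
    have hsT : s * r = T := by rw [hs]; field_simp
    have h6 : 1 ≤ s * (z ^ 4 * q) := by
      have e1 : 1 * (r : ℝ) < s * (z ^ 4 * q) * r := by
        have : s * (z ^ 4 * q) * r = s * r * q * z ^ 4 := by ring
        rw [this, hsT]
        linarith
      exact (lt_of_mul_lt_mul_right e1 hr'.le).le
    constructor
    · have e1 : T * (z ^ 4 * q) ≤ T * 1 := mul_le_mul_of_nonneg_left (qz 4 (by norm_num)) hT0.le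
      have e2 : T * (z ^ 4 * q) = T * q * z ^ 4 := by ring
      have : (r : ℝ) ≤ T := by linarith
      exact_mod_cast this
    · rw [← mul_one (⌈6 * z * (n * q) + z⌉₊ : ℝ)]
      refine mul_ceil_le hz (by norm_num) (by positivity) rfl ?_
      have e1 : C' * 1 ≤ C' * L := mul_le_mul_of_nonneg_left hL (by linarith)
      have e2 := mul_le_mul_of_nonneg_right e1 hs0.le
      have e3 : 8 * s ≤ C' * s := mul_le_mul_of_nonneg_right (by linarith) hs0.le
      have f1 : z * 1 ≤ z * (s * (z ^ 4 * q)) := mul_le_mul_of_nonneg_left h6 hz0.le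
      have f2 : s * (z ^ 5 * q) ≤ s * 1 := mul_le_mul_of_nonneg_left (qz 5 (by norm_num)) hs0.le
      have f3 : z * (s * (z ^ 4 * q)) = s * (z ^ 5 * q) := by ring
      have g1 : 6 * z * (n * q) * 1 ≤ 6 * z * (n * q) * (s * (z ^ 4 * q)) :=
        mul_le_mul_of_nonneg_left h6 (by positivity)
      have g2 : 6 * z * (n * q) * (s * (z ^ 4 * q)) = 6 * (s * (n * q ^ 2 * z ^ 5)) := by ring
      have g3 := mul_le_mul_of_nonneg_left (nz 5 (by norm_num)) hs0.le
      linarith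

end Scales

/-! ### Both verdicts are about equally likely -/

namespace Large

variable {n r k : ℕ} {A B : Fin n → Fin r} {u : Fin n} {T : ℕ} {eu : Fin n → Bool}
  {q z L C C' η : ℝ}

theorem six_le_n (h : Large n r q z L C C' η) : 6 ≤ n := by
  have h1 : (1 : ℝ) ≤ 1 / 16 * n := by
    have := mul_le_mul_of_nonneg_right h.η_le (Nat.cast_nonneg (α := ℝ) n)
    linarith [h.le_n, h.one_le_C']
  have h2 : (6 : ℝ) ≤ n := by linarith
  exact_mod_cast h2

theorem r_le_n (h : Large n r q z L C C' η) (hnk : n = r * k) : r ≤ n := by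
  have hk : 0 < k := Nat.pos_of_ne_zero fun hk => by
    have := h.n_pos
    rw [hnk, hk] at this
    omega
  rw [hnk]
  exact Nat.le_mul_of_pos_right r hk

theorem r_ge (h : Large n r q z L C C' η) : (128 : ℝ) ≤ r := by
  have h1 : 128 ≤ L := by linarith [h.le_L, h.one_le_C']
  rw [h.r_eq]
  exact h1.trans (le_self_pow₀ (by linarith) (by norm_num))

theorem exp_le_η (h : Large n r q z L C C' η) : Real.exp (-(z / 2)) ≤ η := by
  have h1 : (1 : ℝ) ≤ n := by exact_mod_cast h.n_pos
  have h2 := mul_le_mul_of_nonneg_right h1 (Real.exp_pos (-(z / 2))).le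
  have h3 := h.exp_le
  have h4 := Real.exp_pos (-(z / 2))
  linarith

/-- Users with a bounded number of ratings. -/
theorem le_verdictProb_of_few_rated (h : Large n r q z L 4 C' η) (hnk : n = r * k)
    (hA : ∀ a, (Finset.univ.filter fun i => A i = a).card = k)
    (hB : ∀ b, (Finset.univ.filter fun j => B j = b).card = k) (hT : T ≤ n) {c : ℝ} {K : ℕ}
    (hc : n * q ≤ c) (hK : Real.exp c / 2 ^ K ≤ η) (hC' : 6 + c + 2 * (c * K) + K ≤ C') (v : Bool) :
    1 / 2 - 12 * η ≤ verdictProb A B q u T v := by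
  have h0 := h.q_pos
  have h1 := h.q_le
  have hη := h.η_pos
  have hlaw := isLaw_bitMatrix r r
  have hn0 : (0 : ℝ) < n := by exact_mod_cast h.n_pos
  have hr0 : (0 : ℝ) < r := by exact_mod_cast h.r_pos
  have hz1 := h.one_le_z
  have hzC := h.le_z
  have hC'1 := h.one_le_C'
  have hc0 : 0 ≤ c := le_trans (by positivity) hc
  have hcK : 0 ≤ c * K := by positivity
  have hK0 : (0 : ℝ) ≤ K := Nat.cast_nonneg K
  have hG : expec (coins (Fin n) (1 - q)) (fun eu => ind (¬ (rated eu).card < K)) ≤ η := by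
    have h2 := tail_count_two h0.le h1 (Finset.univ : Finset (Fin n)) K
    rw [Finset.card_univ, Fintype.card_fin] at h2
    refine le_trans (le_trans (le_of_eq ?_) h2) (le_trans ?_ hK)
    · refine congrArg (expec _) (funext fun eu => ind_congr ?_)
      rw [not_lt]
      rfl
    · gcongr
  have key := le_verdictProb (A := A) (B := B) (u := u) (T := T) (v := v) h0.le h1
    (lo := 1 / 2 - 11 * η) (by linarith) hG ?_
  · linarith
  intro eu heu
  have hOK : ((rated eu).card : ℝ) ≤ K := by exact_mod_cast heu.le
  have hO : ((rated eu).card : ℝ) ≤ η * n := by linarith [h.le_n]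
  have hnO : n * ((rated eu).card * q) ≤ c * K := by
    have := mul_le_mul hc hOK (Nat.cast_nonneg _) hc0
    linarith
  rcases le_or_gt (T : ℝ) (z ^ 9) with hTz | hTz
  · have hg : expec (matLaw r r (1 / 2)) (fun χ => expec (selLaw n (1 - q)) fun y =>
        ind (η * T < mult A (chosen A B u T eu χ y) (A u))) ≤ η := by
      refine expec_le_of_le hlaw fun χ => ?_
      refine (prob_mult_chosen_of_few_rated h0.le h1 h.six_le_n hnk hA hη).trans
        (le_trans ?_ h.cluster)
      rw [add_comm, ← sub_nonneg, ← sub_sub, ← sub_div, sub_nonneg, le_div_iff₀ (by positivity)]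
      have e1 : k * ((rated eu).card * q) * (η * r) = η * (n * ((rated eu).card * q)) := by
        have e3 : (n : ℝ) = r * k := by exact_mod_cast hnk
        rw [e3]; ring
      have e2 : η * (n * ((rated eu).card * q)) ≤ 1 * (c * K) :=
        mul_le_mul (by linarith [h.η_le]) hnO (by positivity) (by norm_num)
      rw [e1]
      linarith
    have := h.le_verdictGiven_of_few_rows hT hTz hnk hB hO hg v
    linarith
  · have hT0 : 0 < T := by
      have : (0 : ℝ) < T := lt_of_le_of_lt (by positivity) hTz
      exact_mod_cast this
    set τ₀ := ⌈2 * (c * K) + z⌉₊ with hτ₀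
    have hdiv := diverse_of_few_rated (B := B) (u := u) (eu := eu) h0.le h1 h.six_le_n hnk hA hT0 τ₀
    have hceil := Nat.le_ceil (2 * (c * K) + z)
    have he : Real.exp (n * ((rated eu).card * q)) / 2 ^ τ₀ ≤ η :=
      (exp_div_two_pow_le (z := z) (by linarith)).trans h.exp_le_η
    have := h.le_verdictGiven_of_diverse (h.r_le_n hnk) hT hTz hO hdiv le_rfl
      (Real.exp_pos _).le he ?_ v
    · linarith
    have hz0 : 0 < z := by linarith
    have hT0' : (0 : ℝ) < T := by exact_mod_cast hT0
    have hTq : T * q ≤ c := by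
      refine le_trans (mul_le_mul_of_nonneg_right ?_ h0.le) hc
      exact_mod_cast hT
    have hτz : (τ₀ : ℝ) ≤ 3 * z := by
      have := Nat.ceil_lt_add_one (show 0 ≤ 2 * (c * K) + z by positivity)
      linarith
    rcases le_or_gt (z ^ 4) (r : ℝ) with h4 | h4
    · refine Or.inl ⟨?_, h4, ?_⟩
      · exact mul_le_mul (by linarith) h4 (by positivity) (by linarith)
      · have e1 : τ₀ * (T * q + z) ≤ 3 * z * (z + z) :=
          mul_le_mul hτz (by linarith) (by positivity) (by positivity)
        have e2 := mul_le_mul_of_nonneg_right e1 hz0.le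
        have e3 : 3 * z * (z + z) * z = 6 * z ^ 3 := by ring
        have e4 : z ^ 3 ≤ z ^ 9 := pow_le_pow_right₀ hz1 (by norm_num)
        have e5 : 6 * (T : ℝ) ≤ C' * T := mul_le_mul_of_nonneg_right (by linarith) hT0'.le
        linarith
    · have hz49 : z ^ 4 ≤ z ^ 9 := pow_le_pow_right₀ hz1 (by norm_num)
      refine Or.inr ⟨?_, ?_⟩
      · have : (r : ℝ) ≤ T := by linarith
        exact_mod_cast this
      · have e1 : z ≤ T / r := by
          rw [le_div_iff₀ hr0]
          have e2 : z * r ≤ z * z ^ 4 := mul_le_mul_of_nonneg_left h4.le hz0.le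
          have e3 : z * z ^ 4 = z ^ 5 := by ring
          have e4 : z ^ 5 ≤ z ^ 9 := pow_le_pow_right₀ hz1 (by norm_num)
          linarith
        have e5 : 3 * 1 ≤ C' * L :=
          mul_le_mul (by linarith) (by linarith [h.le_L]) (by norm_num) (by linarith)
        have e6 : 3 * (T / r : ℝ) ≤ C' * L * (T / r) :=
          mul_le_mul_of_nonneg_right (by linarith) (by positivity)
        linarith

/-- Both verdicts are about equally likely if `u` has rated about as many columns as expected: the
selection is diverse, on one of two possible scales of `τ₀`. -/
theorem le_verdictGiven_of_many_rated {M : ℕ} (h : Large n r q z L (2 * (2 * 16 ^ M) ^ 2) C' η)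
    (hnk : n = r * k)
    (hA : ∀ a, (Finset.univ.filter fun i => A i = a).card = k)
    (hB : ∀ b, (Finset.univ.filter fun j => B j = b).card = k) (hT : T ≤ n)
    (hC' : 12 * (1 + 32 * M) + 8 ≤ C') (hnq : 64 * z ^ 5 ≤ n * q)
    (hxM : n * (3 * (3 * n * q ^ 2) ^ (M + 1)) ≤ η / 6)
    (hr : r * (2 * Real.exp (-(r / 96 : ℝ))) ≤ η / 6)
    (hR1 : n * q / 4 ≤ (rated eu).card) (hR2 : ((rated eu).card : ℝ) ≤ 2 * (n * q) + z)
    (hob : ∀ b, ((ratedIn B eu b).card : ℝ) ≤ 2 * (k * q) + z) (v : Bool) :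
    1 / 2 - 12 * η ≤ verdictGiven A B q u T v eu := by
  have h0 := h.q_pos
  have h1 := h.q_le
  have hη := h.η_pos
  have hη1 := h.η_le
  have hlaw := isLaw_bitMatrix r r
  have hlawx := isLaw_selLaw n (p := 1 - q) (by linarith) (by linarith)
  have hn0 : (0 : ℝ) < n := by exact_mod_cast h.n_pos
  have hr0 : (0 : ℝ) < r := by exact_mod_cast h.r_pos
  have hr128 := h.r_ge
  have hz1 := h.one_le_z
  have hz0 : 0 < z := by linarith
  have hzC := h.le_z
  have hC'1 := h.one_le_C'
  have hk0 : (0 : ℝ) ≤ k := Nat.cast_nonneg _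
  have hnrk : (n : ℝ) = r * k := by rw [hnk]; push_cast; ring
  have hM0 : (0 : ℝ) ≤ M := Nat.cast_nonneg M
  have hz5 : z ≤ z ^ 5 := le_self_pow₀ hz1 (by norm_num)
  have hnq1 : 1 ≤ n * q := by linarith
  have hqz := h.pow_mul_q_le
  have hnqz : n * (z ^ 9 * q) ^ 2 ≤ 1 := by linarith [h.two_votes]
  have hnq2 : 3 * n * q ^ 2 ≤ 1 / 2 := by
    have e1 : 3 * n * (1 * q) ^ 2 ≤ 3 * n * (z ^ 9 * q) ^ 2 := by
      have : 1 ≤ z ^ 9 := one_le_pow₀ hz1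
      gcongr
    rw [one_mul] at e1
    linarith [h.two_votes]
  set R : ℝ := ((rated eu).card : ℝ) with hR
  set ob : ℝ := 2 * (k * q) + z with hob_def
  have hR0 : 0 < R := by linarith
  have hob0 : 0 < ob := by positivity
  have hkq : 128 * (k * q) ≤ n * q := by
    have := mul_le_mul_of_nonneg_right hr128 (by positivity : 0 ≤ k * q)
    rw [hnrk]
    linarith
  have hob8 : 8 * ob ≤ R := by rw [hob_def]; linarith
  have hR3 : R ≤ 3 * (n * q) := by linarith
  have hO : R ≤ η * n := by
    refine hR3.trans ?_
    have e1 : 3 * q ≤ η := by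
      have e2 : q * z ≤ 1 := by
        have := mul_le_mul_of_nonneg_right (le_self_pow₀ hz1 (by norm_num : (9 : ℕ) ≠ 0)) h0.le
        linarith
      have e3 : 416 * C' / z ≤ η := by
        refine le_trans ?_ h.markov
        gcongr
        have := h.C_nonneg
        linarith
      rw [div_le_iff₀ hz0] at e3
      by_contra hc
      have e4 := mul_lt_mul_of_pos_right (not_le.1 hc) hz0
      linarith
    have := mul_le_mul_of_nonneg_right e1 hn0.le
    linarith
  have hRx : R * q ≤ 3 * n * q ^ 2 := by
    have := mul_le_mul_of_nonneg_right hR3 h0.le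
    have e1 : 3 * (n * q) * q = 3 * n * q ^ 2 := by ring
    linarith
  have hM16 : 16 * M ≤ R := by linarith
  -- the selection is diverse, except with a small probability
  set e : ℝ :=
    r * (2 * Real.exp (-(R / (8 * ob)))) + n * (3 * (3 * n * q ^ 2) ^ (M + 1)) with he_def
  have he : e ≤ η := by
    have e1 : Real.exp (-(R / (8 * ob))) ≤ Real.exp (-(r / 96 : ℝ)) + Real.exp (-(z / 2)) := by
      rcases le_or_gt z (k * q) with hzk | hzk
      · have e2 : r / 96 ≤ R / (8 * ob) := by
          rw [div_le_div_iff₀ (by norm_num) (by positivity)]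
          have e3 : r * (8 * ob) ≤ r * (24 * (k * q)) :=
            mul_le_mul_of_nonneg_left (by linarith) hr0.le
          have e4 : r * (24 * (k * q)) = 24 * (n * q) := by rw [hnrk]; ring
          linarith
        have := Real.exp_le_exp.2 (neg_le_neg e2)
        linarith [Real.exp_pos (-(z / 2))]
      · have e2 : z / 2 ≤ R / (8 * ob) := by
          rw [div_le_div_iff₀ (by norm_num) (by positivity)]
          have e3 : z * (8 * ob) ≤ z * (24 * z) := mul_le_mul_of_nonneg_left (by linarith) hz0.le
          have e4 : z * (24 * z) = 24 * z ^ 2 := by ring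
          have e5 : z ^ 2 ≤ z ^ 5 := pow_le_pow_right₀ hz1 (by norm_num)
          linarith
        have := Real.exp_le_exp.2 (neg_le_neg e2)
        linarith [Real.exp_pos (-(r / 96 : ℝ))]
    have e2 := mul_le_mul_of_nonneg_left e1 (by positivity : (0 : ℝ) ≤ 2 * r)
    have e3 : r * Real.exp (-(z / 2)) ≤ n * Real.exp (-(z / 2)) := by
      have : (r : ℝ) ≤ n := by exact_mod_cast h.r_le_n hnk
      exact mul_le_mul_of_nonneg_right this (Real.exp_pos _).le
    have e4 := h.exp_le
    rw [he_def]
    linarith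
  have hdiv : 0 < T → ∀ {τ₀ : ℕ} {δ : ℝ}, (Real.exp (T * (ob * (q + M / (R / 8)))) / 2 ^ τ₀ ≤ δ ∨
      Real.exp (n * (ob * q)) / 2 ^ τ₀ ≤ δ) →
      Diverse A B q u T eu τ₀ δ e (2 * (2 * 16 ^ M) ^ 2) := fun hT0 {_ _} hδ =>
    diverse_of_many_rated h0.le h1 h.six_le_n hnk hA hT0 M hR hR0 hob0 hob hob8 hM16
      (by positivity) hnq2 hRx hδ
  rcases le_or_gt (T : ℝ) (z ^ 9) with hTz | hTz
  · have hg : expec (matLaw r r (1 / 2)) (fun χ => expec (selLaw n (1 - q)) fun y =>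
        ind (η * T < mult A (chosen A B u T eu χ y) (A u))) ≤ 2 * η := by
      rcases Nat.eq_zero_or_pos T with hT0 | hT0
      · refine expec_le_of_le hlaw fun χ => expec_le_of_le hlawx fun y => ?_
        rw [ind_of_not]
        · linarith
        · rw [not_lt]
          have h2 : mult A (chosen A B u T eu χ y) (A u) ≤ T :=
            (Finset.card_filter_le _ _).trans card_chosen_le
          have h3 : mult A (chosen A B u T eu χ y) (A u) = 0 := by omega
          rw [h3]
          push_cast
          positivity
      · obtain ⟨X, Y, -, hexc, ha, -⟩ := hdiv hT0 (τ₀ := 0) (Or.inl le_rfl)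
        have hpt : ∀ χ y, ind (η * T < mult A (chosen A B u T eu χ y) (A u)) ≤
            ind (¬ X χ ∨ ¬ Y y) + ind (X χ) * ind (Y y ∧ ((0 : ℕ) : ℝ) + η * r * (T / r) <
              mult A (chosen A B u T eu χ y) (A u)) := by
          intro χ y
          rw [← ind_and]
          refine le_trans (ind_mono fun hm => ?_) (ind_or_le _ _)
          by_contra hc
          push Not at hc
          refine absurd hm (not_lt.2 ((hc.2 hc.1.1 hc.1.2).trans (le_of_eq ?_)))
          push_cast
          field_simp
          ring
        refine (expec_mono hlaw fun χ => expec_mono hlawx fun y => hpt χ y).trans ?_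
        simp only [expec_add, expec_mul_left]
        have e1 : expec (matLaw r r (1 / 2)) (fun χ => ind (X χ) * expec (selLaw n (1 - q)) fun y =>
            ind (Y y ∧ ((0 : ℕ) : ℝ) + η * r * (T / r) <
              mult A (chosen A B u T eu χ y) (A u))) ≤ η :=
          expec_le_of_le hlaw fun χ => ind_mul_le hη.le fun hX =>
            (ha χ hX (η * r) (by positivity)).trans (le_trans (by
              gcongr
              linarith) h.cluster)
        linarith
    have := h.le_verdictGiven_of_few_rows hT hTz hnk hB hO hg v
    linarith
  · have hT0' : (0 : ℝ) < T := lt_of_le_of_lt (by positivity) hTz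
    have hT0 : 0 < T := by exact_mod_cast hT0'
    have hL1 : 1 ≤ L := by linarith [h.le_L]
    have fin : ∀ {τ₀ : ℕ}, (2 * (T * (ob * (q + M / (R / 8)))) + z ≤ τ₀ ∨
        2 * (n * (ob * q)) + z ≤ τ₀) → Spread r T q z L C' τ₀ →
        1 / 2 - 12 * η ≤ verdictGiven A B q u T v eu := by
      intro τ₀ hτ hs
      have hd := hdiv hT0 (τ₀ := τ₀) (δ := Real.exp (-(z / 2)))
        (hτ.imp exp_div_two_pow_le exp_div_two_pow_le)
      have := h.le_verdictGiven_of_diverse (h.r_le_n hnk) hT hTz hO hd (Real.exp_pos _).le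
        le_rfl he hs v
      linarith
    -- the probability that a selected row has rated a given column
    have hβ : q + M / (R / 8) ≤ (1 + 32 * M) / (n * q) := by
      have e1 : q ≤ 1 / (n * q) := by
        rw [le_div_iff₀ (by positivity)]
        have e2 : q * (n * q) = n * q ^ 2 := by ring
        linarith
      have e2 : M / (R / 8) ≤ 32 * M / (n * q) := by
        rw [div_le_div_iff₀ (by positivity) (by positivity)]
        have := mul_le_mul_of_nonneg_left hR1 hM0
        linarith
      have e3 : (1 + 32 * M) / (n * q) = 1 / (n * q) + 32 * M / (n * q) := add_div _ _ _
      linarith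
    have hC₃ : (1 : ℝ) ≤ 1 + 32 * M := by linarith
    rcases le_or_gt z (k * q) with hzk | hzk
    · refine fin (Or.inl ?_) (spread_of_many_ratings h.r_pos h0 hz1 hTz hqz hC₃ hC' hL1 rfl rfl)
      refine le_trans ?_ (Nat.le_ceil _)
      have e1 : ob * (q + M / (R / 8)) ≤ 3 * (k * q) * ((1 + 32 * M) / (n * q)) :=
        mul_le_mul (by linarith) hβ (by positivity) (by positivity)
      have hkq0 : 0 < k * q := by linarith
      have hk0' : (0 : ℝ) < k := pos_of_mul_pos_left hkq0 h0.le
      have e2 : 3 * (k * q) * ((1 + 32 * M) / (n * q)) = 3 * (1 + 32 * M) / r := by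
        rw [hnrk]; field_simp
      have e3 := mul_le_mul_of_nonneg_left (e1.trans_eq e2) hT0'.le
      have e4 : 2 * (T * (3 * (1 + 32 * M) / r)) = 6 * (1 + 32 * (M : ℝ)) * (T / r) := by ring
      linarith
    · have hob3 : ob ≤ 3 * z := by linarith
      have hnr : n * q ≤ r * z := by
        have := mul_le_mul_of_nonneg_left hzk.le hr0.le
        rw [hnrk]
        linarith
      rcases spread_of_few_ratings h.r_pos h.n_pos h0 hz1 hTz hqz hnqz (by linarith) hnr hC₃ hC' hL1
        with hs | hs
      · refine fin (Or.inl ?_) hs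
        refine le_trans ?_ (Nat.le_ceil _)
        have e1 : ob * (q + M / (R / 8)) ≤ 3 * z * ((1 + 32 * M) / (n * q)) :=
          mul_le_mul hob3 hβ (by positivity) (by positivity)
        have e3 := mul_le_mul_of_nonneg_left e1 hT0'.le
        have e4 : 2 * (T * (3 * z * ((1 + 32 * M) / (n * q)))) =
            6 * (1 + 32 * (M : ℝ)) * (z * T / (n * q)) := by ring
        linarith
      · refine fin (Or.inr ?_) hs
        refine le_trans ?_ (Nat.le_ceil _)
        have e1 := mul_le_mul_of_nonneg_right hob3 (by positivity : 0 ≤ n * q)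
        linarith

/-- Users with an unbounded number of ratings. -/
theorem le_verdictProb_of_many_rated {M : ℕ} (h : Large n r q z L (2 * (2 * 16 ^ M) ^ 2) C' η)
    (hnk : n = r * k)
    (hA : ∀ a, (Finset.univ.filter fun i => A i = a).card = k)
    (hB : ∀ b, (Finset.univ.filter fun j => B j = b).card = k) (hT : T ≤ n)
    (hC' : 12 * (1 + 32 * M) + 8 ≤ C') (hnq : 64 * z ^ 5 ≤ n * q)
    (hxM : n * (3 * (3 * n * q ^ 2) ^ (M + 1)) ≤ η / 6)
    (hr : r * (2 * Real.exp (-(r / 96 : ℝ))) ≤ η / 6) (v : Bool) :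
    1 / 2 - 13 * η ≤ verdictProb A B q u T v := by
  have h0 := h.q_pos
  have h1 := h.q_le
  have hlaw : IsLaw (coins (Fin n) (1 - q)) := isLaw_coins (by linarith) (by linarith)
  have hz1 := h.one_le_z
  have hn1 : (1 : ℝ) ≤ n := by exact_mod_cast h.n_pos
  set G : (Fin n → Bool) → Prop := fun eu => n * q / 4 ≤ (rated eu).card ∧
    ((rated eu).card : ℝ) ≤ 2 * (n * q) + z ∧
      ∀ b, ((ratedIn B eu b).card : ℝ) ≤ 2 * (k * q) + z with hG_def
  have hG : expec (coins (Fin n) (1 - q)) (fun eu => ind (¬ G eu)) ≤ η := by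
    have hpt : ∀ eu, ind (¬ G eu) ≤
        ind (((Finset.univ.filter fun l => eu l = false).card : ℝ) <
          (Finset.univ : Finset (Fin n)).card * q / 4) +
        (ind (2 * (n * q) + z < (Finset.univ.filter fun l => eu l = false).card) +
        ∑ b, ind (2 * (k * q) + z < ((PAF.cluster B b).filter fun l => eu l = false).card)) := by
      intro eu
      refine le_trans (ind_mono fun hc => ?_) ((ind_or_le _ _).trans (add_le_add le_rfl
        ((ind_or_le _ _).trans (add_le_add le_rfl (ind_exists_le _)))))
      by_contra hn
      push Not at hn
      obtain ⟨n1, n2, n3⟩ := hn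
      rw [Finset.card_univ, Fintype.card_fin] at n1
      refine hc ⟨n1, n2, fun b => ?_⟩
      have e1 : ratedIn B eu b = (PAF.cluster B b).filter fun l => eu l = false := by
        unfold ratedIn PAF.cluster
        rw [Finset.filter_filter]
        exact Finset.filter_congr fun l _ => and_comm
      rw [e1]
      exact n3 b
    refine (expec_mono hlaw hpt).trans ?_
    simp only [expec_add, expec_sum]
    have p1 := prob_card_rated_lt h0.le h1 (Finset.univ : Finset (Fin n))
    have p2 := prob_le_card_rated h0.le h1 (Finset.univ : Finset (Fin n)) (x := n * q) (s := z)
      (by rw [Finset.card_univ, Fintype.card_fin])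
    have p3 : ∀ b ∈ (Finset.univ : Finset (Fin r)), expec (coins (Fin n) (1 - q)) (fun eu =>
        ind (2 * (k * q) + z < ((PAF.cluster B b).filter fun l => eu l = false).card)) ≤
        Real.exp (-(z / 2)) := fun b _ =>
      prob_le_card_rated h0.le h1 (PAF.cluster B b) (by rw [PAF.cluster, hB])
    have p4 := Finset.sum_le_card_nsmul _ _ _ p3
    rw [Finset.card_univ, Fintype.card_fin, nsmul_eq_mul] at p4
    have p5 : Real.exp (-((Finset.univ : Finset (Fin n)).card * q / 4)) ≤ Real.exp (-(z / 2)) := by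
      rw [Finset.card_univ, Fintype.card_fin, Real.exp_le_exp]
      have : z ≤ z ^ 5 := le_self_pow₀ hz1 (by norm_num)
      linarith
    have p6 := h.exp_le
    have p7 : r * Real.exp (-(z / 2)) ≤ n * Real.exp (-(z / 2)) := by
      have : (r : ℝ) ≤ n := by exact_mod_cast h.r_le_n hnk
      exact mul_le_mul_of_nonneg_right this (Real.exp_pos _).le
    have p8 := mul_le_mul_of_nonneg_right hn1 (Real.exp_pos (-(z / 2))).le
    linarith
  have key := le_verdictProb (A := A) (B := B) (u := u) (T := T) (v := v) h0.le h1
    (lo := 1 / 2 - 12 * η) (by linarith [h.η_pos]) hG fun eu heu =>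
      h.le_verdictGiven_of_many_rated hnk hA hB hT hC' hnq hxM hr heu.1 heu.2.1 heu.2.2 v
  linarith

end Large

/-! ### The parameters are large eventually -/

section Eventually

variable {α c ζ η C C' : ℝ}

theorem tendsto_natCast_rpow (hζ : 0 < ζ) : Tendsto (fun n : ℕ => (n : ℝ) ^ ζ) atTop atTop :=
  (tendsto_rpow_atTop hζ).comp tendsto_natCast_atTop_atTop

theorem tendsto_natCast_rpow_neg (hζ : ζ < 0) : Tendsto (fun n : ℕ => (n : ℝ) ^ ζ) atTop (𝓝 0) := by
  have := (tendsto_rpow_neg_atTop (neg_pos.2 hζ)).comp tendsto_natCast_atTop_atTop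
  simpa only [neg_neg, Function.comp_def] using this

theorem tendsto_pow_mul_exp_neg_rpow (m : ℕ) (hζ : 0 < ζ) {b : ℝ} (hb : 0 < b) :
    Tendsto (fun n : ℕ => (n : ℝ) ^ m * Real.exp (-(b * (n : ℝ) ^ ζ))) atTop (𝓝 0) := by
  have h := (tendsto_rpow_mul_exp_neg_mul_atTop_nhds_zero (m / ζ) b hb).comp
    (tendsto_natCast_rpow hζ)
  refine h.congr fun n => ?_
  simp only [Function.comp_apply]
  rw [← Real.rpow_mul (Nat.cast_nonneg n), mul_div_cancel₀ _ hζ.ne', Real.rpow_natCast, neg_mul]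

theorem mul_pow_rpow_mul_sq {n : ℕ} (hn : 0 < n) (i : ℕ) :
    (n : ℝ) * (((n : ℝ) ^ ζ) ^ i * (c / (n : ℝ) ^ α)) ^ 2 =
      c ^ 2 * (n : ℝ) ^ (1 + 2 * i * ζ - 2 * α) := by
  have hn' : (0 : ℝ) < n := by exact_mod_cast hn
  rw [Real.rpow_sub hn', Real.rpow_add hn', Real.rpow_one,
    show 2 * i * ζ = ζ * ((i * 2 : ℕ) : ℝ) by push_cast; ring,
    show 2 * α = α * ((2 : ℕ) : ℝ) by push_cast; ring,
    Real.rpow_mul_natCast hn'.le, Real.rpow_mul_natCast hn'.le, pow_mul]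
  have : (n : ℝ) ^ α ≠ 0 := (Real.rpow_pos_of_pos hn' _).ne'
  field_simp

theorem eventually_large_n (hα : 0 < α) (hc : 0 < c) (hζ : 0 < ζ) (hζα : 1 + 18 * ζ < 2 * α)
    (hη : 0 < η) :
    ∀ᶠ n : ℕ in atTop, 1 ≤ n ∧ 0 < c / (n : ℝ) ^ α ∧ c / (n : ℝ) ^ α ≤ 1 ∧
      128 * C' ≤ (n : ℝ) ^ ζ ∧ 3 * n * (((n : ℝ) ^ ζ) ^ 9 * (c / (n : ℝ) ^ α)) ^ 2 ≤ η ∧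
      (416 * C' + 2 * C) / (n : ℝ) ^ ζ ≤ η ∧
      n * (2 * n ^ 3 * Real.exp (-((n : ℝ) ^ ζ / 2)) + (3 * Real.exp (-((n : ℝ) ^ ζ / 2)) +
        2 * Real.exp (-((n : ℝ) ^ ζ / (256 * (C' ^ 2 + 1))))) +
        Real.exp (-((n : ℝ) ^ ζ / 16))) ≤ η ∧
      C' ≤ η * n := by
  have hz := tendsto_natCast_rpow hζ
  have hq : Tendsto (fun n : ℕ => c / (n : ℝ) ^ α) atTop (𝓝 0) :=
    (tendsto_natCast_rpow hα).const_div_atTop c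
  have h2 : Tendsto (fun n : ℕ => 3 * (c ^ 2 * (n : ℝ) ^ (1 + 2 * (9 : ℕ) * ζ - 2 * α))) atTop
      (𝓝 (3 * (c ^ 2 * 0))) :=
    ((tendsto_natCast_rpow_neg (by push_cast; linarith)).const_mul _).const_mul _
  rw [mul_zero, mul_zero] at h2
  have h3 : Tendsto (fun n : ℕ => (416 * C' + 2 * C) / (n : ℝ) ^ ζ) atTop (𝓝 0) :=
    hz.const_div_atTop _
  have h4 : Tendsto (fun n : ℕ => 2 * ((n : ℝ) ^ 4 * Real.exp (-(1 / 2 * (n : ℝ) ^ ζ))) +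
      3 * ((n : ℝ) ^ 1 * Real.exp (-(1 / 2 * (n : ℝ) ^ ζ))) +
      2 * ((n : ℝ) ^ 1 * Real.exp (-(1 / (256 * (C' ^ 2 + 1)) * (n : ℝ) ^ ζ))) +
      (n : ℝ) ^ 1 * Real.exp (-(1 / 16 * (n : ℝ) ^ ζ))) atTop (𝓝 (2 * 0 + 3 * 0 + 2 * 0 + 0)) := by
    refine Tendsto.add (Tendsto.add (Tendsto.add ?_ ?_) ?_) ?_
    · exact (tendsto_pow_mul_exp_neg_rpow 4 hζ (by norm_num)).const_mul _
    · exact (tendsto_pow_mul_exp_neg_rpow 1 hζ (by norm_num)).const_mul _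
    · exact (tendsto_pow_mul_exp_neg_rpow 1 hζ (by positivity)).const_mul _
    · exact tendsto_pow_mul_exp_neg_rpow 1 hζ (by norm_num)
  norm_num only at h4
  have h5 : Tendsto (fun n : ℕ => η * (n : ℝ)) atTop atTop :=
    tendsto_natCast_atTop_atTop.const_mul_atTop hη
  filter_upwards [eventually_ge_atTop 1, hq.eventually_le_const one_pos,
    hz.eventually_ge_atTop (128 * C'), h2.eventually_le_const hη, h3.eventually_le_const hη,
    h4.eventually_le_const hη, h5.eventually_ge_atTop C'] with n e1 e2 e3 e4 e5 e6 e7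
  have hn' : (0 : ℝ) < n := by exact_mod_cast e1
  refine ⟨e1, by positivity, e2, e3, ?_, e5, ?_, e7⟩
  · rw [mul_assoc, mul_pow_rpow_mul_sq (by omega) 9]
    exact e4
  · refine le_trans (le_of_eq ?_) e6
    rw [show (n : ℝ) ^ ζ / 2 = 1 / 2 * (n : ℝ) ^ ζ by ring,
      show (n : ℝ) ^ ζ / 16 = 1 / 16 * (n : ℝ) ^ ζ by ring,
      show (n : ℝ) ^ ζ / (256 * (C' ^ 2 + 1)) = 1 / (256 * (C' ^ 2 + 1)) * (n : ℝ) ^ ζ by ring]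
    ring

theorem eventually_large_r (hη : 0 < η) :
    ∀ᶠ r : ℕ in atTop, 128 * C' ≤ (r : ℝ) ^ (1 / 20 : ℝ) ∧
      (r : ℝ) = ((r : ℝ) ^ (1 / 20 : ℝ)) ^ 20 ∧
      2 * C / (r : ℝ) ^ (1 / 20 : ℝ) +
        r * (4 * Real.exp (-(((r : ℝ) ^ (1 / 20 : ℝ)) ^ 3 / (512 * (C' ^ 2 + 1))))) ≤ η ∧
      Real.exp (1 / ((r : ℝ) ^ (1 / 20 : ℝ)) ^ 2) ≤ 1 + η ∧
      r * (4 * Real.exp (-(η ^ 2 * r / 2))) ≤ η ∧ (C + C') / (η * r) ≤ η ∧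
      r * (2 * Real.exp (-(r / 96 : ℝ))) ≤ η / 6 := by
  have hL : Tendsto (fun r : ℕ => (r : ℝ) ^ (1 / 20 : ℝ)) atTop atTop :=
    tendsto_natCast_rpow (by norm_num)
  have h1 : Tendsto (fun r : ℕ => 2 * C / (r : ℝ) ^ (1 / 20 : ℝ) + 4 * ((r : ℝ) ^ 1 *
      Real.exp (-(1 / (512 * (C' ^ 2 + 1)) * (r : ℝ) ^ (3 / 20 : ℝ))))) atTop
      (𝓝 (0 + 4 * 0)) :=
    (hL.const_div_atTop _).add
      ((tendsto_pow_mul_exp_neg_rpow 1 (by norm_num) (by positivity)).const_mul _)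
  norm_num only at h1
  have h2 : Tendsto (fun r : ℕ => Real.exp (1 / ((r : ℝ) ^ (1 / 20 : ℝ)) ^ 2)) atTop (𝓝 1) := by
    have : Tendsto (fun r : ℕ => 1 / ((r : ℝ) ^ (1 / 20 : ℝ)) ^ 2) atTop (𝓝 0) :=
      ((tendsto_pow_atTop (two_ne_zero)).comp hL).const_div_atTop 1
    have h3 := (Real.continuous_exp.tendsto 0).comp this
    rw [Real.exp_zero] at h3
    exact h3
  have h3 : Tendsto (fun r : ℕ => 4 * ((r : ℝ) ^ 1 *
      Real.exp (-(η ^ 2 / 2 * (r : ℝ) ^ (1 : ℝ))))) atTop (𝓝 (4 * 0)) :=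
    (tendsto_pow_mul_exp_neg_rpow 1 one_pos (by positivity)).const_mul _
  have h4 : Tendsto (fun r : ℕ => (C + C') / (η * r)) atTop (𝓝 0) :=
    (tendsto_natCast_atTop_atTop.const_mul_atTop hη).const_div_atTop _
  have h5 : Tendsto (fun r : ℕ => 2 * ((r : ℝ) ^ 1 *
      Real.exp (-(1 / 96 * (r : ℝ) ^ (1 : ℝ))))) atTop (𝓝 (2 * 0)) :=
    (tendsto_pow_mul_exp_neg_rpow 1 one_pos (by norm_num)).const_mul _
  rw [mul_zero] at h3 h5
  filter_upwards [hL.eventually_ge_atTop (128 * C'), h1.eventually_le_const hη,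
    h2.eventually_le_const (show (1 : ℝ) < 1 + η by linarith), h3.eventually_le_const hη,
    h4.eventually_le_const hη, h5.eventually_le_const (show 0 < η / 6 by linarith)]
    with r e1 e2 e3 e4 e5 e6
  have hr : (0 : ℝ) ≤ r := Nat.cast_nonneg r
  refine ⟨e1, ?_, ?_, e3, ?_, e5, ?_⟩
  · rw [← Real.rpow_mul_natCast hr]
    norm_num
  · refine le_trans (le_of_eq ?_) e2
    rw [← Real.rpow_mul_natCast hr, show (1 / 20 * ((3 : ℕ) : ℝ) : ℝ) = 3 / 20 by norm_num,
      show (r : ℝ) ^ (3 / 20 : ℝ) / (512 * (C' ^ 2 + 1)) =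
        1 / (512 * (C' ^ 2 + 1)) * (r : ℝ) ^ (3 / 20 : ℝ) by ring]
    ring
  · refine le_trans (le_of_eq ?_) e4
    rw [Real.rpow_one, show η ^ 2 / 2 * (r : ℝ) = η ^ 2 * r / 2 by ring]
    ring
  · refine le_trans (le_of_eq ?_) e6
    rw [Real.rpow_one, show 1 / 96 * (r : ℝ) = r / 96 by ring]
    ring

theorem exists_large (hα : 0 < α) (hc : 0 < c) (hζ : 0 < ζ) (hζα : 1 + 18 * ζ < 2 * α)
    (hη : 0 < η) (hη1 : η ≤ 1 / 16) (hC : 0 ≤ C) (hC' : 1 ≤ C') :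
    ∃ N : ℕ, ∀ n r : ℕ, N ≤ n → N ≤ r →
      Large n r (c / (n : ℝ) ^ α) ((n : ℝ) ^ ζ) ((r : ℝ) ^ (1 / 20 : ℝ)) C C' η ∧
        r * (2 * Real.exp (-(r / 96 : ℝ))) ≤ η / 6 := by
  obtain ⟨N₁, h1⟩ := eventually_atTop.1
    (eventually_large_n (C := C) (C' := C') hα hc hζ hζα hη)
  obtain ⟨N₂, h2⟩ := eventually_atTop.1 (eventually_large_r (C := C) (C' := C') hη)
  refine ⟨max N₁ N₂, fun n r hn hr => ?_⟩
  obtain ⟨-, a1, a2, a3, a4, a5, a6, a7⟩ := h1 n ((le_max_left _ _).trans hn)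
  obtain ⟨b1, b2, b3, b4, b5, b6, b7⟩ := h2 r ((le_max_right _ _).trans hr)
  exact ⟨⟨hη, hη1, hC, hC', a1, a2, a3, a4, a5, a6, a7, b1, b2, b3, b4, b5, b6⟩, b7⟩

/-- Both verdicts are about equally likely if there are many rows and many clusters. -/
theorem exists_le_verdictProb (hα : 1 / 2 < α) (hc : 0 < c) (hη : 0 < η) (hη1 : η ≤ 1 / 16) :
    ∃ N : ℕ, ∀ (n r k : ℕ) (A B : Fin n → Fin r), N ≤ n → N ≤ r → n = r * k →
      (∀ a, (Finset.univ.filter fun i => A i = a).card = k) →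
      (∀ b, (Finset.univ.filter fun j => B j = b).card = k) →
      ∀ (u : Fin n) (T : ℕ), T ≤ n → ∀ v,
        1 / 2 - 13 * η ≤ verdictProb A B (c / (n : ℝ) ^ α) u T v := by
  rcases le_or_gt 1 α with hα1 | hα1
  · -- The expected number of ratings of a user is bounded. The exponent `ζ` of the scale `z` is
    -- such that `n * (z ^ 9 * q) ^ 2` tends to `0`.
    obtain ⟨K, hK⟩ := pow_unbounded_of_one_lt (Real.exp c / η) (one_lt_two : (1 : ℝ) < 2)
    have hcK : 0 ≤ c * K := by positivity
    obtain ⟨N, hN⟩ := exists_large (α := α) (c := c) (ζ := (2 * α - 1) / 36) (C := 4)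
      (C' := 6 + c + 2 * (c * K) + K) (by linarith) hc (by linarith) (by linarith) hη hη1
      (by norm_num) (by have : (0 : ℝ) ≤ K := Nat.cast_nonneg K; linarith)
    refine ⟨N, fun n r k A B hn hr hnk hA hB u T hT v => ?_⟩
    have h := (hN n r hn hr).1
    have hn1 : (1 : ℝ) ≤ n := by exact_mod_cast h.n_pos
    have key := h.le_verdictProb_of_few_rated (A := A) (B := B) (u := u) hnk hA hB hT
      (c := c) (K := K) ?_ ?_ le_rfl v
    · linarith
    · rw [mul_div_assoc', div_le_iff₀ (by positivity), mul_comm]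
      refine mul_le_mul_of_nonneg_left ?_ hc.le
      calc (n : ℝ) = (n : ℝ) ^ (1 : ℝ) := (Real.rpow_one _).symm
        _ ≤ _ := Real.rpow_le_rpow_of_exponent_le hn1 hα1
    · rw [div_le_iff₀ (by positivity)]
      rw [div_lt_iff₀ hη] at hK
      linarith
  · -- The expected number of ratings of a user is a power of `n`. Scores above `M` are ruled out as
    -- `n * (n * q ^ 2) ^ (M + 1)` tends to `0`, and the second bound on `ζ` ensures
    -- `64 * z ^ 5 ≤ n * q`.
    obtain ⟨M, hM⟩ := exists_nat_gt (1 / (2 * α - 1))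
    rw [div_lt_iff₀ (by linarith)] at hM
    set ζ := min ((2 * α - 1) / 36) ((1 - α) / 10) with hζ
    have hζ0 : 0 < ζ := lt_min (by linarith) (by linarith)
    have hζ1 : ζ ≤ (2 * α - 1) / 36 := min_le_left _ _
    have hζ2 : ζ ≤ (1 - α) / 10 := min_le_right _ _
    obtain ⟨N, hN⟩ := exists_large (α := α) (c := c) (ζ := ζ) (C := 2 * (2 * 16 ^ M) ^ 2)
      (C' := 12 * (1 + 32 * M) + 8) (by linarith) hc hζ0 (by linarith) hη hη1
      (by positivity) (by have : (0 : ℝ) ≤ M := Nat.cast_nonneg M; linarith)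
    have h1 : Tendsto (fun n : ℕ => c * (n : ℝ) ^ (1 - α - 5 * ζ)) atTop atTop :=
      (tendsto_natCast_rpow (by linarith)).const_mul_atTop hc
    have h2 : Tendsto (fun n : ℕ => 3 * (3 * c ^ 2) ^ (M + 1) *
        (n : ℝ) ^ (1 + (1 - 2 * α) * ((M + 1 : ℕ) : ℝ))) atTop
        (𝓝 (3 * (3 * c ^ 2) ^ (M + 1) * 0)) :=
      (tendsto_natCast_rpow_neg (by push_cast; linarith)).const_mul _
    rw [mul_zero] at h2
    obtain ⟨N', hN'⟩ := eventually_atTop.1 ((h1.eventually_ge_atTop 64).and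
      (h2.eventually_le_const (show 0 < η / 6 by linarith)))
    refine ⟨max N N', fun n r k A B hn hr hnk hA hB u T hT v => ?_⟩
    obtain ⟨h, h96⟩ := hN n r ((le_max_left _ _).trans hn) ((le_max_left _ _).trans hr)
    obtain ⟨h3, h4⟩ := hN' n ((le_max_right _ _).trans hn)
    have hn0 : (0 : ℝ) < n := by exact_mod_cast h.n_pos
    refine h.le_verdictProb_of_many_rated hnk hA hB hT le_rfl ?_ ?_ h96 v
    · have e1 := mul_le_mul_of_nonneg_right h3 (by positivity : 0 ≤ ((n : ℝ) ^ ζ) ^ 5)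
      refine e1.trans (le_of_eq ?_)
      rw [Real.rpow_sub hn0, Real.rpow_sub hn0, Real.rpow_one,
        show 5 * ζ = ζ * ((5 : ℕ) : ℝ) by push_cast; ring, Real.rpow_mul_natCast hn0.le]
      have f1 : (n : ℝ) ^ α ≠ 0 := (Real.rpow_pos_of_pos hn0 _).ne'
      have f2 : (n : ℝ) ^ ζ ≠ 0 := (Real.rpow_pos_of_pos hn0 _).ne'
      field_simp
    · refine le_trans (le_of_eq ?_) h4
      have e1 := mul_pow_rpow_mul_sq (c := c) (α := α) (ζ := 0) h.n_pos 0
      rw [pow_zero, one_mul, mul_zero, add_zero] at e1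
      have e2 : 3 * n * (c / (n : ℝ) ^ α) ^ 2 = 3 * c ^ 2 * (n : ℝ) ^ (1 - 2 * α) := by
        rw [mul_assoc, e1]; ring
      rw [e2, Real.rpow_add hn0, Real.rpow_one, Real.rpow_mul_natCast hn0.le, mul_pow]
      ring

end Eventually

section Truncate

variable {n r : ℕ}

theorem topRows_min (s : Fin n → ℕ) (π : Equiv.Perm (Fin n)) (T : ℕ) :
    topRows s π (min T n) = topRows s π T := by
  ext i
  rw [mem_topRows, mem_topRows, lt_min_iff, and_iff_left (ahead_lt s π i)]

theorem verdictProb_min (A B : Fin n → Fin r) (q : ℝ) (u : Fin n) (T : ℕ) (v : Bool) :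
    verdictProb A B q u (min T n) v = verdictProb A B q u T v := by
  unfold verdictProb likes selected
  simp only [topRows_min]

end Truncate

end PAF

end

theorem theorem4 (α c : ℝ) (hα : 1 / 2 < α) (hc : 0 < c)
    (n r k : ℕ → ℕ)
    (A B : ∀ t, Fin (n t) → Fin (r t))
    (hA : ∀ t, ∀ l : Fin (r t), (Finset.univ.filter fun i => A t i = l).card = k t)
    (hB : ∀ t, ∀ l : Fin (r t), (Finset.univ.filter fun j => B t j = l).card = k t)
    (hn : Tendsto n atTop atTop)
    (hk : (fun t => (k t : ℝ)) =o[atTop] (fun t => (n t : ℝ)))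
    (ε : ℕ → unitInterval)
    (hε : ∀ᶠ t in atTop, (ε t : ℝ) = 1 - c / (n t : ℝ) ^ α)
    (u : ∀ t, Fin (n t)) (T : ℕ → ℕ) :
    Tendsto (fun t => PAF.errorProb (A t) (B t) 0 (ε t) (u t) (T t)) atTop (𝓝 (1 / 2)) := by
  refine Metric.tendsto_nhds.2 fun e he => ?_
  have hη : 0 < min (1 / 16) (e / 14) := lt_min (by norm_num) (by linarith)
  obtain ⟨N, hN⟩ := PAF.exists_le_verdictProb hα hc hη (min_le_left _ _)
  have hsmall : ∀ᶠ t in atTop, (k t : ℝ) * (N + 1) ≤ n t := by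
    filter_upwards [hk.bound (show (0 : ℝ) < 1 / (N + 1) by positivity)] with t ht
    rw [Real.norm_natCast, Real.norm_natCast, one_div_mul_eq_div, le_div_iff₀ (by positivity)] at ht
    exact ht
  filter_upwards [hsmall, hε, hn.eventually_ge_atTop N] with t h1 h2 h3
  have hnk : n t = r t * k t := by
    have h := Finset.card_eq_sum_card_fiberwise (f := A t) (s := Finset.univ) (t := Finset.univ)
      fun _ _ => Finset.mem_univ _
    rw [Finset.card_univ, Fintype.card_fin] at h
    rw [h, Finset.sum_congr rfl fun l _ => hA t l]
    simp
  have hk0 : 0 < k t := Nat.pos_of_ne_zero fun h => by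
    have := (u t).pos
    rw [hnk, h] at this
    omega
  have hr : N ≤ r t := by
    have h4 : k t * (N + 1) ≤ r t * k t := by
      rw [← hnk]
      exact_mod_cast h1
    rw [mul_comm (r t)] at h4
    have := Nat.le_of_mul_le_mul_left h4 hk0
    omega
  have key := hN (n t) (r t) (k t) (A t) (B t) h3 hr hnk (hA t) (hB t) (u t) (min (T t) (n t))
    (min_le_right _ _)
  have hq : c / (n t : ℝ) ^ α = 1 - ε t := by rw [h2]; ring
  rw [hq] at key
  simp only [PAF.verdictProb_min] at key
  have hf := key false
  have ht := key true
  have hsum := PAF.verdictProb_add_le (A t) (B t) (q := 1 - (ε t : ℝ))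
    (by linarith [(ε t).2.2]) (by linarith [(ε t).2.1]) (u t) (T t)
  rw [PAF.errorProb_eq_verdictProb, Real.dist_eq, abs_lt]
  have := min_le_right (1 / 16) (e / 14)
  constructor <;> linarith
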